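/- **Theorem (Sequential empirical CLT for $\mathcal B$-geometrically ergodic Markov chains).** Let $(X_i)_{i\ge 0}$ be a time-homogeneous Markov chain on a measurable space $(\mathcal X,\mathcal A)$ with transition probability $P$, started from an invariant probability measure $\nu$, and write $Pf=\int f(y)\,P(\cdot,dy)$, $\nu f=\int f\,d\nu$. Let $(\mathcal B,\|\cdot\|_{\mathcal B})$ be a complex Banach space of measurable functions $\mathcal X\to\mathbb C$ on which $P$ acts as a bounded linear operator, and let $m\in[1,\infty]$, $s=m/(m-1)\in[1,\infty]$ (so $\tfrac1m+\tfrac1s=1$). Let $\|\cdot\|_\infty$ denote either the supremum norm or the $\nu$-essential supremum norm (the theorem holds for either choice, the same one being used throughout). Let $\mathcal F$ be a $\|\cdot\|_\infty$-bounded class of measurable functions $\mathcal X\to\mathbb R$, and let $\mathcal G$ be a $\|\cdot\|_\infty$-bounded set of real-valued functions in $\mathcal B$. Assume: * (A) $1_{\mathcal X}\in\mathcal B$; $|f|,\overline f\in\mathcal B$ for all $f\in\mathcal B$; the map $f\mapsto f(x)$ is continuous on $\mathcal B$ for each $x\in\mathcal X$. * (B) There is $K>0$ with $\|f\|_{L^m(\nu)}\le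 K\|f\|_{\mathcal B}$ for all $f\in\mathcal B$. * (C) There are $\kappa>0$ and $\theta\in[0,1)$ with $\|P^nf-(\nu f)1_{\mathcal X}\|_{\mathcal B}\le\kappa\|f\|_{\mathcal B}\,\theta^n$ for all $n$ and all $f\in\mathcal B$. * (D) For every $f$ in the real vector space spanned by $\mathcal G$, for $t$ in a neighbourhood of $0$ the operator $P_{f,t}\varphi=P(e^{itf}\varphi)$ is a bounded linear operator on $\mathcal B$, and $t\mapsto P_{f,t}$ is twice continuously differentiable there in operator norm, with $\bigl(\tfrac{d^k}{dt^k}P_{f,t}\bigr)_{t=0}\varphi=P((if)^k\varphi)$ for $\varphi\in\mathcal B$, $k=1,2$. * (E) There are $C>0$ and an integer $\ell\ge1$ such that for all $f,g\in\mathcal B$ with $\|f\|_\infty,\|g\|_\infty\le1$ one has $fg\in\mathcal B$ and $\|fg\|_{\mathcal B}\le C\max\{\|f\|_{\mathcal B},\|g\|_{\mathcal B}\}^\ell$. * (F) There are $C>0$, $r>-1$, $\gamma>1$ with $$\int_0^1\varepsilon^r\sup_{\varepsilon\le\delta\le1}N^2\bigl(\delta,\exp(C\delta^{-1/\gamma}),\mathcal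 F,\mathcal G,L^s(\nu)\bigr)\,d\varepsilon<\infty,$$ where $N(\delta,A,\mathcal F,\mathcal G,L^s(\nu))$ is the smallest number of brackets $[l,u]=\{f: l\le f\le u \text{ pointwise}\}$ needed to cover $\mathcal F$, with $l,u\in\mathcal G$, $l\le u$ pointwise, $\|u-l\|_{L^s(\nu)}\le\delta$, $\|l\|_{\mathcal B}\le A$ and $\|u\|_{\mathcal B}\le A$ ($N=\infty$ if there is no finite cover). Then the sequential empirical process $$U_n(f,t)=\frac1{\sqrt n}\sum_{i=1}^{[nt]}\bigl(f(X_i)-\nu f\bigr),\qquad (f,t)\in\mathcal F\times[0,1],$$ takes values in the space $\ell^\infty(\mathcal F\times[0,1])$ of bounded functions with the supremum norm, and converges there in distribution to a tight centred Gaussian process $K$; that is, $\mathbb E^*\phi(U_n)\to\mathbb E\,\phi(K)$ for every bounded continuous $\phi:\ell^\infty(\mathcal F\times[0,1])\to\mathbb R$, where $\mathbb E^*$ is outer expectation. The covariance of $K$ is $$\operatorname{Cov}\bigl(K(f_1,t_1),K(f_2,t_2)\bigr)=\min\{t_1,t_2\}\Bigl\{\sum_{k=0}^\infty\operatorname{Cov}\bigl(f_1(X_0),f_2(X_k)\bigr)+\sum_{k=1}^\infty\operatorname{Cov}\bigl(f_1(X_k),f_2(X_0)\bigr)\Bigr\},$$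 where both series converge absolutely. -/

import Mathlib

open MeasureTheory ProbabilityTheory Filter Topology
open scoped ENNReal lp BoundedContinuousFunction

noncomputable section

namespace SeqEmp

/-! ### The space of bounded functions and convergence in distribution -/

/-- The space `ℓ^∞(T)` of bounded real functions on `T` carries its Borel σ-field. -/
instance linftyMeasurableSpace (T : Type*) : MeasurableSpace (ℓ^∞(T, ℝ)) := borel _

instance linftyBorelSpace (T : Type*) : BorelSpace (ℓ^∞(T, ℝ)) := ⟨rfl⟩

/-- Outer expectation `E^* Y` of a bounded, possibly non-measurable `Y : Ω → ℝ`: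
the infimum of `E Z` over all integrable measurable `Z ≥ Y`. -/
def outerExpectation {Ω : Type*} [MeasurableSpace Ω] (μ : Measure Ω) (Y : Ω → ℝ) : ℝ :=
  sInf {c : ℝ | ∃ Z : Ω → ℝ, Measurable Z ∧ Integrable Z μ ∧ (∀ ω, Y ω ≤ Z ω) ∧ c = ∫ ω, Z ω ∂μ}

/-- Convergence in distribution of (possibly non-measurable) random elements `U n` of a
topological space to a Borel law `κ`: `E^* φ(U n) → ∫ φ dκ` for all bounded continuous `φ`. -/
def ConvergesInDistribution {Ω E : Type*} [MeasurableSpace Ω] [TopologicalSpace E]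
    [MeasurableSpace E] (μ : Measure Ω) (U : ℕ → Ω → E) (κ : Measure E) : Prop :=
  ∀ φ : E →ᵇ ℝ,
    Tendsto (fun n => outerExpectation μ (fun ω => φ (U n ω))) atTop (𝓝 (∫ x, φ x ∂κ))

/-! ### Markov chains and the sequential empirical process -/

/-- `Z` is a time homogeneous Markov chain with transition kernel `P` and initial law `ν`:
given `(Z 0, …, Z n)`, the variable `Z (n + 1)` has conditional law `P (Z n)`. -/
structure IsMarkovChain {Ω S : Type*} [MeasurableSpace Ω] [MeasurableSpace S]
    (μ : Measure Ω) (Z : ℕ → Ω → S) (P : Kernel S S) (ν : Measure S) : Prop where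
  measurable : ∀ n, Measurable (Z n)
  initial : μ.map (Z 0) = ν
  markov : ∀ n : ℕ,
    μ.map (fun ω => ((fun i : Fin (n + 1) => Z i ω), Z (n + 1) ω)) =
      (μ.map (fun ω => fun i : Fin (n + 1) => Z i ω)) ⊗ₘ
        (P.comap (fun z : Fin (n + 1) → S => z (Fin.last n)) (measurable_pi_apply _))

/-- The sequential empirical process
`U_n(f, t) = n^{-1/2} ∑_{i = 1}^{[n t]} (f(Z_i) - ν f)`. -/
def seqEmpirical {Ω S : Type*} [MeasurableSpace S] (Z : ℕ → Ω → S) (ν : Measure S)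
    (n : ℕ) (ω : Ω) (f : S → ℝ) (t : ℝ) : ℝ :=
  (1 / Real.sqrt n) * ∑ i ∈ Finset.Icc 1 ⌊(n : ℝ) * t⌋₊, (f (Z i ω) - ∫ x, f x ∂ν)

/-! ### Conditions on the Banach space of functions

A complex Banach space of measurable functions `S → ℂ` is given by a Banach space `B` together
with an injective linear map `ι : B → (S → ℂ)` all of whose values are measurable functions. -/

section Conditions

variable {S B : Type*} [MeasurableSpace S] [NormedAddCommGroup B] [NormedSpace ℂ B]

/-- `B` is a space of measurable functions on `S`, through the realization `ι`. -/
structure IsFunctionSpace (ι : B →ₗ[ℂ] (S → ℂ)) : Prop where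
  injective : Function.Injective ι
  measurable : ∀ b, Measurable (ι b)

/-- `T` is the Markov operator `f ↦ ∫ f(y) P(·, dy)` on `B`. -/
def IsMarkovOperator (ι : B →ₗ[ℂ] (S → ℂ)) (P : Kernel S S) (T : B →L[ℂ] B) : Prop :=
  ∀ (b : B) (x : S), Integrable (ι b) (P x) ∧ ι (T b) x = ∫ y, ι b y ∂(P x)

/-- Condition (A): `1 ∈ B`, `|f|` and `conj f` are in `B` for all `f ∈ B`, and the Dirac
measures are continuous on `B`. -/
structure CondA (ι : B →ₗ[ℂ] (S → ℂ)) : Prop where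
  one_mem : ∃ e : B, ι e = fun _ => 1
  abs_mem : ∀ b : B, ∃ c : B, ι c = fun x => ((‖ι b x‖ : ℝ) : ℂ)
  conj_mem : ∀ b : B, ∃ c : B, ι c = fun x => (starRingEnd ℂ) (ι b x)
  dirac_continuous : ∀ x : S, Continuous (fun b : B => ι b x)

/-- Condition (B): `B` is continuously included in `L^m(ν)`. -/
def CondB (ι : B →ₗ[ℂ] (S → ℂ)) (ν : Measure S) (m : ℝ≥0∞) : Prop :=
  ∃ K : ℝ, 0 < K ∧ ∀ b : B, eLpNorm (ι b) m ν ≤ ENNReal.ofReal (K * ‖b‖)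

/-- Condition (C), geometric ergodicity on `B`: `‖P^n f - (ν f) 1‖ ≤ κ ‖f‖ θ^n`. -/
def CondC (ι : B →ₗ[ℂ] (S → ℂ)) (ν : Measure S) (T : B →L[ℂ] B) : Prop :=
  ∃ e : B, (ι e = fun _ => 1) ∧ ∃ κ θ : ℝ, 0 < κ ∧ 0 ≤ θ ∧ θ < 1 ∧
    ∀ (n : ℕ) (b : B), ‖(T ^ n) b - (∫ x, ι b x ∂ν) • e‖ ≤ κ * ‖b‖ * θ ^ n

/-- Condition (D) for one element `g` (a real-valued function): for `t` near `0` the perturbed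
operators `P_{g,t} φ = P (e^{itg} φ)` are bounded on `B`, and `t ↦ P_{g,t}` is twice
continuously differentiable with `k`-th derivative `φ ↦ P ((i g)^k φ)` at `0`, `k = 1, 2`. -/
def CondDAt (ι : B →ₗ[ℂ] (S → ℂ)) (P : Kernel S S) (g : B) : Prop :=
  ∃ ε : ℝ, 0 < ε ∧ ∃ Q : ℝ → B →L[ℂ] B,
    (∀ t ∈ Set.Ioo (-ε) ε, ∀ (b : B) (x : S),
      ι (Q t b) x = ∫ y, Complex.exp (Complex.I * t * ι g y) * ι b y ∂(P x)) ∧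
    ContDiffOn ℝ 2 Q (Set.Ioo (-ε) ε) ∧
    ∀ k ∈ ({1, 2} : Set ℕ), ∀ (b : B) (x : S),
      Integrable (fun y => (Complex.I * ι g y) ^ k * ι b y) (P x) ∧
      ι (iteratedDeriv k Q 0 b) x = ∫ y, (Complex.I * ι g y) ^ k * ι b y ∂(P x)

/-- Condition (D) for the real vector space spanned by `G`. -/
def CondD (ι : B →ₗ[ℂ] (S → ℂ)) (P : Kernel S S) (G : Set B) : Prop :=
  ∀ g ∈ Submodule.span ℝ G, CondDAt ι P g

/-- Condition (E): `‖f g‖ ≤ C max(‖f‖, ‖g‖)^ℓ` for `f, g ∈ B` bounded by `1`.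
The filter `l` says in which sense: everywhere (`l = ⊤`) or almost everywhere (`l = ae ν`). -/
def CondE (ι : B →ₗ[ℂ] (S → ℂ)) (l : Filter S) : Prop :=
  ∃ C : ℝ, 0 < C ∧ ∃ ℓ : ℕ, 1 ≤ ℓ ∧ ∀ f g : B,
    (∀ᶠ x in l, ‖ι f x‖ ≤ 1) → (∀ᶠ x in l, ‖ι g x‖ ≤ 1) →
      ∃ h : B, (ι h = fun x => ι f x * ι g x) ∧ ‖h‖ ≤ C * (max ‖f‖ ‖g‖) ^ ℓ

/-- `[u.1, u.2]` is an `(ε, A, G, L^s(ν))`-bracket, for a set `G` of real-valued elements. -/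
structure IsBracket (ι : B →ₗ[ℂ] (S → ℂ)) (ν : Measure S) (G : Set B) (ε A : ℝ) (s : ℝ≥0∞)
    (u : B × B) : Prop where
  lower_mem : u.1 ∈ G
  upper_mem : u.2 ∈ G
  le : ∀ x, (ι u.1 x).re ≤ (ι u.2 x).re
  size : eLpNorm (fun x => ι u.2 x - ι u.1 x) s ν ≤ ENNReal.ofReal ε
  norm_upper : ‖u.2‖ ≤ A
  norm_lower : ‖u.1‖ ≤ A

/-- The bracketing number `N(ε, A, F, G, L^s(ν))`: the least number of brackets covering `F`
(`⊤` if there is no finite cover). -/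
def bracketingNumber (ι : B →ₗ[ℂ] (S → ℂ)) (ν : Measure S) (F : Set (S → ℝ)) (G : Set B)
    (ε A : ℝ) (s : ℝ≥0∞) : ℕ∞ :=
  ⨅ (W : Finset (B × B)) (_ : (∀ u ∈ W, IsBracket ι ν G ε A s u) ∧
    ∀ f ∈ F, ∃ u ∈ W, ∀ x, (ι u.1 x).re ≤ f x ∧ f x ≤ (ι u.2 x).re), (W.card : ℕ∞)

/-- Condition (F), the bracketing entropy condition. -/
def CondF (ι : B →ₗ[ℂ] (S → ℂ)) (ν : Measure S) (F : Set (S → ℝ)) (G : Set B)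
    (s : ℝ≥0∞) : Prop :=
  ∃ C r γ : ℝ, 0 < C ∧ -1 < r ∧ 1 < γ ∧
    ∫⁻ ε in Set.Ioo (0 : ℝ) 1, ENNReal.ofReal (ε ^ r) *
      (⨆ δ ∈ Set.Icc ε 1,
        (bracketingNumber ι ν F G δ (Real.exp (C * δ ^ (-(1 / γ)))) s : ℝ≥0∞) ^ 2) < ∞

end Conditions

/-! ### The limit process -/

/-- The long-run covariance
`∑_{k ≥ 0} Cov(f₁(Z₀), f₂(Z_k)) + ∑_{k ≥ 1} Cov(f₁(Z_k), f₂(Z₀))`. -/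
def longRunCov {Ω S : Type*} [MeasurableSpace Ω] (μ : Measure Ω) (Z : ℕ → Ω → S)
    (f₁ f₂ : S → ℝ) : ℝ :=
  (∑' k : ℕ, cov[fun ω => f₁ (Z 0 ω), fun ω => f₂ (Z k ω); μ]) +
    ∑' k : ℕ, cov[fun ω => f₁ (Z (k + 1) ω), fun ω => f₂ (Z 0 ω); μ]

/-- `κ` is the law on `ℓ^∞(F × [0,1])` of a tight centred Gaussian process with covariance
`min(t₁, t₂)` times the long-run covariance. -/
structure IsKieferLaw {Ω S : Type*} [MeasurableSpace Ω] (μ : Measure Ω) (Z : ℕ → Ω → S)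
    (F : Set (S → ℝ)) (κ : Measure (ℓ^∞(F × Set.Icc (0 : ℝ) 1, ℝ))) : Prop where
  prob : IsProbabilityMeasure κ
  tight : IsTightMeasureSet {κ}
  gaussian : IsGaussianProcess
    (fun (p : F × Set.Icc (0 : ℝ) 1) (x : ℓ^∞(F × Set.Icc (0 : ℝ) 1, ℝ)) => x p) κ
  centred : ∀ p : F × Set.Icc (0 : ℝ) 1, ∫ x, x p ∂κ = 0
  cov_eq : ∀ p q : F × Set.Icc (0 : ℝ) 1,
    cov[fun x => x p, fun x => x q; κ] =
      min (p.2 : ℝ) (q.2 : ℝ) * longRunCov μ Z (p.1 : S → ℝ) (q.1 : S → ℝ)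

end SeqEmp

end

noncomputable section

namespace SeqEmp

set_option linter.unusedSectionVars false

/-! ### Outer expectations and convergence in distribution -/

section OuterExpectation

variable {Ω : Type*} [MeasurableSpace Ω] {μ : Measure Ω} [IsProbabilityMeasure μ]

/-! The Banach space is used to produce mixing in L¹(ν). By (B) and (C), a bounded real function g
given by b ∈ B satisfies ‖Pⁿg − νg‖ ≤ A‖b‖θⁿ in L¹(ν) (`exists_mixing`), and by (E) the square of g
is again given by an element of B, with norm polynomial in ‖b‖. Bounded functions given by elements
of B thus form an algebra, stable under P, on which P contracts geometrically in L¹ (`repAlgebra`,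
`isMixingAlgebra_repAlgebra`).

Finite-dimensional limits come from martingale approximation. With ψ = g + Pg + … + P^K g, the
partial sums of g split into a martingale with bounded differences ψ(Z_{i+1}) − Pψ(Z_i), a bounded
boundary term, and the partial sums of P^{K+1}g, whose variance is O(nθ^K). The conditional
variances of the martingale lie in the algebra and obey a law of large numbers, so its
characteristic function converges (`norm_charFun_martingale_sub_le`). Letting K grow turns the
limiting variance into the long-run covariance (`tendsto_charFun_chain`).

Asymptotic equicontinuity rests on a tail bound for maxima of partial sums. Along a progression of
step L, the function is expanded in rows of martingale differences built from g, P^L g, P^{2L} g, ….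
Row 0 obeys Freedman's inequality with variance close to ν(g²); later rows are so small in L¹ that
Kolmogorov's inequality suffices (`array_tail`, `chain_tail_opt`). Bracket norms at size 2^{-q} grow
like exp(C b^q) with b = 2^{1/γ} < 2, so a step L of order b^q lets θ^L absorb them. At threshold
w^{-q}√n the Freedman exponent is of order w^{-2q} 2^q / b^q, and the choice b w⁴ = 2 makes it
w^{2q}. This beats the number of links, which (F) bounds by a geometric sequence in q
(`exists_summable_link_tail`). Chaining down to a level Q with 2^{-Q}n of order √n then compares the
whole class, uniformly in time, with finitely many lower brackets (`IsBracketSystem.chaining`). Each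
of these is discretized in time on a grid of mesh L^{-2} (`eventually_time_discretization`).

The process is therefore uniformly close to maps of finite range applied to countably many
coordinates, which converge jointly in a countable product of lines. The corresponding maps of the
limit are almost surely Cauchy in ℓ^∞, and the law of their limit is the tight law sought
(`exists_limit_of_approx`, `exists_gaussian_limit`). Its covariance is identified by continuity of
the long-run covariance along the brackets (`IsBracketSystem.tendsto_kernelLongRunCov`).

Boundedness may hold only ν-almost everywhere; truncating at the common bound changes functions on
null sets only, so it alters neither their elements of B nor the laws along the chain. -/

lemma outerExpectation_set_nonempty {Y : Ω → ℝ} {M : ℝ} (hY : ∀ ω, Y ω ≤ M) :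
    {c : ℝ | ∃ Z : Ω → ℝ, Measurable Z ∧ Integrable Z μ ∧ (∀ ω, Y ω ≤ Z ω) ∧
      c = ∫ ω, Z ω ∂μ}.Nonempty :=
  ⟨_, fun _ => M, measurable_const, integrable_const _, hY, rfl⟩

lemma le_outerExpectation {Y : Ω → ℝ} {M c : ℝ} (hY : ∀ ω, Y ω ≤ M)
    (h : ∀ Z : Ω → ℝ, Measurable Z → Integrable Z μ → (∀ ω, Y ω ≤ Z ω) → c ≤ ∫ ω, Z ω ∂μ) :
    c ≤ outerExpectation μ Y := by
  refine le_csInf (outerExpectation_set_nonempty hY) ?_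
  rintro _ ⟨Z, hZ, hZi, hYZ, rfl⟩
  exact h Z hZ hZi hYZ

lemma outerExpectation_le {Y Z : Ω → ℝ} {M : ℝ} (hY : ∀ ω, M ≤ Y ω)
    (hZ : Measurable Z) (hZi : Integrable Z μ) (hYZ : ∀ ω, Y ω ≤ Z ω) :
    outerExpectation μ Y ≤ ∫ ω, Z ω ∂μ := by
  refine csInf_le ⟨M, ?_⟩ ⟨Z, hZ, hZi, hYZ, rfl⟩
  rintro _ ⟨W, -, hWi, hYW, rfl⟩
  calc M = ∫ _, M ∂μ := by simp
    _ ≤ ∫ ω, W ω ∂μ := integral_mono (integrable_const _) hWi fun ω => (hY ω).trans (hYW ω)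

lemma outerExpectation_mono {Y Y' : Ω → ℝ} {M : ℝ} (hY : ∀ ω, M ≤ Y ω) (hY' : ∀ ω, Y' ω ≤ -M)
    (h : ∀ ω, Y ω ≤ Y' ω) : outerExpectation μ Y ≤ outerExpectation μ Y' :=
  le_outerExpectation hY' fun _ hZ hZi hYZ =>
    outerExpectation_le hY hZ hZi fun ω => (h ω).trans (hYZ ω)

/-- The variable W is measurable, so W ± (a + 2M·1_A) are measurable bounds enclosing Y; no
measurability of Y is needed. This is how non-measurable processes are replaced by measurable
approximations. -/
lemma abs_outerExpectation_sub_integral_le {Y W : Ω → ℝ} {M a : ℝ} (hY : ∀ ω, |Y ω| ≤ M)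
    (hW : ∀ ω, |W ω| ≤ M) (hWm : Measurable W) (ha : 0 ≤ a) {A : Set Ω} (hA : MeasurableSet A)
    (h : ∀ ω ∉ A, |Y ω - W ω| ≤ a) :
    |outerExpectation μ Y - ∫ ω, W ω ∂μ| ≤ a + 2 * M * μ.real A := by
  have hWi : Integrable W μ := .of_bound hWm.aestronglyMeasurable M (.of_forall hW)
  have hi : Integrable (A.indicator fun _ => 2 * M) μ := (integrable_const _).indicator hA
  have hint : ∫ ω, A.indicator (fun _ => 2 * M) ω ∂μ = 2 * M * μ.real A := by
    rw [integral_indicator_const _ hA, smul_eq_mul, mul_comm]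
  have hi2 : Integrable (fun ω => a + A.indicator (fun _ => 2 * M) ω) μ :=
    (integrable_const _).add hi
  have hint2 : ∫ ω, (a + A.indicator (fun _ => 2 * M) ω) ∂μ = a + 2 * M * μ.real A := by
    rw [integral_add (integrable_const _) hi, hint]
    simp
  have key : ∀ ω, |Y ω - W ω| ≤ a + A.indicator (fun _ => 2 * M) ω := by
    intro ω
    by_cases hω : ω ∈ A
    · have h1 := abs_sub (Y ω) (W ω)
      simp only [hω, Set.indicator_of_mem]
      linarith [hY ω, hW ω]
    · simpa [hω] using h ω hω
  rw [abs_le]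
  constructor
  · have : ∫ ω, W ω ∂μ - (a + 2 * M * μ.real A) ≤ outerExpectation μ Y := by
      refine le_outerExpectation (fun ω => (le_abs_self _).trans (hY ω)) fun Z hZ hZi hYZ => ?_
      have e : ∫ ω, (W ω - (a + A.indicator (fun _ => 2 * M) ω)) ∂μ
          = ∫ ω, W ω ∂μ - (a + 2 * M * μ.real A) := by
        rw [integral_sub hWi hi2, hint2]
      rw [← e]
      refine integral_mono (hWi.sub hi2) hZi fun ω => ?_
      have := (abs_le.1 (key ω)).1
      have := hYZ ω
      simp only
      linarith
    linarith
  · have : outerExpectation μ Y ≤ ∫ ω, (W ω + (a + A.indicator (fun _ => 2 * M) ω)) ∂μ := by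
      refine outerExpectation_le (M := -M) (fun ω => (abs_le.1 (hY ω)).1) ?_
        (hWi.add hi2) fun ω => ?_
      · exact hWm.add (measurable_const.add (measurable_const.indicator hA))
      · have := (abs_le.1 (key ω)).2
        linarith
    rw [integral_add hWi hi2, hint2] at this
    linarith

end OuterExpectation

/-! ### Reduction to Lipschitz test functions by inf-convolution -/

section Lipschitz

variable {E : Type*} [PseudoMetricSpace E]

/-- The inf-convolution of a bounded function with `k` times the distance. -/
def infConv (φ : E → ℝ) (k : ℝ) (x : E) : ℝ := ⨅ y, (φ y + k * dist x y)

variable {φ : E → ℝ} {M k : ℝ}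

lemma infConv_bddBelow (hφ : ∀ x, |φ x| ≤ M) (hk : 0 ≤ k) (x : E) :
    BddBelow (Set.range fun y => φ y + k * dist x y) := by
  refine ⟨-M, ?_⟩
  rintro _ ⟨y, rfl⟩
  have := (abs_le.1 (hφ y)).1
  have : 0 ≤ k * dist x y := by positivity
  simp only
  linarith

lemma infConv_le (hφ : ∀ x, |φ x| ≤ M) (hk : 0 ≤ k) (x : E) : infConv φ k x ≤ φ x := by
  have := ciInf_le (infConv_bddBelow hφ hk x) x
  simp only [dist_self, mul_zero, add_zero] at this
  exact this

lemma abs_infConv_le (hφ : ∀ x, |φ x| ≤ M) (hk : 0 ≤ k) (x : E) : |infConv φ k x| ≤ M := by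
  have : Nonempty E := ⟨x⟩
  rw [abs_le]
  refine ⟨le_ciInf fun y => ?_, (infConv_le hφ hk x).trans ((le_abs_self _).trans (hφ x))⟩
  have := (abs_le.1 (hφ y)).1
  have : 0 ≤ k * dist x y := by positivity
  linarith

lemma lipschitzWith_infConv (hφ : ∀ x, |φ x| ≤ M) (k : NNReal) :
    LipschitzWith k (infConv φ k) := by
  refine LipschitzWith.of_le_add_mul k fun x y => ?_
  have : Nonempty E := ⟨x⟩
  rw [infConv, ← sub_le_iff_le_add]
  refine le_ciInf fun z => ?_
  have h1 := ciInf_le (infConv_bddBelow hφ k.2 x) z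
  have h2 := mul_le_mul_of_nonneg_left (dist_triangle x y z) k.2
  have : (⨅ y, (φ y + (k : ℝ) * dist x y)) ≤ φ z + k * dist x z := h1
  have h2' : (k : ℝ) * dist x z ≤ k * (dist x y + dist y z) := h2
  rw [sub_le_iff_le_add]
  linarith

/-- Once kδ ≥ 2M, a point at distance at least δ costs more than the total oscillation of φ, so only
points of the δ-ball, where φ is within ε/2 of φ(x), can lower the infimum. -/
lemma tendsto_infConv (hφ : ∀ x, |φ x| ≤ M) (hc : Continuous φ) (x : E) :
    Tendsto (fun k : ℕ => infConv φ k x) atTop (𝓝 (φ x)) := by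
  have : Nonempty E := ⟨x⟩
  rw [Metric.tendsto_atTop]
  intro ε hε
  obtain ⟨δ, hδ, h⟩ := Metric.continuous_iff.1 hc x (ε / 2) (by positivity)
  obtain ⟨N, hN⟩ := exists_nat_ge (2 * M / δ)
  refine ⟨N, fun k hk => ?_⟩
  have hkN : 2 * M ≤ k * δ := by
    rw [div_le_iff₀ hδ] at hN
    exact hN.trans (by gcongr)
  have h1 := infConv_le hφ (Nat.cast_nonneg (α := ℝ) k) x
  have h2 : φ x - ε / 2 ≤ infConv φ k x := by
    refine le_ciInf fun y => ?_
    by_cases hy : dist y x < δ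
    · have := h y hy
      rw [Real.dist_eq, abs_lt] at this
      have : 0 ≤ (k : ℝ) * dist x y := by positivity
      linarith
    · push Not at hy
      rw [dist_comm] at hy
      have := (abs_le.1 (hφ y)).1
      have := (abs_le.1 (hφ x)).2
      have : (k : ℝ) * δ ≤ k * dist x y := by gcongr
      linarith
  rw [Real.dist_eq, abs_lt]
  constructor <;> linarith

variable [MeasurableSpace E] [BorelSpace E]

/-- Inf-convolutions lie below φ, are uniformly bounded and converge pointwise; dominated
convergence under the fixed law κ selects one of them. -/
lemma exists_lipschitz_le_integral (κ : Measure E) [IsProbabilityMeasure κ] (φ : E →ᵇ ℝ) {ε : ℝ}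
    (hε : 0 < ε) : ∃ ψ : E →ᵇ ℝ, (∃ K, LipschitzWith K ψ) ∧ (∀ x, ψ x ≤ φ x) ∧
      (∀ x, |ψ x| ≤ ‖φ‖) ∧ ∫ x, φ x ∂κ - ε ≤ ∫ x, ψ x ∂κ := by
  have hφ : ∀ x, |φ x| ≤ ‖φ‖ := fun x => φ.norm_coe_le_norm x
  have hc : ∀ k : ℕ, Continuous (infConv φ k) := fun k =>
    (lipschitzWith_infConv hφ k).continuous
  have hlim : Tendsto (fun k : ℕ => ∫ x, infConv φ k x ∂κ) atTop (𝓝 (∫ x, φ x ∂κ)) := by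
    refine tendsto_integral_of_dominated_convergence (fun _ => ‖φ‖)
      (fun k => (hc k).measurable.aestronglyMeasurable) (integrable_const _)
      (fun k => .of_forall fun x => abs_infConv_le hφ k.cast_nonneg x)
      (.of_forall fun x => tendsto_infConv hφ φ.continuous x)
  obtain ⟨k, hk⟩ := (hlim.eventually_const_lt (sub_lt_self _ hε)).exists
  refine ⟨BoundedContinuousFunction.ofNormedAddCommGroup (infConv φ k) (hc k) ‖φ‖
    (abs_infConv_le hφ k.cast_nonneg), ⟨k, lipschitzWith_infConv hφ k⟩,
    infConv_le hφ k.cast_nonneg, abs_infConv_le hφ k.cast_nonneg, hk.le⟩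

/-- Convergence in distribution may be tested on bounded Lipschitz functions. -/
theorem convergesInDistribution_of_lipschitz {Ω : Type*} [MeasurableSpace Ω] {μ : Measure Ω}
    [IsProbabilityMeasure μ] {U : ℕ → Ω → E} {κ : Measure E} [IsProbabilityMeasure κ]
    (h : ∀ φ : E →ᵇ ℝ, (∃ K, LipschitzWith K φ) →
      Tendsto (fun n => outerExpectation μ (fun ω => φ (U n ω))) atTop (𝓝 (∫ x, φ x ∂κ))) :
    ConvergesInDistribution μ U κ := by
  intro φ
  have hφ : ∀ x, |φ x| ≤ ‖φ‖ := fun x => φ.norm_coe_le_norm x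
  rw [Metric.tendsto_atTop]
  intro ε hε
  obtain ⟨ψ, hψL, hψ, hψb, hψi⟩ := exists_lipschitz_le_integral κ φ (half_pos hε)
  -- The negative of a Lipschitz minorant of −φ is a Lipschitz majorant of φ. Outer expectation is
  -- monotone but not linear, hence a sandwich instead of a difference estimate.
  obtain ⟨χ, ⟨K, hχL⟩, hχ, hχb, hχi⟩ := exists_lipschitz_le_integral κ (-φ) (half_pos hε)
  have hneg : ∀ x, (-χ) x = - χ x := fun x => rfl
  have hχL' : LipschitzWith K (-χ : E →ᵇ ℝ) := by
    intro x y
    simpa [hneg] using hχL x y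
  have h1 := Metric.tendsto_atTop.1 (h ψ hψL) (ε / 2) (by positivity)
  have h2 := Metric.tendsto_atTop.1 (h (-χ) ⟨K, hχL'⟩) (ε / 2) (by positivity)
  obtain ⟨N1, h1⟩ := h1
  obtain ⟨N2, h2⟩ := h2
  refine ⟨max N1 N2, fun n hn => ?_⟩
  have h1 := h1 n (le_of_max_le_left hn)
  have h2 := h2 n (le_of_max_le_right hn)
  have l1 : outerExpectation μ (fun ω => ψ (U n ω)) ≤ outerExpectation μ (fun ω => φ (U n ω)) :=
    outerExpectation_mono (M := -‖φ‖) (fun ω => (abs_le.1 (hψb _)).1)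
      (fun ω => by simpa using (abs_le.1 (hφ _)).2) fun ω => hψ _
  have l2 : outerExpectation μ (fun ω => φ (U n ω)) ≤ outerExpectation μ (fun ω => (-χ) (U n ω)) :=
    outerExpectation_mono (M := -‖φ‖) (fun ω => (abs_le.1 (hφ _)).1)
      (fun ω => by
        have := (abs_le.1 (hχb (U n ω))).1
        rw [norm_neg] at this
        rw [hneg]; linarith) fun ω => by
          have := hχ (U n ω)
          rw [hneg]
          simp only [BoundedContinuousFunction.coe_neg, Pi.neg_apply] at this
          linarith
  simp only [hneg, BoundedContinuousFunction.coe_neg, Pi.neg_apply, integral_neg] at h2 hχi l2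
  rw [Real.dist_eq, abs_lt] at *
  constructor <;> linarith [h1.1, h1.2, h2.1, h2.2]

end Lipschitz

/-! ### Weak limits in countable products from characteristic functions -/

section Fidi

variable {I : Type*}

/-- Probability measures on a product of lines are determined by the characteristic functions of
the finite linear combinations of the coordinates. -/
lemma ext_of_charFun_finset {P Q : Measure (I → ℝ)} [IsProbabilityMeasure P]
    [IsProbabilityMeasure Q]
    (h : ∀ (J : Finset I) (a : I → ℝ),
      ∫ x, Complex.exp (((∑ i ∈ J, a i * x i : ℝ) : ℂ) * Complex.I) ∂P =
        ∫ x, Complex.exp (((∑ i ∈ J, a i * x i : ℝ) : ℂ) * Complex.I) ∂Q) : P = Q := by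
  classical
  have hP : IsProjectiveLimit P (fun J : Finset I => P.map J.restrict) := fun J => rfl
  have hQ : IsProjectiveLimit Q (fun J : Finset I => P.map J.restrict) := by
    intro J
    have : IsProbabilityMeasure (P.map J.restrict) :=
      Measure.isProbabilityMeasure_map (Finset.measurable_restrict J).aemeasurable
    have : IsProbabilityMeasure (Q.map J.restrict) :=
      Measure.isProbabilityMeasure_map (Finset.measurable_restrict J).aemeasurable
    refine (Measure.ext_of_charFunDual ?_).symm
    ext ℓ
    have hm : Continuous fun x : J → ℝ => Complex.exp ((ℓ x : ℂ) * Complex.I) := by fun_prop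
    rw [charFunDual_apply, charFunDual_apply,
      integral_map (Finset.measurable_restrict J).aemeasurable hm.aestronglyMeasurable,
      integral_map (Finset.measurable_restrict J).aemeasurable hm.aestronglyMeasurable]
    have key : ∀ x : I → ℝ, ℓ (J.restrict x) =
        ∑ i ∈ J, (if hi : i ∈ J then ℓ (Pi.single ⟨i, hi⟩ 1) else 0) * x i := by
      intro x
      have h1 : J.restrict x = ∑ i : J, x i • (Pi.single i (1 : ℝ) : J → ℝ) := by
        ext k
        simp [Finset.sum_apply, Pi.single_apply]
      rw [h1, map_sum, ← Finset.sum_coe_sort J]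
      refine Finset.sum_congr rfl fun i _ => ?_
      simp [mul_comm]
    simp only [key]
    exact h J _
  exact hP.unique hQ

variable {Ω : Type*} [MeasurableSpace Ω] {μ : Measure Ω} [IsProbabilityMeasure μ]

/-- The mass ε is distributed as a convergent sum over the countably many coordinates, and a product
of compact sets is compact. -/
lemma isTightMeasureSet_range_pi [Countable I] {ρ : ℕ → Measure (I → ℝ)}
    (h : ∀ i, IsTightMeasureSet (Set.range fun n => (ρ n).map fun x => x i)) :
    IsTightMeasureSet (Set.range ρ) := by
  rw [isTightMeasureSet_iff_exists_isCompact_measure_compl_le]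
  intro ε hε
  obtain ⟨δ, hδ, hδε⟩ := ENNReal.exists_pos_sum_of_countable' hε.ne' I
  choose K hK hKδ using fun i =>
    isTightMeasureSet_iff_exists_isCompact_measure_compl_le.1 (h i) (δ i) (hδ i)
  refine ⟨Set.pi Set.univ K, isCompact_univ_pi hK, ?_⟩
  rintro _ ⟨n, rfl⟩
  have hsub : (Set.pi Set.univ K)ᶜ ⊆ ⋃ i, (fun x : I → ℝ => x i) ⁻¹' (K i)ᶜ := by
    intro x hx
    simpa [Set.mem_pi] using hx
  calc ρ n (Set.pi Set.univ K)ᶜ ≤ ∑' i, ρ n ((fun x : I → ℝ => x i) ⁻¹' (K i)ᶜ) :=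
        (measure_mono hsub).trans (measure_iUnion_le _)
    _ ≤ ∑' i, δ i := by
        refine ENNReal.tsum_le_tsum fun i => ?_
        rw [← Measure.map_apply (measurable_pi_apply i) (hK i).measurableSet.compl]
        exact hKδ i _ ⟨n, rfl⟩
    _ ≤ ε := hδε.le

/-- If the characteristic functions of all finite linear combinations of random sequences converge
to continuous limits, the sequences converge weakly in the product space. -/
theorem exists_tendsto_pi [Countable I] {X : ℕ → Ω → I → ℝ}
    (hX : ∀ n, Measurable (X n)) {q : Finset I → (I → ℝ) → ℝ}
    (hq : ∀ J a (t : ℝ), q J (fun i => t * a i) = t ^ 2 * q J a)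
    (h : ∀ (J : Finset I) (a : I → ℝ), Tendsto
      (fun n => ∫ ω, Complex.exp (((∑ i ∈ J, a i * X n ω i : ℝ) : ℂ) * Complex.I) ∂μ) atTop
      (𝓝 (Complex.exp (((-(q J a) / 2 : ℝ) : ℂ))))) :
    ∃ Λ : ProbabilityMeasure (I → ℝ),
      (∀ (J : Finset I) (a : I → ℝ),
        ∫ x, Complex.exp (((∑ i ∈ J, a i * x i : ℝ) : ℂ) * Complex.I) ∂(Λ : Measure (I → ℝ)) =
          Complex.exp (((-(q J a) / 2 : ℝ) : ℂ))) ∧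
      ∀ f : (I → ℝ) →ᵇ ℝ, Tendsto (fun n => ∫ ω, f (X n ω) ∂μ) atTop
        (𝓝 (∫ x, f x ∂(Λ : Measure (I → ℝ)))) := by
  classical
  let L : ℕ → ProbabilityMeasure (I → ℝ) := fun n =>
    ⟨μ.map (X n), Measure.isProbabilityMeasure_map (hX n).aemeasurable⟩
  have hL : ∀ n, (L n : Measure (I → ℝ)) = μ.map (X n) := fun n => rfl
  have tight : IsTightMeasureSet (Set.range fun n => (L n : Measure (I → ℝ))) := by
    refine isTightMeasureSet_range_pi fun i => ?_
    have hm : ∀ n, Measurable fun ω => X n ω i := fun n =>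
      (measurable_pi_apply i).comp (hX n)
    have hmap : ∀ n, (L n : Measure (I → ℝ)).map (fun x => x i) = μ.map fun ω => X n ω i := by
      intro n
      rw [hL, Measure.map_map (measurable_pi_apply i) (hX n)]
      rfl
    have : ∀ n, IsProbabilityMeasure ((L n : Measure (I → ℝ)).map fun x => x i) := fun n =>
      Measure.isProbabilityMeasure_map (measurable_pi_apply i).aemeasurable
    -- Lévy's criterion: homogeneity of q identifies the limit of the coordinate's characteristic
    -- function as exp(−t²q/2), which is continuous.
    refine isTightMeasureSet_of_tendsto_charFun
      (f := fun t => Complex.exp (((-(t ^ 2 * q {i} 1) / 2 : ℝ) : ℂ))) (by fun_prop) fun t => ?_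
    have ht := h {i} (fun _ => t * 1)
    have hq' := hq {i} 1 t
    simp only [Pi.one_apply] at hq'
    rw [hq'] at ht
    refine ht.congr fun n => ?_
    rw [hmap, charFun_apply_real, integral_map (hm n).aemeasurable (by fun_prop)]
    simp
  have compact : IsCompact (closure (Set.range L)) := by
    refine isCompact_closure_of_isTightMeasureSet ?_
    convert tight using 1
    ext m
    simp
  -- Tightness gives a limit along every ultrafilter. Its characteristic functions are prescribed by
  -- the hypothesis, so all these limits coincide and the whole sequence converges.
  have lim : ∀ U : Ultrafilter ℕ, (U : Filter ℕ) ≤ atTop → ∃ Λ : ProbabilityMeasure (I → ℝ),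
      Tendsto L U (𝓝 Λ) ∧ ∀ (J : Finset I) (a : I → ℝ),
        ∫ x, Complex.exp (((∑ i ∈ J, a i * x i : ℝ) : ℂ) * Complex.I) ∂(Λ : Measure (I → ℝ)) =
          Complex.exp (((-(q J a) / 2 : ℝ) : ℂ)) := by
    intro U hU
    obtain ⟨Λ, -, hΛ : Tendsto L U (𝓝 Λ)⟩ := compact.ultrafilter_le_nhds (U.map L)
      (le_principal_iff.2 (mem_of_superset (Filter.mem_map.2 (by simp)) subset_closure))
    refine ⟨Λ, hΛ, fun J a => ?_⟩
    rw [ProbabilityMeasure.tendsto_iff_forall_integral_rclike_tendsto ℂ] at hΛ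
    let g : (I → ℝ) →ᵇ ℂ := BoundedContinuousFunction.ofNormedAddCommGroup
      (fun x => Complex.exp (((∑ i ∈ J, a i * x i : ℝ) : ℂ) * Complex.I)) (by fun_prop) 1
      (fun x => (Complex.norm_exp_ofReal_mul_I _).le)
    refine tendsto_nhds_unique (hΛ g) (((h J a).mono_left hU).congr fun n => ?_)
    rw [hL, integral_map (hX n).aemeasurable g.continuous.aestronglyMeasurable]
    rfl
  obtain ⟨Λ, -, hΛ⟩ := lim (Ultrafilter.of atTop) (Ultrafilter.of_le _)
  refine ⟨Λ, hΛ, ?_⟩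
  have hT : Tendsto L atTop (𝓝 Λ) := by
    refine (tendsto_iff_ultrafilter _ _ _).2 fun U hU => ?_
    obtain ⟨Λ', h1, h2⟩ := lim U hU
    have : Λ' = Λ := by
      have e : (Λ' : Measure (I → ℝ)) = (Λ : Measure (I → ℝ)) :=
        ext_of_charFun_finset fun J a => (h2 J a).trans (hΛ J a).symm
      exact Subtype.ext e
    rwa [this] at h1
  intro f
  refine ((ProbabilityMeasure.tendsto_iff_forall_integral_tendsto.1 hT) f).congr fun n => ?_
  rw [hL, integral_map (hX n).aemeasurable f.continuous.aestronglyMeasurable]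

end Fidi

/-! ### Convergence in distribution through approximations by functions of countably many
coordinates -/

/-- The space E need not be separable. A strongly measurable map takes values in a closed separable
subset, which is Polish; tightness holds there and is carried back by the inclusion. -/
lemma isTightMeasureSet_singleton_map {Ω E : Type*} [MeasurableSpace Ω] {μ : Measure Ω}
    [IsFiniteMeasure μ] [MetricSpace E] [CompleteSpace E] [MeasurableSpace E] [BorelSpace E]
    {K : Ω → E} (hK : StronglyMeasurable K) : IsTightMeasureSet {μ.map K} := by
  let C : Set E := closure (Set.range K)
  have hsep : TopologicalSpace.IsSeparable C := hK.isSeparable_range.closure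
  have : CompleteSpace C := isClosed_closure.completeSpace_coe
  have : TopologicalSpace.SeparableSpace C := hsep.separableSpace
  have : SecondCountableTopology C := UniformSpace.secondCountable_of_separable C
  let K' : Ω → C := fun ω => ⟨K ω, subset_closure ⟨ω, rfl⟩⟩
  have hK' : Measurable K' := hK.measurable.subtype_mk
  have h1 : IsTightMeasureSet {μ.map K'} := isTightMeasureSet_singleton
  have h2 := h1.map (continuous_subtype_val (p := fun x => x ∈ C))
  have h3 : (μ.map K').map Subtype.val = μ.map K := by
    rw [Measure.map_map measurable_subtype_coe hK']
    rfl
  simpa [h3] using h2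

/-- Two successive approximations K_j(X_n) and K_{j+1}(X_n) are both close to U_n, hence to each
other. This closeness involves X_n only, so it survives the weak limit and makes K_j almost surely
Cauchy under Λ. The limit map K' then carries Λ to the limit law. Neither separability of E nor
measurability of U_n is required. -/
theorem exists_limit_of_approx {Ω : Type*} [MeasurableSpace Ω] {μ : Measure Ω}
    [IsProbabilityMeasure μ] {V : Type*} [TopologicalSpace V] [SecondCountableTopology V]
    [MeasurableSpace V] [BorelSpace V]
    {E : Type*} [MetricSpace E] [CompleteSpace E] [Nonempty E] [MeasurableSpace E] [BorelSpace E]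
    {X : ℕ → Ω → V} (hX : ∀ n, Measurable (X n)) {Λ : Measure V} [IsProbabilityMeasure Λ]
    (hXΛ : ∀ f : V →ᵇ ℝ, Tendsto (fun n => ∫ ω, f (X n ω) ∂μ) atTop (𝓝 (∫ x, f x ∂Λ)))
    {K : ℕ → V → E} (hK : ∀ j, Continuous (K j)) {U : ℕ → Ω → E}
    (hU : ∀ j : ℕ, ∀ᶠ n in atTop, ∃ A, MeasurableSet A ∧ μ.real A ≤ (1 / 2) ^ j ∧
      ∀ ω ∉ A, dist (U n ω) (K j (X n ω)) ≤ (1 / 2) ^ j) :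
    ∃ K' : V → E, StronglyMeasurable K' ∧
      (∀ᵐ x ∂Λ, Tendsto (fun j => K j x) atTop (𝓝 (K' x))) ∧
      ConvergesInDistribution μ U (Λ.map K') := by
  have hdc : ∀ j k, Continuous fun x => min 1 (dist (K j x) (K k x)) := fun j k =>
    continuous_const.min ((hK j).dist (hK k))
  have hd0 : ∀ j k x, 0 ≤ min 1 (dist (K j x) (K k x)) := fun j k x => by positivity
  have hd1 : ∀ j k x, ‖min 1 (dist (K j x) (K k x))‖ ≤ 1 := fun j k x => by
    rw [Real.norm_of_nonneg (hd0 j k x)]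
    exact min_le_left _ _
  have hdi : ∀ j k, Integrable (fun x => min 1 (dist (K j x) (K k x))) Λ := fun j k =>
    .of_bound (hdc j k).aestronglyMeasurable 1 (.of_forall (hd1 j k))
  -- The truncated distance is a bounded continuous function on V, so its integral under Λ is the
  -- limit of expectations, each at most 2·2^{-j} plus the probability of the two exceptional
  -- events.
  have hdist : ∀ j, ∫ x, min 1 (dist (K j x) (K (j + 1) x)) ∂Λ ≤ 4 * (1 / 2) ^ j := by
    intro j
    refine le_of_tendsto (hXΛ (BoundedContinuousFunction.ofNormedAddCommGroup _ (hdc j (j + 1)) 1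
      (hd1 j (j + 1)))) ?_
    filter_upwards [hU j, hU (j + 1)] with n ⟨A, hA, hμA, h1⟩ ⟨A', hA', hμA', h2⟩
    have hp : ((1 : ℝ) / 2) ^ (j + 1) ≤ (1 / 2) ^ j :=
      pow_le_pow_of_le_one (by norm_num) (by norm_num) (Nat.le_succ j)
    have hB : MeasurableSet (A ∪ A') := hA.union hA'
    have hμB : μ.real (A ∪ A') ≤ 2 * (1 / 2) ^ j := by
      linarith [measureReal_union_le (μ := μ) A A']
    have hi : Integrable ((A ∪ A').indicator fun _ => (1 : ℝ)) μ :=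
      (integrable_const _).indicator hB
    calc ∫ ω, min 1 (dist (K j (X n ω)) (K (j + 1) (X n ω))) ∂μ
        ≤ ∫ ω, (2 * (1 / 2) ^ j + (A ∪ A').indicator (fun _ => (1 : ℝ)) ω) ∂μ := by
          refine integral_mono (.of_bound ((hdc j (j + 1)).measurable.comp
            (hX n)).aestronglyMeasurable 1 (.of_forall fun ω => hd1 j (j + 1) _))
            ((integrable_const _).add hi) fun ω => ?_
          by_cases hω : ω ∈ A ∪ A'
          · simp only [hω, Set.indicator_of_mem]
            have : (0 : ℝ) ≤ 2 * (1 / 2) ^ j := by positivity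
            linarith [min_le_left 1 (dist (K j (X n ω)) (K (j + 1) (X n ω)))]
          · have h1 := h1 ω fun h => hω (.inl h)
            have h2 := h2 ω fun h => hω (.inr h)
            have := dist_triangle_left (K j (X n ω)) (K (j + 1) (X n ω)) (U n ω)
            simp only [hω, not_false_eq_true, Set.indicator_of_notMem, add_zero]
            exact (min_le_right _ _).trans (by linarith)
      _ = 2 * (1 / 2) ^ j + μ.real (A ∪ A') := by
          rw [integral_add (integrable_const _) hi, integral_indicator_const _ hB]
          simp
      _ ≤ 4 * (1 / 2) ^ j := by linarith
  have hsum : ∀ᵐ x ∂Λ, Summable fun j => min 1 (dist (K j x) (K (j + 1) x)) := by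
    have hnn : ∀ j, ∫⁻ x, ENNReal.ofReal (min 1 (dist (K j x) (K (j + 1) x))) ∂Λ ≤
        ENNReal.ofReal (4 * (1 / 2) ^ j) := fun j => by
      rw [← ofReal_integral_eq_lintegral_ofReal (hdi j (j + 1)) (.of_forall (hd0 j (j + 1)))]
      exact ENNReal.ofReal_le_ofReal (hdist j)
    have hfin : ∫⁻ x, ∑' j, ENNReal.ofReal (min 1 (dist (K j x) (K (j + 1) x))) ∂Λ ≠ ∞ := by
      rw [lintegral_tsum fun j => (hdc j (j + 1)).measurable.ennreal_ofReal.aemeasurable]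
      refine ne_top_of_le_ne_top ?_ (ENNReal.tsum_le_tsum hnn)
      rw [← ENNReal.ofReal_tsum_of_nonneg (fun j => by positivity)
        ((summable_geometric_of_lt_one (by norm_num) (by norm_num)).mul_left _)]
      exact ENNReal.ofReal_ne_top
    filter_upwards [ae_lt_top' (AEMeasurable.tsum fun j =>
      (hdc j (j + 1)).measurable.ennreal_ofReal.aemeasurable) hfin] with x hx
    refine (ENNReal.summable_toReal hx.ne).congr fun j => ?_
    rw [ENNReal.toReal_ofReal (hd0 j (j + 1) x)]
  have hlim : ∀ᵐ x ∂Λ, ∃ l, Tendsto (fun j => K j x) atTop (𝓝 l) := by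
    filter_upwards [hsum] with x hx
    refine cauchySeq_tendsto_of_complete (cauchySeq_of_summable_dist ?_)
    -- The terms of a convergent series tend to zero, so the truncation at 1 is eventually inactive.
    refine hx.congr_atTop ?_
    filter_upwards [hx.tendsto_atTop_zero.eventually_lt_const one_pos] with j hj
    exact min_eq_right (by by_contra! h; rw [min_eq_left h.le] at hj; exact lt_irrefl _ hj)
  obtain ⟨K', hK'm, hK'⟩ := exists_stronglyMeasurable_limit_of_tendsto_ae
    (fun j => (hK j).stronglyMeasurable.aestronglyMeasurable) hlim
  refine ⟨K', hK'm, hK', ?_⟩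
  have : IsProbabilityMeasure (Λ.map K') :=
    Measure.isProbabilityMeasure_map hK'm.measurable.aemeasurable
  refine convergesInDistribution_of_lipschitz fun φ ⟨C, hC⟩ => ?_
  have hφ : ∀ x, |φ x| ≤ ‖φ‖ := fun x => φ.norm_coe_le_norm x
  rw [integral_map hK'm.measurable.aemeasurable φ.continuous.aestronglyMeasurable]
  have hconv : Tendsto (fun j => ∫ x, φ (K j x) ∂Λ) atTop (𝓝 (∫ x, φ (K' x) ∂Λ)) := by
    refine tendsto_integral_of_dominated_convergence (fun _ => ‖φ‖)
      (fun j => (φ.continuous.comp (hK j)).aestronglyMeasurable) (integrable_const _)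
      (fun j => .of_forall fun x => hφ _) ?_
    filter_upwards [hK'] with x hx
    exact (φ.continuous.tendsto _).comp hx
  have hpow : Tendsto (fun j : ℕ => (C + 2 * ‖φ‖) * (1 / 2 : ℝ) ^ j) atTop (𝓝 0) := by
    simpa using (tendsto_pow_atTop_nhds_zero_of_lt_one (by norm_num : (0 : ℝ) ≤ 1 / 2)
      (by norm_num)).const_mul ((C : ℝ) + 2 * ‖φ‖)
  rw [Metric.tendsto_atTop]
  intro ε hε
  -- The level j is fixed first, making both K_j → K' and the approximation error small; only then
  -- does n tend to infinity.
  obtain ⟨j, hj1, hj2⟩ := ((Metric.tendsto_nhds.1 hconv (ε / 3) (by positivity)).and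
    (hpow.eventually_lt_const (by positivity : (0 : ℝ) < ε / 3))).exists
  have hj3 := Metric.tendsto_nhds.1 (hXΛ (BoundedContinuousFunction.ofNormedAddCommGroup
    (fun x => φ (K j x)) (φ.continuous.comp (hK j)) ‖φ‖ fun x => hφ _)) (ε / 3) (by positivity)
  refine eventually_atTop.1 ?_
  filter_upwards [hj3, hU j] with n h3 ⟨A, hA, hμA, hd⟩
  have h4 := abs_outerExpectation_sub_integral_le (μ := μ) (Y := fun ω => φ (U n ω))
    (W := fun ω => φ (K j (X n ω))) (fun ω => hφ _) (fun ω => hφ _)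
    ((φ.continuous.comp (hK j)).measurable.comp (hX n)) (a := C * (1 / 2) ^ j) (by positivity)
    hA fun ω hω => by
      have := hC.dist_le_mul (U n ω) (K j (X n ω))
      rw [Real.dist_eq] at this
      exact this.trans (by gcongr; exact hd ω hω)
  have h5 : 2 * ‖φ‖ * μ.real A ≤ 2 * ‖φ‖ * (1 / 2) ^ j := by gcongr
  rw [Real.dist_eq] at *
  simp only [BoundedContinuousFunction.coe_ofNormedAddCommGroup] at h3
  rw [abs_lt] at *
  rw [abs_le] at h4
  constructor <;> linarith [h4.1, h4.2, h3.1, h3.2, hj1.1, hj1.2]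

/-! ### Gaussian processes from characteristic functions -/

section Gaussian

variable {Ω T : Type*} [MeasurableSpace Ω] {μ : Measure Ω} [IsProbabilityMeasure μ]
  {Y : T → Ω → ℝ} {c : T → T → ℝ}

/-- The quadratic form of a kernel. -/
def quadForm (c : T → T → ℝ) (J : Finset T) (a : T → ℝ) : ℝ :=
  ∑ i ∈ J, ∑ k ∈ J, a i * a k * c i k

lemma quadForm_smul (c : T → T → ℝ) (J : Finset T) (a : T → ℝ) (t : ℝ) :
    quadForm c J (fun i => t * a i) = t ^ 2 * quadForm c J a := by
  simp only [quadForm, Finset.mul_sum]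
  exact Finset.sum_congr rfl fun i _ => Finset.sum_congr rfl fun k _ => by ring

/-- Nonnegativity of the quadratic form is not assumed: it follows because a characteristic function
has modulus at most one. Scaling the coefficients by t then yields the full Gaussian characteristic
function. -/
lemma map_sum_eq_gaussianReal (hY : ∀ p, Measurable (Y p))
    (h : ∀ (J : Finset T) (a : T → ℝ),
      ∫ ω, Complex.exp (((∑ i ∈ J, a i * Y i ω : ℝ) : ℂ) * Complex.I) ∂μ =
        Complex.exp (((-(quadForm c J a) / 2 : ℝ) : ℂ))) (J : Finset T) (a : T → ℝ) :
    0 ≤ quadForm c J a ∧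
      μ.map (fun ω => ∑ i ∈ J, a i * Y i ω) = gaussianReal 0 (quadForm c J a).toNNReal := by
  have hq : 0 ≤ quadForm c J a := by
    have h1 : ‖∫ ω, Complex.exp (((∑ i ∈ J, a i * Y i ω : ℝ) : ℂ) * Complex.I) ∂μ‖ ≤ 1 := by
      refine (norm_integral_le_of_norm_le_const (C := 1) (.of_forall fun ω => ?_)).trans
        (by simp)
      rw [Complex.norm_exp_ofReal_mul_I]
    rw [h, ← Complex.ofReal_exp, Complex.norm_real, Real.norm_of_nonneg (Real.exp_pos _).le,
      Real.exp_le_one_iff] at h1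
    linarith
  refine ⟨hq, ?_⟩
  have hm : Measurable fun ω => ∑ i ∈ J, a i * Y i ω :=
    Finset.measurable_sum _ fun i _ => (hY i).const_mul _
  have : IsProbabilityMeasure (μ.map fun ω => ∑ i ∈ J, a i * Y i ω) :=
    Measure.isProbabilityMeasure_map hm.aemeasurable
  refine Measure.ext_of_charFun ?_
  ext t
  rw [charFun_apply_real, charFun_gaussianReal, integral_map hm.aemeasurable (by fun_prop)]
  have := h J fun i => t * a i
  rw [quadForm_smul] at this
  convert this using 2
  · ext ω
    rw [← Complex.ofReal_mul, Finset.mul_sum]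
    simp only [mul_assoc]
  · rw [Real.coe_toNNReal _ hq]
    push_cast
    ring

/-- A linear functional of a finite marginal is a linear combination of coordinates, hence Gaussian.
The covariance is obtained by polarization from the variances of Y_p, Y_q and Y_p + Y_q, which is
where symmetry of c enters. -/
theorem isGaussianProcess_of_charFun (hY : ∀ p, Measurable (Y p)) (hc : ∀ p q, c p q = c q p)
    (h : ∀ (J : Finset T) (a : T → ℝ),
      ∫ ω, Complex.exp (((∑ i ∈ J, a i * Y i ω : ℝ) : ℂ) * Complex.I) ∂μ =
        Complex.exp (((-(quadForm c J a) / 2 : ℝ) : ℂ))) :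
    IsGaussianProcess Y μ ∧ (∀ p, ∫ ω, Y p ω ∂μ = 0) ∧ ∀ p q, cov[Y p, Y q; μ] = c p q := by
  classical
  have hmap := map_sum_eq_gaussianReal hY h
  have hG : IsGaussianProcess Y μ := by
    refine ⟨fun J => ⟨isGaussian_of_map_eq_gaussianReal fun ℓ => ?_⟩⟩
    have hm : Measurable fun ω => J.restrict (Y · ω) :=
      measurable_pi_lambda _ fun i => hY i
    have hJ := (hmap J fun i => if hi : i ∈ J then ℓ (Pi.single ⟨i, hi⟩ 1) else 0).2
    refine ⟨_, _, Eq.trans ?_ hJ⟩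
    rw [Measure.map_map (by fun_prop) hm]
    congr 1
    ext ω
    have h1 : J.restrict (Y · ω) = ∑ i : J, Y i ω • (Pi.single i (1 : ℝ) : J → ℝ) := by
      ext k
      simp [Finset.sum_apply, Pi.single_apply]
    rw [Function.comp_apply, h1, map_sum, ← Finset.sum_coe_sort J]
    refine Finset.sum_congr rfl fun i _ => ?_
    simp [mul_comm]
  have hvar : ∀ p, Var[Y p; μ] = c p p ∧ ∫ ω, Y p ω ∂μ = 0 := by
    intro p
    obtain ⟨h0, h1⟩ := hmap {p} fun _ => 1
    have e : (fun ω => ∑ i ∈ ({p} : Finset T), 1 * Y i ω) = Y p := by ext; simp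
    have e' : quadForm c {p} (fun _ => 1) = c p p := by simp [quadForm]
    rw [e, e'] at h1
    rw [e'] at h0
    have hL : HasLaw (Y p) (gaussianReal 0 (c p p).toNNReal) μ := ⟨(hY p).aemeasurable, h1⟩
    rw [hL.variance_eq, variance_id_gaussianReal, hL.integral_eq, integral_id_gaussianReal]
    simp [h0]
  have hL2 : ∀ p, MemLp (Y p) 2 μ := fun p => (hG.hasGaussianLaw_eval p).memLp_two
  refine ⟨hG, fun p => (hvar p).2, fun p q => ?_⟩
  by_cases hpq : p = q
  · subst hpq
    rw [covariance_self (hY p).aemeasurable, (hvar p).1]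
  obtain ⟨h0, h1⟩ := hmap {p, q} fun _ => 1
  have e : (fun ω => ∑ i ∈ ({p, q} : Finset T), 1 * Y i ω) = Y p + Y q := by
    ext; simp [Finset.sum_pair hpq]
  have e' : quadForm c {p, q} (fun _ => 1) = c p p + 2 * c p q + c q q := by
    simp [quadForm, Finset.sum_pair hpq, hc q p]
    ring
  rw [e, e'] at h1
  rw [e'] at h0
  have hL : HasLaw (Y p + Y q) (gaussianReal 0 (c p p + 2 * c p q + c q q).toNNReal) μ :=
    ⟨((hY p).add (hY q)).aemeasurable, h1⟩
  have h2 := hL.variance_eq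
  rw [variance_id_gaussianReal, variance_add (hL2 p) (hL2 q), (hvar p).1, (hvar q).1,
    Real.coe_toNNReal _ h0] at h2
  linarith

end Gaussian

/-! ### A limit theorem in `ℓ^∞(T)` -/

section LInfty

variable {T I : Type*}

/-- A function with finite range, composed with a family of real numbers, as an element of
`ℓ^∞(T)`. -/
def finiteRangeComp (π : T → I) (hπ : (Set.range π).Finite) (x : I → ℝ) : ℓ^∞(T, ℝ) :=
  ⟨fun p => x (π p), memℓp_infty (((hπ.image fun i => ‖x i‖).subset (by
    rintro _ ⟨p, rfl⟩
    exact ⟨_, ⟨p, rfl⟩, rfl⟩)).bddAbove)⟩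

lemma dist_le_of_forall {x y : ℓ^∞(T, ℝ)} {C : ℝ} (hC : 0 ≤ C) (h : ∀ p, |x p - y p| ≤ C) :
    dist x y ≤ C := by
  rw [dist_eq_norm]
  exact lp.norm_le_of_forall_le hC h

lemma abs_sub_le_dist (x y : ℓ^∞(T, ℝ)) (p : T) : |x p - y p| ≤ dist x y := by
  rw [dist_eq_norm]
  exact lp.norm_apply_le_norm ENNReal.top_ne_zero (x - y) p

lemma continuous_linfty_apply (p : T) : Continuous fun x : ℓ^∞(T, ℝ) => x p := by
  refine (LipschitzWith.of_dist_le_mul (K := 1) fun x y => ?_).continuous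
  simpa [Real.dist_eq] using abs_sub_le_dist x y p

/-- Only finitely many coordinates of x occur, so convergence in the product topology is uniform
over them. -/
lemma continuous_finiteRangeComp (π : T → I) (hπ : (Set.range π).Finite) :
    Continuous (finiteRangeComp π hπ) := by
  rw [continuous_iff_continuousAt]
  intro x
  rw [ContinuousAt, Metric.tendsto_nhds]
  intro ε hε
  have : ∀ᶠ y in 𝓝 x, ∀ i ∈ Set.range π, dist (y i) (x i) < ε / 2 := by
    rw [eventually_all_finite hπ]
    intro i _
    exact Metric.tendsto_nhds.1 ((continuous_apply i).tendsto x) _ (by positivity)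
  filter_upwards [this] with y hy
  refine (dist_le_of_forall (by positivity : 0 ≤ ε / 2) fun p => ?_).trans_lt (by linarith)
  exact (hy _ ⟨p, rfl⟩).le

lemma tendsto_integral_exp_sum {V : Type*} [MeasurableSpace V] {Λ : Measure V}
    [IsProbabilityMeasure Λ] {Y : ℕ → T → V → ℝ} {Y' : V → T → ℝ} (J : Finset T) (a : T → ℝ)
    (hY : ∀ j p, Measurable (Y j p))
    (h : ∀ᵐ x ∂Λ, ∀ p, Tendsto (fun j => Y j p x) atTop (𝓝 (Y' x p))) :
    Tendsto (fun j => ∫ x, Complex.exp (((∑ i ∈ J, a i * Y j i x : ℝ) : ℂ) * Complex.I) ∂Λ) atTop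
      (𝓝 (∫ x, Complex.exp (((∑ i ∈ J, a i * Y' x i : ℝ) : ℂ) * Complex.I) ∂Λ)) := by
  refine tendsto_integral_of_dominated_convergence (fun _ => 1) (fun j => ?_)
    (integrable_const _) (fun j => .of_forall fun x => ?_) ?_
  · have : Measurable fun x => ∑ i ∈ J, a i * Y j i x :=
      Finset.measurable_sum _ fun i _ => (hY j i).const_mul _
    exact (by fun_prop : Measurable fun x =>
      Complex.exp (((∑ i ∈ J, a i * Y j i x : ℝ) : ℂ) * Complex.I)).aestronglyMeasurable
  · rw [Complex.norm_exp_ofReal_mul_I]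
  · filter_upwards [h] with x hx
    refine (Complex.continuous_exp.tendsto _).comp (Tendsto.mul_const _ ?_)
    exact (Complex.continuous_ofReal.tendsto _).comp
      (tendsto_finsetSum _ fun i _ => (hx i).const_mul _)

/-- Several indices may share one image under π; their coefficients are collected along fibres,
turning a combination over T into one over I. -/
lemma sum_image_mul [DecidableEq I] (π : T → I) (J : Finset T) (a : T → ℝ) (f : I → ℝ) :
    ∑ i ∈ J.image π, (∑ p ∈ J with π p = i, a p) * f i = ∑ p ∈ J, a p * f (π p) := by
  rw [← Finset.sum_fiberwise_of_maps_to (g := π) (t := J.image π)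
    fun p hp => Finset.mem_image_of_mem _ hp]
  refine Finset.sum_congr rfl fun i _ => ?_
  rw [Finset.sum_mul]
  refine Finset.sum_congr rfl fun p hp => ?_
  rw [(Finset.mem_filter.1 hp).2]

lemma quadForm_image [DecidableEq I] (c : I → I → ℝ) (π : T → I) (J : Finset T) (a : T → ℝ) :
    quadForm c (J.image π) (fun i => ∑ p ∈ J with π p = i, a p) =
      ∑ i ∈ J, ∑ k ∈ J, a i * a k * c (π i) (π k) := by
  simp only [quadForm, mul_assoc, ← Finset.mul_sum]
  rw [sum_image_mul π J a fun i => ∑ k ∈ J.image π, (∑ p ∈ J with π p = k, a p) * c i k]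
  refine Finset.sum_congr rfl fun p _ => ?_
  rw [sum_image_mul π J a fun k => c (π p) k]

/-- Convergence in distribution in `ℓ^∞(T)` to a tight Gaussian process, for processes which are
approximated by finitely many coordinates. -/
theorem exists_gaussian_limit {Ω : Type*} [MeasurableSpace Ω] {μ : Measure Ω}
    [IsProbabilityMeasure μ] [Countable I] {X : ℕ → Ω → I → ℝ} (hX : ∀ n, Measurable (X n))
    {c : I → I → ℝ} (h : ∀ (J : Finset I) (a : I → ℝ), Tendsto
      (fun n => ∫ ω, Complex.exp (((∑ i ∈ J, a i * X n ω i : ℝ) : ℂ) * Complex.I) ∂μ) atTop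
      (𝓝 (Complex.exp (((-(quadForm c J a) / 2 : ℝ) : ℂ)))))
    {π : ℕ → T → I} (hπ : ∀ j, (Set.range (π j)).Finite) {U : ℕ → Ω → ℓ^∞(T, ℝ)}
    (hU : ∀ j : ℕ, ∀ᶠ n in atTop, ∃ A, MeasurableSet A ∧ μ.real A ≤ (1 / 2) ^ j ∧
      ∀ ω ∉ A, ∀ p, |U n ω p - X n ω (π j p)| ≤ (1 / 2) ^ j)
    {d : T → T → ℝ} (hd : ∀ p q, d p q = d q p)
    (hlim : ∀ p q, Tendsto (fun j => c (π j p) (π j q)) atTop (𝓝 (d p q))) :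
    ∃ κ : Measure (ℓ^∞(T, ℝ)), IsProbabilityMeasure κ ∧ IsTightMeasureSet {κ} ∧
      IsGaussianProcess (fun (p : T) (x : ℓ^∞(T, ℝ)) => x p) κ ∧ (∀ p, ∫ x, x p ∂κ = 0) ∧
      (∀ p q, cov[fun x => x p, fun x => x q; κ] = d p q) ∧
      ConvergesInDistribution μ U κ := by
  classical
  obtain ⟨Λ, hΛ, hXΛ⟩ := exists_tendsto_pi hX (q := quadForm c)
    (fun J a t => quadForm_smul c J a t) h
  obtain ⟨K, hKm, hK, hconv⟩ := exists_limit_of_approx (E := ℓ^∞(T, ℝ)) hX hXΛ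
    (K := fun j => finiteRangeComp (π j) (hπ j)) (fun j => continuous_finiteRangeComp _ _)
    (U := U) fun j => by
      filter_upwards [hU j] with n ⟨A, hA, hμA, hd⟩
      exact ⟨A, hA, hμA, fun ω hω => dist_le_of_forall (by positivity) (hd ω hω)⟩
  have hprob : IsProbabilityMeasure ((Λ : Measure (I → ℝ)).map K) :=
    Measure.isProbabilityMeasure_map hKm.measurable.aemeasurable
  have hGauss := isGaussianProcess_of_charFun (μ := (Λ : Measure (I → ℝ)).map K)
    (Y := fun (p : T) (x : ℓ^∞(T, ℝ)) => x p) (c := d)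
    (fun p => (continuous_linfty_apply p).measurable) hd ?_
  · exact ⟨_, hprob, isTightMeasureSet_singleton_map hKm, hGauss.1, hGauss.2.1, hGauss.2.2, hconv⟩
  intro J a
  have hcont : Continuous fun x : ℓ^∞(T, ℝ) =>
      Complex.exp (((∑ i ∈ J, a i * x i : ℝ) : ℂ) * Complex.I) :=
    Complex.continuous_exp.comp ((Complex.continuous_ofReal.comp
      (continuous_finsetSum _ fun i _ => (continuous_linfty_apply i).const_mul _)).mul
        continuous_const)
  rw [integral_map hKm.measurable.aemeasurable hcont.aestronglyMeasurable]
  have hKp : ∀ᵐ x ∂(Λ : Measure (I → ℝ)), ∀ p, Tendsto (fun j => x (π j p)) atTop (𝓝 (K x p)) := by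
    filter_upwards [hK] with x hx p
    exact ((continuous_linfty_apply p).tendsto _).comp hx
  -- The characteristic function of the limit law is computed twice along j: by almost sure
  -- convergence, and from the known Gaussian coordinates with covariance c(π_j p, π_j q), which
  -- tends to d.
  refine tendsto_nhds_unique (tendsto_integral_exp_sum J a
    (fun j p => measurable_pi_apply (π j p)) hKp) ?_
  have e : ∀ j, ∫ x, Complex.exp
      (((∑ i ∈ J, a i * x (π j i) : ℝ) : ℂ) * Complex.I) ∂(Λ : Measure (I → ℝ)) =
      Complex.exp (((-(∑ i ∈ J, ∑ k ∈ J, a i * a k * c (π j i) (π j k)) / 2 : ℝ) : ℂ)) := by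
    intro j
    rw [← quadForm_image c (π j) J a, ← hΛ]
    simp only [sum_image_mul]
  simp only [e]
  refine (Complex.continuous_exp.tendsto _).comp ((Complex.continuous_ofReal.tendsto _).comp ?_)
  refine (Tendsto.neg ?_).div_const _
  exact tendsto_finsetSum _ fun i _ => tendsto_finsetSum _ fun k _ => (hlim i k).const_mul _

end LInfty

/-! ### Maximal inequalities for bounded martingale differences -/

section Martingale

variable {Ω : Type*} {m0 : MeasurableSpace Ω} {μ : Measure Ω}

/-- `X` and `Y` have the same conditional expectation given `m`, tested against bounded
`m`-measurable functions. -/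
def CondEq (μ : Measure Ω) (m : MeasurableSpace Ω) (X Y : Ω → ℝ) : Prop :=
  ∀ H : Ω → ℝ, Measurable[m] H → (∃ C, ∀ ω, |H ω| ≤ C) → ∫ ω, H ω * X ω ∂μ = ∫ ω, H ω * Y ω ∂μ

lemma CondEq.mono {m m' : MeasurableSpace Ω} (h : m ≤ m') {X Y : Ω → ℝ} (hXY : CondEq μ m' X Y) :
    CondEq μ m X Y :=
  fun H hH hC => hXY H (hH.mono h le_rfl) hC

lemma CondEq.trans {m : MeasurableSpace Ω} {X Y W : Ω → ℝ} (h1 : CondEq μ m X Y)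
    (h2 : CondEq μ m Y W) : CondEq μ m X W :=
  fun H hH hC => (h1 H hH hC).trans (h2 H hH hC)

lemma integral_add_add {f g h : Ω → ℝ} (hf : Integrable f μ) (hg : Integrable g μ)
    (hh : Integrable h μ) :
    ∫ ω, (f ω + g ω + h ω) ∂μ = ∫ ω, f ω ∂μ + ∫ ω, g ω ∂μ + ∫ ω, h ω ∂μ := by
  have hfg : Integrable (fun ω => f ω + g ω) μ := hf.add hg
  rw [integral_add hfg hh, integral_add hf hg]

lemma markov_real {X : Ω → ℝ} (hX : Integrable X μ) (h0 : ∀ ω, 0 ≤ X ω) {c : ℝ} (hc : 0 < c) :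
    μ.real {ω | c ≤ X ω} ≤ (∫ ω, X ω ∂μ) / c := by
  rw [le_div_iff₀ hc, mul_comm]
  exact mul_meas_ge_le_integral_of_nonneg (.of_forall h0) hX c

variable [IsProbabilityMeasure μ]

lemma integrable_of_bound {X : Ω → ℝ} (hX : Measurable X) {C : ℝ} (h : ∀ ω, |X ω| ≤ C) :
    Integrable X μ :=
  .of_bound hX.aestronglyMeasurable C (.of_forall h)

lemma abs_mul_le_mul {a b A B : ℝ} (ha : |a| ≤ A) (hb : |b| ≤ B) : |a * b| ≤ A * B := by
  rw [abs_mul]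
  exact mul_le_mul ha hb (abs_nonneg _) ((abs_nonneg _).trans ha)

variable {𝓕 : Filtration ℕ m0} {D w : ℕ → Ω → ℝ} {b lam : ℝ}

/-- The differences `D`, switched off after the partial sums have entered `C`. -/
def stoppedDiff (D : ℕ → Ω → ℝ) (C : Set ℝ) (i : ℕ) : Ω → ℝ :=
  {ω | ∀ N ≤ i, ∑ k ∈ Finset.range N, D k ω ∉ C}.indicator (D i)

lemma measurable_partialSum (hD : ∀ i, Measurable[𝓕 (i + 1)] (D i)) {N i : ℕ} (h : N ≤ i) :
    Measurable[𝓕 i] fun ω => ∑ k ∈ Finset.range N, D k ω :=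
  Finset.measurable_sum _ fun k hk => (hD k).mono (𝓕.mono (by
    have := Finset.mem_range.1 hk; omega)) le_rfl

lemma measurableSet_notEntered (hD : ∀ i, Measurable[𝓕 (i + 1)] (D i)) {C : Set ℝ}
    (hC : MeasurableSet C) (i : ℕ) :
    MeasurableSet[𝓕 i] {ω | ∀ N ≤ i, ∑ k ∈ Finset.range N, D k ω ∉ C} := by
  have : {ω | ∀ N ≤ i, ∑ k ∈ Finset.range N, D k ω ∉ C} =
      ⋂ N ∈ Set.Iic i, (fun ω => ∑ k ∈ Finset.range N, D k ω) ⁻¹' Cᶜ := by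
    ext; simp
  rw [this]
  exact MeasurableSet.biInter (Set.to_countable _) fun N hN =>
    measurable_partialSum hD hN hC.compl

lemma stoppedDiff_measurable (hD : ∀ i, Measurable[𝓕 (i + 1)] (D i)) {C : Set ℝ}
    (hC : MeasurableSet C) (i : ℕ) : Measurable[𝓕 (i + 1)] (stoppedDiff D C i) :=
  (hD i).indicator (𝓕.mono (Nat.le_succ i) _ (measurableSet_notEntered hD hC i))

lemma abs_stoppedDiff_le (D : ℕ → Ω → ℝ) (C : Set ℝ) (i : ℕ) (ω : Ω) :
    |stoppedDiff D C i ω| ≤ |D i ω| := by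
  classical
  rw [stoppedDiff, Set.indicator_apply]
  split_ifs <;> simp

/-- The stopped sum freezes at the first entrance into C. A statement about the maximum thereby
becomes one about the terminal value. -/
lemma sum_stoppedDiff_mem {C : Set ℝ} {N₀ : ℕ} {ω : Ω}
    (h : ∃ N ≤ N₀, ∑ k ∈ Finset.range N, D k ω ∈ C) :
    ∑ k ∈ Finset.range N₀, stoppedDiff D C k ω ∈ C := by
  classical
  let τ := Nat.find (p := fun N => ∑ k ∈ Finset.range N, D k ω ∈ C) (h.imp fun _ h => h.2)
  have hτ : ∑ k ∈ Finset.range τ, D k ω ∈ C :=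
    Nat.find_spec (p := fun N => ∑ k ∈ Finset.range N, D k ω ∈ C) (h.imp fun _ h => h.2)
  have hτ' : ∀ N < τ, ∑ k ∈ Finset.range N, D k ω ∉ C := fun N hN => Nat.find_min _ hN
  have hle : τ ≤ N₀ := by
    obtain ⟨N, hN, hm⟩ := h
    exact (Nat.find_min' _ hm).trans hN
  have : ∑ k ∈ Finset.range N₀, stoppedDiff D C k ω = ∑ k ∈ Finset.range τ, D k ω := by
    rw [← Finset.sum_subset (Finset.range_mono hle) fun k _ hk => ?_]
    · refine Finset.sum_congr rfl fun k hk => ?_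
      rw [stoppedDiff, Set.indicator_of_mem]
      exact fun N hN => hτ' N (hN.trans_lt (Finset.mem_range.1 hk))
    · rw [stoppedDiff, Set.indicator_of_notMem]
      simp only [Finset.mem_range, not_lt] at hk
      intro h'
      exact h' τ hk hτ
  rwa [this]

/-- Transfer of an integral identity to the stopped differences. -/
lemma integral_mul_stoppedDiff {C : Set ℝ} {i : ℕ} {H : Ω → ℝ} :
    ∀ ω, H ω * stoppedDiff D C i ω =
      {ω | ∀ N ≤ i, ∑ k ∈ Finset.range N, D k ω ∉ C}.indicator H ω * D i ω := by
  classical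
  intro ω
  rw [stoppedDiff]
  simp only [Set.indicator_apply]
  split_ifs <;> simp

lemma abs_indicator_le {H : Ω → ℝ} {B : ℝ} (hH : ∀ ω, |H ω| ≤ B) (A : Set Ω) (ω : Ω) :
    |A.indicator H ω| ≤ B := by
  classical
  rw [Set.indicator_apply]
  split_ifs
  · exact hH ω
  · simpa using (abs_nonneg _).trans (hH ω)

/-- Whether C has been entered by time i is known at time i, so the stopping indicator may be moved
into the test function. -/
lemma stoppedDiff_condEq (hD : ∀ i, Measurable[𝓕 (i + 1)] (D i))
    (h0 : ∀ i, CondEq μ (𝓕 i) (D i) 0) {C : Set ℝ} (hC : MeasurableSet C) (i : ℕ) :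
    CondEq μ (𝓕 i) (stoppedDiff D C i) 0 := by
  rintro H hH ⟨B, hB⟩
  simp only [integral_mul_stoppedDiff]
  rw [h0 i _ (hH.indicator (measurableSet_notEntered hD hC i)) ⟨B, abs_indicator_le hB _⟩]
  simp

/-- The exponential moment of a bounded martingale, compensated by its conditional variance. -/
lemma integral_exp_martingale_le (hD : ∀ i, Measurable[𝓕 (i + 1)] (D i))
    (hb : ∀ i ω, |D i ω| ≤ b) (h0 : ∀ i, CondEq μ (𝓕 i) (D i) 0)
    (hw : ∀ i, Measurable[𝓕 i] (w i)) (hw0 : ∀ i ω, 0 ≤ w i ω) {W : ℝ} (hW : ∀ i ω, w i ω ≤ W)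
    (hDw : ∀ i (H : Ω → ℝ), Measurable[𝓕 i] H → (∃ C, ∀ ω, |H ω| ≤ C) → (∀ ω, 0 ≤ H ω) →
      ∫ ω, H ω * D i ω ^ 2 ∂μ ≤ ∫ ω, H ω * w i ω ∂μ)
    (hlam : 0 < lam) (hlb : lam * b ≤ 1) (N : ℕ) :
    ∫ ω, Real.exp (lam * ∑ i ∈ Finset.range N, D i ω -
      lam ^ 2 * ∑ i ∈ Finset.range N, w i ω) ∂μ ≤ 1 := by
  have hb0 : 0 ≤ b := by
    have : Nonempty Ω := nonempty_of_isProbabilityMeasure μ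
    exact (abs_nonneg _).trans (hb 0 (Classical.arbitrary Ω))
  induction N with
  | zero => simp
  | succ N ih =>
    refine le_trans ?_ ih
    -- The compensator already includes w N, one index further than D: it is measurable at time N,
    -- so H is an admissible test function.
    set H : Ω → ℝ := fun ω => Real.exp (lam * ∑ i ∈ Finset.range N, D i ω -
      lam ^ 2 * ∑ i ∈ Finset.range (N + 1), w i ω) with hHdef
    have hHm : Measurable[𝓕 N] H := by
      have h1 := measurable_partialSum hD (le_refl N)
      have h2 : Measurable[𝓕 N] fun ω => ∑ i ∈ Finset.range (N + 1), w i ω :=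
        Finset.measurable_sum _ fun k hk => (hw k).mono (𝓕.mono (by
          have := Finset.mem_range.1 hk; omega)) le_rfl
      exact Real.measurable_exp.comp ((h1.const_mul _).sub (h2.const_mul _))
    have hH0 : ∀ ω, 0 ≤ H ω := fun ω => (Real.exp_pos _).le
    have hHb : ∀ ω, |H ω| ≤ Real.exp (lam * (N * b)) := by
      intro ω
      rw [abs_of_nonneg (hH0 ω)]
      refine Real.exp_le_exp.2 ?_
      have h1 : ∑ i ∈ Finset.range N, D i ω ≤ N * b := by
        refine (Finset.sum_le_sum fun i _ => (le_abs_self _).trans (hb i ω)).trans ?_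
        simp
      have h2 : 0 ≤ ∑ i ∈ Finset.range (N + 1), w i ω := Finset.sum_nonneg fun i _ => hw0 i ω
      have := mul_le_mul_of_nonneg_left h1 hlam.le
      nlinarith [mul_nonneg (sq_nonneg lam) h2]
    have hHm' := hHm.mono (𝓕.le N) le_rfl
    have hDm := (hD N).mono (𝓕.le _) le_rfl
    have hwm := (hw N).mono (𝓕.le _) le_rfl
    have hwb : ∀ ω, |w N ω| ≤ W := fun ω => by rw [abs_of_nonneg (hw0 N ω)]; exact hW N ω
    have i1 : Integrable H μ := integrable_of_bound hHm' hHb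
    have i2 : Integrable (fun ω => H ω * D N ω) μ :=
      integrable_of_bound (hHm'.mul hDm) fun ω => abs_mul_le_mul (hHb ω) (hb N ω)
    have i3 : Integrable (fun ω => H ω * D N ω ^ 2) μ :=
      integrable_of_bound (C := Real.exp (lam * (N * b)) * (b * b)) (hHm'.mul (hDm.pow_const 2))
        fun ω => by
          rw [pow_two]
          exact abs_mul_le_mul (hHb ω) (abs_mul_le_mul (hb N ω) (hb N ω))
    have i4 : Integrable (fun ω => H ω * w N ω) μ :=
      integrable_of_bound (hHm'.mul hwm) fun ω => abs_mul_le_mul (hHb ω) (hwb ω)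
    have i5 : Integrable (fun ω => Real.exp (lam * ∑ i ∈ Finset.range N, D i ω -
        lam ^ 2 * ∑ i ∈ Finset.range N, w i ω)) μ := by
      refine integrable_of_bound (C := Real.exp (lam * (N * b)) * Real.exp (lam ^ 2 * W)) ?_
        fun ω => ?_
      · have h1 := (measurable_partialSum hD (le_refl N)).mono (𝓕.le N) le_rfl
        have h2 : Measurable fun ω => ∑ i ∈ Finset.range N, w i ω :=
          Finset.measurable_sum _ fun k _ => (hw k).mono (𝓕.le k) le_rfl
        exact Real.measurable_exp.comp ((h1.const_mul _).sub (h2.const_mul _))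
      · have e : Real.exp (lam * ∑ i ∈ Finset.range N, D i ω -
            lam ^ 2 * ∑ i ∈ Finset.range N, w i ω) = H ω * Real.exp (lam ^ 2 * w N ω) := by
          rw [hHdef, ← Real.exp_add, Finset.sum_range_succ]
          congr 1
          ring
        rw [e]
        refine abs_mul_le_mul (hHb ω) ?_
        rw [Real.abs_exp]
        exact Real.exp_le_exp.2 (mul_le_mul_of_nonneg_left (hW N ω) (sq_nonneg _))
    calc ∫ ω, Real.exp (lam * ∑ i ∈ Finset.range (N + 1), D i ω -
          lam ^ 2 * ∑ i ∈ Finset.range (N + 1), w i ω) ∂μ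
        ≤ ∫ ω, (H ω + lam * (H ω * D N ω) + lam ^ 2 * (H ω * D N ω ^ 2)) ∂μ := by
          refine integral_mono_of_nonneg (.of_forall fun ω => (Real.exp_pos _).le)
            ((i1.add (i2.const_mul _)).add (i3.const_mul _)) (.of_forall fun ω => ?_)
          have h1 : |lam * D N ω| ≤ 1 := by
            rw [abs_mul, abs_of_pos hlam]
            exact (mul_le_mul_of_nonneg_left (hb N ω) hlam.le).trans hlb
          have h2 := Real.abs_exp_sub_one_sub_id_le h1
          -- The bound eˣ ≤ 1 + x + x² requires |x| ≤ 1, which is the purpose of the condition lam *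
          -- b ≤ 1.
          have h3 : Real.exp (lam * D N ω) ≤ 1 + lam * D N ω + (lam * D N ω) ^ 2 := by
            linarith [(abs_le.1 h2).2]
          have e : Real.exp (lam * ∑ i ∈ Finset.range (N + 1), D i ω -
              lam ^ 2 * ∑ i ∈ Finset.range (N + 1), w i ω) =
              H ω * Real.exp (lam * D N ω) := by
            rw [hHdef, ← Real.exp_add, Finset.sum_range_succ (fun i => D i ω)]
            congr 1
            ring
          simp only [e]
          calc H ω * Real.exp (lam * D N ω) ≤ H ω * (1 + lam * D N ω + (lam * D N ω) ^ 2) :=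
                mul_le_mul_of_nonneg_left h3 (hH0 ω)
            _ = _ := by ring
      _ = ∫ ω, H ω ∂μ + lam ^ 2 * ∫ ω, H ω * D N ω ^ 2 ∂μ := by
          have e0 : ∫ ω, H ω * D N ω ∂μ = 0 := by
            rw [h0 N H hHm ⟨_, hHb⟩]; simp
          rw [integral_add_add i1 (i2.const_mul _) (i3.const_mul _), integral_const_mul,
            integral_const_mul, e0]
          simp
      _ ≤ ∫ ω, H ω ∂μ + lam ^ 2 * ∫ ω, H ω * w N ω ∂μ := by
          have := mul_le_mul_of_nonneg_left (hDw N H hHm ⟨_, hHb⟩ hH0) (sq_nonneg lam)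
          linarith
      _ = ∫ ω, (H ω + lam ^ 2 * (H ω * w N ω)) ∂μ := by
          rw [integral_add i1 (i4.const_mul _), integral_const_mul]
      _ ≤ _ := by
          refine integral_mono (i1.add (i4.const_mul _)) i5 fun ω => ?_
          have e : Real.exp (lam * ∑ i ∈ Finset.range N, D i ω -
            lam ^ 2 * ∑ i ∈ Finset.range N, w i ω) = H ω * Real.exp (lam ^ 2 * w N ω) := by
            rw [hHdef, ← Real.exp_add, Finset.sum_range_succ]
            congr 1
            ring
          simp only [e]
          calc H ω + lam ^ 2 * (H ω * w N ω) = H ω * (lam ^ 2 * w N ω + 1) := by ring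
            _ ≤ _ := mul_le_mul_of_nonneg_left (Real.add_one_le_exp _) (hH0 ω)

/-- **Freedman's inequality** in maximal form. -/
theorem freedman (hD : ∀ i, Measurable[𝓕 (i + 1)] (D i))
    (hb : ∀ i ω, |D i ω| ≤ b) (h0 : ∀ i, CondEq μ (𝓕 i) (D i) 0)
    (hw : ∀ i, Measurable[𝓕 i] (w i)) (hw0 : ∀ i ω, 0 ≤ w i ω) {W : ℝ} (hW : ∀ i ω, w i ω ≤ W)
    (hDw : ∀ i (H : Ω → ℝ), Measurable[𝓕 i] H → (∃ C, ∀ ω, |H ω| ≤ C) → (∀ ω, 0 ≤ H ω) →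
      ∫ ω, H ω * D i ω ^ 2 ∂μ ≤ ∫ ω, H ω * w i ω ∂μ)
    (hlam : 0 < lam) (hlb : lam * b ≤ 1) (N₀ : ℕ) (y v : ℝ) :
    μ.real {ω | (∃ N ≤ N₀, y ≤ ∑ i ∈ Finset.range N, D i ω) ∧
      ∑ i ∈ Finset.range N₀, w i ω ≤ v} ≤ Real.exp (-(lam * y) + lam ^ 2 * v) := by
  have hC : MeasurableSet (Set.Ici y) := measurableSet_Ici
  have hD' := stoppedDiff_measurable hD hC
  -- The exponential bound is applied to the stopped differences with the unstopped compensator;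
  -- Markov's inequality at the terminal time then controls the maximum.
  have key := integral_exp_martingale_le (μ := μ) (D := stoppedDiff D (Set.Ici y)) (w := w) hD'
    (fun i ω => (abs_stoppedDiff_le D _ i ω).trans (hb i ω)) (stoppedDiff_condEq hD h0 hC)
    hw hw0 hW ?_ hlam hlb N₀
  · set X : Ω → ℝ := fun ω => Real.exp (lam * ∑ i ∈ Finset.range N₀,
      stoppedDiff D (Set.Ici y) i ω - lam ^ 2 * ∑ i ∈ Finset.range N₀, w i ω)
    have hXm : Measurable X := by
      have h1 := (measurable_partialSum hD' (le_refl N₀)).mono (𝓕.le N₀) le_rfl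
      have h2 : Measurable fun ω => ∑ i ∈ Finset.range N₀, w i ω :=
        Finset.measurable_sum _ fun k _ => (hw k).mono (𝓕.le k) le_rfl
      exact Real.measurable_exp.comp ((h1.const_mul _).sub (h2.const_mul _))
    have hXi : Integrable X μ := by
      refine integrable_of_bound (C := Real.exp (lam * (N₀ * b))) hXm fun ω => ?_
      rw [Real.abs_exp]
      refine Real.exp_le_exp.2 ?_
      have h1 : ∑ i ∈ Finset.range N₀, stoppedDiff D (Set.Ici y) i ω ≤ N₀ * b := by
        refine (Finset.sum_le_sum fun i _ => (le_abs_self _).trans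
          ((abs_stoppedDiff_le D _ i ω).trans (hb i ω))).trans ?_
        simp
      have h2 : 0 ≤ ∑ i ∈ Finset.range N₀, w i ω := Finset.sum_nonneg fun i _ => hw0 i ω
      have := mul_le_mul_of_nonneg_left h1 hlam.le
      nlinarith [mul_nonneg (sq_nonneg lam) h2]
    have hsub : {ω | (∃ N ≤ N₀, y ≤ ∑ i ∈ Finset.range N, D i ω) ∧
        ∑ i ∈ Finset.range N₀, w i ω ≤ v} ⊆ {ω | Real.exp (lam * y - lam ^ 2 * v) ≤ X ω} := by
      rintro ω ⟨h1, h2⟩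
      have h3 : y ≤ ∑ i ∈ Finset.range N₀, stoppedDiff D (Set.Ici y) i ω :=
        sum_stoppedDiff_mem (C := Set.Ici y) h1
      refine Real.exp_le_exp.2 ?_
      have := mul_le_mul_of_nonneg_left h3 hlam.le
      have := mul_le_mul_of_nonneg_left h2 (sq_nonneg lam)
      linarith
    calc _ ≤ μ.real {ω | Real.exp (lam * y - lam ^ 2 * v) ≤ X ω} := measureReal_mono hsub
      _ ≤ (∫ ω, X ω ∂μ) / Real.exp (lam * y - lam ^ 2 * v) :=
          markov_real hXi (fun ω => (Real.exp_pos _).le) (Real.exp_pos _)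
      _ ≤ 1 / Real.exp (lam * y - lam ^ 2 * v) := by gcongr
      _ = _ := by rw [one_div, ← Real.exp_neg]; congr 1; ring
  · rintro i H hH ⟨B, hB⟩ hH0
    -- The stopping indicator is absorbed by the test function on the left and discarded on the
    -- right, where w ≥ 0.
    have e : ∀ ω, H ω * stoppedDiff D (Set.Ici y) i ω ^ 2 =
        {ω | ∀ N ≤ i, ∑ k ∈ Finset.range N, D k ω ∉ Set.Ici y}.indicator H ω * D i ω ^ 2 := by
      classical
      intro ω
      rw [stoppedDiff]
      simp only [Set.indicator_apply]
      split_ifs <;> simp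
    have hHI := hH.indicator (measurableSet_notEntered hD hC i)
    have hHI0 : ∀ ω, 0 ≤ {ω | ∀ N ≤ i, ∑ k ∈ Finset.range N, D k ω ∉ Set.Ici y}.indicator H ω :=
      fun ω => Set.indicator_nonneg (fun ω _ => hH0 ω) ω
    simp only [e]
    have hwb : ∀ ω, |w i ω| ≤ W := fun ω => by rw [abs_of_nonneg (hw0 i ω)]; exact hW i ω
    refine (hDw i _ hHI ⟨B, abs_indicator_le hB _⟩ hHI0).trans ?_
    refine integral_mono
      (integrable_of_bound ((hHI.mono (𝓕.le i) le_rfl).mul ((hw i).mono (𝓕.le i) le_rfl))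
        fun ω => abs_mul_le_mul (abs_indicator_le hB _ ω) (hwb ω))
      (integrable_of_bound ((hH.mono (𝓕.le i) le_rfl).mul ((hw i).mono (𝓕.le i) le_rfl))
        fun ω => abs_mul_le_mul (hB ω) (hwb ω)) fun ω => ?_
    exact mul_le_mul_of_nonneg_right (Set.indicator_le_self' (fun _ _ => hH0 _) ω) (hw0 i ω)

lemma integral_sq_martingale (hD : ∀ i, Measurable[𝓕 (i + 1)] (D i))
    (hb : ∀ i ω, |D i ω| ≤ b) (h0 : ∀ i, CondEq μ (𝓕 i) (D i) 0) (N : ℕ) :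
    ∫ ω, (∑ i ∈ Finset.range N, D i ω) ^ 2 ∂μ = ∑ i ∈ Finset.range N, ∫ ω, D i ω ^ 2 ∂μ := by
  induction N with
  | zero => simp
  | succ N ih =>
    have hS := measurable_partialSum hD (le_refl N)
    have hSb : ∀ ω, |∑ i ∈ Finset.range N, D i ω| ≤ N * b := fun ω =>
      (Finset.abs_sum_le_sum_abs _ _).trans ((Finset.sum_le_sum fun i _ => hb i ω).trans (by simp))
    have hS' := hS.mono (𝓕.le N) le_rfl
    have hDm := (hD N).mono (𝓕.le _) le_rfl
    have e : ∀ ω, (∑ i ∈ Finset.range (N + 1), D i ω) ^ 2 = (∑ i ∈ Finset.range N, D i ω) ^ 2 +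
        2 * ((∑ i ∈ Finset.range N, D i ω) * D N ω) + D N ω ^ 2 := fun ω => by
      rw [Finset.sum_range_succ]; ring
    have i1 : Integrable (fun ω => (∑ i ∈ Finset.range N, D i ω) ^ 2) μ := by
      simp only [pow_two]
      exact integrable_of_bound (hS'.mul hS') fun ω => abs_mul_le_mul (hSb ω) (hSb ω)
    have i2 : Integrable (fun ω => (∑ i ∈ Finset.range N, D i ω) * D N ω) μ :=
      integrable_of_bound (hS'.mul hDm) fun ω => abs_mul_le_mul (hSb ω) (hb N ω)
    have i3 : Integrable (fun ω => D N ω ^ 2) μ := by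
      simp only [pow_two]
      exact integrable_of_bound (hDm.mul hDm) fun ω => abs_mul_le_mul (hb N ω) (hb N ω)
    simp only [e]
    rw [integral_add_add i1 (i2.const_mul _) i3, integral_const_mul, h0 N _ hS ⟨_, hSb⟩, ih, Finset.sum_range_succ]
    simp

/-- **Kolmogorov's inequality** for bounded martingale differences. -/
theorem kolmogorov_maximal (hD : ∀ i, Measurable[𝓕 (i + 1)] (D i))
    (hb : ∀ i ω, |D i ω| ≤ b) (h0 : ∀ i, CondEq μ (𝓕 i) (D i) 0) {x : ℝ} (hx : 0 < x) {s : ℝ}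
    (hs : ∀ i, ∫ ω, D i ω ^ 2 ∂μ ≤ s) (N₀ : ℕ) :
    μ.real {ω | ∃ N ≤ N₀, x ≤ |∑ i ∈ Finset.range N, D i ω|} ≤ N₀ * s / x ^ 2 := by
  have hC : MeasurableSet {z : ℝ | x ≤ |z|} := measurableSet_le measurable_const measurable_abs
  have hD' := stoppedDiff_measurable hD hC
  have hb' : ∀ i ω, |stoppedDiff D {z : ℝ | x ≤ |z|} i ω| ≤ b :=
    fun i ω => (abs_stoppedDiff_le D _ i ω).trans (hb i ω)
  -- Stopped differences remain orthogonal, so Chebyshev's inequality for their terminal sum is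
  -- enough.
  have key := integral_sq_martingale hD' hb' (stoppedDiff_condEq hD h0 hC) N₀
  set X : Ω → ℝ := fun ω => (∑ i ∈ Finset.range N₀, stoppedDiff D {z : ℝ | x ≤ |z|} i ω) ^ 2
  have hXi : Integrable X μ := by
    have h1 := (measurable_partialSum hD' (le_refl N₀)).mono (𝓕.le N₀) le_rfl
    have hSb : ∀ ω, |∑ i ∈ Finset.range N₀, stoppedDiff D {z : ℝ | x ≤ |z|} i ω| ≤ N₀ * b :=
      fun ω => (Finset.abs_sum_le_sum_abs _ _).trans
        ((Finset.sum_le_sum fun i _ => hb' i ω).trans (by simp))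
    simp only [X, pow_two]
    exact integrable_of_bound (h1.mul h1) fun ω => abs_mul_le_mul (hSb ω) (hSb ω)
  have hsub : {ω | ∃ N ≤ N₀, x ≤ |∑ i ∈ Finset.range N, D i ω|} ⊆ {ω | x ^ 2 ≤ X ω} := by
    intro ω h
    have h3 : x ≤ |∑ i ∈ Finset.range N₀, stoppedDiff D {z : ℝ | x ≤ |z|} i ω| :=
      sum_stoppedDiff_mem (C := {z : ℝ | x ≤ |z|}) h
    change x ^ 2 ≤ (∑ i ∈ Finset.range N₀, stoppedDiff D {z : ℝ | x ≤ |z|} i ω) ^ 2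
    rw [← sq_abs (∑ i ∈ Finset.range N₀, stoppedDiff D {z : ℝ | x ≤ |z|} i ω)]
    gcongr
  have hsum : ∫ ω, X ω ∂μ ≤ N₀ * s := by
    rw [key]
    calc _ ≤ ∑ i ∈ Finset.range N₀, s := Finset.sum_le_sum fun i _ => (integral_mono_of_nonneg
          (.of_forall fun ω => sq_nonneg _) (by
            simp only [pow_two]
            have := (hD i).mono (𝓕.le _) le_rfl
            exact integrable_of_bound (this.mul this) fun ω => abs_mul_le_mul (hb i ω) (hb i ω))
          (.of_forall fun ω => sq_le_sq.2 (abs_stoppedDiff_le D _ i ω))).trans (hs i)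
      _ = N₀ * s := by simp
  calc _ ≤ μ.real {ω | x ^ 2 ≤ X ω} := measureReal_mono hsub
    _ ≤ (∫ ω, X ω ∂μ) / x ^ 2 := markov_real hXi (fun ω => sq_nonneg _) (by positivity)
    _ ≤ N₀ * s / x ^ 2 := by gcongr

end Martingale

/-! ### Partial sums of sequences with geometrically decaying predictions -/

section Array

variable {Ω : Type*} {m0 : MeasurableSpace Ω} {μ : Measure Ω} [IsProbabilityMeasure μ]
  {𝓕 : Filtration ℕ m0} {X : ℕ → ℕ → Ω → ℝ} {ζ : ℕ → Ω → ℝ} {B A ρ v : ℝ}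

/-- The martingale differences of the `k`-th row of an array. -/
def rowDiff (X : ℕ → ℕ → Ω → ℝ) (k i : ℕ) (ω : Ω) : ℝ := X k (i + 1) ω - X (k + 1) i ω

/-- Each entry is X k (i+1) = (row difference) + X (k+1) i. Since X (k+1) 0 = 0, the second terms
form the same kind of sum one row lower with one term fewer; iterating leaves N − j differences in
row k + j. -/
lemma sum_row_eq (h0 : ∀ k ω, X k 0 ω = 0) (ω : Ω) (N k : ℕ) :
    ∑ i ∈ Finset.range N, X k (i + 1) ω =
      ∑ j ∈ Finset.range N, ∑ i ∈ Finset.range (N - j), rowDiff X (k + j) i ω := by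
  induction N generalizing k with
  | zero => simp
  | succ N ih =>
    have h1 : ∑ i ∈ Finset.range (N + 1), X k (i + 1) ω =
        ∑ i ∈ Finset.range (N + 1), rowDiff X k i ω +
          ∑ i ∈ Finset.range N, X (k + 1) (i + 1) ω := by
      have : ∑ i ∈ Finset.range N, X (k + 1) (i + 1) ω =
          ∑ i ∈ Finset.range (N + 1), X (k + 1) i ω := by
        rw [Finset.sum_range_succ', h0, add_zero]
      rw [this, ← Finset.sum_add_distrib]
      simp [rowDiff]
    rw [h1, ih (k + 1), add_comm, Finset.sum_range_succ' (fun j =>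
      ∑ i ∈ Finset.range (N + 1 - j), rowDiff X (k + j) i ω)]
    congr 1
    refine Finset.sum_congr rfl fun j _ => ?_
    rw [Nat.add_sub_add_right]
    simp only [add_assoc, add_comm 1 j]

lemma rowDiff_measurable (hX : ∀ k i, Measurable[𝓕 i] (X k i)) (k i : ℕ) :
    Measurable[𝓕 (i + 1)] (rowDiff X k i) :=
  (hX k (i + 1)).sub ((hX (k + 1) i).mono (𝓕.mono (Nat.le_succ i)) le_rfl)

lemma abs_rowDiff_le (hB : ∀ k i ω, |X k i ω| ≤ B) (k i : ℕ) (ω : Ω) :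
    |rowDiff X k i ω| ≤ 2 * B := by
  have := abs_sub (X k (i + 1) ω) (X (k + 1) i ω)
  rw [rowDiff]
  linarith [hB k (i + 1) ω, hB (k + 1) i ω]

lemma rowDiff_condEq (hX : ∀ k i, Measurable[𝓕 i] (X k i)) (hB : ∀ k i ω, |X k i ω| ≤ B)
    (hc : ∀ k i, CondEq μ (𝓕 i) (X k (i + 1)) (X (k + 1) i)) (k i : ℕ) :
    CondEq μ (𝓕 i) (rowDiff X k i) 0 := by
  rintro H hH ⟨C, hC⟩
  have hHm := hH.mono (𝓕.le i) le_rfl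
  have i1 : Integrable (fun ω => H ω * X k (i + 1) ω) μ :=
    integrable_of_bound (hHm.mul ((hX k (i + 1)).mono (𝓕.le _) le_rfl))
      fun ω => abs_mul_le_mul (hC ω) (hB _ _ ω)
  have i2 : Integrable (fun ω => H ω * X (k + 1) i ω) μ :=
    integrable_of_bound (hHm.mul ((hX (k + 1) i).mono (𝓕.le _) le_rfl))
      fun ω => abs_mul_le_mul (hC ω) (hB _ _ ω)
  simp only [rowDiff, mul_sub]
  rw [integral_sub i1 i2, hc k i H hH ⟨C, hC⟩]
  simp

/-- The conditional second moment of a row difference is at most that of the row. -/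
lemma integral_mul_rowDiff_sq_le (hX : ∀ k i, Measurable[𝓕 i] (X k i))
    (hB : ∀ k i ω, |X k i ω| ≤ B)
    (hc : ∀ k i, CondEq μ (𝓕 i) (X k (i + 1)) (X (k + 1) i)) (k i : ℕ) {H : Ω → ℝ}
    (hH : Measurable[𝓕 i] H) {C : ℝ} (hC : ∀ ω, |H ω| ≤ C) (hH0 : ∀ ω, 0 ≤ H ω) :
    ∫ ω, H ω * rowDiff X k i ω ^ 2 ∂μ ≤ ∫ ω, H ω * X k (i + 1) ω ^ 2 ∂μ := by
  have hHm := hH.mono (𝓕.le i) le_rfl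
  have hm1 := (hX k (i + 1)).mono (𝓕.le _) le_rfl
  have hm2 := (hX (k + 1) i).mono (𝓕.le _) le_rfl
  have i1 : Integrable (fun ω => H ω * X k (i + 1) ω ^ 2) μ := by
    simp only [pow_two]
    exact integrable_of_bound (hHm.mul (hm1.mul hm1))
      fun ω => abs_mul_le_mul (hC ω) (abs_mul_le_mul (hB _ _ ω) (hB _ _ ω))
  have i2 : Integrable (fun ω => H ω * X (k + 1) i ω * X k (i + 1) ω) μ :=
    integrable_of_bound ((hHm.mul hm2).mul hm1)
      fun ω => abs_mul_le_mul (abs_mul_le_mul (hC ω) (hB _ _ ω)) (hB _ _ ω)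
  have i3 : Integrable (fun ω => H ω * X (k + 1) i ω * X (k + 1) i ω) μ :=
    integrable_of_bound ((hHm.mul hm2).mul hm2)
      fun ω => abs_mul_le_mul (abs_mul_le_mul (hC ω) (hB _ _ ω)) (hB _ _ ω)
  have e : ∀ ω, H ω * rowDiff X k i ω ^ 2 = H ω * X k (i + 1) ω ^ 2 +
      (-2) * (H ω * X (k + 1) i ω * X k (i + 1) ω) +
        H ω * X (k + 1) i ω * X (k + 1) i ω := fun ω => by rw [rowDiff]; ring
  simp only [e]
  rw [integral_add_add i1 (i2.const_mul _) i3, integral_const_mul,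
    hc k i (fun ω => H ω * X (k + 1) i ω) (hH.mul (hX _ _))
      ⟨_, fun ω => abs_mul_le_mul (hC ω) (hB _ _ ω)⟩]
  have : 0 ≤ ∫ ω, H ω * X (k + 1) i ω * X (k + 1) i ω ∂μ :=
    integral_nonneg fun ω => by
      simp only [mul_assoc]
      exact mul_nonneg (hH0 ω) (mul_self_nonneg _)
  linarith

/-- Tail bound for the maximum of partial sums: the first row is controlled by Freedman's
inequality, the later ones by Kolmogorov's. -/
theorem array_tail (hX : ∀ k i, Measurable[𝓕 i] (X k i)) (h0 : ∀ k ω, X k 0 ω = 0)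
    (hB : ∀ k i ω, |X k i ω| ≤ B)
    (hc : ∀ k i, CondEq μ (𝓕 i) (X k (i + 1)) (X (k + 1) i))
    (hρ0 : 0 ≤ ρ) (hρ : ρ ≤ 1 / 16) (hA : 0 ≤ A)
    (hXA : ∀ k i, 1 ≤ k → ∫ ω, |X k i ω| ∂μ ≤ A * ρ ^ k)
    (hζ : ∀ i, Measurable[𝓕 i] (ζ i)) (hζ0 : ∀ i ω, 0 ≤ ζ i ω) {W : ℝ} (hW : ∀ i ω, ζ i ω ≤ W)
    (hζc : ∀ i, CondEq μ (𝓕 i) (fun ω => X 0 (i + 1) ω ^ 2) (ζ i)) (hv : 0 < v)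
    {v₀ : ℝ} (hv₀ : v₀ ≤ v) (hζv : ∀ i, ∫ ω, |ζ i ω - v₀| ∂μ ≤ A * ρ)
    {lam y : ℝ} (hlam : 0 < lam) (hlB : lam * (2 * B) ≤ 1) (hy : 0 < y) (N₀ : ℕ) :
    μ.real {ω | ∃ N ≤ N₀, 3 * y ≤ |∑ i ∈ Finset.range N, X 0 (i + 1) ω|} ≤
      2 * Real.exp (-(lam * y) + lam ^ 2 * (2 * N₀ * v)) + A * ρ / v +
        6 * N₀ * B * A * ρ / y ^ 2 := by
  have hB0 : 0 ≤ B := by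
    have : Nonempty Ω := nonempty_of_isProbabilityMeasure μ
    exact (abs_nonneg _).trans (hB 0 0 (Classical.arbitrary Ω))
  have hDm := rowDiff_measurable hX
  have hDb := abs_rowDiff_le hB
  have hDc := rowDiff_condEq hX hB hc
  -- The budget 3y is divided as y for row 0 and y·2^{-k} for row k+1, the latter summing to at most
  -- 2y. E1 and E2 treat the two signs of row 0 when the accumulated conditional variance is at most
  -- 2N₀v, E3 contains the remaining case because v₀ ≤ v, and E4 treats the later rows.
  let E1 : Set Ω := {ω | (∃ N ≤ N₀, y ≤ ∑ i ∈ Finset.range N, rowDiff X 0 i ω) ∧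
    ∑ i ∈ Finset.range N₀, ζ i ω ≤ 2 * N₀ * v}
  let E2 : Set Ω := {ω | (∃ N ≤ N₀, y ≤ ∑ i ∈ Finset.range N, -rowDiff X 0 i ω) ∧
    ∑ i ∈ Finset.range N₀, ζ i ω ≤ 2 * N₀ * v}
  let E3 : Set Ω := {ω | N₀ * v < |∑ i ∈ Finset.range N₀, (ζ i ω - v₀)|}
  let E4 : ℕ → Set Ω := fun k =>
    {ω | ∃ N ≤ N₀, y * (1 / 2) ^ k ≤ |∑ i ∈ Finset.range N, rowDiff X (k + 1) i ω|}
  have hsq : ∀ i (H : Ω → ℝ), Measurable[𝓕 i] H → (∃ C, ∀ ω, |H ω| ≤ C) → (∀ ω, 0 ≤ H ω) →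
      ∫ ω, H ω * rowDiff X 0 i ω ^ 2 ∂μ ≤ ∫ ω, H ω * ζ i ω ∂μ := by
    rintro i H hH ⟨C, hC⟩ hH0
    rw [← hζc i H hH ⟨C, hC⟩]
    exact integral_mul_rowDiff_sq_le hX hB hc 0 i hH hC hH0
  have p1 : μ.real E1 ≤ Real.exp (-(lam * y) + lam ^ 2 * (2 * N₀ * v)) :=
    freedman (hDm 0) (hDb 0) (hDc 0) hζ hζ0 hW hsq hlam hlB N₀ y (2 * N₀ * v)
  have p2 : μ.real E2 ≤ Real.exp (-(lam * y) + lam ^ 2 * (2 * N₀ * v)) := by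
    refine freedman (D := fun i ω => -rowDiff X 0 i ω) (fun i => (hDm 0 i).neg)
      (fun i ω => by rw [abs_neg]; exact hDb 0 i ω) (fun i H hH hC => ?_) hζ hζ0 hW
      (fun i H hH hC hH0 => ?_) hlam hlB N₀ y (2 * N₀ * v)
    · have := hDc 0 i H hH hC
      simp only [mul_neg, integral_neg, this]
      simp
    · simpa only [neg_sq] using hsq i H hH hC hH0
  have p3 : μ.real E3 ≤ A * ρ / v := by
    rcases Nat.eq_zero_or_pos N₀ with hN | hN
    · have : E3 = ∅ := by
        ext ω
        simp [E3, hN]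
      rw [this, measureReal_empty]
      positivity
    have hN' : (0 : ℝ) < N₀ := Nat.cast_pos.2 hN
    have hζi : ∀ i, Integrable (fun ω => |ζ i ω - v₀|) μ := fun i =>
      (integrable_of_bound (C := W + |v₀|) (((hζ i).mono (𝓕.le i) le_rfl).sub measurable_const)
        fun ω => by
          have := abs_sub (ζ i ω) v₀
          rw [abs_of_nonneg (hζ0 i ω)] at this
          exact this.trans (add_le_add_left (hW i ω) _)).abs
    have hsumi : Integrable (fun ω => ∑ i ∈ Finset.range N₀, |ζ i ω - v₀|) μ :=
      integrable_finsetSum _ fun i _ => hζi i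
    calc μ.real E3 ≤ μ.real {ω | N₀ * v ≤ ∑ i ∈ Finset.range N₀, |ζ i ω - v₀|} :=
          measureReal_mono fun ω hω =>
            (le_of_lt (show N₀ * v < _ from hω)).trans (Finset.abs_sum_le_sum_abs _ _)
      _ ≤ (∫ ω, ∑ i ∈ Finset.range N₀, |ζ i ω - v₀| ∂μ) / (N₀ * v) :=
          markov_real hsumi (fun ω => Finset.sum_nonneg fun i _ => abs_nonneg _) (by positivity)
      _ ≤ (N₀ * (A * ρ)) / (N₀ * v) := by
          rw [integral_finsetSum _ fun i _ => hζi i]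
          gcongr
          refine (Finset.sum_le_sum fun i _ => hζv i).trans ?_
          simp
      _ = A * ρ / v := mul_div_mul_left _ _ hN'.ne'
  have p4 : ∀ k, μ.real (E4 k) ≤ N₀ * B * A * ρ / y ^ 2 * (1 / 4) ^ k := by
    intro k
    have hs : ∀ i, ∫ ω, rowDiff X (k + 1) i ω ^ 2 ∂μ ≤ B * (A * ρ ^ (k + 1)) := by
      intro i
      have h1 := integral_mul_rowDiff_sq_le hX hB hc (k + 1) i (H := fun _ => 1)
        measurable_const (C := 1) (by simp) (by simp)
      simp only [one_mul] at h1
      refine h1.trans ?_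
      have h2 : ∫ ω, X (k + 1) (i + 1) ω ^ 2 ∂μ ≤ ∫ ω, B * |X (k + 1) (i + 1) ω| ∂μ := by
        have hm := (hX (k + 1) (i + 1)).mono (𝓕.le _) le_rfl
        refine integral_mono_of_nonneg (.of_forall fun ω => sq_nonneg _)
          ((integrable_of_bound hm (hB _ _)).abs.const_mul _) (.of_forall fun ω => ?_)
        change X (k + 1) (i + 1) ω ^ 2 ≤ B * |X (k + 1) (i + 1) ω|
        rw [← sq_abs, pow_two]
        exact mul_le_mul_of_nonneg_right (hB _ _ ω) (abs_nonneg _)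
      rw [integral_const_mul] at h2
      exact h2.trans (mul_le_mul_of_nonneg_left (hXA _ _ (Nat.le_add_left 1 k)) hB0)
    refine (kolmogorov_maximal (hDm (k + 1)) (hDb (k + 1)) (hDc (k + 1))
      (x := y * (1 / 2) ^ k) (by positivity) hs N₀).trans ?_
    -- Halving the threshold costs 4^k in Kolmogorov's inequality, while the row contributes ρ^k;
    -- with ρ ≤ 1/16 the product is at most 4^{-k}.
    have e : N₀ * (B * (A * ρ ^ (k + 1))) / (y * (1 / 2) ^ k) ^ 2 =
        N₀ * B * A * ρ / y ^ 2 * (4 * ρ) ^ k := by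
      have : (((1 : ℝ) / 2) ^ k) ^ 2 = 1 / 4 ^ k := by
        rw [← pow_mul, mul_comm, pow_mul, one_div, one_div, ← inv_pow]
        norm_num
      rw [mul_pow y, this, mul_pow, pow_succ]
      field_simp
    rw [e]
    gcongr
    linarith
  have hsub : {ω | ∃ N ≤ N₀, 3 * y ≤ |∑ i ∈ Finset.range N, X 0 (i + 1) ω|} ⊆
      (E1 ∪ E2) ∪ E3 ∪ ⋃ k ∈ Finset.range N₀, E4 k := by
    rintro ω ⟨N, hN, hω⟩
    by_contra hcon
    simp only [Set.mem_union, Set.mem_iUnion, Finset.mem_range, exists_prop, not_or, not_exists,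
      not_and] at hcon
    obtain ⟨⟨⟨c1, c2⟩, c3⟩, c4⟩ := hcon
    have hV : ∑ i ∈ Finset.range N₀, ζ i ω ≤ 2 * N₀ * v := by
      have : |∑ i ∈ Finset.range N₀, (ζ i ω - v₀)| ≤ N₀ * v := not_lt.1 c3
      rw [Finset.sum_sub_distrib] at this
      have := (abs_le.1 this).2
      simp at this
      have := mul_le_mul_of_nonneg_left hv₀ (Nat.cast_nonneg (α := ℝ) N₀)
      linarith
    have d1 : ∀ N ≤ N₀, |∑ i ∈ Finset.range N, rowDiff X 0 i ω| < y := by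
      intro N hN
      rw [abs_lt]
      constructor
      · by_contra! h
        refine c2 ⟨⟨N, hN, ?_⟩, hV⟩
        rw [Finset.sum_neg_distrib]
        linarith
      · by_contra! h
        exact c1 ⟨⟨N, hN, h⟩, hV⟩
    have d2 : ∀ k < N₀, ∀ N ≤ N₀, |∑ i ∈ Finset.range N, rowDiff X (k + 1) i ω| <
        y * (1 / 2) ^ k := by
      intro k hk N hN
      by_contra! h
      exact c4 k hk ⟨N, hN, h⟩
    rw [sum_row_eq h0] at hω
    have : |∑ j ∈ Finset.range N, ∑ i ∈ Finset.range (N - j), rowDiff X (0 + j) i ω| < 3 * y := by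
      rcases N with _ | N
      · simpa using hy
      rw [Finset.sum_range_succ']
      have h1 : |∑ j ∈ Finset.range N, ∑ i ∈ Finset.range (N + 1 - (j + 1)),
          rowDiff X (0 + (j + 1)) i ω| ≤ 2 * y := by
        refine (Finset.abs_sum_le_sum_abs _ _).trans ?_
        calc _ ≤ ∑ j ∈ Finset.range N, y * (1 / 2) ^ j := by
              refine Finset.sum_le_sum fun j hj => ?_
              have hj := Finset.mem_range.1 hj
              rw [zero_add]
              exact (d2 j (by omega) _ (by omega)).le
          _ = y * ∑ j ∈ Finset.range N, (1 / 2 : ℝ) ^ j := by rw [Finset.mul_sum]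
          _ ≤ y * 2 := by
              gcongr
              exact sum_geometric_two_le N
          _ = 2 * y := mul_comm _ _
      have h2 := d1 (N + 1) hN
      have h3 := abs_add_le (∑ j ∈ Finset.range N, ∑ i ∈ Finset.range (N + 1 - (j + 1)),
          rowDiff X (0 + (j + 1)) i ω) (∑ i ∈ Finset.range (N + 1 - 0), rowDiff X (0 + 0) i ω)
      simp only [Nat.sub_zero, add_zero] at h3 ⊢
      linarith
    exact absurd hω (not_le.2 this)
  calc _ ≤ μ.real ((E1 ∪ E2) ∪ E3 ∪ ⋃ k ∈ Finset.range N₀, E4 k) := measureReal_mono hsub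
    _ ≤ μ.real E1 + μ.real E2 + μ.real E3 + ∑ k ∈ Finset.range N₀, μ.real (E4 k) := by
        refine (measureReal_union_le _ _).trans (add_le_add ((measureReal_union_le _ _).trans
          (add_le_add_left (measureReal_union_le _ _) _)) ?_)
        exact measureReal_biUnion_finset_le _ _
    _ ≤ Real.exp (-(lam * y) + lam ^ 2 * (2 * N₀ * v)) +
          Real.exp (-(lam * y) + lam ^ 2 * (2 * N₀ * v)) + A * ρ / v +
            ∑ k ∈ Finset.range N₀, N₀ * B * A * ρ / y ^ 2 * (1 / 4) ^ k := by
        gcongr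
        exact p4 _
    _ ≤ _ := by
        have h1 : ∑ k ∈ Finset.range N₀, N₀ * B * A * ρ / y ^ 2 * (1 / 4 : ℝ) ^ k ≤
            6 * N₀ * B * A * ρ / y ^ 2 := by
          rw [← Finset.mul_sum]
          have h2 : ∑ k ∈ Finset.range N₀, (1 / 4 : ℝ) ^ k ≤ 6 := by
            refine (Finset.sum_le_sum fun k _ => ?_).trans ((sum_geometric_two_le N₀).trans
              (by norm_num))
            gcongr
            norm_num
          have h3 : 0 ≤ N₀ * B * A * ρ / y ^ 2 := by positivity
          calc _ ≤ N₀ * B * A * ρ / y ^ 2 * 6 := by gcongr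
            _ = _ := by ring
        linarith

end Array

/-! ### A central limit theorem for bounded martingale differences -/

section MartingaleCLT

variable {Ω : Type*} {m0 : MeasurableSpace Ω} {μ : Measure Ω}

lemma integral_mul_ofReal_eq {H : Ω → ℂ} (hH : Measurable H) {C : ℝ} (hC : ∀ ω, ‖H ω‖ ≤ C)
    {X : Ω → ℝ} (hX : Integrable X μ) : ∫ ω, H ω * (X ω : ℂ) ∂μ =
      ((∫ ω, (H ω).re * X ω ∂μ : ℝ) : ℂ) + Complex.I * ((∫ ω, (H ω).im * X ω ∂μ : ℝ) : ℂ) := by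
  have i1 : Integrable (fun ω => (H ω).re * X ω) μ :=
    hX.bdd_mul (Complex.measurable_re.comp hH).aestronglyMeasurable
      (.of_forall fun ω => (Complex.abs_re_le_norm _).trans (hC ω))
  have i2 : Integrable (fun ω => (H ω).im * X ω) μ :=
    hX.bdd_mul (Complex.measurable_im.comp hH).aestronglyMeasurable
      (.of_forall fun ω => (Complex.abs_im_le_norm _).trans (hC ω))
  rw [← integral_complex_ofReal, ← integral_complex_ofReal, ← integral_const_mul,
    ← integral_add i1.ofReal (i2.ofReal.const_mul _)]
  congr 1
  ext ω
  conv_lhs => rw [← Complex.re_add_im (H ω)]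
  push_cast
  ring

lemma CondEq.complex {m : MeasurableSpace Ω} (hm : m ≤ m0) {X Y : Ω → ℝ} (h : CondEq μ m X Y)
    (hX : Integrable X μ) (hY : Integrable Y μ) {H : Ω → ℂ}
    (hH : Measurable[m] H) {C : ℝ} (hC : ∀ ω, ‖H ω‖ ≤ C) :
    ∫ ω, H ω * (X ω : ℂ) ∂μ = ∫ ω, H ω * (Y ω : ℂ) ∂μ := by
  have hre : Measurable[m] fun ω => (H ω).re := Complex.measurable_re.comp hH
  have him : Measurable[m] fun ω => (H ω).im := Complex.measurable_im.comp hH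
  have bre : ∀ ω, |(H ω).re| ≤ C := fun ω => (Complex.abs_re_le_norm _).trans (hC ω)
  have bim : ∀ ω, |(H ω).im| ≤ C := fun ω => (Complex.abs_im_le_norm _).trans (hC ω)
  rw [integral_mul_ofReal_eq (hH.mono hm le_rfl) hC hX,
    integral_mul_ofReal_eq (hH.mono hm le_rfl) hC hY, h _ hre ⟨C, bre⟩, h _ him ⟨C, bim⟩]

variable [IsProbabilityMeasure μ]

lemma integrable_of_norm_le {X : Ω → ℂ} (hX : Measurable X) {C : ℝ} (h : ∀ ω, ‖X ω‖ ≤ C) :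
    Integrable X μ :=
  .of_bound hX.aestronglyMeasurable C (.of_forall h)

lemma norm_exp_mul_I_sub_le (x : ℝ) (hx : |x| ≤ 1) :
    ‖Complex.exp ((x : ℂ) * Complex.I) - (1 + (x : ℂ) * Complex.I - (x : ℂ) ^ 2 / 2)‖ ≤
      |x| ^ 3 := by
  have h := Complex.exp_bound (x := (x : ℂ) * Complex.I) (by simpa using hx) (n := 3) (by norm_num)
  have e : ∑ m ∈ Finset.range 3, ((x : ℂ) * Complex.I) ^ m / (m.factorial : ℂ) =
      1 + (x : ℂ) * Complex.I - (x : ℂ) ^ 2 / 2 := by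
    simp [Finset.sum_range_succ, mul_pow]
    ring
  rw [e] at h
  refine h.trans ?_
  simp only [norm_mul, Complex.norm_real, Complex.norm_I, mul_one, Real.norm_eq_abs]
  have : 0 ≤ |x| ^ 3 := by positivity
  norm_num
  nlinarith

lemma abs_exp_mul_one_sub_sub_one_le {x : ℝ} (h0 : 0 ≤ x) (h1 : x ≤ 1) :
    |Real.exp x * (1 - x) - 1| ≤ 2 * x ^ 2 := by
  have h := Real.abs_exp_sub_one_sub_id_le (x := x) (by rwa [abs_of_nonneg h0])
  have e : Real.exp x * (1 - x) - 1 = -x ^ 2 + (Real.exp x - 1 - x) * (1 - x) := by ring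
  rw [e]
  refine (abs_add_le _ _).trans ?_
  rw [abs_neg, abs_of_nonneg (sq_nonneg x), abs_mul, abs_of_nonneg (sub_nonneg.2 h1)]
  nlinarith [abs_nonneg (Real.exp x - 1 - x)]

lemma abs_exp_neg_sub_exp_neg_le {a b : ℝ} (ha : 0 ≤ a) (hb : 0 ≤ b) :
    |Real.exp (-a) - Real.exp (-b)| ≤ |a - b| := by
  wlog h : a ≤ b generalizing a b
  · rw [abs_sub_comm, abs_sub_comm a b]
    exact this hb ha (le_of_not_ge h)
  have h1 : Real.exp (-b) ≤ Real.exp (-a) := Real.exp_le_exp.2 (by linarith)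
  have h2 : Real.exp (-a) ≤ 1 := Real.exp_le_one_iff.2 (by linarith)
  have h3 : Real.exp (-b) = Real.exp (-a) * Real.exp (-(b - a)) := by
    rw [← Real.exp_add]; congr 1; ring
  have h4 := Real.one_sub_le_exp_neg (b - a)
  rw [abs_of_nonneg (by linarith), abs_sub_comm, abs_of_nonneg (by linarith), h3]
  nlinarith [Real.exp_pos (-a)]

variable {𝓕 : Filtration ℕ m0} {D w : ℕ → Ω → ℝ} {b W u : ℝ}

/-- One step of the exponential martingale. -/
lemma norm_integral_exp_step_le {m m' : MeasurableSpace Ω} (hm : m ≤ m0) (hm' : m' ≤ m0)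
    {Z : Ω → ℂ} (hZ : Measurable[m] Z) {C : ℝ} (hC : ∀ ω, ‖Z ω‖ ≤ C) {D w : Ω → ℝ}
    (hD : Measurable[m'] D) (hb : ∀ ω, |D ω| ≤ b) (hw : Measurable[m] w) (hw0 : ∀ ω, 0 ≤ w ω)
    (hW : ∀ ω, w ω ≤ W) (h0 : CondEq μ m D 0) (h2 : CondEq μ m (fun ω => D ω ^ 2) w)
    (hu : 0 ≤ u) (hub : u * b ≤ 1) (huW : u ^ 2 * W ≤ 1) :
    ‖∫ ω, Z ω * Complex.exp (((u * D ω : ℝ) : ℂ) * Complex.I + ((u ^ 2 * w ω / 2 : ℝ) : ℂ)) ∂μ -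
      ∫ ω, Z ω ∂μ‖ ≤ 3 * C * ((u * b) ^ 3 + (u ^ 2 * W) ^ 2) := by
  have hne : Nonempty Ω := nonempty_of_isProbabilityMeasure μ
  have hb0 : 0 ≤ b := (abs_nonneg _).trans (hb (Classical.arbitrary Ω))
  have hC0 : 0 ≤ C := (norm_nonneg _).trans (hC (Classical.arbitrary Ω))
  have hW0 : 0 ≤ W := (hw0 _).trans (hW (Classical.arbitrary Ω))
  -- The compensating factor is measurable with respect to m, so it joins Z in the test function H.
  -- Conditionally, the D-factor averages to 1 − u²w/2 up to third order, which e cancels up to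
  -- second order in u²w.
  set e : Ω → ℂ := fun ω => ((Real.exp (u ^ 2 * w ω / 2) : ℝ) : ℂ) with he
  have hem : Measurable[m] e := Complex.measurable_ofReal.comp
    (Real.measurable_exp.comp ((hw.const_mul _).div_const _))
  have hx0 : ∀ ω, 0 ≤ u ^ 2 * w ω / 2 := fun ω => by have := hw0 ω; positivity
  have hx2 : ∀ ω, u ^ 2 * w ω / 2 ≤ u ^ 2 * W / 2 := fun ω => by have := hW ω; gcongr
  have hx1 : ∀ ω, u ^ 2 * w ω / 2 ≤ 1 / 2 := fun ω => (hx2 ω).trans (by linarith)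
  have heb : ∀ ω, ‖e ω‖ ≤ 3 := fun ω => by
    rw [he, Complex.norm_real, Real.norm_of_nonneg (Real.exp_pos _).le]
    refine (Real.exp_le_exp.2 ((hx1 ω).trans (by norm_num : (1 : ℝ) / 2 ≤ 1))).trans ?_
    linarith [Real.exp_one_lt_d9]
  set H : Ω → ℂ := fun ω => Z ω * e ω with hH
  have hHm : Measurable[m] H := hZ.mul hem
  have hHb : ∀ ω, ‖H ω‖ ≤ 3 * C := fun ω => by
    rw [hH, norm_mul, mul_comm]
    exact mul_le_mul (heb ω) (hC ω) (norm_nonneg _) (by norm_num)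
  have hHm0 := hHm.mono hm le_rfl
  have hZm0 := hZ.mono hm le_rfl
  have hDm0 := hD.mono hm' le_rfl
  have hwm0 := hw.mono hm le_rfl
  have hDi : Integrable D μ := integrable_of_bound hDm0 hb
  have hD2i : Integrable (fun ω => D ω ^ 2) μ := by
    simp only [pow_two]
    exact integrable_of_bound (hDm0.mul hDm0) fun ω => abs_mul_le_mul (hb ω) (hb ω)
  have hwi : Integrable w μ := integrable_of_bound (C := W) hwm0 fun ω => by
    rw [abs_of_nonneg (hw0 ω)]; exact hW ω
  have iZ : Integrable Z μ := integrable_of_norm_le hZm0 hC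
  have iH : Integrable H μ := integrable_of_norm_le hHm0 hHb
  have iHD : Integrable (fun ω => H ω * (D ω : ℂ)) μ :=
    hDi.ofReal.bdd_mul hHm0.aestronglyMeasurable (.of_forall hHb)
  have iHD2 : Integrable (fun ω => H ω * ((D ω ^ 2 : ℝ) : ℂ)) μ :=
    hD2i.ofReal.bdd_mul hHm0.aestronglyMeasurable (.of_forall hHb)
  have iHw : Integrable (fun ω => H ω * (w ω : ℂ)) μ :=
    hwi.ofReal.bdd_mul hHm0.aestronglyMeasurable (.of_forall hHb)
  have hEm : Measurable[m0] fun ω => Complex.exp (((u * D ω : ℝ) : ℂ) * Complex.I) :=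
    Complex.measurable_exp.comp
      ((Complex.measurable_ofReal.comp (hDm0.const_mul u)).mul_const _)
  have iHE : Integrable (fun ω => H ω * Complex.exp (((u * D ω : ℝ) : ℂ) * Complex.I)) μ :=
    integrable_of_norm_le (C := 3 * C) (hHm0.mul hEm) fun ω => by
      rw [norm_mul, Complex.norm_exp_ofReal_mul_I, mul_one]
      exact hHb ω
  -- the quadratic expansion, integrated
  have step1 : ∫ ω, (H ω + Complex.I * u * (H ω * (D ω : ℂ)) +
      (-(u : ℂ) ^ 2 / 2) * (H ω * ((D ω ^ 2 : ℝ) : ℂ))) ∂μ =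
      ∫ ω, (H ω + (-(u : ℂ) ^ 2 / 2) * (H ω * (w ω : ℂ))) ∂μ := by
    have i12 : Integrable (fun ω => H ω + Complex.I * u * (H ω * (D ω : ℂ))) μ :=
      iH.add (iHD.const_mul _)
    rw [integral_add i12 (iHD2.const_mul _), integral_add iH (iHD.const_mul _),
      integral_add iH (iHw.const_mul _), integral_const_mul, integral_const_mul,
      integral_const_mul, h2.complex hm hD2i hwi hHm hHb,
      h0.complex hm hDi (integrable_zero _ _ _) hHm hHb]
    simp
  have hexp : ∀ ω, Z ω * Complex.exp (((u * D ω : ℝ) : ℂ) * Complex.I +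
      ((u ^ 2 * w ω / 2 : ℝ) : ℂ)) = H ω * Complex.exp (((u * D ω : ℝ) : ℂ) * Complex.I) := by
    intro ω
    simp only [hH, he]
    rw [Complex.exp_add, Complex.ofReal_exp]
    ring
  have b1 : ‖∫ ω, H ω * Complex.exp (((u * D ω : ℝ) : ℂ) * Complex.I) ∂μ -
      ∫ ω, (H ω + Complex.I * u * (H ω * (D ω : ℂ)) +
      (-(u : ℂ) ^ 2 / 2) * (H ω * ((D ω ^ 2 : ℝ) : ℂ))) ∂μ‖ ≤ 3 * C * (u * b) ^ 3 := by
    have i12 : Integrable (fun ω => H ω + Complex.I * u * (H ω * (D ω : ℂ))) μ :=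
      iH.add (iHD.const_mul _)
    have i123 : Integrable (fun ω => H ω + Complex.I * u * (H ω * (D ω : ℂ)) +
        (-(u : ℂ) ^ 2 / 2) * (H ω * ((D ω ^ 2 : ℝ) : ℂ))) μ := i12.add (iHD2.const_mul _)
    rw [← integral_sub iHE i123]
    refine (norm_integral_le_of_norm_le_const (C := 3 * C * (u * b) ^ 3)
      (.of_forall fun ω => ?_)).trans (by simp)
    have hle : |u * D ω| ≤ u * b := by
      rw [abs_mul, abs_of_nonneg hu]
      exact mul_le_mul_of_nonneg_left (hb ω) hu
    have e1 : H ω * Complex.exp (((u * D ω : ℝ) : ℂ) * Complex.I) -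
        (H ω + Complex.I * u * (H ω * (D ω : ℂ)) +
          (-(u : ℂ) ^ 2 / 2) * (H ω * ((D ω ^ 2 : ℝ) : ℂ))) =
        H ω * (Complex.exp (((u * D ω : ℝ) : ℂ) * Complex.I) -
          (1 + ((u * D ω : ℝ) : ℂ) * Complex.I - ((u * D ω : ℝ) : ℂ) ^ 2 / 2)) := by
      push_cast
      ring
    rw [e1, norm_mul]
    refine mul_le_mul (hHb ω) ((norm_exp_mul_I_sub_le _ (hle.trans hub)).trans ?_)
      (norm_nonneg _) (by positivity)
    gcongr
  have b2 : ‖∫ ω, (H ω + (-(u : ℂ) ^ 2 / 2) * (H ω * (w ω : ℂ))) ∂μ - ∫ ω, Z ω ∂μ‖ ≤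
      C * (u ^ 2 * W) ^ 2 := by
    have i12 : Integrable (fun ω => H ω + (-(u : ℂ) ^ 2 / 2) * (H ω * (w ω : ℂ))) μ :=
      iH.add (iHw.const_mul _)
    rw [← integral_sub i12 iZ]
    refine (norm_integral_le_of_norm_le_const (C := C * (u ^ 2 * W) ^ 2)
      (.of_forall fun ω => ?_)).trans (by simp)
    have e1 : H ω + (-(u : ℂ) ^ 2 / 2) * (H ω * (w ω : ℂ)) - Z ω =
        Z ω * ((Real.exp (u ^ 2 * w ω / 2) * (1 - u ^ 2 * w ω / 2) - 1 : ℝ) : ℂ) := by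
      rw [hH, he]
      push_cast
      ring
    rw [e1, norm_mul, Complex.norm_real, Real.norm_eq_abs]
    refine mul_le_mul (hC ω) ?_ (abs_nonneg _) hC0
    refine (abs_exp_mul_one_sub_sub_one_le (hx0 ω) ((hx1 ω).trans (by norm_num))).trans ?_
    nlinarith [hx0 ω, hx2 ω]
  simp only [hexp]
  calc _ ≤ 3 * C * (u * b) ^ 3 + C * (u ^ 2 * W) ^ 2 := by
        refine le_trans ?_ (add_le_add b1 b2)
        rw [step1]
        exact norm_sub_le_norm_sub_add_norm_sub _ _ _
    _ ≤ _ := by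
        have : 0 ≤ C * (u ^ 2 * W) ^ 2 := by positivity
        linarith

/-- The characteristic function of a normalized sum of bounded martingale differences. -/
theorem norm_charFun_martingale_sub_le (hD : ∀ i, Measurable[𝓕 (i + 1)] (D i))
    (hb : ∀ i ω, |D i ω| ≤ b) (h0 : ∀ i, CondEq μ (𝓕 i) (D i) 0)
    (hw : ∀ i, Measurable[𝓕 i] (w i)) (hw0 : ∀ i ω, 0 ≤ w i ω) (hW : ∀ i ω, w i ω ≤ W)
    (h2 : ∀ i, CondEq μ (𝓕 i) (fun ω => D i ω ^ 2) (w i))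
    (hu : 0 ≤ u) (hub : u * b ≤ 1) (huW : u ^ 2 * W ≤ 1) (n : ℕ) {σ : ℝ} (hσ : 0 ≤ σ) :
    ‖∫ ω, Complex.exp (((u * ∑ i ∈ Finset.range n, D i ω : ℝ) : ℂ) * Complex.I) ∂μ -
      Complex.exp (((-σ / 2 : ℝ) : ℂ))‖ ≤
      Real.exp (n * (u ^ 2 * W)) * (3 * n * ((u * b) ^ 3 + (u ^ 2 * W) ^ 2) +
        ∫ ω, |u ^ 2 * ∑ i ∈ Finset.range n, w i ω - σ| ∂μ) := by
  have hne : Nonempty Ω := nonempty_of_isProbabilityMeasure μ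
  have hb0 : 0 ≤ b := (abs_nonneg _).trans (hb 0 (Classical.arbitrary Ω))
  have hW0 : 0 ≤ W := (hw0 0 _).trans (hW 0 (Classical.arbitrary Ω))
  -- Compensating by the conditional variance makes Z almost a complex martingale: its mean starts
  -- at 1 and moves little at each step, while its modulus is at most exp(n u² W).
  set Z : ℕ → Ω → ℂ := fun j ω => Complex.exp (((u * ∑ i ∈ Finset.range j, D i ω : ℝ) : ℂ) *
    Complex.I + ((u ^ 2 * ∑ i ∈ Finset.range j, w i ω / 2 : ℝ) : ℂ)) with hZ
  have hVm : ∀ j, Measurable[𝓕 j] fun ω => ∑ i ∈ Finset.range j, w i ω := fun j =>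
    Finset.measurable_sum _ fun k hk => (hw k).mono (𝓕.mono (Finset.mem_range.1 hk).le) le_rfl
  have hVm2 : ∀ j, Measurable[𝓕 j] fun ω => ∑ i ∈ Finset.range j, w i ω / 2 := fun j =>
    Finset.measurable_sum _ fun k hk =>
      ((hw k).mono (𝓕.mono (Finset.mem_range.1 hk).le) le_rfl).div_const _
  have hZm : ∀ j, Measurable[𝓕 j] (Z j) := fun j => by
    refine Complex.measurable_exp.comp (Measurable.add (Measurable.mul_const ?_ _) ?_)
    · exact Complex.measurable_ofReal.comp ((measurable_partialSum hD le_rfl).const_mul _)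
    · exact Complex.measurable_ofReal.comp ((hVm2 j).const_mul _)
  have hV0 : ∀ j ω, 0 ≤ ∑ i ∈ Finset.range j, w i ω := fun j ω =>
    Finset.sum_nonneg fun i _ => hw0 i ω
  have hVb : ∀ j ω, ∑ i ∈ Finset.range j, w i ω ≤ j * W := fun j ω =>
    (Finset.sum_le_sum fun i _ => hW i ω).trans (by simp)
  have hZb : ∀ j ≤ n, ∀ ω, ‖Z j ω‖ ≤ Real.exp (n * (u ^ 2 * W)) := by
    intro j hj ω
    rw [hZ, Complex.norm_exp]
    refine Real.exp_le_exp.2 ?_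
    have h1 : (j : ℝ) * W ≤ n * W := by gcongr
    have h3 := hVb j ω
    have h4 := hV0 j ω
    have h5 : u ^ 2 * ∑ i ∈ Finset.range j, w i ω / 2 ≤ u ^ 2 * (n * W) := by
      rw [← Finset.sum_div]
      gcongr
      linarith
    simp only [Complex.add_re, Complex.mul_re, Complex.ofReal_re, Complex.I_re, mul_zero,
      Complex.ofReal_im, Complex.I_im, sub_zero, zero_add, mul_one]
    linarith
  have hstep : ∀ j < n, ‖∫ ω, Z (j + 1) ω ∂μ - ∫ ω, Z j ω ∂μ‖ ≤
      3 * Real.exp (n * (u ^ 2 * W)) * ((u * b) ^ 3 + (u ^ 2 * W) ^ 2) := by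
    intro j hj
    refine le_trans (le_of_eq ?_) (norm_integral_exp_step_le (𝓕.le j) (𝓕.le (j + 1)) (hZm j)
      (hZb j hj.le) (hD j) (hb j) (hw j) (hw0 j) (hW j) (h0 j) (h2 j) hu hub huW)
    congr 3
    ext ω
    rw [hZ]
    simp only
    rw [← Complex.exp_add, Finset.sum_range_succ, Finset.sum_range_succ]
    congr 1
    push_cast
    ring
  have htel : ∀ j ≤ n, ‖∫ ω, Z j ω ∂μ - 1‖ ≤
      j * (3 * Real.exp (n * (u ^ 2 * W)) * ((u * b) ^ 3 + (u ^ 2 * W) ^ 2)) := by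
    intro j
    induction j with
    | zero => simp [hZ]
    | succ j ih =>
      intro hj
      have h1 := ih (by omega)
      have h3 := hstep j (by omega)
      refine (norm_sub_le_norm_sub_add_norm_sub _ (∫ ω, Z j ω ∂μ) _).trans ?_
      push_cast
      linarith
  have hn := htel n le_rfl
  set V : Ω → ℝ := fun ω => u ^ 2 * ∑ i ∈ Finset.range n, w i ω with hV
  have hVm0 : Measurable V := ((hVm n).mono (𝓕.le n) le_rfl).const_mul _
  have hVnn : ∀ ω, 0 ≤ V ω := fun ω => mul_nonneg (sq_nonneg u) (hV0 n ω)
  have hVi : Integrable V μ := integrable_of_bound (C := u ^ 2 * (n * W)) hVm0 fun ω => by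
    rw [abs_of_nonneg (hVnn ω)]
    exact mul_le_mul_of_nonneg_left (hVb n ω) (sq_nonneg _)
  have hZi : Integrable (Z n) μ :=
    integrable_of_norm_le ((hZm n).mono (𝓕.le n) le_rfl) (hZb n le_rfl)
  have hMm : Measurable fun ω => ∑ i ∈ Finset.range n, D i ω :=
    (measurable_partialSum hD le_rfl).mono (𝓕.le n) le_rfl
  have hEi : Integrable (fun ω => Complex.exp (((u * ∑ i ∈ Finset.range n, D i ω : ℝ) : ℂ) *
      Complex.I)) μ := by
    refine integrable_of_norm_le (C := 1) (by fun_prop) fun ω => ?_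
    rw [Complex.norm_exp_ofReal_mul_I]
  -- The random factor exp(−V/2) is then replaced by the constant exp(−σ/2), at a cost proportional
  -- to the mean of |V − σ|.
  have hsplit : ∀ ω, Complex.exp (((u * ∑ i ∈ Finset.range n, D i ω : ℝ) : ℂ) * Complex.I) =
      Z n ω * ((Real.exp (-(V ω / 2)) : ℝ) : ℂ) := by
    intro ω
    rw [hZ, Complex.ofReal_exp]
    simp only
    rw [← Complex.exp_add, ← Finset.sum_div]
    congr 1
    simp only [hV]
    push_cast
    ring
  have b1 : ‖∫ ω, Complex.exp (((u * ∑ i ∈ Finset.range n, D i ω : ℝ) : ℂ) * Complex.I) ∂μ -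
      ∫ ω, Z n ω * ((Real.exp (-(σ / 2)) : ℝ) : ℂ) ∂μ‖ ≤
      Real.exp (n * (u ^ 2 * W)) * ∫ ω, |V ω - σ| ∂μ := by
    rw [← integral_sub hEi (hZi.mul_const _), ← integral_const_mul]
    refine norm_integral_le_of_norm_le ((hVi.sub (integrable_const σ)).abs.const_mul _)
      (.of_forall fun ω => ?_)
    rw [hsplit, ← mul_sub, norm_mul, ← Complex.ofReal_sub, Complex.norm_real, Real.norm_eq_abs]
    refine mul_le_mul (hZb n le_rfl ω) ?_ (abs_nonneg _) (Real.exp_pos _).le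
    refine (abs_exp_neg_sub_exp_neg_le (by have := hVnn ω; positivity) (by positivity)).trans ?_
    rw [← sub_div, abs_div, abs_two]
    change |V ω - σ| / 2 ≤ |V ω - σ|
    linarith [abs_nonneg (V ω - σ)]
  have b2 : ‖∫ ω, Z n ω * ((Real.exp (-(σ / 2)) : ℝ) : ℂ) ∂μ -
      Complex.exp (((-σ / 2 : ℝ) : ℂ))‖ ≤
      n * (3 * Real.exp (n * (u ^ 2 * W)) * ((u * b) ^ 3 + (u ^ 2 * W) ^ 2)) := by
    rw [integral_mul_const, ← Complex.ofReal_exp, neg_div]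
    have : (∫ ω, Z n ω ∂μ) * ((Real.exp (-(σ / 2)) : ℝ) : ℂ) - ((Real.exp (-(σ / 2)) : ℝ) : ℂ) =
        (∫ ω, Z n ω ∂μ - 1) * ((Real.exp (-(σ / 2)) : ℝ) : ℂ) := by ring
    rw [this, norm_mul, Complex.norm_real, Real.norm_of_nonneg (Real.exp_pos _).le]
    have h1 : Real.exp (-(σ / 2)) ≤ 1 := Real.exp_le_one_iff.2 (by linarith)
    exact (mul_le_of_le_one_right (norm_nonneg _) h1).trans hn
  refine (norm_sub_le_norm_sub_add_norm_sub _ _ _).trans ((add_le_add b1 b2).trans (le_of_eq ?_))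
  ring

end MartingaleCLT

/-! ### The Markov property -/

section MarkovOperator

variable {S : Type*} [MeasurableSpace S] {P : Kernel S S} {g : S → ℝ} {C : ℝ}

/-- The Markov operator `g ↦ ∫ g(y) P(·, dy)` on real functions. -/
def Pop (P : Kernel S S) (g : S → ℝ) (x : S) : ℝ := ∫ y, g y ∂P x

lemma measurable_Pop (hg : Measurable g) : Measurable (Pop P g) :=
  (hg.stronglyMeasurable.integral_kernel (κ := P)).measurable

variable [IsMarkovKernel P]

lemma abs_Pop_le (hC : ∀ x, |g x| ≤ C) (x : S) : |Pop P g x| ≤ C := by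
  refine (norm_integral_le_of_norm_le_const (C := C) (f := g) (.of_forall hC)).trans ?_
  simp

lemma measurable_Pop_iterate (hg : Measurable g) (n : ℕ) : Measurable ((Pop P)^[n] g) := by
  induction n with
  | zero => exact hg
  | succ n ih => rw [Function.iterate_succ_apply']; exact measurable_Pop ih

lemma abs_Pop_iterate_le (hC : ∀ x, |g x| ≤ C) (n : ℕ) (x : S) : |(Pop P)^[n] g x| ≤ C := by
  induction n generalizing x with
  | zero => exact hC x
  | succ n ih => rw [Function.iterate_succ_apply']; exact abs_Pop_le ih x

lemma Pop_sub_const (hg : Measurable g) (hC : ∀ x, |g x| ≤ C) (c : ℝ) :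
    Pop P (fun x => g x - c) = fun x => Pop P g x - c := by
  ext x
  rw [Pop, integral_sub (integrable_of_bound hg hC) (integrable_const c)]
  simp [Pop]

lemma Pop_iterate_sub_const (hg : Measurable g) (hC : ∀ x, |g x| ≤ C) (c : ℝ) (n : ℕ) :
    (Pop P)^[n] (fun x => g x - c) = fun x => (Pop P)^[n] g x - c := by
  induction n with
  | zero => rfl
  | succ n ih =>
    rw [Function.iterate_succ_apply', Function.iterate_succ_apply', ih,
      Pop_sub_const (measurable_Pop_iterate hg n) (abs_Pop_iterate_le hC n)]

variable {ν : Measure S} [IsProbabilityMeasure ν]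

lemma integral_Pop (hinv : P.Invariant ν) (hg : Measurable g) (hC : ∀ x, |g x| ≤ C) :
    ∫ x, Pop P g x ∂ν = ∫ x, g x ∂ν := by
  have h1 := Measure.integral_compProd (μ := ν) (κ := P) (f := fun p : S × S => g p.2)
    (integrable_of_bound (hg.comp measurable_snd) fun p => hC p.2)
  rw [← integral_map (φ := Prod.snd) (f := g) measurable_snd.aemeasurable
    hg.aestronglyMeasurable] at h1
  change ∫ y, g y ∂(ν ⊗ₘ P).snd = _ at h1
  rw [Measure.snd_compProd] at h1
  exact h1.symm.trans (congrArg (fun ρ => ∫ x, g x ∂ρ) hinv.def)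

lemma integral_Pop_iterate (hinv : P.Invariant ν) (hg : Measurable g) (hC : ∀ x, |g x| ≤ C)
    (n : ℕ) : ∫ x, (Pop P)^[n] g x ∂ν = ∫ x, g x ∂ν := by
  induction n with
  | zero => rfl
  | succ n ih =>
    rw [Function.iterate_succ_apply',
      integral_Pop hinv (measurable_Pop_iterate hg n) (abs_Pop_iterate_le hC n), ih]

end MarkovOperator

section MarkovChain

variable {Ω S : Type*} {m0 : MeasurableSpace Ω} [MeasurableSpace S] {μ : Measure Ω}
  [IsProbabilityMeasure μ] {ν : Measure S} {P : Kernel S S}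
  [IsMarkovKernel P] {Z : ℕ → Ω → S} {g : S → ℝ} {C : ℝ}

/-- The σ-algebra of the past of a chain. -/
def past (Z : ℕ → Ω → S) (hZ : ∀ n, Measurable (Z n)) : Filtration ℕ m0 where
  seq n := MeasurableSpace.comap (fun ω (i : Fin (n + 1)) => Z i ω) inferInstance
  mono' := by
    intro i j hij
    have : (fun ω (k : Fin (i + 1)) => Z k ω) =
        (fun (z : Fin (j + 1) → S) (k : Fin (i + 1)) => z (Fin.castLE (by omega) k)) ∘
          (fun ω (k : Fin (j + 1)) => Z k ω) := rfl
    change MeasurableSpace.comap _ _ ≤ _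
    rw [this, ← MeasurableSpace.comap_comp]
    refine MeasurableSpace.comap_mono (Measurable.comap_le ?_)
    exact measurable_pi_lambda _ fun k => measurable_pi_apply _
  le' n := (measurable_pi_lambda (fun ω (i : Fin (n + 1)) => Z i ω) fun k => hZ k).comap_le

lemma measurable_past (hZ : ∀ n, Measurable (Z n)) {k n : ℕ} (h : k ≤ n) :
    Measurable[past Z hZ n] (Z k) := by
  have : Measurable[past Z hZ n] fun ω (i : Fin (n + 1)) => Z i ω := comap_measurable _
  exact (measurable_pi_apply (⟨k, by omega⟩ : Fin (n + 1))).comp this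

lemma measurable_past_comp (hZ : ∀ n, Measurable (Z n)) {k n : ℕ} (h : k ≤ n)
    (hg : Measurable g) : Measurable[past Z hZ n] fun ω => g (Z k ω) :=
  hg.comp (measurable_past hZ h)

/-- The Markov property, one step. -/
lemma condEq_past_succ (hZ : IsMarkovChain μ Z P ν) (hg : Measurable g) (hC : ∀ x, |g x| ≤ C)
    (n : ℕ) : CondEq μ (past Z hZ.measurable n) (fun ω => g (Z (n + 1) ω))
      (fun ω => Pop P g (Z n ω)) := by
  rintro H hH ⟨D, hD⟩
  -- A function measurable for the past factors through the path (Z_0, …, Z_n), so the claim becomes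
  -- Fubini for the composition-product in the Markov property.
  obtain ⟨h, hh, rfl⟩ := hH.exists_eq_measurable_comp
  set φ : Ω → (Fin (n + 1) → S) := fun ω i => Z i ω with hφ
  have hφm : Measurable φ := measurable_pi_lambda _ fun k => hZ.measurable k
  have hpm : Measurable fun ω => (φ ω, Z (n + 1) ω) := hφm.prodMk (hZ.measurable _)
  have hfm : Measurable fun p : (Fin (n + 1) → S) × S => h p.1 * g p.2 :=
    (hh.comp measurable_fst).mul (hg.comp measurable_snd)
  have hm := hZ.markov n
  have hprob : IsProbabilityMeasure (μ.map φ) :=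
    Measure.isProbabilityMeasure_map hφm.aemeasurable
  have hi : Integrable (fun p : (Fin (n + 1) → S) × S => h p.1 * g p.2)
      (μ.map fun ω => (φ ω, Z (n + 1) ω)) := by
    rw [integrable_map_measure hfm.aestronglyMeasurable hpm.aemeasurable]
    exact integrable_of_bound (hfm.comp hpm) fun ω => abs_mul_le_mul (hD ω) (hC _)
  have e1 : ∫ ω, (h ∘ φ) ω * g (Z (n + 1) ω) ∂μ =
      ∫ p, h p.1 * g p.2 ∂(μ.map fun ω => (φ ω, Z (n + 1) ω)) := by
    rw [integral_map hpm.aemeasurable hfm.aestronglyMeasurable]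
    rfl
  rw [hm] at hi e1
  rw [e1, Measure.integral_compProd hi]
  simp only [integral_const_mul]
  have hm2 : Measurable fun z : Fin (n + 1) → S => h z * Pop P g (z (Fin.last n)) :=
    hh.mul ((measurable_Pop hg).comp (measurable_pi_apply _))
  rw [integral_map hφm.aemeasurable]
  · simp only [Kernel.comap_apply]
    rfl
  · exact hm2.aestronglyMeasurable

/-- The Markov property, several steps. -/
lemma condEq_past_add (hZ : IsMarkovChain μ Z P ν) (hg : Measurable g) (hC : ∀ x, |g x| ≤ C)
    (n k : ℕ) : CondEq μ (past Z hZ.measurable n) (fun ω => g (Z (n + k) ω))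
      (fun ω => (Pop P)^[k] g (Z n ω)) := by
  induction k generalizing g with
  | zero => exact fun H _ _ => rfl
  | succ k ih =>
    refine CondEq.trans ?_ (ih (measurable_Pop hg) (abs_Pop_le hC))
    exact (condEq_past_succ hZ hg hC (n + k)).mono ((past Z hZ.measurable).mono (by omega))

variable [IsProbabilityMeasure ν]

lemma integral_chain (hinv : P.Invariant ν) (hZ : IsMarkovChain μ Z P ν) (hg : Measurable g)
    (hC : ∀ x, |g x| ≤ C) (n : ℕ) : ∫ ω, g (Z n ω) ∂μ = ∫ x, g x ∂ν := by
  have h := condEq_past_add hZ hg hC 0 n (fun _ => 1) measurable_const ⟨1, by simp⟩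
  simp only [one_mul, zero_add] at h
  rw [h, ← integral_map (f := (Pop P)^[n] g) (hZ.measurable 0).aemeasurable
    (measurable_Pop_iterate hg n).aestronglyMeasurable, hZ.initial,
    integral_Pop_iterate hinv hg hC]

/-- The chain is stationary. -/
lemma map_chain (hinv : P.Invariant ν) (hZ : IsMarkovChain μ Z P ν) (n : ℕ) :
    μ.map (Z n) = ν := by
  have := Measure.isProbabilityMeasure_map (μ := μ) (hZ.measurable n).aemeasurable
  ext A hA
  have h := integral_chain (g := A.indicator fun _ => 1) (C := 1) hinv hZ
    (measurable_const.indicator hA) (abs_indicator_le (by simp) A) n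
  rw [← integral_map (f := A.indicator fun _ => (1 : ℝ)) (hZ.measurable n).aemeasurable
    (measurable_const.indicator hA).aestronglyMeasurable] at h
  rw [integral_indicator_const _ hA, integral_indicator_const _ hA] at h
  simpa [measureReal_def, ENNReal.toReal_eq_toReal_iff'] using h

lemma ae_chain (hinv : P.Invariant ν) (hZ : IsMarkovChain μ Z P ν) {p : S → Prop}
    (hp : ∀ᵐ x ∂ν, p x) (n : ℕ) : ∀ᵐ ω ∂μ, p (Z n ω) := by
  rw [← map_chain hinv hZ n] at hp
  exact ae_of_ae_map (hZ.measurable n).aemeasurable hp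

end MarkovChain

/-! ### Tail bounds for partial sums along the chain -/

section ChainTail

variable {Ω S : Type*} {m0 : MeasurableSpace Ω} [MeasurableSpace S] {μ : Measure Ω}
  [IsProbabilityMeasure μ] {ν : Measure S} [IsProbabilityMeasure ν] {P : Kernel S S}
  [IsMarkovKernel P] {Z : ℕ → Ω → S} {g : S → ℝ}

/-- The past of a chain along an arithmetic progression. -/
def progressionPast (Z : ℕ → Ω → S) (hZ : ∀ n, Measurable (Z n)) (a L : ℕ) :
    Filtration ℕ m0 where
  seq n := match n with
    -- Time 0 of the filtration precedes the progression and carries no information: its predictions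
    -- are unconditional means, matching the zero initial column of the array.
    | 0 => ⊥
    | i + 1 => past Z hZ (a + i * L)
  mono' := by
    intro i j hij
    rcases i with _ | i
    · exact bot_le
    · rcases j with _ | j
      · omega
      · exact (past Z hZ).mono (by gcongr; omega)
  le' n := by
    rcases n with _ | n
    · exact bot_le
    · exact (past Z hZ).le _

lemma condEq_bot_zero {X : Ω → ℝ} (hX : ∫ ω, X ω ∂μ = 0) : CondEq μ ⊥ X 0 := by
  rintro H hH -
  obtain ⟨c, rfl⟩ := stronglyMeasurable_bot_iff.1 hH.stronglyMeasurable
  simp [integral_const_mul, hX]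

lemma condEq_bot_const {X : Ω → ℝ} : CondEq μ ⊥ X (fun _ => ∫ ω, X ω ∂μ) := by
  rintro H hH -
  obtain ⟨c, rfl⟩ := stronglyMeasurable_bot_iff.1 hH.stronglyMeasurable
  simp [integral_const_mul]

lemma integral_abs_comp_chain (hinv : P.Invariant ν) (hZ : IsMarkovChain μ Z P ν)
    (hg : Measurable g) {C : ℝ} (hC : ∀ x, |g x| ≤ C) (n : ℕ) :
    ∫ ω, |g (Z n ω)| ∂μ = ∫ x, |g x| ∂ν :=
  integral_chain (g := fun x => |g x|) (C := C) hinv hZ hg.abs (fun x => by simpa using hC x) n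

/-- Tail bound along an arithmetic progression. -/
theorem progression_tail (hinv : P.Invariant ν) (hZ : IsMarkovChain μ Z P ν) (hg : Measurable g)
    {B A θ v lam y : ℝ} (hB : ∀ x, |g x| ≤ B) (h0 : ∫ x, g x ∂ν = 0) (hA : 0 ≤ A) (hθ : 0 ≤ θ)
    (hmix : ∀ n, ∫ x, |(Pop P)^[n] g x| ∂ν ≤ A * θ ^ n)
    (hmix2 : ∀ n, ∫ x, |(Pop P)^[n] (fun x => g x ^ 2) x - ∫ x, g x ^ 2 ∂ν| ∂ν ≤ A * θ ^ n)
    {L : ℕ} (hL : θ ^ L ≤ 1 / 16) (hv : 0 < v) (hgv : ∫ x, g x ^ 2 ∂ν ≤ v)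
    (hlam : 0 < lam) (hlB : lam * (2 * B) ≤ 1) (hy : 0 < y) (a N₀ : ℕ) :
    μ.real {ω | ∃ N ≤ N₀, 3 * y ≤ |∑ i ∈ Finset.range N, g (Z (a + i * L) ω)|} ≤
      2 * Real.exp (-(lam * y) + lam ^ 2 * (2 * N₀ * v)) + A * θ ^ L / v +
        6 * N₀ * B * A * θ ^ L / y ^ 2 := by
  have hne : Nonempty S := nonempty_of_isProbabilityMeasure ν
  have hB0 : 0 ≤ B := (abs_nonneg _).trans (hB (Classical.arbitrary S))
  set q : S → ℝ := fun x => g x ^ 2 with hq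
  have hqm : Measurable q := hg.pow_const 2
  have hqB : ∀ x, |q x| ≤ B * B := fun x => by
    simp only [hq, pow_two]
    exact abs_mul_le_mul (hB x) (hB x)
  have hq0 : 0 ≤ ∫ x, q x ∂ν := integral_nonneg fun x => sq_nonneg _
  have hpop0 : ∀ n x, 0 ≤ (Pop P)^[n] q x := by
    intro n
    induction n with
    | zero => exact fun x => sq_nonneg _
    | succ n ih =>
      intro x
      rw [Function.iterate_succ_apply']
      exact integral_nonneg ih
  -- Entry (k, i+1) is the prediction of g at position i+k of the progression from position i.
  -- Column 0 is the prediction from no information, which vanishes because g is centred.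
  let X : ℕ → ℕ → Ω → ℝ := fun k i => match i with
    | 0 => fun _ => 0
    | i + 1 => fun ω => (Pop P)^[k * L] g (Z (a + i * L) ω)
  -- The conditional second moment of the next value, starting with the stationary value ν(g²).
  let ζ : ℕ → Ω → ℝ := fun i => match i with
    | 0 => fun _ => ∫ x, q x ∂ν
    | i + 1 => fun ω => (Pop P)^[L] q (Z (a + i * L) ω)
  have hX0 : ∀ i ω, X 0 (i + 1) ω = g (Z (a + i * L) ω) := fun i ω => by simp [X]
  have key := array_tail (μ := μ) (𝓕 := progressionPast Z hZ.measurable a L) (X := X) (ζ := ζ)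
    (B := B) (A := A) (ρ := θ ^ L) (v := v) (W := B * B) (v₀ := ∫ x, q x ∂ν) (lam := lam) (y := y)
    ?_ (fun k ω => rfl) ?_ ?_ (pow_nonneg hθ L) hL hA ?_ ?_ ?_ ?_ ?_ hv hgv ?_ hlam hlB hy N₀
  · simpa only [hX0] using key
  · rintro k (_ | i)
    · exact measurable_const
    · exact measurable_past_comp hZ.measurable le_rfl (measurable_Pop_iterate hg _)
  · rintro k (_ | i) ω
    · simpa [X] using hB0
    · exact abs_Pop_iterate_le hB _ _
  · rintro k (_ | i)
    · refine condEq_bot_zero ?_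
      change ∫ ω, (Pop P)^[k * L] g (Z (a + 0 * L) ω) ∂μ = 0
      rw [integral_chain hinv hZ (measurable_Pop_iterate hg _) (abs_Pop_iterate_le hB _),
        integral_Pop_iterate hinv hg hB, h0]
    · have h := condEq_past_add hZ (measurable_Pop_iterate (P := P) hg (k * L))
        (abs_Pop_iterate_le hB (k * L)) (a + i * L) L
      rw [← Function.iterate_add_apply] at h
      have e1 : a + i * L + L = a + (i + 1) * L := by ring
      have e2 : L + k * L = (k + 1) * L := by ring
      rw [e1, e2] at h
      exact h
  · rintro k (_ | i) hk
    · simp only [X, abs_zero, integral_zero]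
      positivity
    · rw [← pow_mul, mul_comm L k]
      refine le_of_eq_of_le ?_ (hmix (k * L))
      exact integral_abs_comp_chain hinv hZ (measurable_Pop_iterate hg _)
        (abs_Pop_iterate_le hB _) _
  · rintro (_ | i)
    · exact measurable_const
    · exact measurable_past_comp hZ.measurable le_rfl (measurable_Pop_iterate hqm _)
  · rintro (_ | i) ω
    · exact hq0
    · exact hpop0 _ _
  · rintro (_ | i) ω
    · refine (le_abs_self _).trans ((norm_integral_le_of_norm_le_const (C := B * B) (f := q)
        (.of_forall hqB)).trans (by simp))
    · exact (le_abs_self _).trans (abs_Pop_iterate_le hqB _ _)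
  · rintro (_ | i)
    · have : ∫ x, q x ∂ν = ∫ ω, X 0 (0 + 1) ω ^ 2 ∂μ := by
        simp only [hX0]
        exact (integral_chain hinv hZ hqm hqB _).symm
      simp only [ζ, this]
      exact condEq_bot_const
    · have h := condEq_past_add hZ hqm hqB (a + i * L) L
      have e1 : a + i * L + L = a + (i + 1) * L := by ring
      rw [e1] at h
      change CondEq μ (past Z hZ.measurable (a + i * L))
        (fun ω => (Pop P)^[0 * L] g (Z (a + (i + 1) * L) ω) ^ 2) _
      rw [zero_mul]
      exact h
  · rintro (_ | i)
    · simp only [ζ, sub_self, abs_zero, integral_zero]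
      positivity
    · refine le_of_eq_of_le ?_ (hmix2 L)
      exact integral_abs_comp_chain (g := fun x => (Pop P)^[L] q x - ∫ x, q x ∂ν) hinv hZ
        ((measurable_Pop_iterate hqm _).sub_const _)
        (fun x => (abs_sub _ _).trans (add_le_add (abs_Pop_iterate_le hqB _ _) le_rfl)) _

/-- Splitting a sum into residue classes. -/
lemma exists_sum_range_eq_residues (f : ℕ → ℝ) {L : ℕ} (hL : 0 < L) (N : ℕ) :
    ∃ c : ℕ → ℕ, (∀ r < L, N ≤ r + c r * L ∧ r + c r * L < N + L) ∧
      ∑ i ∈ Finset.range N, f i =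
        ∑ r ∈ Finset.range L, ∑ i ∈ Finset.range (c r), f (r + i * L) := by
  classical
  induction N with
  | zero => exact ⟨fun _ => 0, fun r hr => by simpa using hr, by simp⟩
  | succ N ih =>
    obtain ⟨c, hc, hs⟩ := ih
    have hr : N % L < L := Nat.mod_lt _ hL
    -- The first index not yet used in the residue class of N is N itself, so adding N lengthens
    -- that class by one and leaves the others alone.
    have hcN : N % L + c (N % L) * L = N := by
      obtain ⟨h1, h2⟩ := hc _ hr
      have hdm := Nat.mod_add_div N L
      have h3 : N / L ≤ c (N % L) := by
        by_contra! h
        have : (c (N % L) + 1) * L ≤ N / L * L := Nat.mul_le_mul_right _ h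
        nlinarith
      have h4 : c (N % L) < N / L + 1 := by
        by_contra! h
        have : (N / L + 1) * L ≤ c (N % L) * L := Nat.mul_le_mul_right _ h
        nlinarith
      have h5 : c (N % L) = N / L := by omega
      rw [h5, mul_comm]
      exact hdm
    refine ⟨Function.update c (N % L) (c (N % L) + 1), fun r hrL => ?_, ?_⟩
    · by_cases h : r = N % L
      · subst h
        rw [Function.update_self, add_mul, one_mul, ← add_assoc, hcN]
        omega
      · rw [Function.update_of_ne h]
        obtain ⟨h1, h2⟩ := hc r hrL
        refine ⟨?_, by omega⟩
        by_contra! h3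
        have h4 : r + c r * L = N := by omega
        apply h
        rw [← h4, Nat.add_mul_mod_self_right, Nat.mod_eq_of_lt hrL]
    · rw [Finset.sum_range_succ, hs, ← Finset.add_sum_erase _ _ (Finset.mem_range.2 hr),
        ← Finset.add_sum_erase (Finset.range L) _ (Finset.mem_range.2 hr), Function.update_self,
        Finset.sum_range_succ, hcN]
      have : ∑ r ∈ (Finset.range L).erase (N % L), ∑ i ∈ Finset.range
          (Function.update c (N % L) (c (N % L) + 1) r), f (r + i * L) =
          ∑ r ∈ (Finset.range L).erase (N % L), ∑ i ∈ Finset.range (c r), f (r + i * L) :=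
        Finset.sum_congr rfl fun r hr => by
          rw [Function.update_of_ne (Finset.ne_of_mem_erase hr)]
      rw [this]
      ring

/-- Tail bound for the maximum of the partial sums along the chain. -/
theorem chain_tail (hinv : P.Invariant ν) (hZ : IsMarkovChain μ Z P ν) (hg : Measurable g)
    {B A θ v lam y : ℝ} (hB : ∀ x, |g x| ≤ B) (h0 : ∫ x, g x ∂ν = 0) (hA : 0 ≤ A) (hθ : 0 ≤ θ)
    (hmix : ∀ n, ∫ x, |(Pop P)^[n] g x| ∂ν ≤ A * θ ^ n)
    (hmix2 : ∀ n, ∫ x, |(Pop P)^[n] (fun x => g x ^ 2) x - ∫ x, g x ^ 2 ∂ν| ∂ν ≤ A * θ ^ n)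
    {L : ℕ} (hL0 : 0 < L) (hL : θ ^ L ≤ 1 / 16) (hv : 0 < v) (hgv : ∫ x, g x ^ 2 ∂ν ≤ v)
    (hlam : 0 < lam) (hlB : lam * (2 * B) ≤ 1) (hy : 0 < y) (a : ℕ) {n N₀ : ℕ}
    (hN₀ : n + L ≤ N₀ * L) :
    μ.real {ω | ∃ N ≤ n, 3 * y * L ≤ |∑ i ∈ Finset.range N, g (Z (a + i) ω)|} ≤
      L * (2 * Real.exp (-(lam * y) + lam ^ 2 * (2 * N₀ * v)) + A * θ ^ L / v +
        6 * N₀ * B * A * θ ^ L / y ^ 2) := by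
  -- If all partial sums along each of the L residue classes stay below 3y, the full sum stays below
  -- 3yL. The class lengths do not exceed N₀ because n + L ≤ N₀ L.
  have hsub : {ω | ∃ N ≤ n, 3 * y * L ≤ |∑ i ∈ Finset.range N, g (Z (a + i) ω)|} ⊆
      ⋃ r ∈ Finset.range L,
        {ω | ∃ N ≤ N₀, 3 * y ≤ |∑ i ∈ Finset.range N, g (Z (a + r + i * L) ω)|} := by
    rintro ω ⟨N, hN, hω⟩
    by_contra hcon
    simp only [Set.mem_iUnion, Finset.mem_range, Set.mem_ofPred_eq, exists_prop, not_exists,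
      not_and, not_le] at hcon
    obtain ⟨c, hc, hs⟩ := exists_sum_range_eq_residues (fun i => g (Z (a + i) ω)) hL0 N
    rw [hs] at hω
    have : |∑ r ∈ Finset.range L, ∑ i ∈ Finset.range (c r), g (Z (a + (r + i * L)) ω)| <
        3 * y * L := by
      refine (Finset.abs_sum_le_sum_abs _ _).trans_lt ?_
      calc _ < ∑ r ∈ Finset.range L, 3 * y := by
            refine Finset.sum_lt_sum_of_nonempty ⟨0, Finset.mem_range.2 hL0⟩ fun r hr => ?_
            have hr := Finset.mem_range.1 hr
            simp only [← add_assoc]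
            refine hcon r hr _ ?_
            by_contra! h
            have : (N₀ + 1) * L ≤ c r * L := Nat.mul_le_mul_right _ h
            have := (hc r hr).2
            nlinarith
        _ = _ := by simp; ring
    exact absurd hω (not_le.2 this)
  refine (measureReal_mono hsub (measure_ne_top _ _)).trans ((measureReal_biUnion_finset_le _ _).trans ?_)
  refine (Finset.sum_le_sum fun r _ => progression_tail hinv hZ hg hB h0 hA hθ hmix hmix2 hL hv hgv
    hlam hlB hy (a + r) N₀).trans ?_
  rw [Finset.sum_const, Finset.card_range, nsmul_eq_mul]

end ChainTail

/-! ### Real functions represented in the Banach space -/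

section Represents

variable {S B : Type*} [MeasurableSpace S] [NormedAddCommGroup B] [NormedSpace ℂ B]
  {ι : B →ₗ[ℂ] (S → ℂ)} {l : Filter S} {ν : Measure S} {P : Kernel S S} {T : B →L[ℂ] B}
  {b b' : B} {g g' : S → ℝ}

/-- The element `b` of the function space is the real function `g`, in the sense of `l`. -/
def Represents (ι : B →ₗ[ℂ] (S → ℂ)) (l : Filter S) (b : B) (g : S → ℝ) : Prop :=
  ∀ᶠ x in l, ι b x = (g x : ℂ)

lemma ae_le_of_eq_top_or (hl : l = ⊤ ∨ l = ae ν) : ae ν ≤ l := by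
  rcases hl with rfl | rfl
  exacts [le_top, le_rfl]

lemma Represents.add (h : Represents ι l b g) (h' : Represents ι l b' g') :
    Represents ι l (b + b') (g + g') := by
  filter_upwards [h, h'] with x h1 h2
  simp [h1, h2]

lemma Represents.sub (h : Represents ι l b g) (h' : Represents ι l b' g') :
    Represents ι l (b - b') (g - g') := by
  filter_upwards [h, h'] with x h1 h2
  simp [h1, h2]

/-- For identities holding almost everywhere, invariance is essential: a ν-null set is P(x, ·)-null
for ν-almost every x, so P respects the exceptional set. -/
lemma Represents.pop (hT : IsMarkovOperator ι P T) (hinv : P.Invariant ν)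
    (hl : l = ⊤ ∨ l = ae ν) (h : Represents ι l b g) : Represents ι l (T b) (Pop P g) := by
  rcases hl with rfl | rfl
  · have h : ∀ x, ι b x = (g x : ℂ) := by simpa [Represents] using h
    have : ι b = fun x => (g x : ℂ) := funext h
    simp only [Represents, eventually_top]
    intro x
    rw [(hT b x).2, this, integral_complex_ofReal]
    rfl
  · have h' : ∀ᵐ x ∂(ν.bind P), ι b x = (g x : ℂ) := by rw [hinv.def]; exact h
    filter_upwards [Measure.ae_ae_of_ae_comp h'] with x hx
    rw [(hT b x).2, integral_congr_ae hx, integral_complex_ofReal]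
    rfl

lemma Represents.pop_iterate (hT : IsMarkovOperator ι P T) (hinv : P.Invariant ν)
    (hl : l = ⊤ ∨ l = ae ν) (h : Represents ι l b g) (n : ℕ) :
    Represents ι l ((T ^ n) b) ((Pop P)^[n] g) := by
  induction n with
  | zero => simpa using h
  | succ n ih =>
    rw [Function.iterate_succ_apply', pow_succ']
    change Represents ι l (T ((T ^ n) b)) _
    exact ih.pop hT hinv hl

/-- Products of bounded represented functions are represented. -/
lemma exists_represents_mul (hE : CondE ι l) : ∃ C : ℝ, 0 < C ∧ ∃ ℓ : ℕ, ∀ (b b' : B)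
    (g g' : S → ℝ) (M : ℝ), Represents ι l b g → Represents ι l b' g' → 0 < M →
    (∀ x, |g x| ≤ M) → (∀ x, |g' x| ≤ M) →
    ∃ h : B, Represents ι l h (g * g') ∧ ‖h‖ ≤ M ^ 2 * (C * (max ‖b‖ ‖b'‖ / M) ^ ℓ) := by
  obtain ⟨C, hC, ℓ, -, h⟩ := hE
  refine ⟨C, hC, ℓ, fun b b' g g' M hb hb' hM hg hg' => ?_⟩
  -- Condition (E) speaks of functions bounded by 1; dividing by M puts the factors there, and the
  -- product is rescaled by M² afterwards.
  have key : ∀ (b : B) (g : S → ℝ), Represents ι l b g → (∀ x, |g x| ≤ M) →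
      ∀ᶠ x in l, ‖ι (((M⁻¹ : ℝ) : ℂ) • b) x‖ ≤ 1 := by
    intro b g hb hg
    filter_upwards [hb] with x hx
    rw [map_smul, Pi.smul_apply, hx, norm_smul, Complex.norm_real, Complex.norm_real,
      Real.norm_eq_abs, Real.norm_eq_abs, abs_of_pos (inv_pos.2 hM), inv_mul_le_one₀ hM]
    exact hg x
  obtain ⟨k, hk, hkn⟩ := h _ _ (key b g hb hg) (key b' g' hb' hg')
  refine ⟨((M ^ 2 : ℝ) : ℂ) • k, ?_, ?_⟩
  · filter_upwards [hb, hb'] with x h1 h2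
    rw [map_smul, Pi.smul_apply, hk]
    simp only [map_smul, Pi.smul_apply, h1, h2, smul_eq_mul, Pi.mul_apply]
    have hM' : (M : ℂ) ≠ 0 := by exact_mod_cast hM.ne'
    push_cast
    field_simp
  · rw [norm_smul, Complex.norm_real, Real.norm_of_nonneg (sq_nonneg M)]
    refine mul_le_mul_of_nonneg_left (hkn.trans (le_of_eq ?_)) (sq_nonneg M)
    rw [norm_smul, norm_smul, Complex.norm_real, Real.norm_of_nonneg (inv_pos.2 hM).le,
      ← mul_max_of_nonneg _ _ (inv_pos.2 hM).le, inv_mul_eq_div]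

variable [IsProbabilityMeasure ν] [IsMarkovKernel P]

/-- Geometric ergodicity in `L¹(ν)` of the represented functions. -/
lemma exists_mixing (hι : IsFunctionSpace ι) (hT : IsMarkovOperator ι P T)
    (hinv : P.Invariant ν) (hl : l = ⊤ ∨ l = ae ν) {m : ℝ≥0∞} (hm : 1 ≤ m)
    (hB : CondB ι ν m) (hC : CondC ι ν T) :
    ∃ A θ : ℝ, 0 < A ∧ 0 ≤ θ ∧ θ < 1 ∧ ∀ (b : B) (g : S → ℝ), Measurable g →
      (∃ M, ∀ x, |g x| ≤ M) → Represents ι l b g →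
      ∀ n, ∫ x, |(Pop P)^[n] g x - ∫ y, g y ∂ν| ∂ν ≤ A * ‖b‖ * θ ^ n := by
  obtain ⟨K, hK, hB⟩ := hB
  obtain ⟨e, he, κ, θ, hκ, hθ0, hθ1, hC⟩ := hC
  refine ⟨K * κ, θ, mul_pos hK hκ, hθ0, hθ1, ?_⟩
  rintro b g hg ⟨M, hM⟩ hb n
  have hgi : ∫ x, ι b x ∂ν = ((∫ x, g x ∂ν : ℝ) : ℂ) := by
    rw [← integral_complex_ofReal]
    exact integral_congr_ae (ae_le_of_eq_top_or hl hb)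
  -- This element realizes Pⁿg − νg, so its L¹ norm is at most its L^m norm, hence at most K‖c‖, to
  -- which (C) applies.
  set c : B := (T ^ n) b - (∫ x, ι b x ∂ν) • e with hc
  have hce : ∀ᵐ x ∂ν, ι c x = (((Pop P)^[n] g x - ∫ y, g y ∂ν : ℝ) : ℂ) := by
    filter_upwards [ae_le_of_eq_top_or hl (hb.pop_iterate hT hinv hl n)] with x hx
    rw [hc, map_sub, map_smul, Pi.sub_apply, Pi.smul_apply, he, hgi, hx]
    simp
  have h1 : eLpNorm (ι c) 1 ν ≤ ENNReal.ofReal (K * ‖c‖) :=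
    (eLpNorm_le_eLpNorm_of_exponent_le hm (hι.measurable c).aestronglyMeasurable).trans (hB c)
  have h2 : ∫ x, |(Pop P)^[n] g x - ∫ y, g y ∂ν| ∂ν = (eLpNorm (ι c) 1 ν).toReal := by
    rw [eLpNorm_one_eq_lintegral_enorm, ← integral_norm_eq_lintegral_enorm
      (hι.measurable c).aestronglyMeasurable]
    refine integral_congr_ae ?_
    filter_upwards [hce] with x hx
    rw [hx, Complex.norm_real, Real.norm_eq_abs]
  rw [h2]
  refine (ENNReal.toReal_le_of_le_ofReal (by positivity) h1).trans ?_
  calc K * ‖c‖ ≤ K * (κ * ‖b‖ * θ ^ n) := mul_le_mul_of_nonneg_left (hC n b) hK.le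
    _ = _ := by ring

/-- The algebra of bounded measurable functions that are represented in the Banach space. -/
def repAlgebra (hE : CondE ι l) (h1 : ∃ e : B, ι e = fun _ => 1) : Subalgebra ℝ (S → ℝ) where
  carrier := {g | Measurable g ∧ (∃ M, ∀ x, |g x| ≤ M) ∧ ∃ b, Represents ι l b g}
  mul_mem' := by
    rintro g g' ⟨hg, ⟨M, hM⟩, b, hb⟩ ⟨hg', ⟨M', hM'⟩, b', hb'⟩
    refine ⟨hg.mul hg', ⟨M * M', fun x => abs_mul_le_mul (hM x) (hM' x)⟩, ?_⟩
    obtain ⟨C, -, ℓ, h⟩ := exists_represents_mul hE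
    obtain ⟨k, hk, -⟩ := h b b' g g' (max 1 (max M M')) hb hb' (by positivity)
      (fun x => (hM x).trans (by simp)) (fun x => (hM' x).trans (by simp))
    exact ⟨k, hk⟩
  add_mem' := by
    rintro g g' ⟨hg, ⟨M, hM⟩, b, hb⟩ ⟨hg', ⟨M', hM'⟩, b', hb'⟩
    exact ⟨hg.add hg', ⟨M + M', fun x => (abs_add_le _ _).trans (add_le_add (hM x) (hM' x))⟩,
      b + b', hb.add hb'⟩
  algebraMap_mem' := by
    intro r
    obtain ⟨e, he⟩ := h1
    refine ⟨measurable_const, ⟨|r|, fun x => le_rfl⟩, (r : ℂ) • e, .of_forall fun x => ?_⟩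
    simp [he]

end Represents

/-! ### Moment bounds and the law of large numbers along the chain -/

section ChainMoments

variable {Ω S : Type*} {m0 : MeasurableSpace Ω} [MeasurableSpace S] {μ : Measure Ω}
  [IsProbabilityMeasure μ] {ν : Measure S} [IsProbabilityMeasure ν] {P : Kernel S S}
  [IsMarkovKernel P] {Z : ℕ → Ω → S} {g : S → ℝ} {M A θ : ℝ}

lemma integral_mul_chain_eq (hinv : P.Invariant ν) (hZ : IsMarkovChain μ Z P ν) {f : S → ℝ}
    {M' : ℝ} (hf : Measurable f) (hM' : ∀ x, |f x| ≤ M') (hg : Measurable g)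
    (hM : ∀ x, |g x| ≤ M) (i k : ℕ) :
    ∫ ω, f (Z i ω) * g (Z (i + k) ω) ∂μ = ∫ x, f x * (Pop P)^[k] g x ∂ν := by
  have h := condEq_past_add hZ hg hM i k (fun ω => f (Z i ω))
    (measurable_past_comp hZ.measurable le_rfl hf) ⟨M', fun ω => hM' _⟩
  rw [h]
  exact integral_chain (g := fun x => f x * (Pop P)^[k] g x) hinv hZ
    (hf.mul (measurable_Pop_iterate hg k))
    (fun x => abs_mul_le_mul (hM' x) (abs_Pop_iterate_le hM k x)) i

lemma abs_integral_mul_Pop_le {f : S → ℝ} {M' : ℝ} (hM' : ∀ x, |f x| ≤ M') (hg : Measurable g)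
    (hM : ∀ x, |g x| ≤ M) (k : ℕ) :
    |∫ x, f x * (Pop P)^[k] g x ∂ν| ≤ M' * ∫ x, |(Pop P)^[k] g x| ∂ν := by
  have hi := (integrable_of_bound (μ := ν) (measurable_Pop_iterate (P := P) hg k)
    (abs_Pop_iterate_le hM k)).abs
  have e : M' * ∫ x, |(Pop P)^[k] g x| ∂ν = ∫ x, M' * |(Pop P)^[k] g x| ∂ν :=
    (integral_const_mul _ _).symm
  rw [e]
  change ‖∫ x, f x * (Pop P)^[k] g x ∂ν‖ ≤ _
  refine norm_integral_le_of_norm_le (hi.const_mul _) (.of_forall fun x => ?_)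
  rw [Real.norm_eq_abs, abs_mul]
  exact mul_le_mul_of_nonneg_right (hM' x) (abs_nonneg _)

lemma measurable_chain_sum (hZ : ∀ n, Measurable (Z n)) (hg : Measurable g) (a N : ℕ) :
    Measurable fun ω => ∑ i ∈ Finset.range N, g (Z (a + i) ω) :=
  Finset.measurable_sum _ fun _ _ => hg.comp (hZ _)

lemma abs_chain_sum_le (hM : ∀ x, |g x| ≤ M) (a N : ℕ) (ω : Ω) :
    |∑ i ∈ Finset.range N, g (Z (a + i) ω)| ≤ N * M :=
  (Finset.abs_sum_le_sum_abs _ _).trans ((Finset.sum_le_sum fun _ _ => hM _).trans (by simp))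

/-- The variance of the partial sums grows at most linearly. -/
lemma integral_sq_chain_sum_le (hinv : P.Invariant ν) (hZ : IsMarkovChain μ Z P ν)
    (hg : Measurable g) (hM : ∀ x, |g x| ≤ M) (hA : 0 ≤ A) (hθ : 0 ≤ θ) (hθ1 : θ < 1)
    (hmix : ∀ n, ∫ x, |(Pop P)^[n] g x| ∂ν ≤ A * θ ^ n) (a N : ℕ) :
    ∫ ω, (∑ i ∈ Finset.range N, g (Z (a + i) ω)) ^ 2 ∂μ ≤ N * (2 * M * A / (1 - θ)) := by
  have hne : Nonempty S := nonempty_of_isProbabilityMeasure ν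
  have hM0 : 0 ≤ M := (abs_nonneg _).trans (hM (Classical.arbitrary S))
  have h1θ : 0 < 1 - θ := by linarith
  have hgeom : ∀ n, ∑ k ∈ Finset.range n, θ ^ k ≤ 1 / (1 - θ) := fun n => by
    rw [one_div, ← tsum_geometric_of_lt_one hθ hθ1]
    exact (summable_geometric_of_lt_one hθ hθ1).sum_le_tsum _ fun k _ => pow_nonneg hθ k
  have hcor : ∀ i k, ∫ ω, g (Z i ω) * g (Z (i + k) ω) ∂μ ≤ M * (A * θ ^ k) := fun i k => by
    rw [integral_mul_chain_eq hinv hZ hg hM hg hM]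
    exact (le_abs_self _).trans ((abs_integral_mul_Pop_le hM hg hM k).trans
      (mul_le_mul_of_nonneg_left (hmix k) hM0))
  induction N with
  | zero => simp
  | succ N ih =>
    have e : ∀ ω, (∑ i ∈ Finset.range (N + 1), g (Z (a + i) ω)) ^ 2 =
        (∑ i ∈ Finset.range N, g (Z (a + i) ω)) ^ 2 +
        2 * (∑ i ∈ Finset.range N, g (Z (a + i) ω) * g (Z (a + N) ω)) +
          g (Z (a + N) ω) * g (Z (a + N + 0) ω) := fun ω => by
      rw [Finset.sum_range_succ, ← Finset.sum_mul]; simp only [add_zero]; ring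
    have i0 : ∀ i j, Integrable (fun ω => g (Z i ω) * g (Z j ω)) μ := fun i j =>
      integrable_of_bound ((hg.comp (hZ.measurable i)).mul (hg.comp (hZ.measurable j)))
        fun ω => abs_mul_le_mul (hM _) (hM _)
    have i1 : Integrable (fun ω => (∑ i ∈ Finset.range N, g (Z (a + i) ω)) ^ 2) μ := by
      simp only [pow_two]
      have hS := measurable_chain_sum hZ.measurable hg a N
      exact integrable_of_bound (hS.mul hS)
        fun ω => abs_mul_le_mul (abs_chain_sum_le hM a N ω) (abs_chain_sum_le hM a N ω)
    have i2 : Integrable (fun ω => ∑ i ∈ Finset.range N, g (Z (a + i) ω) * g (Z (a + N) ω)) μ :=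
      integrable_finsetSum _ fun i _ => i0 _ _
    simp only [e]
    rw [integral_add_add i1 (i2.const_mul _) (i0 _ _), integral_const_mul,
      integral_finsetSum _ fun i _ => i0 _ _]
    have h2 : ∑ i ∈ Finset.range N, ∫ ω, g (Z (a + i) ω) * g (Z (a + N) ω) ∂μ ≤
        ∑ i ∈ Finset.range N, M * (A * θ ^ (i + 1)) := by
      -- The term at index i has lag N − i; reversing the sum orders it by lags 1, …, N.
      rw [← Finset.sum_range_reflect (fun i => M * (A * θ ^ (i + 1)))]
      refine Finset.sum_le_sum fun i hi => ?_
      have hi := Finset.mem_range.1 hi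
      have := hcor (a + i) (N - i)
      rwa [show a + i + (N - i) = a + N by omega, show N - i = N - 1 - i + 1 by omega] at this
    have h3 := hcor (a + N) 0
    have h4 := hgeom (N + 1)
    rw [Finset.sum_range_succ'] at h4
    rw [← Finset.mul_sum, ← Finset.mul_sum] at h2
    have h5 : M * A * (∑ k ∈ Finset.range N, θ ^ (k + 1) + θ ^ 0) ≤ M * A * (1 / (1 - θ)) :=
      mul_le_mul_of_nonneg_left h4 (mul_nonneg hM0 hA)
    have h6 : 2 * M * A / (1 - θ) = 2 * (M * A * (1 / (1 - θ))) := by ring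
    rw [h6] at ih ⊢
    push_cast
    have h7 : 0 ≤ M * A := mul_nonneg hM0 hA
    simp only [pow_zero] at h3 h5
    nlinarith

lemma integral_abs_le_sqrt {X : Ω → ℝ} (hX : Measurable X) {C : ℝ} (hC : ∀ ω, |X ω| ≤ C) :
    ∫ ω, |X ω| ∂μ ≤ Real.sqrt (∫ ω, X ω ^ 2 ∂μ) := by
  have hX2 : Integrable (fun ω => X ω ^ 2) μ := by
    simp only [pow_two]
    exact integrable_of_bound (hX.mul hX) fun ω => abs_mul_le_mul (hC ω) (hC ω)
  have hXi : Integrable (fun ω => |X ω|) μ := (integrable_of_bound hX hC).abs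
  refine Real.le_sqrt_of_sq_le ?_
  set c := ∫ ω, |X ω| ∂μ with hc
  have h : 0 ≤ ∫ ω, (X ω ^ 2 + (-(2 * c)) * |X ω| + c ^ 2) ∂μ :=
    integral_nonneg fun ω => by
      have : X ω ^ 2 + (-(2 * c)) * |X ω| + c ^ 2 = (|X ω| - c) ^ 2 := by
        rw [← sq_abs (X ω)]; ring
      simp only [this]
      exact sq_nonneg _
  rw [integral_add_add hX2 (hXi.const_mul _) (integrable_const _), integral_const_mul, ← hc] at h
  simp at h
  nlinarith

/-- The law of large numbers in `L¹`. -/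
lemma tendsto_integral_abs_average (hinv : P.Invariant ν) (hZ : IsMarkovChain μ Z P ν)
    (hg : Measurable g) (hM : ∀ x, |g x| ≤ M) (hA : 0 ≤ A) (hθ : 0 ≤ θ) (hθ1 : θ < 1)
    (hmix : ∀ n, ∫ x, |(Pop P)^[n] g x - ∫ y, g y ∂ν| ∂ν ≤ A * θ ^ n) {N : ℕ → ℕ}
    (hN : ∀ n, N n ≤ n) {t : ℝ} (ht : Tendsto (fun n => (N n : ℝ) / n) atTop (𝓝 t)) :
    Tendsto (fun n : ℕ => ∫ ω, |(1 / (n : ℝ)) * ∑ i ∈ Finset.range (N n), g (Z i ω) -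
      t * ∫ x, g x ∂ν| ∂μ) atTop (𝓝 0) := by
  set c := ∫ x, g x ∂ν with hc
  have hM0 : 0 ≤ M := by
    have hne : Nonempty S := nonempty_of_isProbabilityMeasure ν
    exact (abs_nonneg _).trans (hM (Classical.arbitrary S))
  set h : S → ℝ := fun x => g x - c with hh
  have hhm : Measurable h := hg.sub_const _
  have hhM : ∀ x, |h x| ≤ M + |c| := fun x => (abs_sub _ _).trans (add_le_add (hM x) le_rfl)
  have hhmix : ∀ n, ∫ x, |(Pop P)^[n] h x| ∂ν ≤ A * θ ^ n := fun n => by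
    rw [hh, Pop_iterate_sub_const hg hM]
    exact hmix n
  set Q := 2 * (M + |c|) * A / (1 - θ) with hQ
  have hQ0 : 0 ≤ Q := by
    have : 0 < 1 - θ := by linarith
    positivity
  -- The centred fluctuation is of order n^{-1/2} by the linear variance bound; what remains is the
  -- deterministic error N(n)/n − t.
  have hb : ∀ n : ℕ, ∫ ω, |(1 / (n : ℝ)) * ∑ i ∈ Finset.range (N n), g (Z i ω) - t * c| ∂μ ≤
      Real.sqrt (Q / n) + |(N n : ℝ) / n - t| * |c| := by
    intro n
    rcases Nat.eq_zero_or_pos n with rfl | hn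
    · have := hN 0
      simp [Nat.le_zero.1 this, abs_mul]
    have hn' : (0 : ℝ) < n := Nat.cast_pos.2 hn
    have hsm := measurable_chain_sum hZ.measurable hhm 0 (N n)
    have hsb := abs_chain_sum_le (Z := Z) hhM 0 (N n)
    have hvar := integral_sq_chain_sum_le hinv hZ hhm hhM hA hθ hθ1 hhmix 0 (N n)
    simp only [zero_add] at hsm hsb hvar
    have hi : Integrable (fun ω => |∑ i ∈ Finset.range (N n), h (Z i ω)|) μ :=
      (integrable_of_bound hsm hsb).abs
    calc _ ≤ ∫ ω, ((1 / (n : ℝ)) * |∑ i ∈ Finset.range (N n), h (Z i ω)| +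
          |(N n : ℝ) / n - t| * |c|) ∂μ := by
          refine integral_mono_of_nonneg (.of_forall fun ω => abs_nonneg _)
            ((hi.const_mul _).add (integrable_const _)) (.of_forall fun ω => ?_)
          have e : (1 / (n : ℝ)) * ∑ i ∈ Finset.range (N n), g (Z i ω) - t * c =
              (1 / (n : ℝ)) * ∑ i ∈ Finset.range (N n), h (Z i ω) + ((N n : ℝ) / n - t) * c := by
            simp only [hh, Finset.sum_sub_distrib, Finset.sum_const, Finset.card_range,
              nsmul_eq_mul]
            ring
          simp only [e]
          refine (abs_add_le _ _).trans (le_of_eq ?_)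
          rw [abs_mul, abs_mul, abs_of_pos (by positivity : 0 < 1 / (n : ℝ))]
      _ = (1 / (n : ℝ)) * ∫ ω, |∑ i ∈ Finset.range (N n), h (Z i ω)| ∂μ +
          |(N n : ℝ) / n - t| * |c| := by
          rw [integral_add (hi.const_mul _) (integrable_const _), integral_const_mul]
          simp
      _ ≤ _ := by
          gcongr
          have h1 : ∫ ω, |∑ i ∈ Finset.range (N n), h (Z i ω)| ∂μ ≤ Real.sqrt (n * Q) := by
            refine (integral_abs_le_sqrt hsm hsb).trans (Real.sqrt_le_sqrt (hvar.trans ?_))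
            have := hN n
            gcongr
          refine (mul_le_mul_of_nonneg_left h1 (by positivity)).trans (le_of_eq ?_)
          have h2 : Q / n = (n * Q) / n ^ 2 := by field_simp
          rw [h2, Real.sqrt_div (by positivity), Real.sqrt_sq hn'.le]
          ring
  refine squeeze_zero (fun n => integral_nonneg fun ω => abs_nonneg _) hb ?_
  have l1 : Tendsto (fun n : ℕ => Real.sqrt (Q / n)) atTop (𝓝 0) := by
    have := (Real.continuous_sqrt.tendsto 0).comp (tendsto_const_div_atTop_nhds_zero_nat Q)
    rwa [Real.sqrt_zero] at this
  have l2 : Tendsto (fun n => |(N n : ℝ) / n - t| * |c|) atTop (𝓝 0) := by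
    have := ((ht.sub_const t).abs).mul_const |c|
    rwa [sub_self, abs_zero, zero_mul] at this
  simpa using l1.add l2

end ChainMoments

/-! ### Martingale approximation -/

section MartingaleApproximation

variable {Ω S : Type*} {m0 : MeasurableSpace Ω} [MeasurableSpace S] {μ : Measure Ω}
  [IsProbabilityMeasure μ] {ν : Measure S} [IsProbabilityMeasure ν] {P : Kernel S S}
  [IsMarkovKernel P] {Z : ℕ → Ω → S} {f g : S → ℝ} {M M' A θ : ℝ}

/-- An algebra of bounded functions, stable under the Markov operator, on which the latter
contracts geometrically in `L¹`. -/
structure IsMixingAlgebra (P : Kernel S S) (ν : Measure S) (θ : ℝ)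
    (𝓐 : Subalgebra ℝ (S → ℝ)) : Prop where
  measurable : ∀ g ∈ 𝓐, Measurable g
  bounded : ∀ g ∈ 𝓐, ∃ M, ∀ x, |g x| ≤ M
  pop_mem : ∀ g ∈ 𝓐, Pop P g ∈ 𝓐
  mixing : ∀ g ∈ 𝓐, ∃ A, 0 ≤ A ∧ ∀ n, ∫ x, |(Pop P)^[n] g x - ∫ y, g y ∂ν| ∂ν ≤ A * θ ^ n

lemma IsMixingAlgebra.pop_iterate_mem {𝓐 : Subalgebra ℝ (S → ℝ)} (h : IsMixingAlgebra P ν θ 𝓐)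
    (hg : g ∈ 𝓐) (n : ℕ) : (Pop P)^[n] g ∈ 𝓐 := by
  induction n with
  | zero => exact hg
  | succ n ih => rw [Function.iterate_succ_apply']; exact h.pop_mem _ ih

/-- The truncated solution of Poisson's equation. -/
def poissonSum (P : Kernel S S) (g : S → ℝ) (K : ℕ) : S → ℝ :=
  ∑ k ∈ Finset.range K, (Pop P)^[k] g

lemma poissonSum_apply (P : Kernel S S) (g : S → ℝ) (K : ℕ) (x : S) :
    poissonSum P g K x = ∑ k ∈ Finset.range K, (Pop P)^[k] g x := by
  simp [poissonSum]

lemma IsMixingAlgebra.poissonSum_mem {𝓐 : Subalgebra ℝ (S → ℝ)} (h : IsMixingAlgebra P ν θ 𝓐)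
    (hg : g ∈ 𝓐) (K : ℕ) : poissonSum P g K ∈ 𝓐 :=
  sum_mem fun k _ => h.pop_iterate_mem hg k

lemma abs_poissonSum_le (hM : ∀ x, |g x| ≤ M) (K : ℕ) (x : S) :
    |poissonSum P g K x| ≤ K * M := by
  rw [poissonSum_apply]
  refine (Finset.abs_sum_le_sum_abs _ _).trans
    ((Finset.sum_le_sum fun k _ => abs_Pop_iterate_le hM k x).trans (by simp))

lemma measurable_poissonSum (hg : Measurable g) (K : ℕ) : Measurable (poissonSum P g K) := by
  rw [show poissonSum P g K = _ from funext (poissonSum_apply P g K)]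
  exact Finset.measurable_sum _ fun k _ => measurable_Pop_iterate hg k

/-- Applying P shifts the sum by one index, so ψ − Pψ telescopes to g − P^K g: Poisson's equation up
to a geometrically small remainder, without leaving the bounded functions. -/
lemma Pop_poissonSum (hg : Measurable g) (hM : ∀ x, |g x| ≤ M) (K : ℕ) (x : S) :
    Pop P (poissonSum P g K) x = poissonSum P g K x - g x + (Pop P)^[K] g x := by
  have h1 : Pop P (poissonSum P g K) x = ∑ k ∈ Finset.range K, (Pop P)^[k + 1] g x := by
    rw [Pop]
    simp only [poissonSum_apply]
    rw [integral_finsetSum _ fun k _ => integrable_of_bound (measurable_Pop_iterate hg k)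
      (abs_Pop_iterate_le hM k)]
    refine Finset.sum_congr rfl fun k _ => ?_
    rw [Function.iterate_succ_apply']
    rfl
  have h2 := Finset.sum_range_succ' (fun k => (Pop P)^[k] g x) K
  rw [Finset.sum_range_succ] at h2
  rw [h1, poissonSum_apply]
  simp only [Function.iterate_zero, id] at h2
  linarith

/-- Martingale–coboundary decomposition: substituting the truncated Poisson equation leaves
martingale differences, a telescoping boundary term, and partial sums of the remainder P^K g. -/
lemma sum_chain_eq (hg : Measurable g) (hM : ∀ x, |g x| ≤ M) (K N : ℕ) (ω : Ω) :
    ∑ i ∈ Finset.range N, g (Z (i + 1) ω) =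
      ∑ i ∈ Finset.range N,
          (poissonSum P g K (Z (i + 1) ω) - Pop P (poissonSum P g K) (Z i ω)) +
        (Pop P (poissonSum P g K) (Z 0 ω) - Pop P (poissonSum P g K) (Z N ω)) +
        ∑ i ∈ Finset.range N, (Pop P)^[K] g (Z (1 + i) ω) := by
  rw [← Finset.sum_range_sub' (fun i => Pop P (poissonSum P g K) (Z i ω)),
    ← Finset.sum_add_distrib, ← Finset.sum_add_distrib]
  refine Finset.sum_congr rfl fun i _ => ?_
  rw [Pop_poissonSum hg hM K (Z (i + 1) ω), add_comm 1 i]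
  ring

/-- The conditional covariance of `f` and `g` given the present state. -/
def popCov (P : Kernel S S) (f g : S → ℝ) (x : S) : ℝ :=
  Pop P (fun y => f y * g y) x - Pop P f x * Pop P g x

lemma measurable_popCov (hf : Measurable f) (hg : Measurable g) : Measurable (popCov P f g) :=
  (measurable_Pop (hf.mul hg)).sub ((measurable_Pop hf).mul (measurable_Pop hg))

lemma popCov_self_nonneg (hf : Measurable f) (hM : ∀ x, |f x| ≤ M) (x : S) :
    0 ≤ popCov P f f x := by
  have i1 : Integrable (fun y => f y * f y) (P x) :=
    integrable_of_bound (hf.mul hf) fun y => abs_mul_le_mul (hM y) (hM y)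
  have i2 : Integrable f (P x) := integrable_of_bound hf hM
  have h : 0 ≤ ∫ y, (f y * f y + (-(2 * Pop P f x)) * f y + Pop P f x ^ 2) ∂P x :=
    integral_nonneg fun y => by
      have : f y * f y + (-(2 * Pop P f x)) * f y + Pop P f x ^ 2 = (f y - Pop P f x) ^ 2 := by
        ring
      simp only [this]
      exact sq_nonneg _
  rw [integral_add_add i1 (i2.const_mul _) (integrable_const _), integral_const_mul] at h
  have e1 : ∫ y, f y * f y ∂P x = Pop P (fun y => f y * f y) x := rfl
  have e2 : ∫ y, f y ∂P x = Pop P f x := rfl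
  rw [e1, e2] at h
  simp at h
  rw [popCov]
  linarith

lemma popCov_self_le (hM : ∀ x, |f x| ≤ M) (x : S) : popCov P f f x ≤ M * M := by
  have h1 := (le_abs_self _).trans (abs_Pop_le (P := P) (g := fun y => f y * f y)
    (fun y => abs_mul_le_mul (hM y) (hM y)) x)
  rw [popCov]
  linarith [mul_self_nonneg (Pop P f x)]

lemma popCov_sum {I : Type*} (J : Finset I) (a : I → ℝ) {ψ : I → S → ℝ}
    (hψ : ∀ s ∈ J, Measurable (ψ s)) (hM : ∀ s ∈ J, ∃ M, ∀ x, |ψ s x| ≤ M) (x : S) :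
    popCov P (fun x => ∑ s ∈ J, a s * ψ s x) (fun x => ∑ s ∈ J, a s * ψ s x) x =
      ∑ s ∈ J, ∑ s' ∈ J, a s * a s' * popCov P (ψ s) (ψ s') x := by
  have i1 : ∀ s ∈ J, Integrable (ψ s) (P x) := fun s hs => by
    obtain ⟨M, hM⟩ := hM s hs
    exact integrable_of_bound (hψ s hs) hM
  have i2 : ∀ s ∈ J, ∀ s' ∈ J, Integrable (fun y => ψ s y * ψ s' y) (P x) := fun s hs s' hs' => by
    obtain ⟨M, hM1⟩ := hM s hs
    obtain ⟨M', hM2⟩ := hM s' hs'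
    exact integrable_of_bound ((hψ s hs).mul (hψ s' hs')) fun y => abs_mul_le_mul (hM1 y) (hM2 y)
  have e1 : Pop P (fun x => ∑ s ∈ J, a s * ψ s x) x = ∑ s ∈ J, a s * Pop P (ψ s) x := by
    rw [Pop, integral_finsetSum _ fun s hs => (i1 s hs).const_mul _]
    exact Finset.sum_congr rfl fun s _ => integral_const_mul _ _
  have e2 : Pop P (fun y => (∑ s ∈ J, a s * ψ s y) * ∑ s ∈ J, a s * ψ s y) x =
      ∑ s ∈ J, ∑ s' ∈ J, a s * a s' * Pop P (fun y => ψ s y * ψ s' y) x := by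
    have : ∀ y, (∑ s ∈ J, a s * ψ s y) * ∑ s ∈ J, a s * ψ s y =
        ∑ s ∈ J, ∑ s' ∈ J, a s * a s' * (ψ s y * ψ s' y) := fun y => by
      rw [Finset.sum_mul_sum]
      refine Finset.sum_congr rfl fun s _ => Finset.sum_congr rfl fun s' _ => by ring
    simp only [Pop, this]
    rw [integral_finsetSum _ fun s hs => integrable_finsetSum _ fun s' hs' =>
      (i2 s hs s' hs').const_mul _]
    refine Finset.sum_congr rfl fun s hs => ?_
    rw [integral_finsetSum _ fun s' hs' => (i2 s hs s' hs').const_mul _]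
    exact Finset.sum_congr rfl fun s' _ => integral_const_mul _ _
  rw [popCov, e1, e2, Finset.sum_mul_sum, ← Finset.sum_sub_distrib]
  refine Finset.sum_congr rfl fun s _ => ?_
  rw [← Finset.sum_sub_distrib]
  refine Finset.sum_congr rfl fun s' _ => ?_
  rw [popCov]
  ring

lemma condEq_martingaleDiff (hZ : IsMarkovChain μ Z P ν) (hf : Measurable f)
    (hM : ∀ x, |f x| ≤ M) (n : ℕ) :
    CondEq μ (past Z hZ.measurable n) (fun ω => f (Z (n + 1) ω) - Pop P f (Z n ω)) 0 := by
  rintro H hH ⟨C, hC⟩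
  have hHm := hH.mono ((past Z hZ.measurable).le n) le_rfl
  have i1 : Integrable (fun ω => H ω * f (Z (n + 1) ω)) μ :=
    integrable_of_bound (hHm.mul (hf.comp (hZ.measurable _))) fun ω => abs_mul_le_mul (hC ω) (hM _)
  have i2 : Integrable (fun ω => H ω * Pop P f (Z n ω)) μ :=
    integrable_of_bound (hHm.mul ((measurable_Pop hf).comp (hZ.measurable _)))
      fun ω => abs_mul_le_mul (hC ω) (abs_Pop_le hM _)
  simp only [mul_sub]
  rw [integral_sub i1 i2, condEq_past_succ hZ hf hM n H hH ⟨C, hC⟩]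
  simp

lemma condEq_martingaleDiff_sq (hZ : IsMarkovChain μ Z P ν) (hf : Measurable f)
    (hM : ∀ x, |f x| ≤ M) (n : ℕ) :
    CondEq μ (past Z hZ.measurable n) (fun ω => (f (Z (n + 1) ω) - Pop P f (Z n ω)) ^ 2)
      (fun ω => popCov P f f (Z n ω)) := by
  rintro H hH ⟨C, hC⟩
  have hHm := hH.mono ((past Z hZ.measurable).le n) le_rfl
  have hfm := fun n => hf.comp (hZ.measurable n)
  have hpm := fun n => (measurable_Pop (P := P) hf).comp (hZ.measurable n)
  have hff : ∀ x, |f x * f x| ≤ M * M := fun x => abs_mul_le_mul (hM x) (hM x)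
  have hffm : Measurable fun x => f x * f x := hf.mul hf
  have i1 : Integrable (fun ω => H ω * (f (Z (n + 1) ω) * f (Z (n + 1) ω))) μ :=
    integrable_of_bound (hHm.mul ((hfm _).mul (hfm _))) fun ω => abs_mul_le_mul (hC ω) (hff _)
  have i2 : Integrable (fun ω => H ω * Pop P f (Z n ω) * f (Z (n + 1) ω)) μ :=
    integrable_of_bound ((hHm.mul (hpm n)).mul (hfm _))
      fun ω => abs_mul_le_mul (abs_mul_le_mul (hC ω) (abs_Pop_le hM _)) (hM _)
  have i3 : Integrable (fun ω => H ω * Pop P f (Z n ω) * Pop P f (Z n ω)) μ :=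
    integrable_of_bound ((hHm.mul (hpm n)).mul (hpm n))
      fun ω => abs_mul_le_mul (abs_mul_le_mul (hC ω) (abs_Pop_le hM _)) (abs_Pop_le hM _)
  have i4 : Integrable (fun ω => H ω * Pop P (fun x => f x * f x) (Z n ω)) μ :=
    integrable_of_bound (hHm.mul ((measurable_Pop hffm).comp (hZ.measurable n)))
      fun ω => abs_mul_le_mul (hC ω) (abs_Pop_le hff _)
  have e : ∀ ω, H ω * (f (Z (n + 1) ω) - Pop P f (Z n ω)) ^ 2 =
      H ω * (f (Z (n + 1) ω) * f (Z (n + 1) ω)) +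
        (-2) * (H ω * Pop P f (Z n ω) * f (Z (n + 1) ω)) +
          H ω * Pop P f (Z n ω) * Pop P f (Z n ω) := fun ω => by ring
  have e' : ∀ ω, H ω * popCov P f f (Z n ω) = H ω * Pop P (fun x => f x * f x) (Z n ω) -
      H ω * Pop P f (Z n ω) * Pop P f (Z n ω) := fun ω => by rw [popCov]; ring
  have h1 := condEq_past_succ hZ hffm hff n H hH ⟨C, hC⟩
  have h2 := condEq_past_succ hZ hf hM n (fun ω => H ω * Pop P f (Z n ω))
    (hH.mul (measurable_past_comp hZ.measurable le_rfl (measurable_Pop hf)))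
    ⟨_, fun ω => abs_mul_le_mul (hC ω) (abs_Pop_le hM _)⟩
  simp only [e, e']
  rw [integral_add_add i1 (i2.const_mul _) i3, integral_const_mul, integral_sub i4 i3, h1, h2]
  ring

end MartingaleApproximation

/-! ### Convergence of the finite-dimensional distributions -/

section FiniteDimensional

variable {Ω S I : Type*} {m0 : MeasurableSpace Ω} [MeasurableSpace S] {μ : Measure Ω}
  [IsProbabilityMeasure μ] {ν : Measure S} [IsProbabilityMeasure ν] {P : Kernel S S}
  [IsMarkovKernel P] {Z : ℕ → Ω → S} {f g : S → ℝ} {M M' A θ : ℝ} {𝓐 : Subalgebra ℝ (S → ℝ)}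
  {N : I → ℕ → ℕ} {t : I → ℝ}

lemma IsMixingAlgebra.popCov_mem (h𝓐 : IsMixingAlgebra P ν θ 𝓐) (hf : f ∈ 𝓐) (hg : g ∈ 𝓐) :
    popCov P f g ∈ 𝓐 :=
  𝓐.sub_mem (h𝓐.pop_mem _ (𝓐.mul_mem hf hg)) (𝓐.mul_mem (h𝓐.pop_mem _ hf) (h𝓐.pop_mem _ hg))

/-- The law of large numbers for the conditional variances. -/
lemma tendsto_integral_abs_condVar (hinv : P.Invariant ν) (hZ : IsMarkovChain μ Z P ν)
    (hθ : 0 ≤ θ) (hθ1 : θ < 1) (h𝓐 : IsMixingAlgebra P ν θ 𝓐) (J : Finset I) (a : I → ℝ)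
    {ψ : I → S → ℝ} (hψ : ∀ s, ψ s ∈ 𝓐) (hN : ∀ s n, N s n ≤ n)
    (ht : ∀ s, Tendsto (fun n => (N s n : ℝ) / n) atTop (𝓝 (t s))) :
    Tendsto (fun n : ℕ => ∫ ω, |(1 / (n : ℝ)) * (∑ s ∈ J, ∑ s' ∈ J, a s * a s' *
        ∑ i ∈ Finset.range (min (N s n) (N s' n)), popCov P (ψ s) (ψ s') (Z i ω)) -
      ∑ s ∈ J, ∑ s' ∈ J, a s * a s' * (min (t s) (t s') * ∫ x, popCov P (ψ s) (ψ s') x ∂ν)| ∂μ)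
      atTop (𝓝 0) := by
  have hmem : ∀ s s', popCov P (ψ s) (ψ s') ∈ 𝓐 := fun s s' => h𝓐.popCov_mem (hψ s) (hψ s')
  have hmeas := fun s s' => h𝓐.measurable _ (hmem s s')
  choose C hC using fun s s' => h𝓐.bounded _ (hmem s s')
  set Y : I → I → ℕ → Ω → ℝ := fun s s' n ω => (1 / (n : ℝ)) *
    ∑ i ∈ Finset.range (min (N s n) (N s' n)), popCov P (ψ s) (ψ s') (Z i ω) -
      min (t s) (t s') * ∫ x, popCov P (ψ s) (ψ s') x ∂ν with hY
  have hlim : ∀ s s', Tendsto (fun n => ∫ ω, |Y s s' n ω| ∂μ) atTop (𝓝 0) := by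
    intro s s'
    obtain ⟨A, hA, hmix⟩ := h𝓐.mixing _ (hmem s s')
    refine tendsto_integral_abs_average hinv hZ (hmeas s s') (hC s s') hA hθ hθ1 hmix
      (fun n => (min_le_left _ _).trans (hN s n)) ?_
    refine ((ht s).min (ht s')).congr fun n => ?_
    rw [Nat.cast_min, min_div_div_right (Nat.cast_nonneg n)]
  have hYi : ∀ s s' n, Integrable (fun ω => |Y s s' n ω|) μ := by
    intro s s' n
    have hm := measurable_chain_sum hZ.measurable (hmeas s s') 0 (min (N s n) (N s' n))
    have hb := abs_chain_sum_le (Z := Z) (hC s s') 0 (min (N s n) (N s' n))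
    simp only [zero_add] at hm hb
    exact (((integrable_of_bound hm hb).const_mul _).sub (integrable_const _)).abs
  have hsum : Tendsto (fun n => ∑ s ∈ J, ∑ s' ∈ J, |a s * a s'| * ∫ ω, |Y s s' n ω| ∂μ) atTop
      (𝓝 (∑ s ∈ J, ∑ s' ∈ J, |a s * a s'| * 0)) :=
    tendsto_finsetSum _ fun s _ => tendsto_finsetSum _ fun s' _ => (hlim s s').const_mul _
  simp only [mul_zero, Finset.sum_const_zero] at hsum
  refine squeeze_zero (fun n => integral_nonneg fun ω => abs_nonneg _) (fun n => ?_) hsum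
  have e : ∑ s ∈ J, ∑ s' ∈ J, |a s * a s'| * ∫ ω, |Y s s' n ω| ∂μ =
      ∫ ω, ∑ s ∈ J, ∑ s' ∈ J, |a s * a s'| * |Y s s' n ω| ∂μ := by
    rw [integral_finsetSum _ fun s _ => integrable_finsetSum _ fun s' _ => (hYi s s' n).const_mul _]
    refine Finset.sum_congr rfl fun s _ => ?_
    rw [integral_finsetSum _ fun s' _ => (hYi s s' n).const_mul _]
    exact Finset.sum_congr rfl fun s' _ => (integral_const_mul _ _).symm
  rw [e]
  refine integral_mono_of_nonneg (.of_forall fun ω => abs_nonneg _)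
    (integrable_finsetSum _ fun s _ => integrable_finsetSum _ fun s' _ =>
      (hYi s s' n).const_mul _) (.of_forall fun ω => ?_)
  have e2 : (1 / (n : ℝ)) * (∑ s ∈ J, ∑ s' ∈ J, a s * a s' *
        ∑ i ∈ Finset.range (min (N s n) (N s' n)), popCov P (ψ s) (ψ s') (Z i ω)) -
      ∑ s ∈ J, ∑ s' ∈ J, a s * a s' * (min (t s) (t s') * ∫ x, popCov P (ψ s) (ψ s') x ∂ν) =
      ∑ s ∈ J, ∑ s' ∈ J, a s * a s' * Y s s' n ω := by
    rw [Finset.mul_sum, ← Finset.sum_sub_distrib]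
    refine Finset.sum_congr rfl fun s _ => ?_
    rw [Finset.mul_sum, ← Finset.sum_sub_distrib]
    refine Finset.sum_congr rfl fun s' _ => ?_
    rw [hY]
    ring
  simp only [e2]
  refine (Finset.abs_sum_le_sum_abs _ _).trans (Finset.sum_le_sum fun s _ => ?_)
  refine (Finset.abs_sum_le_sum_abs _ _).trans (Finset.sum_le_sum fun s' _ => ?_)
  rw [abs_mul]

/-- Central limit theorem for the martingales approximating the partial sums. -/
lemma tendsto_charFun_martingale (hinv : P.Invariant ν) (hZ : IsMarkovChain μ Z P ν)
    (hθ : 0 ≤ θ) (hθ1 : θ < 1) (h𝓐 : IsMixingAlgebra P ν θ 𝓐) (J : Finset I) (a : I → ℝ)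
    {ψ : I → S → ℝ} (hψ : ∀ s, ψ s ∈ 𝓐) (hN : ∀ s n, N s n ≤ n)
    (ht : ∀ s, Tendsto (fun n => (N s n : ℝ) / n) atTop (𝓝 (t s))) :
    Tendsto (fun n : ℕ => ∫ ω, Complex.exp (((1 / Real.sqrt n * ∑ s ∈ J, a s *
        ∑ i ∈ Finset.range (N s n), (ψ s (Z (i + 1) ω) - Pop P (ψ s) (Z i ω)) : ℝ) : ℂ) *
          Complex.I) ∂μ) atTop
      (𝓝 (Complex.exp ((-(∑ s ∈ J, ∑ s' ∈ J, a s * a s' *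
        (min (t s) (t s') * ∫ x, popCov P (ψ s) (ψ s') x ∂ν)) / 2 : ℝ)))) := by
  have hmeas := fun s => h𝓐.measurable _ (hψ s)
  choose C hC using fun s => h𝓐.bounded _ (hψ s)
  set σ := ∑ s ∈ J, ∑ s' ∈ J, a s * a s' *
        (min (t s) (t s') * ∫ x, popCov P (ψ s) (ψ s') x ∂ν) with hσ
  set Φ := ∑ s ∈ J, |a s| * C s with hΦ
  have hΦ0 : 0 ≤ Φ := by
    have hne : Nonempty S := nonempty_of_isProbabilityMeasure ν
    exact Finset.sum_nonneg fun s _ => mul_nonneg (abs_nonneg _)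
      ((abs_nonneg _).trans (hC s (Classical.arbitrary S)))
  have hlln := tendsto_integral_abs_condVar hinv hZ hθ hθ1 h𝓐 J a hψ hN ht
  rw [← hσ] at hlln
  set V : ℕ → Ω → ℝ := fun n ω => ∑ s ∈ J, ∑ s' ∈ J, a s * a s' *
        ∑ i ∈ Finset.range (min (N s n) (N s' n)), popCov P (ψ s) (ψ s') (Z i ω) with hV
  -- The different time horizons are merged into a single martingale of length n by switching off
  -- the coefficient of s after N s n steps; conditional covariances of s and s' then accumulate up
  -- to the smaller horizon.
  let φ : ℕ → ℕ → S → ℝ := fun n i x => ∑ s ∈ J, (if i < N s n then a s else 0) * ψ s x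
  have hφm : ∀ n i, Measurable (φ n i) := fun n i =>
    Finset.measurable_sum _ fun s _ => (hmeas s).const_mul _
  have hφb : ∀ n i x, |φ n i x| ≤ Φ := fun n i x => by
    refine (Finset.abs_sum_le_sum_abs _ _).trans (Finset.sum_le_sum fun s _ => ?_)
    refine abs_mul_le_mul ?_ (hC s x)
    split_ifs <;> simp
  have hwV : ∀ n ω, ∑ i ∈ Finset.range n, popCov P (φ n i) (φ n i) (Z i ω) = V n ω := by
    intro n ω
    have h1 : ∀ i, popCov P (φ n i) (φ n i) (Z i ω) = ∑ s ∈ J, ∑ s' ∈ J,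
        (if i < N s n then a s else 0) * (if i < N s' n then a s' else 0) *
          popCov P (ψ s) (ψ s') (Z i ω) := fun i =>
      popCov_sum J _ (fun s _ => hmeas s) (fun s _ => ⟨_, hC s⟩) _
    simp only [h1, hV]
    rw [Finset.sum_comm]
    refine Finset.sum_congr rfl fun s _ => ?_
    rw [Finset.sum_comm]
    refine Finset.sum_congr rfl fun s' _ => ?_
    rw [Finset.mul_sum, ← Finset.sum_subset (Finset.range_mono
      ((min_le_left (N s n) (N s' n)).trans (hN s n))) fun i _ hi => ?_]
    · refine Finset.sum_congr rfl fun i hi => ?_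
      have hi := Finset.mem_range.1 hi
      rw [if_pos (lt_of_lt_of_le hi (min_le_left _ _)),
        if_pos (lt_of_lt_of_le hi (min_le_right _ _))]
    · rw [Finset.mem_range, lt_min_iff, not_and_or] at hi
      rcases hi with hi | hi
      · rw [if_neg hi]; simp
      · rw [if_neg hi]; simp
  have hDsum : ∀ n ω, ∑ i ∈ Finset.range n, (φ n i (Z (i + 1) ω) - Pop P (φ n i) (Z i ω)) =
      ∑ s ∈ J, a s * ∑ i ∈ Finset.range (N s n), (ψ s (Z (i + 1) ω) - Pop P (ψ s) (Z i ω)) := by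
    intro n ω
    have h1 : ∀ i x, Pop P (φ n i) x = ∑ s ∈ J, (if i < N s n then a s else 0) * Pop P (ψ s) x := by
      intro i x
      rw [Pop, integral_finsetSum _ fun s _ => (integrable_of_bound (hmeas s) (hC s)).const_mul _]
      exact Finset.sum_congr rfl fun s _ => integral_const_mul _ _
    have h2 : ∀ i, φ n i (Z (i + 1) ω) - Pop P (φ n i) (Z i ω) = ∑ s ∈ J,
        (if i < N s n then a s else 0) * (ψ s (Z (i + 1) ω) - Pop P (ψ s) (Z i ω)) := fun i => by
      rw [h1, ← Finset.sum_sub_distrib]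
      exact Finset.sum_congr rfl fun s _ => by ring
    simp only [h2]
    rw [Finset.sum_comm]
    refine Finset.sum_congr rfl fun s _ => ?_
    rw [Finset.mul_sum, ← Finset.sum_subset (Finset.range_mono (hN s n)) fun i _ hi => ?_]
    · exact Finset.sum_congr rfl fun i hi => by rw [if_pos (Finset.mem_range.1 hi)]
    · rw [if_neg (by simpa using hi), zero_mul]
  have hVi : ∀ n, Integrable (V n) μ := fun n => by
    simp only [hV]
    refine integrable_finsetSum _ fun s _ => integrable_finsetSum _ fun s' _ =>
      (integrable_finsetSum _ fun i _ => ?_).const_mul _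
    obtain ⟨C', hC'⟩ := h𝓐.bounded _ (h𝓐.popCov_mem (hψ s) (hψ s'))
    exact integrable_of_bound ((measurable_popCov (hmeas s) (hmeas s')).comp (hZ.measurable i))
      fun ω => hC' _
  have hV0 : ∀ n ω, 0 ≤ V n ω := fun n ω => by
    rw [← hwV]
    exact Finset.sum_nonneg fun i _ => popCov_self_nonneg (hφm n i) (hφb n i) _
  -- The limiting variance is nonnegative because it is an L¹ limit of averages of nonnegative
  -- conditional variances.
  have hσ0 : 0 ≤ σ := by
    have : ∀ n : ℕ, -σ ≤ ∫ ω, |1 / (n : ℝ) * V n ω - σ| ∂μ := by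
      intro n
      have h1 : ∫ _, -σ ∂μ ≤ ∫ ω, |1 / (n : ℝ) * V n ω - σ| ∂μ := by
        refine integral_mono (integrable_const _)
          (((hVi n).const_mul _).sub (integrable_const _)).abs fun ω => ?_
        have h2 : 0 ≤ 1 / (n : ℝ) * V n ω := mul_nonneg (by positivity) (hV0 n ω)
        have h3 := le_abs_self (1 / (n : ℝ) * V n ω - σ)
        simp only
        linarith
      simpa using h1
    have := ge_of_tendsto' hlln this
    linarith
  rw [tendsto_iff_norm_sub_tendsto_zero]
  set W := Φ * Φ with hW
  set b := 2 * Φ with hb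
  have hlim : Tendsto (fun n : ℕ => Real.exp W * (3 * (b ^ 3 / Real.sqrt n + W ^ 2 / n) +
      ∫ ω, |1 / (n : ℝ) * V n ω - σ| ∂μ)) atTop (𝓝 (Real.exp W * (3 * (0 + 0) + 0))) := by
    have h1 : Tendsto (fun n : ℕ => Real.sqrt n) atTop atTop :=
      Real.tendsto_sqrt_atTop.comp tendsto_natCast_atTop_atTop
    exact ((((h1.const_div_atTop (b ^ 3)).add
      (tendsto_const_div_atTop_nhds_zero_nat (W ^ 2))).const_mul 3).add hlln).const_mul _
  simp only [add_zero, mul_zero] at hlim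
  refine squeeze_zero' (.of_forall fun n => norm_nonneg _) ?_ hlim
  filter_upwards [eventually_ge_atTop (⌈b ^ 2⌉₊ + ⌈W⌉₊ + 1)] with n hn
  have hn0 : (0 : ℝ) < n := Nat.cast_pos.2 (by omega)
  have hsq : Real.sqrt n ^ 2 = n := Real.sq_sqrt hn0.le
  have hs0 : 0 < Real.sqrt n := Real.sqrt_pos.2 hn0
  have hu2 : (1 / Real.sqrt n) ^ 2 = 1 / n := by rw [div_pow, hsq, one_pow]
  have hnb : b ^ 2 ≤ n := (Nat.le_ceil _).trans (by exact_mod_cast (by omega : ⌈b ^ 2⌉₊ ≤ n))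
  have hnW : W ≤ n := (Nat.le_ceil _).trans (by exact_mod_cast (by omega : ⌈W⌉₊ ≤ n))
  have hub : 1 / Real.sqrt n * b ≤ 1 := by
    rw [one_div_mul_eq_div, div_le_one hs0]
    exact Real.le_sqrt_of_sq_le hnb
  have huW : (1 / Real.sqrt n) ^ 2 * W ≤ 1 := by
    rw [hu2, one_div_mul_eq_div, div_le_one hn0]
    exact hnW
  have key := norm_charFun_martingale_sub_le (μ := μ) (𝓕 := past Z hZ.measurable)
    (D := fun i ω => φ n i (Z (i + 1) ω) - Pop P (φ n i) (Z i ω))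
    (w := fun i ω => popCov P (φ n i) (φ n i) (Z i ω)) (b := b) (W := W) (u := 1 / Real.sqrt n)
    (fun i => (measurable_past_comp hZ.measurable le_rfl (hφm n i)).sub
      (measurable_past_comp hZ.measurable (Nat.le_succ i) (measurable_Pop (hφm n i))))
    (fun i ω => by
      have h1 := abs_sub (φ n i (Z (i + 1) ω)) (Pop P (φ n i) (Z i ω))
      have h2 := hφb n i (Z (i + 1) ω)
      have h3 := abs_Pop_le (P := P) (hφb n i) (Z i ω)
      rw [hb]
      linarith)
    (fun i => condEq_martingaleDiff hZ (hφm n i) (hφb n i) i)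
    (fun i => measurable_past_comp hZ.measurable le_rfl (measurable_popCov (hφm n i) (hφm n i)))
    (fun i ω => popCov_self_nonneg (hφm n i) (hφb n i) _)
    (fun i ω => popCov_self_le (hφb n i) _)
    (fun i => condEq_martingaleDiff_sq hZ (hφm n i) (hφb n i) i) (by positivity) hub huW n hσ0
  simp only [hDsum, hwV, hu2] at key
  refine key.trans (le_of_eq ?_)
  have e1 : (n : ℝ) * (1 / n * W) = W := by field_simp
  have e2 : 3 * (n : ℝ) * ((1 / Real.sqrt n * b) ^ 3 + (1 / n * W) ^ 2) =
      3 * (b ^ 3 / Real.sqrt n + W ^ 2 / n) := by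
    have : (n : ℝ) * (1 / Real.sqrt n * b) ^ 3 = b ^ 3 / Real.sqrt n := by
      nth_rewrite 1 [← hsq]
      field_simp
    have h2 : (n : ℝ) * (1 / n * W) ^ 2 = W ^ 2 / n := by field_simp
    linear_combination 3 * this + 3 * h2
  rw [e1, e2]

end FiniteDimensional

/-! ### Long-run covariance and the finite-dimensional central limit theorem -/

section LongRunCovariance

variable {Ω S I : Type*} {m0 : MeasurableSpace Ω} [MeasurableSpace S] {μ : Measure Ω}
  [IsProbabilityMeasure μ] {ν : Measure S} [IsProbabilityMeasure ν] {P : Kernel S S}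
  [IsMarkovKernel P] {Z : ℕ → Ω → S} {f g : S → ℝ} {M M' A A' θ : ℝ} {𝓐 : Subalgebra ℝ (S → ℝ)}
  {N : I → ℕ → ℕ} {t : I → ℝ}

/-- The lag-`k` covariance of the centred functions `f` and `g`. -/
def lagCov (P : Kernel S S) (ν : Measure S) (f g : S → ℝ) (k : ℕ) : ℝ :=
  ∫ x, f x * (Pop P)^[k] g x ∂ν

/-- The long-run covariance of the centred functions `f` and `g`. -/
def kernelLongRunCov (P : Kernel S S) (ν : Measure S) (f g : S → ℝ) : ℝ :=
  ∑' k, lagCov P ν f g k + ∑' k, lagCov P ν g f (k + 1)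

lemma summable_lagCov (hM : ∀ x, |f x| ≤ M) (hM' : ∀ x, |g x| ≤ M') (hg : Measurable g)
    (hθ : 0 ≤ θ) (hθ1 : θ < 1) (hmix : ∀ n, ∫ x, |(Pop P)^[n] g x| ∂ν ≤ A * θ ^ n) :
    Summable (lagCov P ν f g) := by
  have hM0 : 0 ≤ M := by
    have hne : Nonempty S := nonempty_of_isProbabilityMeasure ν
    exact (abs_nonneg _).trans (hM (Classical.arbitrary S))
  refine Summable.of_norm_bounded (g := fun k => M * (A * θ ^ k))
    (((summable_geometric_of_lt_one hθ hθ1).mul_left A).mul_left M) fun k => ?_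
  exact (abs_integral_mul_Pop_le hM hg hM' k).trans (mul_le_mul_of_nonneg_left (hmix k) hM0)

lemma abs_integral_mul_le {h r : S → ℝ} {C : ℝ} (hh : ∀ x, |h x| ≤ C) (hr : Integrable r ν) :
    |∫ x, h x * r x ∂ν| ≤ C * ∫ x, |r x| ∂ν := by
  have e : C * ∫ x, |r x| ∂ν = ∫ x, C * |r x| ∂ν := (integral_const_mul _ _).symm
  rw [e]
  change ‖∫ x, h x * r x ∂ν‖ ≤ _
  refine norm_integral_le_of_norm_le (hr.abs.const_mul _) (.of_forall fun x => ?_)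
  rw [Real.norm_eq_abs, abs_mul]
  exact mul_le_mul_of_nonneg_right (hh x) (abs_nonneg _)

lemma integral_mul_poissonSum (hf : Measurable f) (hM : ∀ x, |f x| ≤ M) (hg : Measurable g)
    (hM' : ∀ x, |g x| ≤ M') (K : ℕ) :
    ∫ x, f x * poissonSum P g K x ∂ν = ∑ k ∈ Finset.range K, lagCov P ν f g k := by
  simp only [poissonSum_apply, Finset.mul_sum]
  exact integral_finsetSum _ fun k _ => integrable_of_bound
    (hf.mul (measurable_Pop_iterate hg k)) fun x => abs_mul_le_mul (hM x) (abs_Pop_iterate_le hM' k x)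

/-- By invariance the integral is ν(ψψ') − ν(Pψ·Pψ'). Inserting Pψ = ψ − f + P^{K+1}f and its
analogue for g leaves ν(fψ') + ν(gψ) − ν(fg), the truncated two-sided covariance series with lag 0
counted once, plus terms containing P^{K+1}f or P^{K+1}g. -/
lemma abs_integral_popCov_poissonSum_sub_le (hinv : P.Invariant ν) (hf : Measurable f)
    (hM : ∀ x, |f x| ≤ M) (hg : Measurable g) (hM' : ∀ x, |g x| ≤ M')
    (hmix : ∀ n, ∫ x, |(Pop P)^[n] f x| ∂ν ≤ A * θ ^ n)
    (hmix' : ∀ n, ∫ x, |(Pop P)^[n] g x| ∂ν ≤ A' * θ ^ n) (K : ℕ) :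
    |∫ x, popCov P (poissonSum P f (K + 1)) (poissonSum P g (K + 1)) x ∂ν -
      (∑ k ∈ Finset.range (K + 1), lagCov P ν f g k +
        ∑ k ∈ Finset.range K, lagCov P ν g f (k + 1))| ≤
      (K + 2) * M * (A' * θ ^ (K + 1)) + (K + 1) * M' * (A * θ ^ (K + 1)) := by
  have hM0 : 0 ≤ M := by
    have hne : Nonempty S := nonempty_of_isProbabilityMeasure ν
    exact (abs_nonneg _).trans (hM (Classical.arbitrary S))
  have hM0' : 0 ≤ M' := by
    have hne : Nonempty S := nonempty_of_isProbabilityMeasure ν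
    exact (abs_nonneg _).trans (hM' (Classical.arbitrary S))
  set ψ := poissonSum P f (K + 1) with hψ
  set ψ' := poissonSum P g (K + 1) with hψ'
  have mψ : Measurable ψ := measurable_poissonSum hf _
  have mψ' : Measurable ψ' := measurable_poissonSum hg _
  have bψ : ∀ x, |ψ x| ≤ (K + 1) * M := fun x => by
    simpa using abs_poissonSum_le (P := P) hM (K + 1) x
  have bψ' : ∀ x, |ψ' x| ≤ (K + 1) * M' := fun x => by
    simpa using abs_poissonSum_le (P := P) hM' (K + 1) x
  set r := (Pop P)^[K + 1] f with hr
  set r' := (Pop P)^[K + 1] g with hr'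
  have mr : Measurable r := measurable_Pop_iterate hf _
  have mr' : Measurable r' := measurable_Pop_iterate hg _
  have br : ∀ x, |r x| ≤ M := abs_Pop_iterate_le hM _
  have br' : ∀ x, |r' x| ≤ M' := abs_Pop_iterate_le hM' _
  have e1 : ∀ x, Pop P ψ x = ψ x - f x + r x := Pop_poissonSum hf hM (K + 1)
  have e2 : ∀ x, Pop P ψ' x = ψ' x - g x + r' x := Pop_poissonSum hg hM' (K + 1)
  have ib : ∀ {u v : S → ℝ} {U V : ℝ}, Measurable u → Measurable v → (∀ x, |u x| ≤ U) →
      (∀ x, |v x| ≤ V) → Integrable (fun x => u x * v x) ν := fun hu hv hU hV =>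
    integrable_of_bound (hu.mul hv) fun x => abs_mul_le_mul (hU x) (hV x)
  have bd : ∀ x, |ψ x - f x| ≤ (K + 2) * M := fun x => by
    have := abs_sub (ψ x) (f x)
    linarith [bψ x, hM x]
  have i1 : Integrable (fun x => f x * ψ' x) ν := ib hf mψ' hM bψ'
  have i2 : Integrable (fun x => g x * ψ x) ν := ib hg mψ hM' bψ
  have i3 : Integrable (fun x => g x * f x) ν := ib hg hf hM' hM
  have i4 : Integrable (fun x => (ψ x - f x) * r' x) ν := ib (mψ.sub hf) mr' bd br'
  have i5 : Integrable (fun x => Pop P ψ' x * r x) ν :=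
    ib (measurable_Pop mψ') mr (abs_Pop_le bψ') br
  have i6 : Integrable (fun x => Pop P ψ x * Pop P ψ' x) ν :=
    ib (measurable_Pop mψ) (measurable_Pop mψ') (abs_Pop_le bψ) (abs_Pop_le bψ')
  have i7 : Integrable (fun x => ψ x * ψ' x) ν := ib mψ mψ' bψ bψ'
  have i8 : Integrable (Pop P fun x => ψ x * ψ' x) ν :=
    integrable_of_bound (measurable_Pop (mψ.mul mψ'))
      (abs_Pop_le fun x => abs_mul_le_mul (bψ x) (bψ' x))
  have h1 : ∫ x, popCov P ψ ψ' x ∂ν =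
      ∫ x, f x * ψ' x ∂ν + ∫ x, g x * ψ x ∂ν + (-1) * ∫ x, g x * f x ∂ν -
        (∫ x, (ψ x - f x) * r' x ∂ν + ∫ x, Pop P ψ' x * r x ∂ν) := by
    simp only [popCov]
    rw [integral_sub i8 i6, integral_Pop (g := fun x => ψ x * ψ' x) hinv (mψ.mul mψ')
      (fun x => abs_mul_le_mul (bψ x) (bψ' x)), ← integral_sub i7 i6, ← integral_add i4 i5,
      ← integral_const_mul, ← integral_add_add i1 i2 (i3.const_mul _), ← integral_sub]
    · refine integral_congr_ae (.of_forall fun x => ?_)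
      simp only [e1, e2]
      ring
    · exact (i1.add i2).add (i3.const_mul _)
    · exact i4.add i5
  have h2 : ∫ x, g x * f x ∂ν = lagCov P ν g f 0 := rfl
  rw [h1, integral_mul_poissonSum hf hM hg hM', integral_mul_poissonSum hg hM' hf hM, h2,
    Finset.sum_range_succ' (lagCov P ν g f)]
  have h3 := abs_integral_mul_le (ν := ν) bd (integrable_of_bound mr' br')
  have h4 := abs_integral_mul_le (ν := ν) (h := Pop P ψ') (abs_Pop_le bψ')
    (integrable_of_bound mr br)
  have h5 : (K + 2) * M * ∫ x, |r' x| ∂ν ≤ (K + 2) * M * (A' * θ ^ (K + 1)) := by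
    gcongr; exact hmix' _
  have h6 : (K + 1) * M' * ∫ x, |r x| ∂ν ≤ (K + 1) * M' * (A * θ ^ (K + 1)) := by
    gcongr; exact hmix _
  refine le_trans (le_of_eq ?_) ((abs_add_le _ _).trans (add_le_add (h3.trans h5) (h4.trans h6)))
  rw [← abs_neg]
  congr 1
  ring

lemma tendsto_integral_popCov_poissonSum (hinv : P.Invariant ν) (hf : Measurable f)
    (hM : ∀ x, |f x| ≤ M) (hg : Measurable g) (hM' : ∀ x, |g x| ≤ M') (hθ : 0 ≤ θ) (hθ1 : θ < 1)
    (hmix : ∀ n, ∫ x, |(Pop P)^[n] f x| ∂ν ≤ A * θ ^ n)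
    (hmix' : ∀ n, ∫ x, |(Pop P)^[n] g x| ∂ν ≤ A' * θ ^ n) :
    Tendsto (fun K => ∫ x, popCov P (poissonSum P f (K + 1)) (poissonSum P g (K + 1)) x ∂ν)
      atTop (𝓝 (kernelLongRunCov P ν f g)) := by
  have s1 := (summable_lagCov (P := P) (ν := ν) hM hM' hg hθ hθ1 hmix').hasSum.tendsto_sum_nat
  have s2 := (((summable_lagCov (P := P) (ν := ν) hM' hM hf hθ hθ1 hmix).comp_injective
    (add_left_injective 1))).hasSum.tendsto_sum_nat
  have s3 := ((tendsto_add_atTop_iff_nat 1).2 s1).add s2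
  have l1 : Tendsto (fun K : ℕ => ((K + 1 : ℕ) : ℝ) * θ ^ (K + 1)) atTop (𝓝 0) :=
    (tendsto_add_atTop_iff_nat 1).2 (tendsto_self_mul_const_pow_of_lt_one hθ hθ1)
  have l2 : Tendsto (fun K : ℕ => θ ^ (K + 1)) atTop (𝓝 0) :=
    (tendsto_add_atTop_iff_nat 1).2 (tendsto_pow_atTop_nhds_zero_of_lt_one hθ hθ1)
  have l3 : Tendsto (fun K : ℕ => (K + 2) * M * (A' * θ ^ (K + 1)) +
      (K + 1) * M' * (A * θ ^ (K + 1))) atTop (𝓝 0) := by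
    have := ((l1.const_mul (M * A')).add (l2.const_mul (M * A'))).add (l1.const_mul (M' * A))
    simp only [mul_zero, add_zero] at this
    refine this.congr fun K => ?_
    push_cast
    ring
  have l4 : Tendsto (fun K =>
      ∫ x, popCov P (poissonSum P f (K + 1)) (poissonSum P g (K + 1)) x ∂ν -
        (∑ k ∈ Finset.range (K + 1), lagCov P ν f g k +
          ∑ k ∈ Finset.range K, lagCov P ν g f (k + 1))) atTop (𝓝 0) :=
    squeeze_zero_norm (fun K => abs_integral_popCov_poissonSum_sub_le hinv hf hM hg hM'
    hmix hmix' K) l3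
  have := l4.add s3
  rw [zero_add] at this
  refine this.congr fun K => ?_
  simp only [Function.comp_def]
  ring

lemma norm_exp_mul_I_sub_exp_mul_I_le (x y : ℝ) :
    ‖Complex.exp ((x : ℂ) * Complex.I) - Complex.exp ((y : ℂ) * Complex.I)‖ ≤ |x - y| := by
  have h := Real.norm_exp_I_mul_ofReal_sub_one_le (x := x - y)
  have e : Complex.exp ((x : ℂ) * Complex.I) - Complex.exp ((y : ℂ) * Complex.I) =
      Complex.exp ((y : ℂ) * Complex.I) * (Complex.exp (Complex.I * ((x - y : ℝ) : ℂ)) - 1) := by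
    rw [mul_sub, ← Complex.exp_add, mul_one]
    congr 2
    push_cast
    ring
  rw [e, norm_mul, Complex.norm_exp_ofReal_mul_I, one_mul]
  exact h

/-- **Central limit theorem** for the finite-dimensional distributions of the sequential partial
sum process. -/
theorem tendsto_charFun_chain (hinv : P.Invariant ν) (hZ : IsMarkovChain μ Z P ν)
    (hθ : 0 ≤ θ) (hθ1 : θ < 1) (h𝓐 : IsMixingAlgebra P ν θ 𝓐) (J : Finset I) (a : I → ℝ)
    {g : I → S → ℝ} (hg : ∀ s, g s ∈ 𝓐) (hg0 : ∀ s, ∫ x, g s x ∂ν = 0) (hN : ∀ s n, N s n ≤ n)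
    (ht : ∀ s, Tendsto (fun n => (N s n : ℝ) / n) atTop (𝓝 (t s))) :
    Tendsto (fun n : ℕ => ∫ ω, Complex.exp (((∑ s ∈ J, a s * (1 / Real.sqrt n *
        ∑ i ∈ Finset.range (N s n), g s (Z (i + 1) ω)) : ℝ) : ℂ) * Complex.I) ∂μ) atTop
      (𝓝 (Complex.exp ((-(∑ s ∈ J, ∑ s' ∈ J, a s * a s' *
        (min (t s) (t s') * kernelLongRunCov P ν (g s) (g s'))) / 2 : ℝ)))) := by
  have hmeas := fun s => h𝓐.measurable _ (hg s)
  choose C hC using fun s => h𝓐.bounded _ (hg s)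
  choose A hA hmix using fun s => h𝓐.mixing _ (hg s)
  simp only [hg0, sub_zero] at hmix
  have hC0 : ∀ s, 0 ≤ C s := fun s => by
    have hne : Nonempty S := nonempty_of_isProbabilityMeasure ν
    exact (abs_nonneg _).trans (hC s (Classical.arbitrary S))
  have h1θ : 0 < 1 - θ := by linarith
  let ψ : ℕ → I → S → ℝ := fun K s => poissonSum P (g s) (K + 1)
  have hψ : ∀ K s, ψ K s ∈ 𝓐 := fun K s => h𝓐.poissonSum_mem (hg s) _
  have hmart := fun K => tendsto_charFun_martingale hinv hZ hθ hθ1 h𝓐 J a (hψ K) hN ht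
  set y : ℕ → ℂ := fun K => Complex.exp ((-(∑ s ∈ J, ∑ s' ∈ J, a s * a s' *
        (min (t s) (t s') * ∫ x, popCov P (ψ K s) (ψ K s') x ∂ν)) / 2 : ℝ)) with hy
  have hyl : Tendsto y atTop (𝓝 (Complex.exp ((-(∑ s ∈ J, ∑ s' ∈ J, a s * a s' *
        (min (t s) (t s') * kernelLongRunCov P ν (g s) (g s'))) / 2 : ℝ)))) := by
    refine (Complex.continuous_exp.tendsto _).comp
      ((Complex.continuous_ofReal.tendsto _).comp (Tendsto.div_const (Tendsto.neg ?_) _))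
    exact tendsto_finsetSum _ fun s _ => tendsto_finsetSum _ fun s' _ =>
      ((tendsto_integral_popCov_poissonSum hinv (hmeas s) (hC s) (hmeas s') (hC s') hθ hθ1 (hmix s)
        (hmix s')).const_mul _).const_mul _
  -- A bound, uniform in n, for the normalized partial sums of P^{K+1}g: the mixing constant of this
  -- function is A θ^{K+1}, which enters the variance bound.
  set R : ℕ → ℝ := fun K => ∑ s ∈ J, |a s| *
    Real.sqrt (2 * C s * (A s * θ ^ (K + 1)) / (1 - θ)) with hR
  have hRl : Tendsto R atTop (𝓝 0) := by
    have : Tendsto R atTop (𝓝 (∑ s ∈ J, |a s| *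
        Real.sqrt (2 * C s * (A s * 0) / (1 - θ)))) := by
      refine tendsto_finsetSum _ fun s _ => Tendsto.const_mul _ ?_
      refine (Real.continuous_sqrt.tendsto _).comp (Tendsto.div_const (Tendsto.const_mul _
        (Tendsto.const_mul _ ?_)) _)
      exact (tendsto_add_atTop_iff_nat 1).2 (tendsto_pow_atTop_nhds_zero_of_lt_one hθ hθ1)
    simpa using this
  -- Since x ↦ exp(ix) is 1-Lipschitz, only the boundary term, O(n^{-1/2}) for fixed K, and the
  -- remainder, at most R K, matter.
  have hdiff : ∀ K n : ℕ, ‖∫ ω, Complex.exp (((∑ s ∈ J, a s * (1 / Real.sqrt n *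
        ∑ i ∈ Finset.range (N s n), g s (Z (i + 1) ω)) : ℝ) : ℂ) * Complex.I) ∂μ -
      ∫ ω, Complex.exp (((1 / Real.sqrt n * ∑ s ∈ J, a s * ∑ i ∈ Finset.range (N s n),
        (ψ K s (Z (i + 1) ω) - Pop P (ψ K s) (Z i ω)) : ℝ) : ℂ) * Complex.I) ∂μ‖ ≤
      (∑ s ∈ J, |a s| * (2 * ((K + 1) * C s))) / Real.sqrt n + R K := by
    intro K n
    rcases Nat.eq_zero_or_pos n with rfl | hn
    · simp only [Nat.cast_zero, Real.sqrt_zero, div_zero, zero_mul, mul_zero,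
        Finset.sum_const_zero, sub_self, norm_zero, zero_add]
      exact Finset.sum_nonneg fun s _ => by positivity
    have hn0 : (0 : ℝ) < n := Nat.cast_pos.2 hn
    have hs0 : 0 < Real.sqrt n := Real.sqrt_pos.2 hn0
    have hψm : ∀ s, Measurable (ψ K s) := fun s => measurable_poissonSum (hmeas s) _
    have hψb : ∀ s x, |Pop P (ψ K s) x| ≤ (K + 1) * C s := fun s x => by
      refine abs_Pop_le (fun x => ?_) x
      simpa using abs_poissonSum_le (P := P) (hC s) (K + 1) x
    have hZm := hZ.measurable
    have m1 : Measurable fun ω => ∑ s ∈ J, a s * (1 / Real.sqrt n *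
        ∑ i ∈ Finset.range (N s n), g s (Z (i + 1) ω)) :=
      Finset.measurable_sum _ fun s _ => ((Finset.measurable_sum _ fun i _ =>
        (hmeas s).comp (hZm _)).const_mul _).const_mul _
    have m2 : Measurable fun ω => 1 / Real.sqrt n * ∑ s ∈ J, a s * ∑ i ∈ Finset.range (N s n),
        (ψ K s (Z (i + 1) ω) - Pop P (ψ K s) (Z i ω)) :=
      (Finset.measurable_sum _ fun s _ => (Finset.measurable_sum _ fun i _ =>
        ((hψm s).comp (hZm _)).sub ((measurable_Pop (hψm s)).comp (hZm _))).const_mul _).const_mul _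
    have j1 : Integrable (fun ω => Complex.exp (((∑ s ∈ J, a s * (1 / Real.sqrt n *
        ∑ i ∈ Finset.range (N s n), g s (Z (i + 1) ω)) : ℝ) : ℂ) * Complex.I)) μ :=
      integrable_of_norm_le (C := 1) (Complex.measurable_exp.comp
        ((Complex.measurable_ofReal.comp m1).mul_const _)) fun ω => by
          rw [Complex.norm_exp_ofReal_mul_I]
    have j2 : Integrable (fun ω => Complex.exp (((1 / Real.sqrt n * ∑ s ∈ J, a s *
        ∑ i ∈ Finset.range (N s n), (ψ K s (Z (i + 1) ω) - Pop P (ψ K s) (Z i ω)) : ℝ) : ℂ) *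
          Complex.I)) μ :=
      integrable_of_norm_le (C := 1) (Complex.measurable_exp.comp
        ((Complex.measurable_ofReal.comp m2).mul_const _)) fun ω => by
          rw [Complex.norm_exp_ofReal_mul_I]
    let Q : I → Ω → ℝ := fun s ω => ∑ i ∈ Finset.range (N s n), (Pop P)^[K + 1] (g s) (Z (1 + i) ω)
    have hQm : ∀ s, Measurable (Q s) := fun s =>
      measurable_chain_sum hZm (measurable_Pop_iterate (hmeas s) _) 1 (N s n)
    have hQb : ∀ s ω, |Q s ω| ≤ N s n * C s := fun s =>
      abs_chain_sum_le (abs_Pop_iterate_le (hC s) _) 1 (N s n)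
    have hQi : ∀ s, Integrable (fun ω => |Q s ω|) μ := fun s =>
      (integrable_of_bound (hQm s) (hQb s)).abs
    have hQl : ∀ s, ∫ ω, |Q s ω| ∂μ ≤
        Real.sqrt n * Real.sqrt (2 * C s * (A s * θ ^ (K + 1)) / (1 - θ)) := by
      intro s
      rw [← Real.sqrt_mul hn0.le]
      refine (integral_abs_le_sqrt (hQm s) (hQb s)).trans (Real.sqrt_le_sqrt ?_)
      refine (integral_sq_chain_sum_le hinv hZ (measurable_Pop_iterate (hmeas s) _)
        (abs_Pop_iterate_le (hC s) _) (A := A s * θ ^ (K + 1))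
        (mul_nonneg (hA s) (pow_nonneg hθ _)) hθ hθ1 (fun k => ?_) 1 (N s n)).trans ?_
      · rw [← Function.iterate_add_apply]
        refine (hmix s _).trans (le_of_eq ?_)
        rw [pow_add]
        ring
      · have h1 := hC0 s
        have h2 := hA s
        have : (N s n : ℝ) ≤ n := Nat.cast_le.2 (hN s n)
        gcongr
    have hpt : ∀ ω, |(∑ s ∈ J, a s * (1 / Real.sqrt n *
        ∑ i ∈ Finset.range (N s n), g s (Z (i + 1) ω))) - 1 / Real.sqrt n * ∑ s ∈ J, a s *
        ∑ i ∈ Finset.range (N s n), (ψ K s (Z (i + 1) ω) - Pop P (ψ K s) (Z i ω))| ≤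
        ∑ s ∈ J, (|a s| * (2 * ((K + 1) * C s)) / Real.sqrt n +
          |a s| * (1 / Real.sqrt n) * |Q s ω|) := by
      intro ω
      rw [Finset.mul_sum, ← Finset.sum_sub_distrib]
      refine (Finset.abs_sum_le_sum_abs _ _).trans (Finset.sum_le_sum fun s _ => ?_)
      rw [sum_chain_eq (P := P) (hmeas s) (hC s) (K + 1)]
      have e : a s * (1 / Real.sqrt n * (∑ i ∈ Finset.range (N s n),
            (ψ K s (Z (i + 1) ω) - Pop P (ψ K s) (Z i ω)) +
            (Pop P (ψ K s) (Z 0 ω) - Pop P (ψ K s) (Z (N s n) ω)) + Q s ω)) -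
          1 / Real.sqrt n * (a s * ∑ i ∈ Finset.range (N s n),
            (ψ K s (Z (i + 1) ω) - Pop P (ψ K s) (Z i ω))) =
          a s * (1 / Real.sqrt n) * ((Pop P (ψ K s) (Z 0 ω) - Pop P (ψ K s) (Z (N s n) ω)) +
            Q s ω) := by ring
      refine (congrArg abs e).le.trans ?_
      have h1 := abs_add_le (Pop P (ψ K s) (Z 0 ω) - Pop P (ψ K s) (Z (N s n) ω)) (Q s ω)
      have h2 := abs_sub (Pop P (ψ K s) (Z 0 ω)) (Pop P (ψ K s) (Z (N s n) ω))
      have h3 := hψb s (Z 0 ω)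
      have h4 := hψb s (Z (N s n) ω)
      rw [abs_mul, abs_mul, abs_of_pos (one_div_pos.2 hs0)]
      refine (mul_le_mul_of_nonneg_left (h1.trans (add_le_add_left (h2.trans (add_le_add h3 h4)) _))
        (by positivity)).trans (le_of_eq ?_)
      ring
    have k1 : ∀ s, Integrable (fun ω => |a s| * (2 * ((K + 1) * C s)) / Real.sqrt n +
          |a s| * (1 / Real.sqrt n) * |Q s ω|) μ := fun s =>
      (integrable_const _).add ((hQi s).const_mul _)
    rw [← integral_sub j1 j2]
    refine (norm_integral_le_of_norm_le (integrable_finsetSum _ fun s _ => k1 s)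
      (.of_forall fun ω => (norm_exp_mul_I_sub_exp_mul_I_le _ _).trans (hpt ω))).trans ?_
    rw [integral_finsetSum _ fun s _ => k1 s, Finset.sum_div, hR, ← Finset.sum_add_distrib]
    refine Finset.sum_le_sum fun s _ => ?_
    rw [integral_add (integrable_const _) ((hQi s).const_mul _), integral_const_mul]
    simp only [integral_const, probReal_univ, one_smul]
    refine add_le_add le_rfl ?_
    rw [mul_assoc]
    refine mul_le_mul_of_nonneg_left ?_ (abs_nonneg _)
    calc 1 / Real.sqrt n * ∫ ω, |Q s ω| ∂μ ≤ 1 / Real.sqrt n * (Real.sqrt n *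
          Real.sqrt (2 * C s * (A s * θ ^ (K + 1)) / (1 - θ))) := by gcongr; exact hQl s
      _ = _ := by field_simp
  rw [Metric.tendsto_atTop]
  intro ε hε
  -- The truncation K is chosen before n, because the boundary bound grows with K.
  obtain ⟨K, hK1, hK2⟩ := ((hRl.eventually (gt_mem_nhds (show 0 < ε / 4 by positivity))).and
    (hyl.eventually (Metric.ball_mem_nhds _ (show 0 < ε / 4 by positivity)))).exists
  have hsq : Tendsto (fun n : ℕ => (∑ s ∈ J, |a s| * (2 * ((K + 1) * C s))) / Real.sqrt n) atTop
      (𝓝 0) :=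
    (Real.tendsto_sqrt_atTop.comp tendsto_natCast_atTop_atTop).const_div_atTop _
  obtain ⟨n₁, h₁⟩ := eventually_atTop.1 (hsq.eventually (gt_mem_nhds
    (show 0 < ε / 4 by positivity)))
  obtain ⟨n₂, h₂⟩ := Metric.tendsto_atTop.1 (hmart K) (ε / 4) (by positivity)
  refine ⟨max n₁ n₂, fun n hn => ?_⟩
  have d1 := hdiff K n
  have d2 := h₂ n ((le_max_right _ _).trans hn)
  have d3 := h₁ n ((le_max_left _ _).trans hn)
  rw [← dist_eq_norm] at d1
  refine lt_of_le_of_lt (dist_triangle4 _ _ (y K) _)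
    (lt_of_le_of_lt (add_le_add (add_le_add d1 d2.le) hK2.le) ?_)
  linarith

end LongRunCovariance

/-! ### Tail bounds for the links of a chain of brackets -/

section Link

variable {Ω S : Type*} {m0 : MeasurableSpace Ω} [MeasurableSpace S] {μ : Measure Ω}
  [IsProbabilityMeasure μ] {ν : Measure S} [IsProbabilityMeasure ν] {P : Kernel S S}
  [IsMarkovKernel P] {Z : ℕ → Ω → S} {g : S → ℝ}

/-- The centred version of a function. -/
def centre (ν : Measure S) (g : S → ℝ) (x : S) : ℝ := g x - ∫ y, g y ∂ν

lemma measurable_centre (hg : Measurable g) : Measurable (centre ν g) := hg.sub_const _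

lemma abs_integral_le_of_bound {M : ℝ} (hM : ∀ x, |g x| ≤ M) : |∫ x, g x ∂ν| ≤ M :=
  (norm_integral_le_of_norm_le_const (C := M) (f := g) (.of_forall hM)).trans (by simp)

lemma abs_centre_le {M : ℝ} (hM : ∀ x, |g x| ≤ M) (x : S) : |centre ν g x| ≤ 2 * M := by
  have := abs_sub (g x) (∫ y, g y ∂ν)
  have := abs_integral_le_of_bound (ν := ν) hM
  rw [centre]
  linarith [hM x]

lemma integral_centre (hg : Measurable g) {M : ℝ} (hM : ∀ x, |g x| ≤ M) :
    ∫ x, centre ν g x ∂ν = 0 := by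
  simp only [centre]
  rw [integral_sub (integrable_of_bound hg hM) (integrable_const _)]
  simp

/-- Boundedness turns smallness in L¹ into smallness of the variance, so bracket sizes control the
variance in Freedman's inequality. -/
lemma integral_centre_sq_le (hg : Measurable g) {M : ℝ} (hM : ∀ x, |g x| ≤ M) :
    ∫ x, centre ν g x ^ 2 ∂ν ≤ M * ∫ x, |g x| ∂ν := by
  set c := ∫ y, g y ∂ν with hc
  have i1 : Integrable (fun x => g x * g x) ν :=
    integrable_of_bound (hg.mul hg) fun x => abs_mul_le_mul (hM x) (hM x)
  have i2 : Integrable g ν := integrable_of_bound hg hM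
  have e : ∀ x, centre ν g x ^ 2 = g x * g x + (-(2 * c)) * g x + c ^ 2 := fun x => by
    rw [centre]; ring
  simp only [e]
  rw [integral_add_add i1 (i2.const_mul _) (integrable_const _), integral_const_mul, ← hc]
  have h1 : ∫ x, g x * g x ∂ν ≤ M * ∫ x, |g x| ∂ν :=
    (le_abs_self _).trans (abs_integral_mul_le hM i2)
  simp only [integral_const, probReal_univ, one_smul]
  nlinarith [sq_nonneg c]

/-- Tail bound for the maximum of the partial sums, with optimized parameters. -/
theorem chain_tail_opt (hinv : P.Invariant ν) (hZ : IsMarkovChain μ Z P ν) (hg : Measurable g)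
    {B A θ v h : ℝ} (hB0 : 0 < B) (hB : ∀ x, |g x| ≤ B) (h0 : ∫ x, g x ∂ν = 0) (hA : 0 ≤ A)
    (hθ : 0 ≤ θ) (hmix : ∀ n, ∫ x, |(Pop P)^[n] g x| ∂ν ≤ A * θ ^ n)
    (hmix2 : ∀ n, ∫ x, |(Pop P)^[n] (fun x => g x ^ 2) x - ∫ x, g x ^ 2 ∂ν| ∂ν ≤ A * θ ^ n)
    {L : ℕ} (hL0 : 0 < L) (hL : θ ^ L ≤ 1 / 16) (hv : 0 < v) (hgv : ∫ x, g x ^ 2 ∂ν ≤ v)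
    (hh : 0 < h) (a : ℕ) {n : ℕ} (hLn : L ≤ n) (hhB : h * B ≤ 18 * n * v) :
    μ.real {ω | ∃ N ≤ n, h ≤ |∑ i ∈ Finset.range N, g (Z (a + i) ω)|} ≤
      L * (2 * Real.exp (-(h ^ 2 / (216 * n * v * L))) + A * θ ^ L / v +
        162 * n * L * B * A * θ ^ L / h ^ 2) := by
  have hL' : (0 : ℝ) < L := Nat.cast_pos.2 hL0
  have hn' : (0 : ℝ) < n := Nat.cast_pos.2 (hL0.trans_le hLn)
  have hLn' : (L : ℝ) ≤ n := Nat.cast_le.2 hLn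
  -- One unit compensates for rounding down and one covers the additional L; since L ≤ n the total
  -- is at most 3n/L.
  set N₀ := n / L + 2 with hN₀
  have hN1 : n + L ≤ N₀ * L := by
    have := Nat.lt_div_mul_add (a := n) hL0
    rw [hN₀, add_mul]
    omega
  have hN2 : (N₀ : ℝ) ≤ 3 * n / L := by
    have h1 : ((n / L : ℕ) : ℝ) ≤ n / L := Nat.cast_div_le
    have h2 : 1 ≤ (n : ℝ) / L := (one_le_div hL').2 hLn'
    rw [hN₀]
    push_cast
    have : 3 * (n : ℝ) / L = n / L + 2 * (n / L) := by ring
    linarith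
  -- The choice y = h/(3L) makes the total threshold h, and lam minimizes −lam·y + lam²·6nv/L. The
  -- requirement lam·2B ≤ 1 then reads hB ≤ 18nv.
  have key := chain_tail hinv hZ hg hB h0 hA hθ hmix hmix2 hL0 hL hv hgv
    (lam := h / (36 * n * v)) (y := h / (3 * L)) (by positivity) (by
      rw [div_mul_eq_mul_div, div_le_one (by positivity)]
      linarith) (by positivity) a hN1
  have e1 : 3 * (h / (3 * L)) * L = h := by field_simp
  rw [e1] at key
  refine key.trans (mul_le_mul_of_nonneg_left ?_ hL'.le)
  have hρ : 0 ≤ θ ^ L := pow_nonneg hθ L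
  gcongr ?_ + _ + ?_
  · gcongr
    have h1 : (h / (36 * n * v)) ^ 2 * (2 * N₀ * v) ≤
        (h / (36 * n * v)) ^ 2 * (2 * (3 * n / L) * v) := by gcongr
    have h2 : (h / (36 * n * v)) ^ 2 * (2 * (3 * n / L) * v) = h ^ 2 / (216 * n * v * L) := by
      field_simp
      norm_num
    have h3 : h / (36 * n * v) * (h / (3 * L)) = 2 * (h ^ 2 / (216 * n * v * L)) := by
      field_simp
      norm_num
    linarith
  · have h1 : 6 * N₀ * B * A * θ ^ L / (h / (3 * L)) ^ 2 ≤
        6 * (3 * n / L) * B * A * θ ^ L / (h / (3 * L)) ^ 2 := by gcongr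
    refine h1.trans (le_of_eq ?_)
    field_simp
    ring

/-- A doubly exponential decay beats any geometric growth: bound e^{-x} by m!/x^m with m so large
that w^m exceeds 2E. -/
lemma summable_pow_mul_exp_neg {E a w : ℝ} (hE : 0 ≤ E) (ha : 0 < a) (hw : 1 < w) :
    Summable fun q : ℕ => E ^ q * Real.exp (-(a * w ^ q)) := by
  obtain ⟨m, hm⟩ := pow_unbounded_of_one_lt (2 * E + 1) hw
  have hw0 : 0 < w := by linarith
  refine Summable.of_nonneg_of_le (fun q => by positivity) (fun q => ?_)
    (summable_geometric_two.mul_left (m.factorial / a ^ m))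
  have h1 := Real.pow_div_factorial_le_exp (a * w ^ q) (by positivity) m
  have h2 : Real.exp (-(a * w ^ q)) ≤ m.factorial / (a * w ^ q) ^ m := by
    rw [Real.exp_neg, inv_le_comm₀ (Real.exp_pos _) (by positivity), inv_div]
    exact h1
  have h3 : E / w ^ m ≤ 1 / 2 := by
    rw [div_le_div_iff₀ (by positivity) (by norm_num)]
    linarith
  calc E ^ q * Real.exp (-(a * w ^ q)) ≤ E ^ q * (m.factorial / (a * w ^ q) ^ m) := by gcongr
    _ = m.factorial / a ^ m * (E / w ^ m) ^ q := by
        rw [mul_pow, ← pow_mul, mul_comm q m, pow_mul, div_pow]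
        field_simp
    _ ≤ _ := by gcongr

/-- A function which is admissible as a link at level `q`: it is small in `L¹`, and it mixes. -/
structure IsLink (P : Kernel S S) (ν : Measure S) (θ M K₁ K₂ b : ℝ) (q : ℕ) (d : S → ℝ) :
    Prop where
  measurable : Measurable d
  bound : ∀ x, |d x| ≤ 2 * M
  small : ∫ x, |d x| ∂ν ≤ 2 * (1 / 2) ^ q
  mix : ∀ n, ∫ x, |(Pop P)^[n] (centre ν d) x| ∂ν ≤ K₁ * Real.exp (K₂ * b ^ q) * θ ^ n
  mix_sq : ∀ n, ∫ x, |(Pop P)^[n] (fun x => centre ν d x ^ 2) x - ∫ x, centre ν d x ^ 2 ∂ν| ∂ν ≤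
    K₁ * Real.exp (K₂ * b ^ q) * θ ^ n

/-- The links have uniformly summable tails. -/
theorem exists_summable_link_tail (hinv : P.Invariant ν) (hZ : IsMarkovChain μ Z P ν)
    {θ M K₁ K₂ b w E : ℝ} (hθ0 : 0 < θ) (hθ1 : θ < 1) (hM : 0 < M) (hK₁ : 0 ≤ K₁) (hK₂ : 0 ≤ K₂)
    (hb : 1 < b) (hw : 1 < w) (hbw : b * w ^ 4 = 2) (hE : 1 ≤ E) :
    ∃ s : ℕ → ℝ, Summable s ∧ (∀ q, 0 ≤ s q) ∧ ∃ D : ℝ, ∀ (q n : ℕ) (d : S → ℝ),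
      IsLink P ν θ M K₁ K₂ b q d → D * 2 ^ q ≤ n → (1 / w) ^ q * 2 ^ q ≤ 18 * Real.sqrt n →
      E ^ q * μ.real {ω | ∃ N ≤ n, (1 / w) ^ q * Real.sqrt n ≤
        |∑ i ∈ Finset.range N, centre ν d (Z (1 + i) ω)|} ≤ s q := by
  set ξ := Real.log (1 / θ) with hξ
  have hξ0 : 0 < ξ := Real.log_pos (by rw [lt_div_iff₀ hθ0]; linarith)
  have hθe : ∀ n : ℕ, θ ^ n = Real.exp (-(ξ * n)) := fun n => by
    rw [hξ, one_div, Real.log_inv, neg_mul, neg_neg, mul_comm, Real.exp_nat_mul,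
      Real.exp_log hθ0]
  -- With L at least D₀ b^q, θ^L ≤ exp(−(K₂+3)b^q): the part K₂ cancels the mixing constant exp(K₂
  -- b^q), while the surplus 3 leaves a summable factor and gives e^{-3} ≤ 1/16.
  set D₀ := (K₂ + 3) / ξ with hD₀
  have hD₀0 : 0 < D₀ := by positivity
  have hw0 : 0 < w := by linarith
  have hb0 : 0 < b := by linarith
  have hbq : ∀ q : ℕ, 1 ≤ b ^ q := fun q => one_le_pow₀ hb.le
  have hb2 : b ≤ 2 := by
    rw [← hbw]
    exact le_mul_of_one_le_right hb0.le (one_le_pow₀ hw.le)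
  let L : ℕ → ℕ := fun q => ⌈D₀ * b ^ q⌉₊
  have hL1 : ∀ q, D₀ * b ^ q ≤ L q := fun q => Nat.le_ceil _
  have hL2 : ∀ q, (L q : ℝ) ≤ (D₀ + 1) * b ^ q := fun q => by
    have := (Nat.ceil_lt_add_one (a := D₀ * b ^ q) (by positivity)).le
    have := hbq q
    change (⌈D₀ * b ^ q⌉₊ : ℝ) ≤ _
    linarith
  have hL0 : ∀ q, 0 < L q := fun q => Nat.ceil_pos.2 (by positivity)
  have hρ : ∀ q, θ ^ L q ≤ Real.exp (-((K₂ + 3) * b ^ q)) := fun q => by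
    rw [hθe]
    refine Real.exp_le_exp.2 (neg_le_neg ?_)
    have := mul_le_mul_of_nonneg_left (hL1 q) hξ0.le
    rw [hD₀] at this
    refine le_trans (le_of_eq ?_) this
    field_simp
  have hρ16 : ∀ q, θ ^ L q ≤ 1 / 16 := fun q => by
    refine (hρ q).trans ((Real.exp_le_exp.2 (neg_le_neg (?_ : (3 : ℝ) ≤ _))).trans ?_)
    · nlinarith [hbq q]
    · rw [Real.exp_neg, one_div]
      refine inv_anti₀ (by norm_num) ?_
      have h1 : Real.exp 3 = Real.exp 1 ^ 3 := by rw [← Real.exp_nat_mul]; norm_num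
      have h2 := Real.exp_one_gt_d9
      rw [h1]
      calc (16 : ℝ) ≤ 2.7 ^ 3 := by norm_num
        _ ≤ _ := by gcongr; linarith
  have hAρ : ∀ q, K₁ * Real.exp (K₂ * b ^ q) * θ ^ L q ≤ K₁ * Real.exp (-(3 * b ^ q)) := fun q => by
    rw [mul_assoc]
    refine mul_le_mul_of_nonneg_left ?_ hK₁
    refine (mul_le_mul_of_nonneg_left (hρ q) (Real.exp_pos _).le).trans (le_of_eq ?_)
    rw [← Real.exp_add]
    congr 1
    ring
  -- With threshold w^{-q}√n, variance bound 4M·2^{-q} and L ≤ (D₀+1)b^q, the Freedman exponent is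
  -- at least a₁(2/(b w²))^q = a₁ w^{2q}, because b w⁴ = 2; here 864 = 216·4.
  set a₁ := 1 / (864 * M * (D₀ + 1)) with ha₁
  have ha₁0 : 0 < a₁ := by positivity
  refine ⟨fun q => (D₀ + 1) * 2 * ((E * b) ^ q * Real.exp (-(a₁ * (w ^ 2) ^ q))) +
    (D₀ + 1) * K₁ / (4 * M) * ((E * b * 2) ^ q * Real.exp (-(3 * b ^ q))) +
    (D₀ + 1) ^ 2 * 648 * M * K₁ * ((E * b * b * (w ^ 2)) ^ q * Real.exp (-(3 * b ^ q))),
    ?_, fun q => by positivity, D₀ + 1, ?_⟩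
  · refine ((Summable.mul_left _ (summable_pow_mul_exp_neg (by positivity) ha₁0 ?_)).add
      (Summable.mul_left _ (summable_pow_mul_exp_neg (by positivity) (by norm_num) hb))).add
      (Summable.mul_left _ (summable_pow_mul_exp_neg (by positivity) (by norm_num) hb))
    exact one_lt_pow₀ hw (by norm_num)
  intro q n d hd hDn hwn
  have hdb : ∀ x, |centre ν d x| ≤ 4 * M := fun x => by
    have := abs_centre_le (ν := ν) hd.bound x
    linarith
  have hLn : (L q : ℝ) ≤ n := by
    refine (hL2 q).trans (le_trans ?_ hDn)
    gcongr
  have hn0 : (0 : ℝ) < n := lt_of_lt_of_le (Nat.cast_pos.2 (hL0 q)) hLn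
  have hs0 : 0 < Real.sqrt n := Real.sqrt_pos.2 hn0
  have hsq : Real.sqrt n ^ 2 = n := Real.sq_sqrt hn0.le
  have hL0' : (0 : ℝ) < L q := Nat.cast_pos.2 (hL0 q)
  have h2q : ((1 : ℝ) / 2) ^ q * 2 ^ q = 1 := by rw [← mul_pow]; norm_num
  have key := chain_tail_opt hinv hZ (measurable_centre hd.measurable) (B := 4 * M)
    (A := K₁ * Real.exp (K₂ * b ^ q)) (v := 4 * M * (1 / 2) ^ q)
    (h := (1 / w) ^ q * Real.sqrt n) (by positivity) hdb
    (integral_centre hd.measurable hd.bound) (by positivity) hθ0.le hd.mix hd.mix_sq (hL0 q)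
    (hρ16 q) (by positivity) ((integral_centre_sq_le hd.measurable hd.bound).trans (by
      have := mul_le_mul_of_nonneg_left hd.small (by positivity : 0 ≤ 2 * M)
      linarith)) (by positivity) 1 (n := n) (by exact_mod_cast hLn) (by
      have h1 : (1 / w) ^ q ≤ 18 * Real.sqrt n * (1 / 2) ^ q := by
        have := mul_le_mul_of_nonneg_right hwn (by positivity : (0 : ℝ) ≤ (1 / 2) ^ q)
        rw [mul_assoc, mul_comm ((2 : ℝ) ^ q), h2q, mul_one] at this
        exact this
      have h2 : 18 * (n : ℝ) * (4 * M * (1 / 2) ^ q) =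
        (18 * Real.sqrt n * (1 / 2) ^ q) * Real.sqrt n * (4 * M) := by
        nth_rewrite 1 [← hsq]
        ring
      rw [h2]
      gcongr)
  refine (mul_le_mul_of_nonneg_left key (by positivity)).trans ?_
  have hAρq := hAρ q
  set ρ := K₁ * Real.exp (K₂ * b ^ q) * θ ^ L q with hρdef
  have hρ0 : 0 ≤ ρ := by positivity
  have hwq : 0 < w ^ q := by positivity
  have e0 : ((1 / w) ^ q * Real.sqrt n) ^ 2 = n / (w ^ q) ^ 2 := by
    rw [mul_pow, hsq, div_pow, one_pow]
    field_simp
  have hexp : Real.exp (-(((1 / w) ^ q * Real.sqrt n) ^ 2 /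
      (216 * n * (4 * M * (1 / 2) ^ q) * L q))) ≤ Real.exp (-(a₁ * (w ^ 2) ^ q)) := by
    refine Real.exp_le_exp.2 (neg_le_neg ?_)
    rw [e0]
    have h1 : (n : ℝ) / (w ^ q) ^ 2 / (216 * n * (4 * M * (1 / 2) ^ q) * L q) =
        2 ^ q / (864 * M * (w ^ q) ^ 2 * L q) := by
      rw [one_div, inv_pow]
      field_simp
      norm_num
    rw [h1, le_div_iff₀ (by positivity)]
    calc a₁ * (w ^ 2) ^ q * (864 * M * (w ^ q) ^ 2 * L q)
        ≤ a₁ * (w ^ 2) ^ q * (864 * M * (w ^ q) ^ 2 * ((D₀ + 1) * b ^ q)) := by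
          gcongr; exact hL2 q
      _ = (b * w ^ 4) ^ q := by
          rw [ha₁, mul_pow b, ← pow_mul, ← pow_mul w 4, ← pow_mul]
          field_simp
          rw [← pow_add]
          congr 1
          ring
      _ = 2 ^ q := by rw [hbw]
  have h3 : 162 * (n : ℝ) * L q * (4 * M) * (K₁ * Real.exp (K₂ * b ^ q)) * θ ^ L q /
      ((1 / w) ^ q * Real.sqrt n) ^ 2 = 648 * M * L q * (w ^ q) ^ 2 * ρ := by
    rw [e0, hρdef]
    field_simp
    ring
  have h4 : K₁ * Real.exp (K₂ * b ^ q) * θ ^ L q / (4 * M * (1 / 2) ^ q) =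
      ρ * 2 ^ q / (4 * M) := by
    rw [hρdef, one_div, inv_pow]
    field_simp
  rw [h3, h4]
  have hL2q := hL2 q
  calc E ^ q * (L q * (2 * Real.exp (-(((1 / w) ^ q * Real.sqrt n) ^ 2 /
          (216 * n * (4 * M * (1 / 2) ^ q) * L q))) + ρ * 2 ^ q / (4 * M) +
          648 * M * L q * (w ^ q) ^ 2 * ρ))
      ≤ E ^ q * ((D₀ + 1) * b ^ q * (2 * Real.exp (-(a₁ * (w ^ 2) ^ q)) +
          K₁ * Real.exp (-(3 * b ^ q)) * 2 ^ q / (4 * M) +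
          648 * M * ((D₀ + 1) * b ^ q) * (w ^ q) ^ 2 * (K₁ * Real.exp (-(3 * b ^ q))))) := by
        gcongr
    _ = _ := by
        simp only [mul_pow, ← pow_mul, mul_comm 2 q]
        ring

end Link

/-! ### Chaining along brackets -/

section Chaining

variable {Ω S T₀ : Type*} {m0 : MeasurableSpace Ω} [MeasurableSpace S] {μ : Measure Ω}
  [IsProbabilityMeasure μ] {ν : Measure S} [IsProbabilityMeasure ν] {P : Kernel S S}
  [IsMarkovKernel P] {Z : ℕ → Ω → S} {g : S → ℝ} {θ M K₁ K₂ b w E : ℝ}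
  {𝓐 : Subalgebra ℝ (S → ℝ)} {φ : T₀ → S → ℝ} {lo up : ℕ → T₀ → S → ℝ}

/-- Brackets `[lo q f, up q f]` around the functions `φ f`, of size `2⁻ᑫ` at level `q`. -/
structure IsBracketSystem (P : Kernel S S) (ν : Measure S) (θ M K₁ K₂ b E : ℝ)
    (𝓐 : Subalgebra ℝ (S → ℝ)) (φ : T₀ → S → ℝ) (lo up : ℕ → T₀ → S → ℝ) : Prop where
  measurable : ∀ f, Measurable (φ f)
  lo_mem : ∀ q f, lo q f ∈ 𝓐
  lo_measurable : ∀ q f, Measurable (lo q f)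
  up_measurable : ∀ q f, Measurable (up q f)
  bound : ∀ f x, |φ f x| ≤ M
  lo_bound : ∀ q f x, |lo q f x| ≤ M
  up_bound : ∀ q f x, |up q f x| ≤ M
  lo_le : ∀ q f x, lo q f x ≤ φ f x
  le_up : ∀ q f x, φ f x ≤ up q f x
  small : ∀ q f, ∫ x, (up q f x - lo q f x) ∂ν ≤ (1 / 2) ^ q
  lo_mix : ∀ q f n, ∫ x, |(Pop P)^[n] (centre ν (lo q f)) x| ∂ν ≤ K₁ * Real.exp (K₂ * b ^ q) * θ ^ n
  link : ∀ q f, IsLink P ν θ M K₁ K₂ b q (fun x => lo (q + 1) f x - lo q f x)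
  last_link : ∀ q f, IsLink P ν θ M K₁ K₂ b q (fun x => up q f x - lo q f x)
  card : ∃ K₀ : ℝ, 0 ≤ K₀ ∧ ∀ q, (Set.range fun f => (lo q f, lo (q + 1) f, up q f)).Finite ∧
    ((Set.range fun f => (lo q f, lo (q + 1) f, up q f)).ncard : ℝ) ≤ K₀ * E ^ q

lemma measurableSet_exists_le {X : ℕ → Ω → ℝ} (hX : ∀ N, Measurable (X N)) (n : ℕ) (c : ℝ) :
    MeasurableSet {ω | ∃ N ≤ n, c ≤ |X N ω|} := by
  have : {ω | ∃ N ≤ n, c ≤ |X N ω|} = ⋃ N ∈ Set.Iic n, {ω | c ≤ |X N ω|} := by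
    ext; simp
  rw [this]
  exact MeasurableSet.biUnion (Set.to_countable _) fun N _ =>
    measurableSet_le measurable_const (hX N).abs

/-- The event that a partial sum of the centred function `d` is large. -/
def largeSum (ν : Measure S) (Z : ℕ → Ω → S) (d : S → ℝ) (n : ℕ) (c : ℝ) : Set Ω :=
  {ω | ∃ N ≤ n, c ≤ |∑ i ∈ Finset.range N, centre ν d (Z (1 + i) ω)|}

lemma measurableSet_largeSum (hZ : ∀ n, Measurable (Z n)) {d : S → ℝ} (hd : Measurable d) (n : ℕ)
    (c : ℝ) : MeasurableSet (largeSum ν Z d n c) :=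
  measurableSet_exists_le (fun N => measurable_chain_sum hZ (measurable_centre hd) 1 N) n c

lemma centre_sub {f g : S → ℝ} (hf : Integrable f ν) (hg : Integrable g ν) (x : S) :
    centre ν (fun x => f x - g x) x = centre ν f x - centre ν g x := by
  rw [centre, integral_sub hf hg, centre, centre]
  ring

namespace IsBracketSystem

variable (h : IsBracketSystem P ν θ M K₁ K₂ b E 𝓐 φ lo up)
include h

lemma integrable_lo (q : ℕ) (f : T₀) : Integrable (lo q f) ν :=
  integrable_of_bound (h.lo_measurable q f) (h.lo_bound q f)

lemma integrable_up (q : ℕ) (f : T₀) : Integrable (up q f) ν :=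
  integrable_of_bound (h.up_measurable q f) (h.up_bound q f)

lemma integrable (f : T₀) : Integrable (φ f) ν :=
  integrable_of_bound (h.measurable f) (h.bound f)

/-- Deterministic part of the chaining argument. -/
lemma abs_sum_sub_le (f : T₀) {j Q : ℕ} (hj : j ≤ Q) (z : ℕ → S) (N : ℕ) (η : ℕ → ℝ)
    (h1 : ∀ q ∈ Finset.Ico j Q,
      |∑ i ∈ Finset.range N, centre ν (fun x => lo (q + 1) f x - lo q f x) (z i)| ≤ η q)
    (h2 : |∑ i ∈ Finset.range N, centre ν (fun x => up Q f x - lo Q f x) (z i)| ≤ η Q) :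
    |∑ i ∈ Finset.range N, centre ν (φ f) (z i) - ∑ i ∈ Finset.range N, centre ν (lo j f) (z i)| ≤
      ∑ q ∈ Finset.Ico j (Q + 1), η q + N * (1 / 2) ^ Q := by
  have i1 := h.integrable_lo
  have i2 := h.integrable_up
  have i3 := h.integrable f
  have tel : ∑ i ∈ Finset.range N, centre ν (lo Q f) (z i) -
      ∑ i ∈ Finset.range N, centre ν (lo j f) (z i) =
      ∑ q ∈ Finset.Ico j Q, ∑ i ∈ Finset.range N,
        centre ν (fun x => lo (q + 1) f x - lo q f x) (z i) := by
    rw [← Finset.sum_Ico_sub (fun q => ∑ i ∈ Finset.range N, centre ν (lo q f) (z i)) hj]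
    refine Finset.sum_congr rfl fun q _ => ?_
    rw [← Finset.sum_sub_distrib]
    exact Finset.sum_congr rfl fun i _ => (centre_sub (i1 _ f) (i1 _ f) _).symm
  have b1 : |∑ i ∈ Finset.range N, centre ν (lo Q f) (z i) -
      ∑ i ∈ Finset.range N, centre ν (lo j f) (z i)| ≤ ∑ q ∈ Finset.Ico j Q, η q := by
    rw [tel]
    exact (Finset.abs_sum_le_sum_abs _ _).trans (Finset.sum_le_sum h1)
  have hsm := h.small Q f
  rw [integral_sub (i2 Q f) (i1 Q f)] at hsm
  have m1 : ∫ x, lo Q f x ∂ν ≤ ∫ x, φ f x ∂ν := integral_mono (i1 Q f) i3 (h.lo_le Q f)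
  have m2 : ∫ x, φ f x ∂ν ≤ ∫ x, up Q f x ∂ν := integral_mono i3 (i2 Q f) (h.le_up Q f)
  -- Beyond the last level only monotonicity is available: φ − lo Q lies between 0 and the bracket
  -- width, and centring costs at most the mean width 2^{-Q} per summand.
  have hup : ∀ x, centre ν (φ f) x - centre ν (lo Q f) x ≤
      centre ν (fun x => up Q f x - lo Q f x) x + (1 / 2) ^ Q := fun x => by
    rw [centre_sub (i2 Q f) (i1 Q f)]
    have := h.le_up Q f x
    simp only [centre]
    linarith
  have hlo : ∀ x, -(1 / 2) ^ Q ≤ centre ν (φ f) x - centre ν (lo Q f) x := fun x => by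
    have := h.lo_le Q f x
    simp only [centre]
    linarith
  have b2 : |∑ i ∈ Finset.range N, centre ν (φ f) (z i) -
      ∑ i ∈ Finset.range N, centre ν (lo Q f) (z i)| ≤ η Q + N * (1 / 2) ^ Q := by
    rw [← Finset.sum_sub_distrib, abs_le]
    have h3 := (abs_nonneg _).trans h2
    constructor
    · have := Finset.sum_le_sum fun i (_ : i ∈ Finset.range N) => hlo (z i)
      rw [Finset.sum_const, Finset.card_range, nsmul_eq_mul] at this
      linarith
    · have := Finset.sum_le_sum fun i (_ : i ∈ Finset.range N) => hup (z i)
      rw [Finset.sum_add_distrib, Finset.sum_const, Finset.card_range, nsmul_eq_mul] at this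
      linarith [le_abs_self (∑ i ∈ Finset.range N,
        centre ν (fun x => up Q f x - lo Q f x) (z i))]
  rw [Finset.sum_Ico_succ_top hj]
  have := abs_sub_le (∑ i ∈ Finset.range N, centre ν (φ f) (z i))
    (∑ i ∈ Finset.range N, centre ν (lo Q f) (z i)) (∑ i ∈ Finset.range N, centre ν (lo j f) (z i))
  linarith

/-- The exceptional event at one level. -/
lemma exists_level_event (hZ : ∀ n, Measurable (Z n)) {K₀ s c : ℝ} {q n : ℕ} (hE : 1 ≤ E)
    (hs : ∀ d, IsLink P ν θ M K₁ K₂ b q d → E ^ q * μ.real (largeSum ν Z d n c) ≤ s)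
    (hfin : (Set.range fun f => (lo q f, lo (q + 1) f, up q f)).Finite)
    (hcard : ((Set.range fun f => (lo q f, lo (q + 1) f, up q f)).ncard : ℝ) ≤ K₀ * E ^ q)
    (hs0 : 0 ≤ s) :
    ∃ A : Set Ω, MeasurableSet A ∧ μ.real A ≤ 2 * K₀ * s ∧ ∀ ω ∉ A, ∀ f, ∀ N ≤ n,
      |∑ i ∈ Finset.range N, centre ν (fun x => lo (q + 1) f x - lo q f x) (Z (1 + i) ω)| ≤ c ∧
      |∑ i ∈ Finset.range N, centre ν (fun x => up q f x - lo q f x) (Z (1 + i) ω)| ≤ c := by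
  classical
  have hEq : 0 < E ^ q := pow_pos (by linarith) q
  let W := hfin.toFinset
  have hWc : (W.card : ℝ) ≤ K₀ * E ^ q := by
    rwa [Set.ncard_eq_toFinset_card _ hfin] at hcard
  let D1 : (S → ℝ) × (S → ℝ) × (S → ℝ) → S → ℝ := fun p x => p.2.1 x - p.1 x
  let D2 : (S → ℝ) × (S → ℝ) × (S → ℝ) → S → ℝ := fun p x => p.2.2 x - p.1 x
  have hW : ∀ p ∈ W, IsLink P ν θ M K₁ K₂ b q (D1 p) ∧ IsLink P ν θ M K₁ K₂ b q (D2 p) := by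
    intro p hp
    obtain ⟨f, rfl⟩ := hfin.mem_toFinset.1 hp
    exact ⟨h.link q f, h.last_link q f⟩
  refine ⟨⋃ p ∈ W, (largeSum ν Z (D1 p) n c ∪ largeSum ν Z (D2 p) n c), ?_, ?_, ?_⟩
  · exact Finset.measurableSet_biUnion _ fun p hp =>
      (measurableSet_largeSum hZ (hW p hp).1.measurable n c).union
        (measurableSet_largeSum hZ (hW p hp).2.measurable n c)
  · refine (measureReal_biUnion_finset_le _ _).trans ?_
    have : ∀ p ∈ W, μ.real (largeSum ν Z (D1 p) n c ∪ largeSum ν Z (D2 p) n c) ≤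
        2 * s / E ^ q := fun p hp => by
      refine (measureReal_union_le _ _).trans ?_
      rw [le_div_iff₀ hEq]
      linarith [hs _ (hW p hp).1, hs _ (hW p hp).2]
    refine (Finset.sum_le_sum this).trans ?_
    rw [Finset.sum_const, nsmul_eq_mul]
    refine (mul_le_mul_of_nonneg_right hWc (by positivity)).trans (le_of_eq ?_)
    field_simp
  · intro ω hω f N hN
    simp only [Set.mem_iUnion, not_exists] at hω
    have hp : (lo q f, lo (q + 1) f, up q f) ∈ W := hfin.mem_toFinset.2 ⟨f, rfl⟩
    have h1 := hω _ hp
    rw [Set.mem_union, not_or] at h1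
    exact ⟨le_of_not_gt fun hlt => h1.1 ⟨N, hN, hlt.le⟩,
      le_of_not_gt fun hlt => h1.2 ⟨N, hN, hlt.le⟩⟩

/-- The partial sum processes of the functions `φ f` are uniformly close to those of finitely many
lower brackets. -/
theorem chaining (hinv : P.Invariant ν) (hZ : IsMarkovChain μ Z P ν) (hθ0 : 0 < θ) (hθ1 : θ < 1)
    (hM : 0 < M) (hK₁ : 0 ≤ K₁) (hK₂ : 0 ≤ K₂) (hb : 1 < b) (hw : 1 < w) (hbw : b * w ^ 4 = 2)
    (hE : 1 ≤ E) {δ : ℝ} (hδ : 0 < δ) (j₁ : ℕ) :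
    ∃ j ≥ j₁, ∀ᶠ n : ℕ in atTop, ∃ A : Set Ω, MeasurableSet A ∧ μ.real A ≤ δ ∧
      ∀ ω ∉ A, ∀ f, ∀ N ≤ n, |∑ i ∈ Finset.range N, centre ν (φ f) (Z (1 + i) ω) -
        ∑ i ∈ Finset.range N, centre ν (lo j f) (Z (1 + i) ω)| ≤ δ * Real.sqrt n := by
  obtain ⟨s, hs, hs0, D, hD⟩ := exists_summable_link_tail hinv hZ hθ0 hθ1 hM hK₁ hK₂ hb hw hbw hE
  obtain ⟨K₀, hK₀, hcard⟩ := h.card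
  have hw0 : 0 < w := by linarith
  have hw1 : 1 / w < 1 := (div_lt_one hw0).2 hw
  have hwg : Summable fun q : ℕ => (1 / w) ^ q :=
    summable_geometric_of_lt_one (by positivity) hw1
  -- The starting level must make three things small: the total probability of the exceptional
  -- events, the total of the thresholds w^{-q}, and w^{-j} itself, which secures the range
  -- condition of the tail bound at all levels used.
  have t1 : ∀ᶠ j in atTop, 2 * K₀ * ∑' k, s (k + j) < δ := by
    have := (tendsto_sum_nat_add s).const_mul (2 * K₀)
    rw [mul_zero] at this
    exact this.eventually (gt_mem_nhds hδ)
  have t2 : ∀ᶠ j in atTop, ∑' k, (1 / w) ^ (k + j) < δ / 2 :=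
    (tendsto_sum_nat_add fun q : ℕ => (1 / w) ^ q).eventually (gt_mem_nhds (half_pos hδ))
  have t3 : ∀ᶠ j : ℕ in atTop, (1 / w) ^ j < δ / 2 :=
    (tendsto_pow_atTop_nhds_zero_of_lt_one (by positivity) hw1).eventually
      (gt_mem_nhds (half_pos hδ))
  obtain ⟨j, hj1, hj2, hj3, hj⟩ := (t1.and (t2.and (t3.and (eventually_ge_atTop j₁)))).exists
  refine ⟨j, hj, ?_⟩
  have hsqrt : Tendsto (fun n : ℕ => Real.sqrt n) atTop atTop :=
    Real.tendsto_sqrt_atTop.comp tendsto_natCast_atTop_atTop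
  filter_upwards [hsqrt.eventually_ge_atTop (|D| * 4 / δ),
    hsqrt.eventually_ge_atTop (2 ^ j * (δ / 2)), hsqrt.eventually_ge_atTop (δ / 2),
    eventually_gt_atTop 0] with n hn1 hn2 hn3 hn0
  have hn0' : (0 : ℝ) < n := Nat.cast_pos.2 hn0
  have hs0' : 0 < Real.sqrt n := Real.sqrt_pos.2 hn0'
  have hsq : Real.sqrt n * Real.sqrt n = n := Real.mul_self_sqrt hn0'.le
  -- The last level Q = k + 1 is the first with 2^Q > 2√n/δ. Then n·2^{-Q} ≤ (δ/2)√n, while 2^Q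
  -- remains of order √n, so the tail bounds still apply at level Q for large n.
  obtain ⟨k, hk1, hk2⟩ := exists_nat_pow_near (x := Real.sqrt n / (δ / 2)) (y := 2)
    ((one_le_div (half_pos hδ)).2 hn3) (by norm_num)
  rw [le_div_iff₀ (half_pos hδ)] at hk1
  rw [div_lt_iff₀ (half_pos hδ)] at hk2
  set Q := k + 1 with hQ
  have hQ2 : (2 : ℝ) ^ Q * (δ / 2) ≤ 2 * Real.sqrt n := by
    rw [hQ, pow_succ]
    linarith
  have hjQ : j ≤ Q := by
    have h1 : (2 : ℝ) ^ j < 2 ^ Q :=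
      lt_of_mul_lt_mul_right (hn2.trans_lt hk2) (half_pos hδ).le
    exact (pow_lt_pow_iff_right₀ (by norm_num : (1 : ℝ) < 2)).1 h1 |>.le
  have hlev : ∀ q ∈ Finset.Ico j (Q + 1), ∃ A : Set Ω, MeasurableSet A ∧
      μ.real A ≤ 2 * K₀ * s q ∧ ∀ ω ∉ A, ∀ f, ∀ N ≤ n,
      |∑ i ∈ Finset.range N, centre ν (fun x => lo (q + 1) f x - lo q f x) (Z (1 + i) ω)| ≤
        (1 / w) ^ q * Real.sqrt n ∧
      |∑ i ∈ Finset.range N, centre ν (fun x => up q f x - lo q f x) (Z (1 + i) ω)| ≤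
        (1 / w) ^ q * Real.sqrt n := by
    intro q hq
    obtain ⟨hq1, hq2⟩ := Finset.mem_Ico.1 hq
    have h2q : (2 : ℝ) ^ q * (δ / 2) ≤ 2 * Real.sqrt n :=
      (mul_le_mul_of_nonneg_right (pow_le_pow_right₀ (by norm_num) (by omega))
        (half_pos hδ).le).trans hQ2
    refine h.exists_level_event hZ.measurable hE (fun d hd => hD q n d hd ?_ ?_) (hcard q).1
      (hcard q).2 (hs0 q)
    · have h3 : (2 : ℝ) ^ q ≤ 4 * Real.sqrt n / δ := by
        rw [le_div_iff₀ hδ]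
        linarith
      calc D * 2 ^ q ≤ |D| * (4 * Real.sqrt n / δ) := by
            refine mul_le_mul (le_abs_self D) h3 (by positivity) (abs_nonneg _)
        _ = |D| * 4 / δ * Real.sqrt n := by ring
        _ ≤ Real.sqrt n * Real.sqrt n := by gcongr
        _ = n := hsq
    · have h3 : (1 / w) ^ q ≤ δ / 2 :=
        (pow_le_pow_of_le_one (by positivity) hw1.le hq1).trans hj3.le
      calc (1 / w) ^ q * 2 ^ q ≤ δ / 2 * 2 ^ q := by gcongr
        _ ≤ 2 * Real.sqrt n := by linarith
        _ ≤ _ := by linarith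
  choose! A hA1 hA2 hA3 using hlev
  have hshift : ∀ u : ℕ → ℝ, Summable u → (∀ q, 0 ≤ u q) →
      ∑ q ∈ Finset.Ico j (Q + 1), u q ≤ ∑' k, u (k + j) := fun u hu hu0 => by
    rw [Finset.sum_Ico_eq_sum_range]
    simp only [add_comm j]
    exact ((summable_nat_add_iff j).2 hu).sum_le_tsum _ fun k _ => hu0 _
  refine ⟨⋃ q ∈ Finset.Ico j (Q + 1), A q, Finset.measurableSet_biUnion _ hA1, ?_, ?_⟩
  · refine (measureReal_biUnion_finset_le _ _).trans ((Finset.sum_le_sum hA2).trans ?_)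
    rw [← Finset.mul_sum]
    exact (mul_le_mul_of_nonneg_left (hshift s hs hs0) (by positivity)).trans hj1.le
  · intro ω hω f N hN
    simp only [Set.mem_iUnion, not_exists] at hω
    have key := h.abs_sum_sub_le f hjQ (fun i => Z (1 + i) ω) N
      (fun q => (1 / w) ^ q * Real.sqrt n) (fun q hq => by
        have hq' : q ∈ Finset.Ico j (Q + 1) := by
          simp only [Finset.mem_Ico] at hq ⊢; omega
        exact (hA3 q hq' ω (hω q hq') f N hN).1)
      (by
        have hq' : Q ∈ Finset.Ico j (Q + 1) := by simp only [Finset.mem_Ico]; omega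
        exact (hA3 Q hq' ω (hω Q hq') f N hN).2)
    refine key.trans ?_
    rw [← Finset.sum_mul]
    have h1 := hshift (fun q => (1 / w) ^ q) hwg fun q => by positivity
    have h2 : (∑ q ∈ Finset.Ico j (Q + 1), (1 / w) ^ q) * Real.sqrt n ≤ δ / 2 * Real.sqrt n :=
      mul_le_mul_of_nonneg_right (h1.trans hj2.le) hs0'.le
    have h3 : (N : ℝ) * (1 / 2) ^ Q ≤ δ / 2 * Real.sqrt n := by
      have hNn : (N : ℝ) ≤ n := Nat.cast_le.2 hN
      rw [one_div, inv_pow, ← div_eq_mul_inv, div_le_iff₀ (by positivity)]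
      calc (N : ℝ) ≤ Real.sqrt n * Real.sqrt n := by rw [hsq]; exact hNn
        _ ≤ Real.sqrt n * (2 ^ Q * (δ / 2)) := by gcongr
        _ = _ := by ring
    linarith

end IsBracketSystem

end Chaining

/-! ### Discretization of the time parameter -/

section Time

variable {Ω S : Type*} {m0 : MeasurableSpace Ω} [MeasurableSpace S] {μ : Measure Ω}
  [IsProbabilityMeasure μ] {ν : Measure S} [IsProbabilityMeasure ν] {P : Kernel S S}
  [IsMarkovKernel P] {Z : ℕ → Ω → S} {g : S → ℝ}

/-- The last point of the grid `{0, 1/m, 2/m, …}` before `t`. -/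
def gridTime (m : ℕ) (t : ℝ) : ℝ := (⌊(m : ℝ) * t⌋₊ : ℝ) / m

lemma gridTime_nonneg (m : ℕ) (t : ℝ) : 0 ≤ gridTime m t := by rw [gridTime]; positivity

lemma gridTime_le {m : ℕ} (hm : 0 < m) {t : ℝ} (ht : 0 ≤ t) : gridTime m t ≤ t := by
  rw [gridTime, div_le_iff₀ (Nat.cast_pos.2 hm), mul_comm t]
  exact Nat.floor_le (by positivity)

lemma lt_gridTime_add {m : ℕ} (hm : 0 < m) (t : ℝ) : t < gridTime m t + 1 / m := by
  have hm' : (0 : ℝ) < m := Nat.cast_pos.2 hm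
  rw [gridTime, ← add_div, lt_div_iff₀ hm', mul_comm t]
  exact Nat.lt_floor_add_one _

/-- Between t and its grid point the sum runs over a block starting at one of m+1 fixed positions
and of length about n/m, so finitely many maxima control all times. -/
lemma exists_block (g : S → ℝ) (z : ℕ → S) (n : ℕ) {m : ℕ} (hm : 0 < m) {t : ℝ} (ht0 : 0 ≤ t)
    (ht1 : t ≤ 1) : ∃ k ≤ m, ∃ N ≤ n / m + 1,
      |∑ i ∈ Finset.range ⌊(n : ℝ) * t⌋₊, g (z (1 + i)) -
        ∑ i ∈ Finset.range ⌊(n : ℝ) * gridTime m t⌋₊, g (z (1 + i))| =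
      |∑ i ∈ Finset.range N, g (z (1 + ⌊(n : ℝ) * (k / m)⌋₊ + i))| := by
  have hm' : (0 : ℝ) < m := Nat.cast_pos.2 hm
  have hn : (0 : ℝ) ≤ n := Nat.cast_nonneg n
  set k := ⌊(m : ℝ) * t⌋₊ with hk
  have hkm : k ≤ m := by
    rw [hk]
    refine Nat.floor_le_of_le ?_
    nlinarith
  set a := ⌊(n : ℝ) * gridTime m t⌋₊ with ha
  have hab : a ≤ ⌊(n : ℝ) * t⌋₊ :=
    Nat.floor_le_floor (mul_le_mul_of_nonneg_left (gridTime_le hm ht0) hn)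
  obtain ⟨N, hN⟩ := Nat.exists_eq_add_of_le hab
  refine ⟨k, hkm, N, ?_, ?_⟩
  · have h1 : (n : ℝ) * t < a + (n / m : ℕ) + 2 := by
      have h2 : (n : ℝ) * gridTime m t < a + 1 := Nat.lt_floor_add_one _
      have h3 : (n : ℝ) / m < (n / m : ℕ) + 1 := by
        rw [div_lt_iff₀ hm']
        have := Nat.lt_div_mul_add (a := n) hm
        have : n < (n / m + 1) * m := by rw [add_mul, one_mul]; exact this
        exact_mod_cast this
      have h4 : (n : ℝ) * t ≤ n * (gridTime m t + 1 / m) :=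
        mul_le_mul_of_nonneg_left (lt_gridTime_add hm t).le hn
      have h5 : (n : ℝ) * (gridTime m t + 1 / m) = n * gridTime m t + n / m := by ring
      linarith
    have h2 : ⌊(n : ℝ) * t⌋₊ < a + n / m + 2 := by
      rw [Nat.floor_lt (by positivity)]
      push_cast
      exact h1
    omega
  · rw [hN, Finset.sum_range_add]
    have e : ⌊(n : ℝ) * ((k : ℝ) / m)⌋₊ = a := rfl
    rw [e, add_sub_cancel_left]
    simp only [add_assoc]

/-- The factor L³ combines the L residue classes of the tail bound with the L² time blocks. -/
lemma tendsto_block_bound {ρ θ D : ℝ} (hρ : 0 ≤ ρ) (hρ1 : ρ < 1) (hθ : 0 ≤ θ) (hθ1 : θ < 1) :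
    Tendsto (fun L : ℕ => 2 * (L : ℝ) ^ 3 * (2 * ρ ^ L + D * θ ^ L)) atTop (𝓝 0) := by
  have h1 := (tendsto_pow_const_mul_const_pow_of_abs_lt_one 3 (r := ρ)
    (by rwa [abs_of_nonneg hρ])).const_mul 4
  have h2 := (tendsto_pow_const_mul_const_pow_of_abs_lt_one 3 (r := θ)
    (by rwa [abs_of_nonneg hθ])).const_mul (2 * D)
  have := h1.add h2
  simp only [mul_zero, add_zero] at this
  exact this.congr fun L => by ring

/-- The partial sum process is uniformly close to its discretization on a fine grid. -/
theorem eventually_time_discretization (hinv : P.Invariant ν) (hZ : IsMarkovChain μ Z P ν)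
    (hg : Measurable g) {B A θ : ℝ} (hB0 : 0 < B) (hB : ∀ x, |g x| ≤ B) (h0 : ∫ x, g x ∂ν = 0)
    (hA : 0 ≤ A) (hθ : 0 ≤ θ) (hθ1 : θ < 1) (hmix : ∀ n, ∫ x, |(Pop P)^[n] g x| ∂ν ≤ A * θ ^ n)
    (hmix2 : ∀ n, ∫ x, |(Pop P)^[n] (fun x => g x ^ 2) x - ∫ x, g x ^ 2 ∂ν| ∂ν ≤ A * θ ^ n)
    {δ : ℝ} (hδ : 0 < δ) :
    ∀ᶠ L : ℕ in atTop, ∀ᶠ n : ℕ in atTop, ∃ A : Set Ω, MeasurableSet A ∧ μ.real A ≤ δ ∧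
      ∀ ω ∉ A, ∀ t ∈ Set.Icc (0 : ℝ) 1, |∑ i ∈ Finset.range ⌊(n : ℝ) * t⌋₊, g (Z (1 + i) ω) -
        ∑ i ∈ Finset.range ⌊(n : ℝ) * gridTime (L ^ 2) t⌋₊, g (Z (1 + i) ω)| ≤
          δ * Real.sqrt n := by
  set v := B ^ 2 with hv
  have hv0 : 0 < v := by positivity
  have hgv : ∫ x, g x ^ 2 ∂ν ≤ v := by
    have : ∀ x, |g x ^ 2| ≤ v := fun x => by
      rw [abs_pow]
      exact pow_le_pow_left₀ (abs_nonneg _) (hB x) 2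
    exact (le_abs_self _).trans (abs_integral_le_of_bound this)
  set ρ := Real.exp (-(δ ^ 2 / (432 * v))) with hρ
  have hρ1 : ρ < 1 := by
    rw [hρ, Real.exp_lt_one_iff]
    have : 0 < δ ^ 2 / (432 * v) := by positivity
    linarith
  set D := A / v + 324 * B * A / δ ^ 2 with hD
  have t1 := (tendsto_block_bound (D := D) (Real.exp_pos _).le hρ1 hθ hθ1).eventually
    (gt_mem_nhds hδ)
  have t2 := (tendsto_pow_atTop_nhds_zero_of_lt_one hθ hθ1).eventually
    (gt_mem_nhds (show (0 : ℝ) < 1 / 16 by norm_num))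
  filter_upwards [t1, t2, eventually_gt_atTop 0] with L hL1 hL2 hL0
  -- The same L is the spacing of the progressions and the square root of the grid size. For blocks
  -- of length at most 2n/L² the exponent is at least δ²L/(432v), so both ρ^L and θ^L outweigh the
  -- polynomial number of events.
  set m := L ^ 2 with hm
  have hm0 : 0 < m := by positivity
  have hL' : (0 : ℝ) < L := Nat.cast_pos.2 hL0
  have hm' : (0 : ℝ) < m := Nat.cast_pos.2 hm0
  have hsqrt : Tendsto (fun n : ℕ => Real.sqrt n) atTop atTop :=
    Real.tendsto_sqrt_atTop.comp tendsto_natCast_atTop_atTop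
  filter_upwards [hsqrt.eventually_ge_atTop (δ * B * m / (18 * v)), eventually_ge_atTop m,
    eventually_ge_atTop (L * m)] with n hn1 hn2 hn3
  have hn0 : (0 : ℝ) < n := Nat.cast_pos.2 (hm0.trans_le hn2)
  have hs0 : 0 < Real.sqrt n := Real.sqrt_pos.2 hn0
  have hsq : Real.sqrt n ^ 2 = n := Real.sq_sqrt hn0.le
  set n' := n / m + 1 with hn'
  have hn'1 : (n : ℝ) / m ≤ n' := by
    rw [div_le_iff₀ hm']
    have := Nat.lt_div_mul_add (a := n) hm0
    have : n ≤ n' * m := by rw [hn', add_mul, one_mul]; exact this.le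
    exact_mod_cast this
  have hn'2 : (n' : ℝ) ≤ 2 * n / m := by
    have h1 : ((n / m : ℕ) : ℝ) ≤ n / m := Nat.cast_div_le
    have h2 : 1 ≤ (n : ℝ) / m := (one_le_div hm').2 (Nat.cast_le.2 hn2)
    rw [hn']
    push_cast
    have : 2 * (n : ℝ) / m = n / m + n / m := by ring
    linarith
  have hLn' : L ≤ n' := ((Nat.le_div_iff_mul_le hm0).2 hn3).trans (Nat.le_succ _)
  have hn'0 : (0 : ℝ) < n' := Nat.cast_pos.2 (hL0.trans_le hLn')
  set c : ℝ := δ * Real.sqrt n with hc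
  have hc0 : 0 < c := by positivity
  have hc2 : c ^ 2 = δ ^ 2 * n := by rw [hc, mul_pow, hsq]
  have hcB : c * B ≤ 18 * n' * v := by
    rw [div_le_iff₀ (by positivity)] at hn1
    have h1 : c * B * m ≤ 18 * n * v := by
      calc c * B * m = Real.sqrt n * (δ * B * m) := by rw [hc]; ring
        _ ≤ Real.sqrt n * (Real.sqrt n * (18 * v)) := by gcongr
        _ = 18 * Real.sqrt n ^ 2 * v := by ring
        _ = 18 * n * v := by rw [hsq]
    have h2 : c * B ≤ 18 * (n / m) * v := by
      rw [show 18 * ((n : ℝ) / m) * v = 18 * n * v / m by ring, le_div_iff₀ hm']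
      exact h1
    exact h2.trans (by gcongr)
  set X : ℕ → Set Ω := fun k => {ω | ∃ N ≤ n', c ≤ |∑ i ∈ Finset.range N,
    g (Z (1 + ⌊(n : ℝ) * (k / m)⌋₊ + i) ω)|} with hX
  have key : ∀ k, μ.real (X k) ≤ L * (2 * ρ ^ L + D * θ ^ L) := by
    intro k
    refine (chain_tail_opt hinv hZ hg hB0 hB h0 hA hθ hmix hmix2 hL0 hL2.le hv0 hgv hc0 _ hLn'
      hcB).trans (mul_le_mul_of_nonneg_left ?_ hL'.le)
    have e1 : ρ ^ L = Real.exp (-(δ ^ 2 / (432 * v)) * L) := by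
      rw [hρ, ← Real.exp_nat_mul]; ring_nf
    have hmL : (m : ℝ) = (L : ℝ) ^ 2 := by rw [hm]; push_cast; rfl
    have h1 : δ ^ 2 / (432 * v) * L ≤ c ^ 2 / (216 * n' * v * L) := by
      rw [hc2]
      calc δ ^ 2 / (432 * v) * L = δ ^ 2 * n / (216 * (2 * n / m) * v * L) := by
            rw [hmL]; field_simp; norm_num
        _ ≤ _ := by gcongr
    have h2 : 162 * n' * L * B * A * θ ^ L / c ^ 2 ≤ 324 * B * A / δ ^ 2 * θ ^ L := by
      rw [hc2]
      have hL1' : (1 : ℝ) ≤ L := Nat.one_le_cast.2 hL0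
      calc 162 * n' * L * B * A * θ ^ L / (δ ^ 2 * n)
          ≤ 162 * (2 * n / m) * L * B * A * θ ^ L / (δ ^ 2 * n) := by gcongr
        _ = 324 * B * A / δ ^ 2 * θ ^ L * (1 / L) := by rw [hmL]; field_simp; ring
        _ ≤ 324 * B * A / δ ^ 2 * θ ^ L * 1 := by
            refine mul_le_mul_of_nonneg_left ?_ (by positivity)
            rw [div_le_one hL']; exact hL1'
        _ = _ := mul_one _
    have h3 : Real.exp (-(c ^ 2 / (216 * n' * v * L))) ≤ ρ ^ L := by
      rw [e1, Real.exp_le_exp]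
      linarith
    have h4 : D * θ ^ L = A * θ ^ L / v + 324 * B * A / δ ^ 2 * θ ^ L := by rw [hD]; ring
    linarith
  refine ⟨⋃ k ∈ Finset.range (m + 1), X k, ?_, ?_, ?_⟩
  · exact Finset.measurableSet_biUnion _ fun k _ =>
      measurableSet_exists_le (fun N => measurable_chain_sum hZ.measurable hg _ N) _ _
  · refine (measureReal_biUnion_finset_le _ _).trans ((Finset.sum_le_sum fun k _ => key k).trans ?_)
    rw [Finset.sum_const, Finset.card_range, nsmul_eq_mul]
    refine le_trans ?_ hL1.le
    have hD0 : 0 ≤ D := by positivity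
    have : 0 ≤ 2 * ρ ^ L + D * θ ^ L := by positivity
    rw [← mul_assoc]
    refine mul_le_mul_of_nonneg_right ?_ this
    have h1 : (1 : ℝ) ≤ m := Nat.one_le_cast.2 hm0
    have hmL : (m : ℝ) = (L : ℝ) ^ 2 := by rw [hm]; push_cast; rfl
    push_cast
    calc ((m : ℝ) + 1) * L ≤ (m + m) * L := by gcongr
      _ = 2 * (L : ℝ) ^ 3 := by rw [hmL]; ring
  · intro ω hω t ht
    obtain ⟨k, hk, N, hN, e⟩ := exists_block g (fun i => Z i ω) n hm0 ht.1 ht.2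
    rw [e]
    by_contra hcon
    refine hω (Set.mem_biUnion (Finset.mem_coe.2 (Finset.mem_range.2 (Nat.lt_succ_of_le hk))) ?_)
    exact ⟨N, hN, (not_le.1 hcon).le⟩

end Time

/-! ### Continuity of the long-run covariance -/

section Covariance

variable {Ω S T₀ : Type*} {m0 : MeasurableSpace Ω} [MeasurableSpace S] {μ : Measure Ω}
  [IsProbabilityMeasure μ] {ν : Measure S} [IsProbabilityMeasure ν] {P : Kernel S S}
  [IsMarkovKernel P] {Z : ℕ → Ω → S} {f g f' g' : S → ℝ} {C θ M K₁ K₂ b w E : ℝ}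
  {𝓐 : Subalgebra ℝ (S → ℝ)} {φ : T₀ → S → ℝ} {lo up : ℕ → T₀ → S → ℝ}

lemma integral_mul_chain_eq_lagCov (hinv : P.Invariant ν) (hZ : IsMarkovChain μ Z P ν)
    (hf : Measurable f) (hfC : ∀ x, |f x| ≤ C) (hg : Measurable g) (hgC : ∀ x, |g x| ≤ C) (k : ℕ) :
    ∫ ω, f (Z 0 ω) * g (Z k ω) ∂μ = lagCov P ν f g k := by
  have := integral_mul_chain_eq hinv hZ hf hfC hg hgC 0 k
  rwa [zero_add] at this

/-- Both covariances are expectations of products along the chain, and by stationarity each factor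
has law ν; the L¹ distances therefore bound the difference uniformly in the lag. -/
lemma abs_lagCov_sub_le (hinv : P.Invariant ν) (hZ : IsMarkovChain μ Z P ν)
    (hf : Measurable f) (hfC : ∀ x, |f x| ≤ C) (hg : Measurable g) (hgC : ∀ x, |g x| ≤ C)
    (hf' : Measurable f') (hfC' : ∀ x, |f' x| ≤ C) (hg' : Measurable g')
    (hgC' : ∀ x, |g' x| ≤ C) (k : ℕ) :
    |lagCov P ν f g k - lagCov P ν f' g' k| ≤
      C * (∫ x, |f x - f' x| ∂ν + ∫ x, |g x - g' x| ∂ν) := by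
  have hm := hZ.measurable
  have i1 : Integrable (fun ω => f (Z 0 ω) * g (Z k ω)) μ :=
    integrable_of_bound ((hf.comp (hm 0)).mul (hg.comp (hm k)))
      fun ω => abs_mul_le_mul (hfC _) (hgC _)
  have i2 : Integrable (fun ω => f' (Z 0 ω) * g' (Z k ω)) μ :=
    integrable_of_bound ((hf'.comp (hm 0)).mul (hg'.comp (hm k)))
      fun ω => abs_mul_le_mul (hfC' _) (hgC' _)
  have bf : ∀ x, |f x - f' x| ≤ C + C := fun x =>
    (abs_sub _ _).trans (add_le_add (hfC x) (hfC' x))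
  have bg : ∀ x, |g x - g' x| ≤ C + C := fun x =>
    (abs_sub _ _).trans (add_le_add (hgC x) (hgC' x))
  have i3 : Integrable (fun ω => |f (Z 0 ω) - f' (Z 0 ω)|) μ :=
    (integrable_of_bound ((hf.comp (hm 0)).sub (hf'.comp (hm 0))) fun ω => bf _).abs
  have i4 : Integrable (fun ω => |g (Z k ω) - g' (Z k ω)|) μ :=
    (integrable_of_bound ((hg.comp (hm k)).sub (hg'.comp (hm k))) fun ω => bg _).abs
  have e1 : ∫ ω, |f (Z 0 ω) - f' (Z 0 ω)| ∂μ = ∫ x, |f x - f' x| ∂ν :=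
    integral_abs_comp_chain hinv hZ (g := fun x => f x - f' x) (hf.sub hf') bf 0
  have e2 : ∫ ω, |g (Z k ω) - g' (Z k ω)| ∂μ = ∫ x, |g x - g' x| ∂ν :=
    integral_abs_comp_chain hinv hZ (g := fun x => g x - g' x) (hg.sub hg') bg k
  rw [← e1, ← e2, ← integral_mul_chain_eq_lagCov hinv hZ hf hfC hg hgC,
    ← integral_mul_chain_eq_lagCov hinv hZ hf' hfC' hg' hgC', ← integral_sub i1 i2,
    ← integral_add i3 i4]
  have e3 : C * ∫ ω, (|f (Z 0 ω) - f' (Z 0 ω)| + |g (Z k ω) - g' (Z k ω)|) ∂μ =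
      ∫ ω, C * (|f (Z 0 ω) - f' (Z 0 ω)| + |g (Z k ω) - g' (Z k ω)|) ∂μ :=
    (integral_const_mul _ _).symm
  rw [e3]
  change ‖∫ ω, (f (Z 0 ω) * g (Z k ω) - f' (Z 0 ω) * g' (Z k ω)) ∂μ‖ ≤ _
  refine norm_integral_le_of_norm_le ((i3.add i4).const_mul C) (.of_forall fun ω => ?_)
  have e : f (Z 0 ω) * g (Z k ω) - f' (Z 0 ω) * g' (Z k ω) =
    (f (Z 0 ω) - f' (Z 0 ω)) * g (Z k ω) + f' (Z 0 ω) * (g (Z k ω) - g' (Z k ω)) := by ring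
  rw [Real.norm_eq_abs, e]
  refine (abs_add_le _ _).trans ?_
  rw [abs_mul, abs_mul, mul_add]
  refine add_le_add ?_ (mul_le_mul_of_nonneg_right (hfC' _) (abs_nonneg _))
  rw [mul_comm C]
  exact mul_le_mul_of_nonneg_left (hgC _) (abs_nonneg _)

lemma integral_abs_centre_sub_le (hf : Measurable f) (hfC : ∀ x, |f x| ≤ C) (hg : Measurable g)
    (hgC : ∀ x, |g x| ≤ C) :
    ∫ x, |centre ν f x - centre ν g x| ∂ν ≤ 2 * ∫ x, |f x - g x| ∂ν := by
  have i1 : Integrable f ν := integrable_of_bound hf hfC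
  have i2 : Integrable g ν := integrable_of_bound hg hgC
  have i3 : Integrable (fun x => |f x - g x|) ν := (i1.sub i2).abs
  have h1 : |∫ x, f x ∂ν - ∫ x, g x ∂ν| ≤ ∫ x, |f x - g x| ∂ν := by
    rw [← integral_sub i1 i2]
    exact abs_integral_le_integral_abs
  have h2 : ∀ x, |centre ν f x - centre ν g x| ≤ |f x - g x| + ∫ x, |f x - g x| ∂ν := fun x => by
    have e : centre ν f x - centre ν g x = (f x - g x) - (∫ x, f x ∂ν - ∫ x, g x ∂ν) := by
      rw [centre, centre]; ring
    rw [e]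
    exact (abs_sub _ _).trans (add_le_add_right h1 _)
  refine (integral_mono_of_nonneg (.of_forall fun x => abs_nonneg _)
    (i3.add (integrable_const _)) (.of_forall h2)).trans (le_of_eq ?_)
  change ∫ x, (|f x - g x| + ∫ x, |f x - g x| ∂ν) ∂ν = _
  rw [integral_add i3 (integrable_const _)]
  simp
  ring

/-- Levels growing so slowly with the lag that both the size of the brackets and the mixing
coefficients are summable. -/
lemma exists_summable_level (hb : 1 < b) (hb2 : b < 2) (hθ0 : 0 < θ) (hθ1 : θ < 1) (hK₂ : 0 < K₂) :
    ∃ q : ℕ → ℕ, Summable (fun k => (1 / 2 : ℝ) ^ q k) ∧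
      Summable fun k => Real.exp (K₂ * b ^ q k) * θ ^ k := by
  set κ := -Real.log θ / 2 with hκ
  have hlogθ : Real.log θ < 0 := Real.log_neg hθ0 hθ1
  have hκ0 : 0 < κ := by rw [hκ]; linarith
  set c := κ / K₂ with hc
  have hc0 : 0 < c := div_pos hκ0 hK₂
  have hlb : 0 < Real.log b := Real.log_pos hb
  have hb0 : 0 < b := by linarith
  set p := Real.log 2 / Real.log b with hp
  have hp1 : 1 < p := by
    rw [hp, one_lt_div hlb]
    exact Real.log_lt_log hb0 hb2
  -- The level is log_b(ck), with c chosen so that K₂ b^q ≤ K₂ + κk, where e^{-2κ} = θ; half of the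
  -- mixing rate remains. Moreover 2^{-q} is of order k^{-p} with p = log 2 / log b, which exceeds 1
  -- because b < 2. The first sum is shifted by one to avoid log 0.
  refine ⟨fun k => ⌊Real.log (c * k) / Real.log b⌋₊, ?_, ?_⟩
  · rw [← summable_nat_add_iff 1]
    have hs := (((summable_nat_add_iff 1).2 (Real.summable_nat_rpow_inv.2 hp1)).mul_left
      (2 * (c ^ p)⁻¹))
    refine Summable.of_nonneg_of_le (fun k => by positivity) (fun k => ?_) hs
    have hk : (0 : ℝ) < ((k + 1 : ℕ) : ℝ) := Nat.cast_pos.2 (Nat.succ_pos k)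
    have hck : 0 < c * ((k + 1 : ℕ) : ℝ) := mul_pos hc0 hk
    set x := Real.log (c * ((k + 1 : ℕ) : ℝ)) / Real.log b with hx
    have h1 : x - 1 ≤ (⌊x⌋₊ : ℝ) := (Nat.sub_one_lt_floor x).le
    have e1 : (1 / 2 : ℝ) ^ ⌊x⌋₊ = (1 / 2 : ℝ) ^ ((⌊x⌋₊ : ℕ) : ℝ) := (Real.rpow_natCast _ _).symm
    have e2 : (1 / 2 : ℝ) ^ (x - 1) = 2 * (1 / 2 : ℝ) ^ x := by
      rw [Real.rpow_sub_one (by norm_num)]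
      ring
    have e3 : (1 / 2 : ℝ) ^ x = (c ^ p)⁻¹ * (((k + 1 : ℕ) : ℝ) ^ p)⁻¹ := by
      rw [← mul_inv, ← Real.mul_rpow hc0.le hk.le, Real.rpow_def_of_pos (by norm_num),
        Real.rpow_def_of_pos hck, ← Real.exp_neg]
      congr 1
      rw [one_div, Real.log_inv, hx, hp]
      field_simp
    rw [e1, mul_assoc, ← e3, ← e2]
    exact Real.rpow_le_rpow_of_exponent_ge (by norm_num) (by norm_num) h1
  · have hs : Summable fun k : ℕ => Real.exp K₂ * Real.exp (-κ) ^ k :=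
      (summable_geometric_of_lt_one (Real.exp_pos _).le
        (Real.exp_lt_one_iff.2 (by linarith))).mul_left _
    refine Summable.of_nonneg_of_le (fun k => by positivity) (fun k => ?_) hs
    set x := Real.log (c * k) / Real.log b with hx
    have h1 : b ^ ⌊x⌋₊ ≤ 1 + c * k := by
      have hck : 0 ≤ c * k := by positivity
      rcases lt_or_ge x 1 with hlt | hge
      · rw [Nat.floor_eq_zero.2 hlt, pow_zero]
        linarith
      · have hck0 : 0 < c * k := by
          refine lt_of_le_of_ne hck fun h0 => ?_
          rw [hx, ← h0, Real.log_zero, zero_div] at hge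
          linarith
        have h2 : b ^ ⌊x⌋₊ ≤ b ^ x := by
          rw [← Real.rpow_natCast]
          exact Real.rpow_le_rpow_of_exponent_le hb.le (Nat.floor_le (by linarith))
        have h3 : b ^ x = c * k := by
          rw [Real.rpow_def_of_pos hb0, hx, mul_div_cancel₀ _ hlb.ne', Real.exp_log hck0]
        linarith
    have e1 : θ ^ k = Real.exp (Real.log θ * k) := by
      rw [mul_comm, Real.exp_nat_mul, Real.exp_log hθ0]
    rw [e1, ← Real.exp_add, ← Real.exp_nat_mul, ← Real.exp_add, Real.exp_le_exp]
    have h2 : K₂ * b ^ ⌊x⌋₊ ≤ K₂ * (1 + c * k) := mul_le_mul_of_nonneg_left h1 hK₂.le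
    have h3 : K₂ * (1 + c * k) = K₂ + κ * k := by rw [hc]; field_simp
    have h4 : Real.log θ = -(2 * κ) := by rw [hκ]; ring
    rw [h4]
    linarith

namespace IsBracketSystem

variable (h : IsBracketSystem P ν θ M K₁ K₂ b E 𝓐 φ lo up)
include h

lemma integral_abs_sub_lo_le (q : ℕ) (f : T₀) : ∫ x, |φ f x - lo q f x| ∂ν ≤ (1 / 2) ^ q := by
  refine (integral_mono ((h.integrable f).sub (h.integrable_lo q f)).abs
    ((h.integrable_up q f).sub (h.integrable_lo q f)) fun x => ?_).trans (h.small q f)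
  change |φ f x - lo q f x| ≤ up q f x - lo q f x
  rw [abs_of_nonneg (sub_nonneg.2 (h.lo_le q f x))]
  linarith [h.le_up q f x]

lemma integral_abs_lo_sub_lo_le (j q : ℕ) (f : T₀) :
    ∫ x, |lo j f x - lo q f x| ∂ν ≤ (1 / 2) ^ j + (1 / 2) ^ q := by
  have i1 : Integrable (fun x => |φ f x - lo j f x|) ν :=
    ((h.integrable f).sub (h.integrable_lo j f)).abs
  have i2 : Integrable (fun x => |φ f x - lo q f x|) ν :=
    ((h.integrable f).sub (h.integrable_lo q f)).abs
  refine (integral_mono ((h.integrable_lo j f).sub (h.integrable_lo q f)).abs (i1.add i2)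
    fun x => ?_).trans ?_
  · change |lo j f x - lo q f x| ≤ |φ f x - lo j f x| + |φ f x - lo q f x|
    rw [abs_sub_comm (φ f x) (lo j f x)]
    exact abs_sub_le _ _ _
  · change ∫ x, (|φ f x - lo j f x| + |φ f x - lo q f x|) ∂ν ≤ _
    rw [integral_add i1 i2]
    exact add_le_add (h.integral_abs_sub_lo_le j f) (h.integral_abs_sub_lo_le q f)

/-- A summable bound for the covariances of a bounded function with functions approximable by
lower brackets. -/
lemma exists_summable_bound (hinv : P.Invariant ν) (hZ : IsMarkovChain μ Z P ν) (hM : 0 ≤ M)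
    (hK₁ : 0 ≤ K₁) (hb : 1 < b) (hb2 : b < 2) (hθ0 : 0 < θ) (hθ1 : θ < 1) (hK₂ : 0 < K₂) :
    ∃ a : ℕ → ℝ, Summable a ∧
      (∀ g, Measurable g → (∀ x, |g x| ≤ 2 * M) → ∀ f k,
        |lagCov P ν g (centre ν (φ f)) k| ≤ a k) ∧
      ∀ g, Measurable g → (∀ x, |g x| ≤ 2 * M) → ∀ j f k,
        |lagCov P ν g (centre ν (lo j f)) k| ≤ a k := by
  obtain ⟨q, hq1, hq2⟩ := exists_summable_level hb hb2 hθ0 hθ1 hK₂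
  have hlo : ∀ g, Measurable g → (∀ x, |g x| ≤ 2 * M) → ∀ p f k,
      |lagCov P ν g (centre ν (lo p f)) k| ≤
        2 * M * (K₁ * (Real.exp (K₂ * b ^ p) * θ ^ k)) := by
    intro g hg hgM p f k
    rw [← mul_assoc K₁]
    exact (abs_integral_mul_Pop_le hgM (measurable_centre (h.lo_measurable p f))
      (abs_centre_le (ν := ν) (h.lo_bound p f)) k).trans
      (mul_le_mul_of_nonneg_left (h.lo_mix p f k) (by positivity))
  have hgen : ∀ g, Measurable g → (∀ x, |g x| ≤ 2 * M) → ∀ (u : S → ℝ) p f k, Measurable u →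
      (∀ x, |u x| ≤ M) → ∫ x, |u x - lo p f x| ∂ν ≤ 2 * (1 / 2) ^ p →
      |lagCov P ν g (centre ν u) k| ≤ 2 * M * (4 * (1 / 2) ^ p) +
        2 * M * (K₁ * (Real.exp (K₂ * b ^ p) * θ ^ k)) := by
    intro g hg hgM u p f k hu huM hsm
    have h1 := abs_lagCov_sub_le hinv hZ hg hgM (measurable_centre hu) (abs_centre_le (ν := ν) huM) hg hgM
      (measurable_centre (h.lo_measurable p f)) (abs_centre_le (ν := ν) (h.lo_bound p f)) k
    have h2 := integral_abs_centre_sub_le (ν := ν) hu huM (h.lo_measurable p f) (h.lo_bound p f)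
    simp only [sub_self, abs_zero, integral_zero, zero_add] at h1
    have h3 : 2 * M * ∫ x, |centre ν u x - centre ν (lo p f) x| ∂ν ≤
        2 * M * (4 * (1 / 2) ^ p) :=
      mul_le_mul_of_nonneg_left (by linarith) (by positivity)
    have h4 := hlo g hg hgM p f k
    have h5 := abs_sub_abs_le_abs_sub (lagCov P ν g (centre ν u) k)
      (lagCov P ν g (centre ν (lo p f)) k)
    linarith
  refine ⟨fun k => 2 * M * (4 * (1 / 2) ^ q k) +
        2 * M * (K₁ * (Real.exp (K₂ * b ^ q k) * θ ^ k)),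
    ((hq1.mul_left 4).mul_left _).add ((hq2.mul_left K₁).mul_left _), ?_, ?_⟩
  · intro g hg hgM f k
    refine hgen g hg hgM (φ f) (q k) f k (h.measurable f) (h.bound f) ?_
    have := h.integral_abs_sub_lo_le (q k) f
    have : (0 : ℝ) ≤ (1 / 2) ^ q k := by positivity
    linarith
  · intro g hg hgM j f k
    -- A bracket finer than level q k is compared in L¹ with the bracket at that level; a coarser
    -- one has a smaller mixing constant and is estimated directly. The bound is therefore uniform
    -- in j.
    rcases le_total (q k) j with hj | hj
    · refine hgen g hg hgM (lo j f) (q k) f k (h.lo_measurable j f) (h.lo_bound j f) ?_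
      have h1 := h.integral_abs_lo_sub_lo_le j (q k) f
      have h2 : (1 / 2 : ℝ) ^ j ≤ (1 / 2) ^ q k :=
        pow_le_pow_of_le_one (by norm_num) (by norm_num) hj
      linarith
    · refine (hlo g hg hgM j f k).trans ?_
      have h1 : b ^ j ≤ b ^ q k := pow_le_pow_right₀ hb.le hj
      have h2 : Real.exp (K₂ * b ^ j) ≤ Real.exp (K₂ * b ^ q k) :=
        Real.exp_le_exp.2 (mul_le_mul_of_nonneg_left h1 hK₂.le)
      have h3 : 2 * M * (K₁ * (Real.exp (K₂ * b ^ j) * θ ^ k)) ≤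
        2 * M * (K₁ * (Real.exp (K₂ * b ^ q k) * θ ^ k)) := by gcongr
      have h4 : 0 ≤ 2 * M * (4 * (1 / 2 : ℝ) ^ q k) := by positivity
      linarith

lemma summable_lagCov_centre (hinv : P.Invariant ν) (hZ : IsMarkovChain μ Z P ν) (hM : 0 ≤ M)
    (hK₁ : 0 ≤ K₁) (hb : 1 < b) (hb2 : b < 2) (hθ0 : 0 < θ) (hθ1 : θ < 1) (hK₂ : 0 < K₂)
    (f f' : T₀) : Summable (lagCov P ν (centre ν (φ f)) (centre ν (φ f'))) := by
  obtain ⟨a, ha, h1, -⟩ := h.exists_summable_bound hinv hZ hM hK₁ hb hb2 hθ0 hθ1 hK₂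
  exact Summable.of_norm_bounded ha fun k =>
    h1 _ (measurable_centre (h.measurable f)) (abs_centre_le (ν := ν) (h.bound f)) f' k

lemma tendsto_lagCov_centre (hinv : P.Invariant ν) (hZ : IsMarkovChain μ Z P ν) (hM : 0 ≤ M)
    (f f' : T₀) (k : ℕ) :
    Tendsto (fun j => lagCov P ν (centre ν (lo j f)) (centre ν (lo j f')) k) atTop
      (𝓝 (lagCov P ν (centre ν (φ f)) (centre ν (φ f')) k)) := by
  have h0 : Tendsto (fun j : ℕ => 8 * M * (1 / 2 : ℝ) ^ j) atTop (𝓝 0) := by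
    have := (tendsto_pow_atTop_nhds_zero_of_lt_one (r := (1 / 2 : ℝ)) (by norm_num)
      (by norm_num)).const_mul (8 * M)
    rwa [mul_zero] at this
  refine tendsto_iff_dist_tendsto_zero.2 (squeeze_zero (fun _ => dist_nonneg) (fun j => ?_) h0)
  rw [dist_comm, Real.dist_eq]
  have h1 := abs_lagCov_sub_le hinv hZ (measurable_centre (h.measurable f))
    (abs_centre_le (ν := ν) (h.bound f)) (measurable_centre (h.measurable f')) (abs_centre_le (ν := ν) (h.bound f'))
    (measurable_centre (h.lo_measurable j f)) (abs_centre_le (ν := ν) (h.lo_bound j f))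
    (measurable_centre (h.lo_measurable j f')) (abs_centre_le (ν := ν) (h.lo_bound j f')) k
  refine h1.trans ?_
  have hh : ∀ f, ∫ x, |centre ν (φ f) x - centre ν (lo j f) x| ∂ν ≤ 2 * (1 / 2) ^ j := fun f =>
    (integral_abs_centre_sub_le (ν := ν) (h.measurable f) (h.bound f) (h.lo_measurable j f)
      (h.lo_bound j f)).trans (mul_le_mul_of_nonneg_left (h.integral_abs_sub_lo_le j f) zero_le_two)
  calc _ ≤ 2 * M * (2 * (1 / 2) ^ j + 2 * (1 / 2) ^ j) :=
        mul_le_mul_of_nonneg_left (add_le_add (hh f) (hh f')) (by positivity)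
    _ = _ := by ring

/-- Dominated convergence for series: each lag covariance converges because the lower brackets
converge in L¹, and the dominating sequence does not depend on the level. -/
theorem tendsto_kernelLongRunCov (hinv : P.Invariant ν) (hZ : IsMarkovChain μ Z P ν) (hM : 0 ≤ M)
    (hK₁ : 0 ≤ K₁) (hb : 1 < b) (hb2 : b < 2) (hθ0 : 0 < θ) (hθ1 : θ < 1) (hK₂ : 0 < K₂)
    (f f' : T₀) :
    Tendsto (fun j => kernelLongRunCov P ν (centre ν (lo j f)) (centre ν (lo j f'))) atTop
      (𝓝 (kernelLongRunCov P ν (centre ν (φ f)) (centre ν (φ f')))) := by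
  obtain ⟨a, ha, -, h2⟩ := h.exists_summable_bound hinv hZ hM hK₁ hb hb2 hθ0 hθ1 hK₂
  refine Tendsto.add (tendsto_tsum_of_dominated_convergence ha
    (fun k => h.tendsto_lagCov_centre hinv hZ hM f f' k) (.of_forall fun j k => ?_))
    (tendsto_tsum_of_dominated_convergence ((summable_nat_add_iff 1).2 ha)
    (fun k => h.tendsto_lagCov_centre hinv hZ hM f' f (k + 1)) (.of_forall fun j k => ?_))
  · exact h2 _ (measurable_centre (h.lo_measurable j f)) (abs_centre_le (ν := ν) (h.lo_bound j f)) j f' k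
  · exact h2 _ (measurable_centre (h.lo_measurable j f')) (abs_centre_le (ν := ν) (h.lo_bound j f')) j f
      (k + 1)

end IsBracketSystem

end Covariance

/-! ### Convergence of the sequential process indexed by a bracket system -/

section BracketLimit

variable {Ω S T₀ : Type*} {m0 : MeasurableSpace Ω} [MeasurableSpace S] {μ : Measure Ω}
  [IsProbabilityMeasure μ] {ν : Measure S} [IsProbabilityMeasure ν] {P : Kernel S S}
  [IsMarkovKernel P] {Z : ℕ → Ω → S} {f g : S → ℝ} {θ M K₁ K₂ b w E : ℝ}
  {𝓐 : Subalgebra ℝ (S → ℝ)} {φ : T₀ → S → ℝ} {lo up : ℕ → T₀ → S → ℝ}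

/-- Exchanging the arguments exchanges the two series except for lag 0, which is symmetric. -/
lemma kernelLongRunCov_comm (hfg : Summable (lagCov P ν f g)) (hgf : Summable (lagCov P ν g f)) :
    kernelLongRunCov P ν f g = kernelLongRunCov P ν g f := by
  have e : lagCov P ν f g 0 = lagCov P ν g f 0 := by
    simp only [lagCov, Function.iterate_zero, id_eq, mul_comm]
  rw [kernelLongRunCov, kernelLongRunCov, hfg.tsum_eq_zero_add, hgf.tsum_eq_zero_add, e]
  ring

lemma centre_mem (hg : g ∈ 𝓐) : centre ν g ∈ 𝓐 := by
  have : centre ν g = g - algebraMap ℝ (S → ℝ) (∫ y, g y ∂ν) := rfl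
  rw [this]
  exact sub_mem hg (𝓐.algebraMap_mem _)

lemma tendsto_gridTime {m : ℕ → ℕ} (hm0 : ∀ j, 0 < m j) (hm : Tendsto m atTop atTop) {t : ℝ}
    (ht : 0 ≤ t) : Tendsto (fun j => gridTime (m j) t) atTop (𝓝 t) := by
  have h1 : Tendsto (fun j => t - 1 / (m j : ℝ)) atTop (𝓝 t) := by
    have := (tendsto_one_div_atTop_nhds_zero_nat (𝕜 := ℝ)).comp hm
    simpa using this.const_sub t
  refine tendsto_of_tendsto_of_tendsto_of_le_of_le h1 tendsto_const_nhds (fun j => ?_)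
    fun j => gridTime_le (hm0 j) ht
  have := lt_gridTime_add (hm0 j) t
  simp only
  linarith

lemma finite_range_gridTime (m : ℕ) : (Set.range fun t : Set.Icc (0 : ℝ) 1 =>
    gridTime m t).Finite := by
  refine ((Set.finite_Iic m).image fun k : ℕ => (k : ℝ) / m).subset ?_
  rintro _ ⟨t, rfl⟩
  refine ⟨⌊(m : ℝ) * t⌋₊, Nat.floor_le_of_le ?_, rfl⟩
  have := t.2.2
  have hm : (0 : ℝ) ≤ m := Nat.cast_nonneg m
  nlinarith

lemma exists_measurableSet_of_ae {p : Ω → Prop} (hp : ∀ᵐ ω ∂μ, p ω) :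
    ∃ D, MeasurableSet D ∧ μ.real D = 0 ∧ ∀ ω ∉ D, p ω := by
  refine ⟨toMeasurable μ {ω | ¬ p ω}, measurableSet_toMeasurable μ _, ?_, fun ω hω => ?_⟩
  · rw [measureReal_def, measure_toMeasurable, ae_iff.1 hp, ENNReal.toReal_zero]
  · by_contra hc
    exact hω (subset_toMeasurable μ _ hc)

namespace IsBracketSystem

variable (h : IsBracketSystem P ν θ M K₁ K₂ b E 𝓐 φ lo up)
include h

lemma finite_range_lo (q : ℕ) : (Set.range (lo q)).Finite := by
  obtain ⟨K₀, -, hK⟩ := h.card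
  refine ((hK q).1.image Prod.fst).subset ?_
  rintro _ ⟨f, rfl⟩
  exact ⟨_, ⟨f, rfl⟩, rfl⟩

/-- The partial sum processes are uniformly close to finitely many of their coordinates. -/
theorem exists_approximation (h𝓐 : IsMixingAlgebra P ν θ 𝓐) (hinv : P.Invariant ν)
    (hZ : IsMarkovChain μ Z P ν) (hθ0 : 0 < θ) (hθ1 : θ < 1) (hM : 0 < M) (hK₁ : 0 ≤ K₁)
    (hK₂ : 0 ≤ K₂) (hb : 1 < b) (hw : 1 < w) (hbw : b * w ^ 4 = 2) (hE : 1 ≤ E) {δ : ℝ}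
    (hδ : 0 < δ) (j₁ : ℕ) :
    ∃ q ≥ j₁, ∃ m : ℕ, 0 < m ∧ j₁ ≤ m ∧ ∀ᶠ n : ℕ in atTop, ∃ A : Set Ω, MeasurableSet A ∧
      μ.real A ≤ δ ∧ ∀ ω ∉ A, ∀ f, ∀ t ∈ Set.Icc (0 : ℝ) 1,
        |∑ i ∈ Finset.range ⌊(n : ℝ) * t⌋₊, centre ν (φ f) (Z (1 + i) ω) -
          ∑ i ∈ Finset.range ⌊(n : ℝ) * gridTime m t⌋₊, centre ν (lo q f) (Z (1 + i) ω)| ≤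
            δ * Real.sqrt n := by
  obtain ⟨q, hq, hch⟩ := h.chaining hinv hZ hθ0 hθ1 hM hK₁ hK₂ hb hw hbw hE (half_pos hδ) j₁
  set W := (h.finite_range_lo q).toFinset with hW
  -- Half of the budget was spent on chaining; the other half is shared by the finitely many lower
  -- brackets. The added 1 keeps the denominator positive and gives δ' ≤ δ/2.
  set δ' := δ / (2 * (W.card + 1)) with hδ'
  have hδ'0 : 0 < δ' := by positivity
  have hδ'1 : W.card * δ' ≤ δ / 2 := by
    rw [hδ', mul_div_assoc', div_le_iff₀ (by positivity)]
    nlinarith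
  have hδ'2 : δ' ≤ δ / 2 := by
    rw [hδ']
    refine div_le_div_of_nonneg_left hδ.le two_pos ?_
    have : (0 : ℝ) ≤ W.card := Nat.cast_nonneg _
    linarith
  have hstep : ∀ u ∈ W, ∀ᶠ L : ℕ in atTop, ∀ᶠ n : ℕ in atTop, ∃ A : Set Ω, MeasurableSet A ∧
      μ.real A ≤ δ' ∧ ∀ ω ∉ A, ∀ t ∈ Set.Icc (0 : ℝ) 1,
        |∑ i ∈ Finset.range ⌊(n : ℝ) * t⌋₊, centre ν u (Z (1 + i) ω) -
        ∑ i ∈ Finset.range ⌊(n : ℝ) * gridTime (L ^ 2) t⌋₊, centre ν u (Z (1 + i) ω)| ≤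
          δ' * Real.sqrt n := by
    intro u hu
    obtain ⟨f, rfl⟩ := (h.finite_range_lo q).mem_toFinset.1 hu
    have hmem := centre_mem (ν := ν) (h.lo_mem q f)
    obtain ⟨A, hA, hAm⟩ := h𝓐.mixing _ hmem
    have hmem2 : (fun x => centre ν (lo q f) x ^ 2) ∈ 𝓐 := pow_mem hmem 2
    obtain ⟨A', hA', hAm'⟩ := h𝓐.mixing _ hmem2
    have h0 := integral_centre (ν := ν) (h.lo_measurable q f) (h.lo_bound q f)
    rw [h0] at hAm
    simp only [sub_zero] at hAm
    refine eventually_time_discretization hinv hZ (measurable_centre (h.lo_measurable q f))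
      (B := 2 * M) (A := max A A') (by positivity) (abs_centre_le (h.lo_bound q f)) h0
      (hA.trans (le_max_left _ _)) hθ0.le hθ1 (fun n => (hAm n).trans ?_)
      (fun n => (hAm' n).trans ?_) hδ'0
    · exact mul_le_mul_of_nonneg_right (le_max_left _ _) (pow_nonneg hθ0.le n)
    · exact mul_le_mul_of_nonneg_right (le_max_right _ _) (pow_nonneg hθ0.le n)
  obtain ⟨L, hL, hLj⟩ := (((Finset.eventually_all W).2 hstep).and
    (eventually_ge_atTop (j₁ + 1))).exists
  have hL0 : 0 < L := by omega
  refine ⟨q, hq, L ^ 2, by positivity, ?_, ?_⟩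
  · have : L ≤ L ^ 2 := Nat.le_self_pow (by norm_num) L
    omega
  filter_upwards [hch, (Finset.eventually_all W).2 hL] with n ⟨A, hAm, hA, hA'⟩ hn
  choose! D hDm hD hD' using hn
  refine ⟨A ∪ ⋃ u ∈ W, D u, hAm.union (Finset.measurableSet_biUnion _ hDm), ?_, ?_⟩
  · have h1 : μ.real (⋃ u ∈ W, D u) ≤ δ / 2 := by
      refine (measureReal_biUnion_finset_le _ _).trans ((Finset.sum_le_sum hD).trans ?_)
      rw [Finset.sum_const, nsmul_eq_mul]
      exact hδ'1
    have h2 := measureReal_union_le (μ := μ) A (⋃ u ∈ W, D u)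
    linarith
  · intro ω hω f t ht
    rw [Set.mem_union, not_or] at hω
    have hf : lo q f ∈ W := (h.finite_range_lo q).mem_toFinset.2 ⟨f, rfl⟩
    have hω2 : ω ∉ D (lo q f) := fun hc => hω.2 (Set.mem_biUnion (Finset.mem_coe.2 hf) hc)
    have hfl : ⌊(n : ℝ) * t⌋₊ ≤ n := by
      refine Nat.floor_le_of_le ?_
      have : (0 : ℝ) ≤ n := Nat.cast_nonneg n
      nlinarith [ht.2]
    have h1 := hA' ω hω.1 f _ hfl
    have h2 := hD' _ hf ω hω2 t ht
    have h3 : δ' * Real.sqrt n ≤ δ / 2 * Real.sqrt n :=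
      mul_le_mul_of_nonneg_right hδ'2 (Real.sqrt_nonneg _)
    refine (abs_sub_le _ (∑ i ∈ Finset.range ⌊(n : ℝ) * t⌋₊,
      centre ν (lo q f) (Z (1 + i) ω)) _).trans ?_
    linarith

/-- Convergence in distribution of the sequential process indexed by the functions `φ f`. -/
theorem exists_limit (h𝓐 : IsMixingAlgebra P ν θ 𝓐) (hinv : P.Invariant ν)
    (hZ : IsMarkovChain μ Z P ν) (hθ0 : 0 < θ) (hθ1 : θ < 1) (hM : 0 < M) (hK₁ : 0 ≤ K₁)
    (hK₂ : 0 < K₂) (hb : 1 < b) (hb2 : b < 2) (hw : 1 < w) (hbw : b * w ^ 4 = 2) (hE : 1 ≤ E)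
    {U : ℕ → Ω → ℓ^∞(T₀ × Set.Icc (0 : ℝ) 1, ℝ)}
    (hU : ∀ᵐ ω ∂μ, ∀ n (p : T₀ × Set.Icc (0 : ℝ) 1), U n ω p = 1 / Real.sqrt n *
      ∑ i ∈ Finset.range ⌊(n : ℝ) * p.2⌋₊, centre ν (φ p.1) (Z (1 + i) ω)) :
    ∃ κ : Measure (ℓ^∞(T₀ × Set.Icc (0 : ℝ) 1, ℝ)), IsProbabilityMeasure κ ∧
      IsTightMeasureSet {κ} ∧
      IsGaussianProcess (fun (p : T₀ × Set.Icc (0 : ℝ) 1) (x : ℓ^∞(T₀ × Set.Icc (0 : ℝ) 1, ℝ)) =>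
        x p) κ ∧ (∀ p : T₀ × Set.Icc (0 : ℝ) 1, ∫ x, x p ∂κ = 0) ∧
      (∀ p q : T₀ × Set.Icc (0 : ℝ) 1, cov[fun x => x p, fun x => x q; κ] =
        min (p.2 : ℝ) q.2 * kernelLongRunCov P ν (centre ν (φ p.1)) (centre ν (φ q.1))) ∧
      ConvergesInDistribution μ U κ := by
  choose q hq m hm0 hm happ using fun j : ℕ => h.exists_approximation h𝓐 hinv hZ hθ0 hθ1 hM hK₁
    hK₂.le hb hw hbw hE (δ := (1 / 2) ^ j) (by positivity) j
  set π₀ : ℕ → T₀ × Set.Icc (0 : ℝ) 1 → (S → ℝ) × ℝ :=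
    fun j p => (lo (q j) p.1, gridTime (m j) p.2) with hπ₀
  have hfin : ∀ j, (Set.range (π₀ j)).Finite := fun j => by
    refine ((h.finite_range_lo (q j)).prod (finite_range_gridTime (m j))).subset ?_
    rintro _ ⟨p, rfl⟩
    exact ⟨⟨p.1, rfl⟩, ⟨p.2, rfl⟩⟩
  -- The pairs of a lower bracket and a grid time that occur at some level: finitely many at each
  -- level, hence countably many coordinates in all, rich enough to approximate the entire process.
  set I : Set ((S → ℝ) × ℝ) := ⋃ j, Set.range (π₀ j) with hI
  have hcount : Countable I := (Set.countable_iUnion fun j => (hfin j).countable).to_subtype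
  let π : ℕ → T₀ × Set.Icc (0 : ℝ) 1 → I := fun j p => ⟨π₀ j p, Set.mem_iUnion.2 ⟨j, p, rfl⟩⟩
  have hImem : ∀ i : I, i.1.1 ∈ 𝓐 ∧ 0 ≤ i.1.2 ∧ i.1.2 ≤ 1 := by
    rintro ⟨i, hi⟩
    obtain ⟨j, p, rfl⟩ := Set.mem_iUnion.1 hi
    exact ⟨h.lo_mem _ _, gridTime_nonneg _ _, (gridTime_le (hm0 j) p.2.2.1).trans p.2.2.2⟩
  have hgm : ∀ i : I, Measurable i.1.1 := fun i => h𝓐.measurable _ (hImem i).1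
  let X : ℕ → Ω → I → ℝ := fun n ω i => 1 / Real.sqrt n *
    ∑ k ∈ Finset.range ⌊(n : ℝ) * i.1.2⌋₊, centre ν i.1.1 (Z (1 + k) ω)
  have hX : ∀ n, Measurable (X n) := fun n => measurable_pi_lambda _ fun i =>
    (measurable_chain_sum hZ.measurable (measurable_centre (hgm i)) 1 _).const_mul _
  have hsum := h.summable_lagCov_centre hinv hZ hM.le hK₁ hb hb2 hθ0 hθ1 hK₂
  refine exists_gaussian_limit hX (c := fun i k => min i.1.2 k.1.2 *
    kernelLongRunCov P ν (centre ν i.1.1) (centre ν k.1.1)) (fun J a => ?_) (π := π) (fun j => ?_)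
    (fun j => ?_) (fun p p' => ?_) (fun p p' => ?_)
  · have key := tendsto_charFun_chain (g := fun i : I => centre ν i.1.1)
      (N := fun i n => ⌊(n : ℝ) * i.1.2⌋₊) (t := fun i => i.1.2) hinv hZ hθ0.le hθ1 h𝓐 J a
      (fun i => centre_mem (hImem i).1) (fun i => by
        obtain ⟨C, hC⟩ := h𝓐.bounded _ (hImem i).1
        exact integral_centre (hgm i) hC) (fun i n => by
        refine Nat.floor_le_of_le ?_
        have : (0 : ℝ) ≤ n := Nat.cast_nonneg n
        nlinarith [(hImem i).2.2]) fun i => by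
        have := (tendsto_nat_floor_mul_div_atTop (hImem i).2.1).comp
          (tendsto_natCast_atTop_atTop (R := ℝ))
        refine this.congr fun n => ?_
        simp only [Function.comp_apply, mul_comm]
    simp only [add_comm _ 1] at key
    exact key
  · refine Set.Finite.of_finite_image ?_ Subtype.val_injective.injOn
    refine (hfin j).subset ?_
    rintro _ ⟨_, ⟨p, rfl⟩, rfl⟩
    exact ⟨p, rfl⟩
  -- The identity for U holds only almost surely; its null set is enclosed in a measurable one and
  -- added to the exceptional event.
  · obtain ⟨D, hDm, hD0, hD⟩ := exists_measurableSet_of_ae hU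
    filter_upwards [happ j, eventually_gt_atTop 0] with n ⟨A, hAm, hA, hA'⟩ hn
    refine ⟨A ∪ D, hAm.union hDm, (measureReal_union_le A D).trans (by rw [hD0, add_zero]; exact hA),
      fun ω hω p => ?_⟩
    rw [Set.mem_union, not_or] at hω
    have hs : 0 < Real.sqrt n := Real.sqrt_pos.2 (Nat.cast_pos.2 hn)
    rw [hD ω hω.2]
    change |1 / Real.sqrt n * _ - 1 / Real.sqrt n * ∑ i ∈ Finset.range ⌊(n : ℝ) *
      gridTime (m j) p.2⌋₊, centre ν (lo (q j) p.1) (Z (1 + i) ω)| ≤ _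
    rw [← mul_sub, abs_mul, abs_of_pos (one_div_pos.2 hs), one_div_mul_eq_div, div_le_iff₀ hs]
    exact hA' ω hω.1 p.1 p.2 p.2.2
  · rw [min_comm, kernelLongRunCov_comm (hsum _ _) (hsum _ _)]
  · have hqt : Tendsto q atTop atTop := tendsto_atTop_mono hq tendsto_id
    have hmt : Tendsto m atTop atTop := tendsto_atTop_mono hm tendsto_id
    exact ((tendsto_gridTime hm0 hmt p.2.2.1).min (tendsto_gridTime hm0 hmt p'.2.2.1)).mul
      ((h.tendsto_kernelLongRunCov hinv hZ hM.le hK₁ hb hb2 hθ0 hθ1 hK₂ p.1 p'.1).comp hqt)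

end IsBracketSystem

end BracketLimit

/-! ### Covers by brackets at dyadic levels -/

section Levels

variable {S B : Type*} [MeasurableSpace S] [NormedAddCommGroup B] [NormedSpace ℂ B]
  {ι : B →ₗ[ℂ] (S → ℂ)} {ν : Measure S} {F : Set (S → ℝ)} {G : Set B} {s : ℝ≥0∞}

/-- A finite infimum of natural numbers is attained: some cover lies strictly below the infimum plus
one. -/
lemma exists_cover_of_bracketingNumber_ne_top {ε A : ℝ}
    (h : bracketingNumber ι ν F G ε A s ≠ ⊤) : ∃ W : Finset (B × B),
      (∀ u ∈ W, IsBracket ι ν G ε A s u) ∧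
      (∀ f ∈ F, ∃ u ∈ W, ∀ x, (ι u.1 x).re ≤ f x ∧ f x ≤ (ι u.2 x).re) ∧
      (W.card : ℕ∞) ≤ bracketingNumber ι ν F G ε A s := by
  have h1 : bracketingNumber ι ν F G ε A s < bracketingNumber ι ν F G ε A s + 1 :=
    ENat.lt_add_one_iff h |>.2 le_rfl
  conv_lhs at h1 => rw [bracketingNumber]
  obtain ⟨W, hW⟩ := iInf_lt_iff.1 h1
  obtain ⟨hp, hW⟩ := iInf_lt_iff.1 hW
  exact ⟨W, hp.1, hp.2, (ENat.lt_add_one_iff h).1 hW⟩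

/-- The integrability condition on the bracketing numbers bounds them at each dyadic level. -/
lemma bracketingNumber_sq_le {r : ℝ} {N : ℝ → ℝ≥0∞} {R : ℕ} (hR : r ≤ R) (q : ℕ) :
    N ((1 / 2) ^ q) ^ 2 * ENNReal.ofReal (((1 / 2) ^ (q + 1)) ^ (R + 1)) ≤
      ∫⁻ ε in Set.Ioo (0 : ℝ) 1, ENNReal.ofReal (ε ^ r) * (⨆ δ ∈ Set.Icc ε 1, N δ ^ 2) := by
  set ε₀ : ℝ := (1 / 2) ^ (q + 1) with hε₀
  have hε0 : 0 < ε₀ := by positivity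
  have hε1 : (1 / 2 : ℝ) ^ q = 2 * ε₀ := by rw [hε₀, pow_succ]; ring
  have hle1 : (1 / 2 : ℝ) ^ q ≤ 1 := pow_le_one₀ (by norm_num) (by norm_num)
  have hsub : Set.Ioo ε₀ ((1 / 2) ^ q) ⊆ Set.Ioo 0 1 := fun x hx =>
    ⟨hε0.trans hx.1, hx.2.trans_le hle1⟩
  refine le_trans ?_ (lintegral_mono_set hsub)
  -- For ε between ε₀ and 2ε₀ = 2^{-q} the supremum includes δ = 2^{-q}, and ε^r ≥ ε₀^R because ε <
  -- 1 and r ≤ R. The length ε₀ of the interval supplies the last factor.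
  have h1 : ∫⁻ _ in Set.Ioo ε₀ ((1 / 2) ^ q), ENNReal.ofReal (ε₀ ^ R) * N ((1 / 2) ^ q) ^ 2 ≤
      ∫⁻ ε in Set.Ioo ε₀ ((1 / 2) ^ q),
        ENNReal.ofReal (ε ^ r) * (⨆ δ ∈ Set.Icc ε 1, N δ ^ 2) := by
    refine setLIntegral_mono' measurableSet_Ioo fun ε hε => ?_
    have hεp : 0 < ε := hε0.trans hε.1
    refine mul_le_mul' (ENNReal.ofReal_le_ofReal ?_)
      (le_iSup₂ (f := fun δ (_ : δ ∈ Set.Icc ε 1) => N δ ^ 2) ((1 / 2) ^ q) ⟨hε.2.le, hle1⟩)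
    calc ε₀ ^ R ≤ ε ^ R := pow_le_pow_left₀ hε0.le hε.1.le R
      _ = ε ^ (R : ℝ) := (Real.rpow_natCast _ _).symm
      _ ≤ ε ^ r := Real.rpow_le_rpow_of_exponent_ge hεp (hsub hε).2.le hR
  refine le_trans (le_of_eq ?_) h1
  rw [setLIntegral_const, Real.volume_Ioo, hε1, show 2 * ε₀ - ε₀ = ε₀ by ring, pow_succ ε₀ R,
    ENNReal.ofReal_mul (by positivity), ← hε1]
  ring

/-- Covers of `F` by brackets of size `2⁻ᑫ` whose norms grow at a stretched exponential rate. -/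
theorem exists_bracket_levels (hF : CondF ι ν F G s) : ∃ C b w K E : ℝ, 0 < C ∧ 1 < b ∧ b < 2 ∧
    1 < w ∧ b * w ^ 4 = 2 ∧ 0 ≤ K ∧ 1 ≤ E ∧ ∃ W : ℕ → Finset (B × B), ∀ q,
      (∀ u ∈ W q, IsBracket ι ν G ((1 / 2) ^ q) (Real.exp (C * b ^ q)) s u) ∧
      (∀ f ∈ F, ∃ u ∈ W q, ∀ x, (ι u.1 x).re ≤ f x ∧ f x ≤ (ι u.2 x).re) ∧
      ((W q).card : ℝ) ≤ K * E ^ q := by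
  obtain ⟨C, r, γ, hC, -, hγ, hI⟩ := hF
  obtain ⟨R, hR⟩ := exists_nat_ge r
  set N : ℝ → ℕ∞ := fun δ => bracketingNumber ι ν F G δ (Real.exp (C * δ ^ (-(1 / γ)))) s with hN
  set J := ∫⁻ ε in Set.Ioo (0 : ℝ) 1, ENNReal.ofReal (ε ^ r) *
      (⨆ δ ∈ Set.Icc ε 1, ((N δ : ℕ∞) : ℝ≥0∞) ^ 2) with hJ
  have hγ0 : 0 < γ := by linarith
  have hγ1 : 1 / γ < 1 := (div_lt_one hγ0).2 hγ
  have hkey := fun q => bracketingNumber_sq_le (N := fun δ => ((N δ : ℕ∞) : ℝ≥0∞)) hR q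
  have hJ' : J ≠ ⊤ := hI.ne
  have hfin : ∀ q : ℕ, N ((1 / 2) ^ q) ≠ ⊤ := by
    intro q hq
    have h1 := hkey q
    simp only [hq, ENat.toENNReal_top] at h1
    rw [ENNReal.top_pow two_ne_zero, ENNReal.top_mul
      (ENNReal.ofReal_pos.2 (by positivity)).ne', top_le_iff] at h1
    exact hJ' h1
  choose W hW1 hW2 hW3 using fun q => exists_cover_of_bracketingNumber_ne_top (hfin q)
  -- Here b comes from δ^{-1/γ} at δ = 2^{-q}, and w is determined by b w⁴ = 2; γ > 1 is what makes
  -- b < 2 and w > 1. The growth rate 2^{R+1} is read off from the dyadic bound for the squared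
  -- bracketing numbers.
  refine ⟨C, 2 ^ (1 / γ), 2 ^ ((1 - 1 / γ) / 4), J.toReal * 2 ^ (R + 1), 2 ^ (R + 1), hC,
    Real.one_lt_rpow one_lt_two (by positivity), ?_, Real.one_lt_rpow one_lt_two (by linarith),
    ?_, by positivity, one_le_pow₀ one_le_two, W, fun q => ⟨?_, hW2 q, ?_⟩⟩
  · calc (2 : ℝ) ^ (1 / γ) < 2 ^ (1 : ℝ) := Real.rpow_lt_rpow_of_exponent_lt one_lt_two hγ1
      _ = 2 := Real.rpow_one 2
  · rw [← Real.rpow_mul_natCast zero_le_two, ← Real.rpow_add two_pos]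
    push_cast
    rw [show 1 / γ + (1 - 1 / γ) / 4 * 4 = 1 by ring, Real.rpow_one]
  · have e : ((1 / 2 : ℝ) ^ q) ^ (-(1 / γ)) = (2 ^ (1 / γ)) ^ q := by
      rw [← Real.rpow_natCast, ← Real.rpow_natCast, ← Real.rpow_mul (by norm_num),
        ← Real.rpow_mul (by norm_num), one_div (2 : ℝ), Real.inv_rpow (by norm_num),
        ← Real.rpow_neg (by norm_num)]
      congr 1
      ring
    rw [← e]
    exact hW1 q
  · have h1 : (((W q).card : ℕ∞) : ℝ≥0∞) ≤ ((N ((1 / 2) ^ q) : ℕ∞) : ℝ≥0∞) :=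
      ENat.toENNReal_le.2 (hW3 q)
    have h2 : ((W q).card : ℝ≥0∞) ^ 2 * ENNReal.ofReal (((1 / 2) ^ (q + 1)) ^ (R + 1)) ≤ J := by
      refine le_trans ?_ (hkey q)
      rw [ENat.toENNReal_coe] at h1
      gcongr
    have h3 := ENNReal.toReal_mono hJ' h2
    rw [ENNReal.toReal_mul, ENNReal.toReal_pow, ENNReal.toReal_natCast,
      ENNReal.toReal_ofReal (by positivity)] at h3
    have h4 : ((W q).card : ℝ) ≤ ((W q).card : ℝ) ^ 2 := by
      exact_mod_cast Nat.le_self_pow two_ne_zero _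
    have e : ((1 / 2 : ℝ) ^ (q + 1)) ^ (R + 1) * (2 ^ (R + 1) * (2 ^ (R + 1)) ^ q) = 1 := by
      rw [← pow_succ', ← pow_mul, ← pow_mul, mul_comm (R + 1) (q + 1), ← mul_pow]
      norm_num
    have h5 : ((W q).card : ℝ) ^ 2 = ((W q).card : ℝ) ^ 2 * ((1 / 2 : ℝ) ^ (q + 1)) ^ (R + 1) *
        (2 ^ (R + 1) * (2 ^ (R + 1)) ^ q) := by rw [mul_assoc, e, mul_one]
    rw [h5] at h4
    refine h4.trans ?_
    rw [mul_assoc J.toReal]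
    gcongr

end Levels

/-! ### The bracket system of an indexing class -/

section Clip

/-- Truncation of a function at level `M`. -/
def clip {S : Type*} (M : ℝ) (g : S → ℝ) (x : S) : ℝ := max (-M) (min (g x) M)

variable {S : Type*} {M : ℝ} {f g : S → ℝ} {x : S}

lemma measurable_clip [MeasurableSpace S] (hg : Measurable g) : Measurable (clip M g) :=
  measurable_const.max (hg.min measurable_const)

lemma abs_clip_le (hM : 0 ≤ M) (g : S → ℝ) (x : S) : |clip M g x| ≤ M :=
  abs_le.2 ⟨le_max_left _ _, max_le (by linarith) (min_le_right _ _)⟩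

lemma clip_eq_self (hx : |g x| ≤ M) : clip M g x = g x := by
  rw [abs_le] at hx
  rw [clip, min_eq_left hx.2, max_eq_right hx.1]

lemma clip_mono (h : f x ≤ g x) : clip M f x ≤ clip M g x :=
  max_le_max_left _ (min_le_min_right _ h)

lemma clip_sub_clip_le (h : f x ≤ g x) : clip M g x - clip M f x ≤ g x - f x := by
  have h1 := abs_max_sub_max_le_abs (min (g x) M) (min (f x) M) (-M)
  have h2 := abs_min_sub_min_le_max (g x) M (f x) M
  rw [sub_self, abs_zero, max_eq_left (abs_nonneg _), abs_of_nonneg (sub_nonneg.2 h)] at h2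
  rw [max_comm _ (-M), max_comm _ (-M)] at h1
  exact (le_abs_self _).trans (h1.trans h2)

end Clip

/-! ### From brackets in the Banach space to a mixing bracket system -/

section System

variable {S B : Type*} [MeasurableSpace S] [NormedAddCommGroup B] [NormedSpace ℂ B]
  {ι : B →ₗ[ℂ] (S → ℂ)} {ν : Measure S} [IsProbabilityMeasure ν] {P : Kernel S S}
  [IsMarkovKernel P] {T : B →L[ℂ] B} {l : Filter S} {F : Set (S → ℝ)} {G : Set B} {m s : ℝ≥0∞}
  {M θ : ℝ}

/-- The real function underlying an element of the function space, truncated at level `M`. -/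
def clipRe (ι : B →ₗ[ℂ] (S → ℂ)) (M : ℝ) (b : B) : S → ℝ := clip M fun x => (ι b x).re

lemma measurable_clipRe (hι : IsFunctionSpace ι) (b : B) : Measurable (clipRe ι M b) :=
  measurable_clip (Complex.measurable_re.comp (hι.measurable b))

/-- Truncation at the bound alters the function only where that bound fails, so the truncated
function is still represented by the same element b. No norm of a truncation in B ever has to be
estimated. -/
lemma represents_clipRe {b : B} (hre : ∀ x, (ι b x).im = 0) (hb : ∀ᶠ x in l, ‖ι b x‖ ≤ M) :
    Represents ι l b (clipRe ι M b) := by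
  filter_upwards [hb] with x hx
  rw [clipRe, clip_eq_self (g := fun x => (ι b x).re) ((Complex.abs_re_le_norm _).trans hx)]
  exact Complex.ext rfl (hre x)

lemma integral_clipRe_sub_le (hι : IsFunctionSpace ι) (hs : 1 ≤ s) {δ A : ℝ} (hδ : 0 ≤ δ)
    {u : B × B} (hu : IsBracket ι ν G δ A s u) :
    ∫ x, (clipRe ι M u.2 x - clipRe ι M u.1 x) ∂ν ≤ δ := by
  have hm : AEStronglyMeasurable (fun x => ι u.2 x - ι u.1 x) ν :=
    ((hι.measurable u.2).sub (hι.measurable u.1)).aestronglyMeasurable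
  have h1 := (eLpNorm_le_eLpNorm_of_exponent_le hs hm).trans hu.size
  rw [eLpNorm_one_eq_lintegral_enorm] at h1
  have hle : ∀ x, clipRe ι M u.1 x ≤ clipRe ι M u.2 x := fun x => clip_mono (hu.le x)
  rw [integral_eq_lintegral_of_nonneg_ae
    (.of_forall fun x => sub_nonneg.2 (hle x))
    ((measurable_clipRe hι u.2).sub (measurable_clipRe hι u.1)).aestronglyMeasurable]
  refine ENNReal.toReal_le_of_le_ofReal hδ ((lintegral_mono fun x => ?_).trans h1)
  rw [← ofReal_norm]
  refine ENNReal.ofReal_le_ofReal ((clip_sub_clip_le (f := fun x => (ι u.1 x).re)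
    (g := fun x => (ι u.2 x).re) (hu.le x)).trans ?_)
  rw [← Complex.sub_re]
  exact Complex.re_le_norm _

/-- The represented functions form a mixing algebra. -/
lemma isMixingAlgebra_repAlgebra (hT : IsMarkovOperator ι P T) (hinv : P.Invariant ν)
    (hl : l = ⊤ ∨ l = ae ν) (hE : CondE ι l) (h1 : ∃ e : B, ι e = fun _ => 1) {A : ℝ} (hA : 0 ≤ A)
    (hmix : ∀ (b : B) (g : S → ℝ), Measurable g → (∃ M, ∀ x, |g x| ≤ M) → Represents ι l b g →
      ∀ n, ∫ x, |(Pop P)^[n] g x - ∫ y, g y ∂ν| ∂ν ≤ A * ‖b‖ * θ ^ n) :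
    IsMixingAlgebra P ν θ (repAlgebra hE h1) where
  measurable g hg := hg.1
  bounded g hg := hg.2.1
  pop_mem := by
    rintro g ⟨hg, ⟨M, hM⟩, b, hb⟩
    exact ⟨measurable_Pop hg, ⟨M, abs_Pop_le hM⟩, T b, hb.pop hT hinv hl⟩
  mixing := by
    rintro g ⟨hg, hM, b, hb⟩
    exact ⟨A * ‖b‖, by positivity, hmix b g hg hM hb⟩

/-- Mixing of the represented functions and of their squares, uniformly on stretched exponential
balls. -/
lemma exists_mixing_centre (hE : CondE ι l) (h1 : ∃ e : B, ι e = fun _ => 1) {A : ℝ} (hA : 0 ≤ A)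
    (hθ : 0 ≤ θ)
    (hmix : ∀ (b : B) (g : S → ℝ), Measurable g → (∃ M, ∀ x, |g x| ≤ M) → Represents ι l b g →
      ∀ n, ∫ x, |(Pop P)^[n] g x - ∫ y, g y ∂ν| ∂ν ≤ A * ‖b‖ * θ ^ n)
    (hM : 0 < M) {C : ℝ} (hC : 0 < C) :
    ∃ K₁ K₂ : ℝ, 0 ≤ K₁ ∧ 0 < K₂ ∧ ∀ (β : B) (d : S → ℝ) (x : ℝ), 0 ≤ x → Measurable d →
      (∀ y, |d y| ≤ 2 * M) → Represents ι l β d → ‖β‖ ≤ 2 * Real.exp (C * x) → ∀ n,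
        ∫ y, |(Pop P)^[n] (centre ν d) y| ∂ν ≤ K₁ * Real.exp (K₂ * x) * θ ^ n ∧
        ∫ y, |(Pop P)^[n] (fun y => centre ν d y ^ 2) y - ∫ y, centre ν d y ^ 2 ∂ν| ∂ν ≤
          K₁ * Real.exp (K₂ * x) * θ ^ n := by
  obtain ⟨e, he⟩ := h1
  obtain ⟨D, hD, ℓ, hmul⟩ := exists_represents_mul hE
  set R := 2 + 2 * M * ‖e‖ with hR
  have hR0 : 0 < R := by positivity
  set Q := (4 * M) ^ 2 * (D * (R / (4 * M)) ^ ℓ) with hQ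
  have hQ0 : 0 < Q := by positivity
  -- The constant R bounds the norm of the centred element in units of exp(Cx), and Q that of its
  -- square, where (E) raises exp(Cx) to the power ℓ; both are below exp(C(ℓ+1)x).
  refine ⟨A * (R + Q), C * (ℓ + 1), by positivity, by positivity, ?_⟩
  intro β d x hx hd hdM hβ hβn n
  have hmul1 : 1 ≤ Real.exp (C * x) := Real.one_le_exp (by positivity)
  set c : ℝ := ∫ y, d y ∂ν with hc
  have hcM : |c| ≤ 2 * M := abs_integral_le_of_bound hdM
  set β' := β - (c : ℂ) • e with hβ'
  have hrep : Represents ι l β' (centre ν d) := by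
    filter_upwards [hβ] with y hy
    simp [hβ', hy, he, centre, hc]
  have hn : ‖β'‖ ≤ R * Real.exp (C * x) := by
    refine (norm_sub_le _ _).trans ?_
    rw [norm_smul, Complex.norm_real, Real.norm_eq_abs]
    have h1 : |c| * ‖e‖ ≤ 2 * M * ‖e‖ := mul_le_mul_of_nonneg_right hcM (norm_nonneg e)
    have h2 : 2 * M * ‖e‖ ≤ 2 * M * ‖e‖ * Real.exp (C * x) :=
      le_mul_of_one_le_right (by positivity) hmul1
    rw [hR]
    linarith
  have hcd := measurable_centre (ν := ν) hd
  have hcb : ∀ y, |centre ν d y| ≤ 4 * M := fun y =>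
    (abs_centre_le (ν := ν) hdM y).trans (by linarith)
  have hp : 0 ≤ θ ^ n := pow_nonneg hθ n
  have hex : Real.exp (C * x) ≤ Real.exp (C * (ℓ + 1) * x) := by
    rw [Real.exp_le_exp]
    have : 0 ≤ C * ℓ * x := by positivity
    linarith
  have hex2 : Real.exp (C * x) ^ ℓ ≤ Real.exp (C * (ℓ + 1) * x) := by
    rw [← Real.exp_nat_mul, Real.exp_le_exp]
    have : 0 ≤ C * x := by positivity
    linarith
  constructor
  · have h2 := hmix β' (centre ν d) hcd ⟨_, hcb⟩ hrep n
    rw [integral_centre hd hdM] at h2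
    simp only [sub_zero] at h2
    refine h2.trans (mul_le_mul_of_nonneg_right ?_ hp)
    calc A * ‖β'‖ ≤ A * (R * Real.exp (C * (ℓ + 1) * x)) := by
          refine mul_le_mul_of_nonneg_left (hn.trans ?_) hA
          exact mul_le_mul_of_nonneg_left hex hR0.le
      _ ≤ A * ((R + Q) * Real.exp (C * (ℓ + 1) * x)) := by
          refine mul_le_mul_of_nonneg_left ?_ hA
          exact mul_le_mul_of_nonneg_right (by linarith) (Real.exp_pos _).le
      _ = _ := by ring
  · obtain ⟨k, hk, hkn⟩ := hmul β' β' _ _ (4 * M) hrep hrep (by positivity) hcb hcb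
    have e2 : (centre ν d) * (centre ν d) = fun y => centre ν d y ^ 2 := by
      ext y; rw [Pi.mul_apply, sq]
    rw [e2] at hk
    have h2 := hmix k _ (hcd.pow_const 2) ⟨(4 * M) ^ 2, fun y => by
      rw [abs_pow]; exact pow_le_pow_left₀ (abs_nonneg _) (hcb y) 2⟩ hk n
    refine h2.trans (mul_le_mul_of_nonneg_right ?_ hp)
    rw [max_self] at hkn
    have h3 : ‖k‖ ≤ Q * Real.exp (C * (ℓ + 1) * x) := by
      calc ‖k‖ ≤ (4 * M) ^ 2 * (D * (‖β'‖ / (4 * M)) ^ ℓ) := hkn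
        _ ≤ (4 * M) ^ 2 * (D * (R * Real.exp (C * x) / (4 * M)) ^ ℓ) := by gcongr
        _ = Q * Real.exp (C * x) ^ ℓ := by
            rw [hQ, mul_div_right_comm, mul_pow]; ring_nf
        _ ≤ _ := mul_le_mul_of_nonneg_left hex2 hQ0.le
    calc A * ‖k‖ ≤ A * (Q * Real.exp (C * (ℓ + 1) * x)) := mul_le_mul_of_nonneg_left h3 hA
      _ ≤ A * ((R + Q) * Real.exp (C * (ℓ + 1) * x)) := by
          refine mul_le_mul_of_nonneg_left ?_ hA
          exact mul_le_mul_of_nonneg_right (by linarith) (Real.exp_pos _).le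
      _ = _ := by ring

/-- A class covered by brackets at dyadic levels has a bracket system. -/
theorem exists_isBracketSystem (hι : IsFunctionSpace ι) (hs : 1 ≤ s) (hE : CondE ι l)
    (h1 : ∃ e : B, ι e = fun _ => 1) {A : ℝ} (hA : 0 ≤ A) (hθ : 0 ≤ θ)
    (hmix : ∀ (b : B) (g : S → ℝ), Measurable g → (∃ M, ∀ x, |g x| ≤ M) → Represents ι l b g →
      ∀ n, ∫ x, |(Pop P)^[n] g x - ∫ y, g y ∂ν| ∂ν ≤ A * ‖b‖ * θ ^ n)
    (hF_meas : ∀ f ∈ F, Measurable f) (hG_real : ∀ g ∈ G, ∀ x, (ι g x).im = 0) (hM : 0 < M)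
    (hG_bdd : ∀ g ∈ G, ∀ᶠ x in l, ‖ι g x‖ ≤ M) {C b K E : ℝ} (hC : 0 < C) (hb : 1 < b)
    (hb2 : b < 2) (hK : 0 ≤ K) (hE1 : 1 ≤ E) {W : ℕ → Finset (B × B)}
    (hW : ∀ q, (∀ u ∈ W q, IsBracket ι ν G ((1 / 2) ^ q) (Real.exp (C * b ^ q)) s u) ∧
      (∀ f ∈ F, ∃ u ∈ W q, ∀ x, (ι u.1 x).re ≤ f x ∧ f x ≤ (ι u.2 x).re) ∧
      ((W q).card : ℝ) ≤ K * E ^ q) :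
    ∃ K₁ K₂ : ℝ, 0 ≤ K₁ ∧ 0 < K₂ ∧ ∃ lo up : ℕ → F → S → ℝ,
      IsBracketSystem P ν θ M K₁ K₂ b (E ^ 2) (repAlgebra hE h1) (fun f : F => clip M f.1) lo up := by
  classical
  -- The constant 2C is used instead of C because a link at level q involves a bracket of level q+1,
  -- and exp(C b^{q+1}) ≤ exp(2C b^q) as b < 2.
  obtain ⟨K₁, K₂, hK₁, hK₂, hcen⟩ := exists_mixing_centre hE h1 hA hθ hmix hM
    (mul_pos two_pos hC)
  choose u huW hu using fun (q : ℕ) (f : F) => (hW q).2.1 f.1 f.2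
  have hbr := fun q f => (hW q).1 _ (huW q f)
  have hrep : ∀ g ∈ G, Represents ι l g (clipRe ι M g) := fun g hg =>
    represents_clipRe (hG_real g hg) (hG_bdd g hg)
  have hbp : ∀ q : ℕ, 0 < b ^ q := fun q => by positivity
  have hexp : ∀ q : ℕ, Real.exp (C * b ^ q) ≤ Real.exp (2 * C * b ^ q) := fun q => by
    rw [Real.exp_le_exp]
    have := mul_pos hC (hbp q)
    linarith
  have hexp1 : ∀ q : ℕ, Real.exp (C * b ^ (q + 1)) ≤ Real.exp (2 * C * b ^ q) := fun q => by
    rw [Real.exp_le_exp, pow_succ]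
    have := mul_pos hC (hbp q)
    nlinarith
  have hdiff : ∀ f g : S → ℝ, (∀ x, |f x| ≤ M) → (∀ x, |g x| ≤ M) → ∀ x, |f x - g x| ≤ 2 * M :=
    fun f g hf hg x => (abs_sub _ _).trans (by linarith [hf x, hg x])
  have hcl := fun b : B => abs_clip_le hM.le fun x => (ι b x).re
  have hsm : ∀ q f, ∫ x, (clipRe ι M (u q f).2 x - clipRe ι M (u q f).1 x) ∂ν ≤ (1 / 2) ^ q :=
    fun q f => integral_clipRe_sub_le hι hs (by positivity) (hbr q f)
  have hlo : ∀ q (f : F) x, clipRe ι M (u q f).1 x ≤ clip M f.1 x := fun q f x =>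
    clip_mono (hu q f x).1
  have hup : ∀ q (f : F) x, clip M f.1 x ≤ clipRe ι M (u q f).2 x := fun q f x =>
    clip_mono (hu q f x).2
  have hint : ∀ c : B, Integrable (clipRe ι M c) ν := fun c =>
    integrable_of_bound (measurable_clipRe hι c) (hcl c)
  have hintf : ∀ f : F, Integrable (clip M f.1) ν := fun f =>
    integrable_of_bound (measurable_clip (hF_meas f.1 f.2)) (abs_clip_le hM.le f.1)
  refine ⟨K₁, K₂, hK₁, hK₂, fun q f => clipRe ι M (u q f).1, fun q f => clipRe ι M (u q f).2, ?_⟩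
  refine
    { measurable := fun f => measurable_clip (hF_meas f.1 f.2)
      lo_mem := fun q f => ⟨measurable_clipRe hι _, ⟨M, hcl _⟩, _, hrep _ (hbr q f).lower_mem⟩
      lo_measurable := fun q f => measurable_clipRe hι _
      up_measurable := fun q f => measurable_clipRe hι _
      bound := fun f => abs_clip_le hM.le f.1
      lo_bound := fun q f => hcl _
      up_bound := fun q f => hcl _
      lo_le := hlo
      le_up := hup
      small := hsm
      lo_mix := fun q f n => ?_
      link := fun q f => ?_
      last_link := fun q f => ?_
      card := ?_ }
  · refine (hcen (u q f).1 _ (b ^ q) (hbp q).le (measurable_clipRe hι _)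
      (fun y => (hcl _ y).trans (by linarith)) (hrep _ (hbr q f).lower_mem) ?_ n).1
    have := (hbr q f).norm_lower
    have := hexp q
    have := Real.exp_pos (2 * C * b ^ q)
    linarith
  · have hd : Measurable fun x => clipRe ι M (u (q + 1) f).1 x - clipRe ι M (u q f).1 x :=
      (measurable_clipRe hι _).sub (measurable_clipRe hι _)
    have hc := hcen ((u (q + 1) f).1 - (u q f).1) _ (b ^ q) (hbp q).le hd
      (hdiff _ _ (hcl _) (hcl _))
      ((hrep _ (hbr (q + 1) f).lower_mem).sub (hrep _ (hbr q f).lower_mem)) (by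
        refine (norm_sub_le _ _).trans ?_
        have := (hbr q f).norm_lower
        have := (hbr (q + 1) f).norm_lower
        have := hexp q
        have := hexp1 q
        linarith)
    refine ⟨hd, hdiff _ _ (hcl _) (hcl _), ?_, fun n => (hc n).1, fun n => (hc n).2⟩
    have i1 : Integrable (fun x => clipRe ι M (u (q + 1) f).2 x - clipRe ι M (u (q + 1) f).1 x) ν :=
      (hint _).sub (hint _)
    have i2 : Integrable (fun x => clipRe ι M (u q f).2 x - clipRe ι M (u q f).1 x) ν :=
      (hint _).sub (hint _)
    -- Lower brackets of successive levels need not be ordered; both lie below the same function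
    -- within their own widths, so their distance is at most the sum of the two widths.
    refine (integral_mono ((hint _).sub (hint _)).abs (i1.add i2) fun x => ?_).trans
      ((integral_add i1 i2).trans_le ?_)
    · change |clipRe ι M (u (q + 1) f).1 x - clipRe ι M (u q f).1 x| ≤
        (clipRe ι M (u (q + 1) f).2 x - clipRe ι M (u (q + 1) f).1 x) +
        (clipRe ι M (u q f).2 x - clipRe ι M (u q f).1 x)
      have a1 := hlo q f x
      have a2 := hup q f x
      have a3 := hlo (q + 1) f x
      have a4 := hup (q + 1) f x
      rw [abs_le]
      constructor <;> linarith
    · have h2 := hsm q f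
      have h3 := hsm (q + 1) f
      have h4 : (1 / 2 : ℝ) ^ (q + 1) ≤ (1 / 2) ^ q :=
        pow_le_pow_of_le_one (by norm_num) (by norm_num) (Nat.le_succ q)
      linarith
  · have hd : Measurable fun x => clipRe ι M (u q f).2 x - clipRe ι M (u q f).1 x :=
      (measurable_clipRe hι _).sub (measurable_clipRe hι _)
    have hc := hcen ((u q f).2 - (u q f).1) _ (b ^ q) (hbp q).le hd
      (hdiff _ _ (hcl _) (hcl _))
      ((hrep _ (hbr q f).upper_mem).sub (hrep _ (hbr q f).lower_mem)) (by
        refine (norm_sub_le _ _).trans ?_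
        have := (hbr q f).norm_lower
        have := (hbr q f).norm_upper
        have := hexp q
        linarith)
    refine ⟨hd, hdiff _ _ (hcl _) (hcl _), ?_, fun n => (hc n).1, fun n => (hc n).2⟩
    have e : ∀ x, |clipRe ι M (u q f).2 x - clipRe ι M (u q f).1 x| =
        clipRe ι M (u q f).2 x - clipRe ι M (u q f).1 x := fun x =>
      abs_of_nonneg (sub_nonneg.2 ((hlo q f x).trans (hup q f x)))
    simp only [e]
    have : (0 : ℝ) ≤ (1 / 2) ^ q := by positivity
    linarith [hsm q f]
  -- A link depends on a bracket of level q and one of level q+1, so the counts multiply and the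
  -- growth rate becomes E².
  · refine ⟨K ^ 2 * E, by positivity, fun q => ?_⟩
    set V : Finset ((S → ℝ) × (S → ℝ) × (S → ℝ)) := (W q ×ˢ W (q + 1)).image fun p =>
      (clipRe ι M p.1.1, clipRe ι M p.2.1, clipRe ι M p.1.2) with hV
    have hsub : (Set.range fun f : F => (clipRe ι M (u q f).1, clipRe ι M (u (q + 1) f).1,
        clipRe ι M (u q f).2)) ⊆ V := by
      rintro _ ⟨f, rfl⟩
      exact Finset.mem_coe.2 (Finset.mem_image.2 ⟨(u q f, u (q + 1) f),
        Finset.mem_product.2 ⟨huW q f, huW (q + 1) f⟩, rfl⟩)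
    refine ⟨V.finite_toSet.subset hsub, ?_⟩
    have h2 : (Set.range fun f : F => (clipRe ι M (u q f).1, clipRe ι M (u (q + 1) f).1,
        clipRe ι M (u q f).2)).ncard ≤ (W q).card * (W (q + 1)).card := by
      refine (Set.ncard_le_ncard hsub V.finite_toSet).trans ?_
      rw [Set.ncard_coe_finset]
      exact Finset.card_image_le.trans (Finset.card_product _ _).le
    calc ((Set.range fun f : F => (clipRe ι M (u q f).1, clipRe ι M (u (q + 1) f).1,
          clipRe ι M (u q f).2)).ncard : ℝ) ≤ (W q).card * (W (q + 1)).card := by exact_mod_cast h2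
      _ ≤ (K * E ^ q) * (K * E ^ (q + 1)) :=
          mul_le_mul (hW q).2.2 (hW (q + 1)).2.2 (Nat.cast_nonneg _) (by positivity)
      _ = K ^ 2 * E * (E ^ 2) ^ q := by ring

end System

/-! ### The sequential empirical process of an almost everywhere bounded class -/

section EmpiricalSums

variable {Ω S : Type*} {m0 : MeasurableSpace Ω} [MeasurableSpace S] {μ : Measure Ω}
  [IsProbabilityMeasure μ] {ν : Measure S} [IsProbabilityMeasure ν] {P : Kernel S S}
  [IsMarkovKernel P] {Z : ℕ → Ω → S} {f g : S → ℝ} {M : ℝ}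

lemma integral_clip (hf : ∀ᵐ x ∂ν, |f x| ≤ M) : ∫ x, clip M f x ∂ν = ∫ x, f x ∂ν :=
  integral_congr_ae (hf.mono fun _ hx => clip_eq_self hx)

/-- By stationarity the chain almost surely avoids the null sets where the bounds fail at any given
time, so truncation does not change the covariances. -/
lemma covariance_chain (hinv : P.Invariant ν) (hZ : IsMarkovChain μ Z P ν) (hM : 0 ≤ M)
    (hf : Measurable f) (hfM : ∀ᵐ x ∂ν, |f x| ≤ M) (hg : Measurable g)
    (hgM : ∀ᵐ x ∂ν, |g x| ≤ M) (i j : ℕ) :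
    cov[fun ω => f (Z i ω), fun ω => g (Z j ω); μ] =
      ∫ ω, centre ν (clip M f) (Z i ω) * centre ν (clip M g) (Z j ω) ∂μ := by
  have hf1 := ae_chain hinv hZ hfM i
  have hg1 := ae_chain hinv hZ hgM j
  have e1 : ∫ ω, f (Z i ω) ∂μ = ∫ x, clip M f x ∂ν := by
    rw [← integral_chain hinv hZ (measurable_clip hf) (abs_clip_le hM f) i]
    exact integral_congr_ae (hf1.mono fun ω hω => (clip_eq_self hω).symm)
  have e2 : ∫ ω, g (Z j ω) ∂μ = ∫ x, clip M g x ∂ν := by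
    rw [← integral_chain hinv hZ (measurable_clip hg) (abs_clip_le hM g) j]
    exact integral_congr_ae (hg1.mono fun ω hω => (clip_eq_self hω).symm)
  rw [covariance, e1, e2]
  refine integral_congr_ae ?_
  filter_upwards [hf1, hg1] with ω h1 h2
  rw [centre, centre, clip_eq_self h1, clip_eq_self h2]

lemma covariance_zero_eq_lagCov (hinv : P.Invariant ν) (hZ : IsMarkovChain μ Z P ν) (hM : 0 ≤ M)
    (hf : Measurable f) (hfM : ∀ᵐ x ∂ν, |f x| ≤ M) (hg : Measurable g)
    (hgM : ∀ᵐ x ∂ν, |g x| ≤ M) (k : ℕ) :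
    cov[fun ω => f (Z 0 ω), fun ω => g (Z k ω); μ] =
      lagCov P ν (centre ν (clip M f)) (centre ν (clip M g)) k := by
  rw [covariance_chain hinv hZ hM hf hfM hg hgM]
  exact integral_mul_chain_eq_lagCov hinv hZ (measurable_centre (measurable_clip hf))
    (abs_centre_le (abs_clip_le hM f)) (measurable_centre (measurable_clip hg))
    (abs_centre_le (abs_clip_le hM g)) k

lemma covariance_eq_lagCov_zero (hinv : P.Invariant ν) (hZ : IsMarkovChain μ Z P ν) (hM : 0 ≤ M)
    (hf : Measurable f) (hfM : ∀ᵐ x ∂ν, |f x| ≤ M) (hg : Measurable g)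
    (hgM : ∀ᵐ x ∂ν, |g x| ≤ M) (k : ℕ) :
    cov[fun ω => f (Z k ω), fun ω => g (Z 0 ω); μ] =
      lagCov P ν (centre ν (clip M g)) (centre ν (clip M f)) k := by
  rw [covariance_comm]
  exact covariance_zero_eq_lagCov hinv hZ hM hg hgM hf hfM k

lemma longRunCov_eq (hinv : P.Invariant ν) (hZ : IsMarkovChain μ Z P ν) (hM : 0 ≤ M)
    (hf : Measurable f) (hfM : ∀ᵐ x ∂ν, |f x| ≤ M) (hg : Measurable g)
    (hgM : ∀ᵐ x ∂ν, |g x| ≤ M) :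
    longRunCov μ Z f g = kernelLongRunCov P ν (centre ν (clip M f)) (centre ν (clip M g)) := by
  simp only [longRunCov, kernelLongRunCov, covariance_zero_eq_lagCov hinv hZ hM hf hfM hg hgM,
    covariance_eq_lagCov_zero hinv hZ hM hf hfM hg hgM]

lemma seqEmpirical_eq_sum_range (Z : ℕ → Ω → S) (ν : Measure S) (n : ℕ) (ω : Ω) (f : S → ℝ)
    (t : ℝ) : seqEmpirical Z ν n ω f t = 1 / Real.sqrt n *
      ∑ i ∈ Finset.range ⌊(n : ℝ) * t⌋₊, centre ν f (Z (1 + i) ω) := by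
  rw [seqEmpirical, ← Finset.Ico_add_one_right_eq_Icc, Finset.sum_Ico_eq_sum_range,
    Nat.add_sub_cancel]
  rfl

/-- Membership in ℓ^∞ is required for every ω, whereas the uniform bound on the class may hold only
almost everywhere; an everywhere finite envelope H replaces it. -/
lemma abs_seqEmpirical_le {H : S → ℝ} (hH : ∀ x, |f x| ≤ H x) (hfM : ∀ᵐ x ∂ν, |f x| ≤ M)
    (n : ℕ) (ω : Ω) {t : ℝ} (ht : t ≤ 1) :
    |seqEmpirical Z ν n ω f t| ≤ 1 / Real.sqrt n *
      ∑ i ∈ Finset.range n, (H (Z (1 + i) ω) + M) := by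
  have hν : |∫ x, f x ∂ν| ≤ M :=
    (norm_integral_le_of_norm_le_const (C := M) (f := f) hfM).trans (by simp)
  have hc : ∀ x, |centre ν f x| ≤ H x + M := fun x =>
    (abs_sub _ _).trans (add_le_add (hH x) hν)
  rw [seqEmpirical_eq_sum_range, abs_mul, abs_of_nonneg (by positivity)]
  refine mul_le_mul_of_nonneg_left ?_ (by positivity)
  refine (Finset.abs_sum_le_sum_abs _ _).trans ((Finset.sum_le_sum fun i _ => hc _).trans
    (Finset.sum_le_sum_of_subset_of_nonneg (Finset.range_mono ?_)
      fun i _ _ => (abs_nonneg _).trans (hc _)))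
  refine Nat.floor_le_of_le ?_
  have : (0 : ℝ) ≤ n := Nat.cast_nonneg n
  nlinarith

end EmpiricalSums

end SeqEmp

end

/-! ### The main theorem -/

theorem mainTheorem1
    {Ω S B : Type*} [MeasurableSpace Ω] [MeasurableSpace S]
    [NormedAddCommGroup B] [NormedSpace ℂ B] [CompleteSpace B]
    -- the stationary Markov chain
    (μ : Measure Ω) [IsProbabilityMeasure μ]
    (ν : Measure S) [IsProbabilityMeasure ν]
    (P : Kernel S S) [IsMarkovKernel P] (hinv : P.Invariant ν)
    (Z : ℕ → Ω → S) (hZ : SeqEmp.IsMarkovChain μ Z P ν)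
    -- the Banach space of functions, with the Markov operator acting on it
    (ι : B →ₗ[ℂ] (S → ℂ)) (hι : SeqEmp.IsFunctionSpace ι)
    (T : B →L[ℂ] B) (hT : SeqEmp.IsMarkovOperator ι P T)
    -- the exponent `m ∈ [1, ∞]` and `s = m / (m - 1)`
    (m s : ℝ≥0∞) (hm : 1 ≤ m) (hms : m⁻¹ + s⁻¹ = 1)
    -- bounds in sup norm are meant everywhere, or `ν`-almost everywhere
    (l : Filter S) (hl : l = ⊤ ∨ l = ae ν)
    -- the indexing class
    (F : Set (S → ℝ)) (hF_meas : ∀ f ∈ F, Measurable f)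
    (hF_bdd : ∃ M : ℝ, ∀ f ∈ F, ∀ᶠ x in l, |f x| ≤ M)
    -- the class of real-valued, bounded elements of `B` used for the brackets
    (G : Set B) (hG_real : ∀ g ∈ G, ∀ x, (ι g x).im = 0)
    (hG_bdd : ∃ M : ℝ, ∀ g ∈ G, ∀ᶠ x in l, ‖ι g x‖ ≤ M)
    (hA : SeqEmp.CondA ι) (hB : SeqEmp.CondB ι ν m) (hC : SeqEmp.CondC ι ν T)
    (hD : SeqEmp.CondD ι P G) (hE : SeqEmp.CondE ι l) (hF : SeqEmp.CondF ι ν F G s) :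
    -- the covariance series converge absolutely
    (∀ f₁ ∈ F, ∀ f₂ ∈ F,
      Summable (fun k : ℕ => cov[fun ω => f₁ (Z 0 ω), fun ω => f₂ (Z k ω); μ]) ∧
      Summable (fun k : ℕ => cov[fun ω => f₁ (Z (k + 1) ω), fun ω => f₂ (Z 0 ω); μ])) ∧
    -- the sequential empirical process takes values in `ℓ^∞(F × [0,1])` and converges there
    ∃ U : ℕ → Ω → ℓ^∞(F × Set.Icc (0 : ℝ) 1, ℝ),
      (∀ n ω (p : F × Set.Icc (0 : ℝ) 1),
        U n ω p = SeqEmp.seqEmpirical Z ν n ω (p.1 : S → ℝ) (p.2 : ℝ)) ∧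
      ∃ κ : Measure (ℓ^∞(F × Set.Icc (0 : ℝ) 1, ℝ)),
        SeqEmp.IsKieferLaw μ Z F κ ∧ SeqEmp.ConvergesInDistribution μ U κ := by
  classical
  have hs : 1 ≤ s := by
    rw [← ENNReal.inv_le_one, ← hms]
    exact le_add_self
  obtain ⟨C, b, w, K, E, hC0, hb, hb2, hw, hbw, hK, hE1, W, hW⟩ := SeqEmp.exists_bracket_levels hF
  obtain ⟨M₀, hM₀⟩ := hG_bdd
  set M := max 1 M₀ with hM
  have hM0 : 0 < M := lt_max_of_lt_left one_pos
  have hGM : ∀ g ∈ G, ∀ᶠ x in l, ‖ι g x‖ ≤ M := fun g hg =>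
    (hM₀ g hg).mono fun x hx => hx.trans (le_max_right _ _)
  have hlν : ae ν ≤ l := SeqEmp.ae_le_of_eq_top_or hl
  obtain ⟨A, θ₀, hA0, hθ₀, hθ₁, hmix₀⟩ := SeqEmp.exists_mixing hι hT hinv hl hm hB hC
  -- The rate is enlarged so as to be positive, since the chaining step divides by log(1/θ).
  set θ := max θ₀ (1 / 2) with hθ
  have hθ0 : 0 < θ := lt_max_of_lt_right (by norm_num)
  have hθ1 : θ < 1 := max_lt hθ₁ (by norm_num)
  have hmix : ∀ (b : B) (g : S → ℝ), Measurable g → (∃ M, ∀ x, |g x| ≤ M) →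
      SeqEmp.Represents ι l b g →
      ∀ n, ∫ x, |(SeqEmp.Pop P)^[n] g x - ∫ y, g y ∂ν| ∂ν ≤ A * ‖b‖ * θ ^ n :=
    fun b g hg hgM hbg n => (hmix₀ b g hg hgM hbg n).trans (mul_le_mul_of_nonneg_left
      (pow_le_pow_left₀ hθ₀ (le_max_left _ _) n) (by positivity))
  have h𝓐 := SeqEmp.isMixingAlgebra_repAlgebra hT hinv hl hE hA.one_mem hA0.le hmix
  obtain ⟨K₁, K₂, hK₁, hK₂, lo, up, hsys⟩ := SeqEmp.exists_isBracketSystem hι hs hE hA.one_mem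
    hA0.le hθ0.le hmix hF_meas hG_real hM0 hGM hC0 hb hb2 hK hE1 hW
  -- A single null set must serve the possibly uncountable class: it is obtained from the finitely
  -- many brackets of level 0, which enclose every function of F.
  have hFM : ∀ᵐ x ∂ν, ∀ f ∈ F, |f x| ≤ M := by
    have h1 : ∀ᵐ x ∂ν, ∀ u ∈ W 0, ‖ι u.1 x‖ ≤ M ∧ ‖ι u.2 x‖ ≤ M :=
      (Finset.eventually_all _).2 fun u hu => hlν ((hGM _ ((hW 0).1 u hu).lower_mem).and
        (hGM _ ((hW 0).1 u hu).upper_mem))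
    filter_upwards [h1] with x hx f hf
    obtain ⟨u, hu, huf⟩ := (hW 0).2.1 f hf
    have h2 := (Complex.abs_re_le_norm (ι u.1 x)).trans (hx u hu).1
    have h3 := (Complex.abs_re_le_norm (ι u.2 x)).trans (hx u hu).2
    rw [abs_le] at h2 h3 ⊢
    exact ⟨h2.1.trans (huf x).1, (huf x).2.trans h3.2⟩
  have hfM : ∀ f ∈ F, ∀ᵐ x ∂ν, |f x| ≤ M := fun f hf => hFM.mono fun x hx => hx f hf
  have hsum := hsys.summable_lagCov_centre hinv hZ hM0.le hK₁ hb hb2 hθ0 hθ1 hK₂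
  refine ⟨fun f₁ h₁ f₂ h₂ => ⟨?_, ?_⟩, ?_⟩
  · simp only [SeqEmp.covariance_zero_eq_lagCov hinv hZ hM0.le (hF_meas f₁ h₁) (hfM f₁ h₁)
      (hF_meas f₂ h₂) (hfM f₂ h₂)]
    exact hsum ⟨f₁, h₁⟩ ⟨f₂, h₂⟩
  · simp only [SeqEmp.covariance_eq_lagCov_zero hinv hZ hM0.le (hF_meas f₁ h₁) (hfM f₁ h₁)
      (hF_meas f₂ h₂) (hfM f₂ h₂)]
    exact (summable_nat_add_iff 1).2 (hsum ⟨f₂, h₂⟩ ⟨f₁, h₁⟩)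
  -- The same finite cover gives an envelope of F that is finite at every point, not merely almost
  -- everywhere.
  set H : S → ℝ := fun x => ∑ u ∈ W 0, (|(ι u.1 x).re| + |(ι u.2 x).re|) with hH
  have hFH : ∀ f ∈ F, ∀ x, |f x| ≤ H x := by
    intro f hf x
    obtain ⟨u, hu, huf⟩ := (hW 0).2.1 f hf
    refine le_trans ?_ (Finset.single_le_sum
      (f := fun u : B × B => |(ι u.1 x).re| + |(ι u.2 x).re|) (fun u _ => by positivity) hu)
    have h1 := neg_abs_le (ι u.1 x).re
    have h2 := le_abs_self (ι u.2 x).re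
    have h3 := abs_nonneg (ι u.1 x).re
    have h4 := abs_nonneg (ι u.2 x).re
    have h5 := huf x
    exact abs_le.2 ⟨by linarith [h5.1], by linarith [h5.2]⟩
  have hmem : ∀ n ω, Memℓp (fun p : F × Set.Icc (0 : ℝ) 1 =>
      SeqEmp.seqEmpirical Z ν n ω (p.1 : S → ℝ) (p.2 : ℝ)) ∞ := by
    intro n ω
    refine memℓp_infty ⟨1 / Real.sqrt n * ∑ i ∈ Finset.range n, (H (Z (1 + i) ω) + M), ?_⟩
    rintro _ ⟨p, rfl⟩
    exact SeqEmp.abs_seqEmpirical_le (hFH p.1 p.1.2) (hfM p.1 p.1.2) n ω p.2.2.2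
  refine ⟨fun n ω => ⟨_, hmem n ω⟩, fun n ω p => rfl, ?_⟩
  have hchain : ∀ᵐ ω ∂μ, ∀ i, ∀ f ∈ F, |f (Z i ω)| ≤ M :=
    ae_all_iff.2 fun i => SeqEmp.ae_chain hinv hZ hFM i
  obtain ⟨κ, h1, h2, h3, h4, h5, h6⟩ := hsys.exists_limit h𝓐 hinv hZ hθ0 hθ1 hM0 hK₁ hK₂ hb hb2 hw
    hbw (one_le_pow₀ hE1) (U := fun n ω => ⟨_, hmem n ω⟩) (by
      filter_upwards [hchain] with ω hω n p
      rw [SeqEmp.seqEmpirical_eq_sum_range]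
      congr 1
      refine Finset.sum_congr rfl fun i _ => ?_
      rw [SeqEmp.centre, SeqEmp.centre, SeqEmp.integral_clip (hfM p.1 p.1.2),
        SeqEmp.clip_eq_self (hω _ p.1 p.1.2)])
  refine ⟨κ, ⟨h1, h2, h3, h4, fun p q => ?_⟩, h6⟩
  rw [h5, SeqEmp.longRunCov_eq hinv hZ hM0.le (hF_meas _ p.1.2) (hfM _ p.1.2) (hF_meas _ q.1.2)
    (hfM _ q.1.2)]
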